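/- **Graphs.** All graphs are finite, connected, oriented, with at least one vertex; loops and multiple edges are allowed. For $n\ge 0$, an $n$-graph monomial indexed by a set $L$ is such a graph with edges labelled by $L$ and an $n$-tuple of vertices, called outputs, up to isomorphism; $\mathbb C\mathcal G^{(n)}\langle L\rangle$ is the vector space with basis the $n$-graph monomials. For $n\ge 1$, $t|t'$ denotes the $0$-graph obtained from two $n$-graph monomials by merging their $i$-th outputs for all $i$ (extended bilinearly). If $L$ has an involution $*$, $t^*$ is obtained by reversing all edges and applying $*$ to the labels, keeping the outputs (extended antilinearly). A linear form $\tau$ on $\mathbb C\mathcal G^{(0)}\langle L\rangle$ is *unital* if it maps the graph with no edge to $1$, and *positive* if $\tau[t|t^*]\ge 0$ for all $n\ge1$ and $t\in\mathbb C\mathcal G^{(n)}\langle L\rangle$. Its injective version $\tau^0$ is determined by $\tau[t]=\sum_{\pi}\tau^0[t^\pi]$, where $\pi$ runs over the partitions of the vertex set of the $0$-graph monomial $t$ and $t^\pi$ is the quotient of $t$ by $\pi$. **Free product of functionals.** Let $(L_j)_{j\in J}$ be sets and $\tau_j$ unital linear forms on $\mathbb C\mathcal G^{(0)}\langle L_j\rangle$.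 For a $0$-graph monomial $T$ labelled by $\bigsqcup_j L_j$, the colored components are the maximal connected subgraphs with at least one edge and with all labels in a single $L_j$; the connectors are the vertices that belong to at least two colored components; $\bar T$ is the bipartite graph on components and connectors, with an edge when the connector belongs to the component. The free product $\star_j\tau_j$ is the linear form whose injective version is $(\star_j\tau_j)^0[T]=\prod_S\tau_{j(S)}^0[S]$, over the colored components $S$ of $T$, of color $j(S)$, if $\bar T$ is a tree (or $T$ has no edge), and $0$ otherwise. **Spaces of traffics.** A graph operation $g$ is a graph as above with ordered edges, an input vertex and an output vertex (possibly equal). A $\mathcal G$-algebra is a complex vector space $\mathcal A$ with multilinear maps $Z_g:\mathcal A^K\to\mathcal A$ for each graph operation $g$ with $K$ edges, compatible with the substitution of graph operations for edges and with reordering of edges, a single edge from input to output acting as the identity. It is an algebraic space of traffics if it has a linear form $\Phi$ with $\Phi(\mathbb I)=1$, where $\mathbb I$ is the image of the graph operation with no edge, that is input-independent: $\Phi\circ Z_g$ does not change when the input and the output of $g$ are merged, and then does not depend on the place of this merged vertex in the graph. Its distribution of traffics is the linear form $\tau$ on $\mathbb C\mathcal G^{(0)}\langle\mathcal A\rangle$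 with $\tau(t)=\Phi(Z_g(\gamma))$, where $g$ is the graph of $t$ with an arbitrary vertex as input and output and $\gamma$ is the family of labels. It is a space of traffics if moreover $\mathcal A$ has an antilinear involution with $Z_g(a_1,\dots,a_K)^*=Z_{g^*}(a_1^*,\dots,a_K^*)$, where $g^*$ is $g$ with all edges reversed and input and output exchanged, and $\tau$ is positive. The free product $\ast_j\mathcal A_j$ of $\mathcal G$-algebras is $\mathbb C\mathcal G^{(2)}\langle\bigsqcup_j\mathcal A_j\rangle$ (the two outputs being an input and an output) modulo linearity in the label of each edge (within each $\mathcal A_j$) and modulo replacing an edge labelled by $Z_h(a_1,\dots,a_k)$, with $a_1,\dots,a_k$ in a same $\mathcal A_j$, by the graph $h$ with edges labelled by $a_1,\dots,a_k$. **Theorem 1.2.** Let $J$ be any index set. 1. Let $(L_j)_{j\in J}$ be sets with involutions and $\tau_j$ unital positive linear forms on $\mathbb C\mathcal G^{(0)}\langle L_j\rangle$ (for instance distributions of traffics of spaces of traffics). Then $\star_j\tau_j$ is a well-defined unital linear form on $\mathbb C\mathcal G^{(0)}\langle\bigsqcup_jL_j\rangle$ and it is positive. 2. Let $(\mathcal A_j)_{j\in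 J}$ be spaces of traffics, with distributions of traffics $\tau_j$. Then substitution of graphs, the involution of labelled graphs (reversing edges, taking adjoints of labels, exchanging input and output), and the linear form $\Phi([m])=(\star_j\tau_j)[\tilde m]$, where $\tilde m$ is $m$ with input and output merged and forgotten, are well-defined on $\ast_j\mathcal A_j$ and make it a space of traffics. The maps $V_j:\mathcal A_j\to\ast_j\mathcal A_j$ sending $a$ to the class of the single edge labelled by $a$ are homomorphisms of spaces of traffics (they are linear and preserve graph operations, involution and trace), and for every $0$-graph monomial $t$ labelled by $\bigsqcup_j\mathcal A_j$ the distribution of traffics of $\ast_j\mathcal A_j$, evaluated at $t$ with each label $a\in\mathcal A_j$ replaced by $V_j(a)$, equals $(\star_j\tau_j)[t]$. -/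

import Mathlib

universe u v w

noncomputable section

namespace Traffic

/-! ## Finite connected oriented graphs -/

/-- A finite connected oriented graph (loops and multiple edges are allowed), with set of edges `E`
and with an `n`-tuple `out` of distinguished vertices, not necessarily distinct. -/
structure TGraph (n : ℕ) (E : Type) where
  V : Type
  src : E → V
  tgt : E → V
  out : Fin n → V
  finite_V : Finite V
  finite_E : Finite E
  nonempty_V : Nonempty V
  connected : ∀ x y : V, Relation.EqvGen (fun a b => ∃ e, src e = a ∧ tgt e = b) x y

attribute [instance] TGraph.finite_V TGraph.nonempty_V

/-- A graph operation whose (labelled) edges are the elements of the finite type `I`: the vertex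
`out 0` is its input and the vertex `out 1` is its output. The case `I = Fin K` gives the
`K`-graph operations. -/
abbrev GraphOp (I : Type) := TGraph 2 I

namespace TGraph

variable {n : ℕ} {E E' : Type}

/-- `g` and `g'` are isomorphic, by an isomorphism which acts on the edges as `σ`. -/
def IsoAlong (σ : E ≃ E') (g : TGraph n E) (g' : TGraph n E') : Prop :=
  ∃ φ : g.V ≃ g'.V, (∀ e, φ (g.src e) = g'.src (σ e)) ∧ (∀ e, φ (g.tgt e) = g'.tgt (σ e)) ∧
    ∀ i, φ (g.out i) = g'.out i

/-- The same graph with other distinguished vertices. -/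
def withOut {k : ℕ} (g : TGraph n E) (o : Fin k → g.V) : TGraph k E :=
  { g with out := o }

/-- Forget the distinguished vertices. -/
def forget (g : TGraph n E) : TGraph 0 E := g.withOut Fin.elim0

/-- Reverse all the edges. -/
def rev (g : TGraph n E) : TGraph n E :=
  { g with
    src := g.tgt
    tgt := g.src
    connected := fun x y => by
      induction g.connected x y with
      | rel a b h =>
        obtain ⟨e, h1, h2⟩ := h
        exact .symm _ _ (.rel _ _ ⟨e, h2, h1⟩)
      | refl a => exact .refl _
      | symm a b _ ih => exact .symm _ _ ih
      | trans a b c _ _ ih1 ih2 => exact .trans _ _ _ ih1 ih2 }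

/-- The involution on graph operations: reverse all the edges and exchange input and output. -/
def adj (g : GraphOp E) : GraphOp E := g.rev.withOut ![g.out 1, g.out 0]

theorem eqvGen_map {X Y : Type} {r : X → X → Prop} {s : Y → Y → Prop} (f : X → Y)
    (h : ∀ a b, r a b → Relation.EqvGen s (f a) (f b)) {a b : X} (hab : Relation.EqvGen r a b) :
    Relation.EqvGen s (f a) (f b) := by
  induction hab with
  | rel a b hr => exact h a b hr
  | refl a => exact .refl _
  | symm a b _ ih => exact .symm _ _ ih
  | trans a b c _ _ ih1 ih2 => exact .trans _ _ _ ih1 ih2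

/-- Identify the vertices which are related by `r` (or by the equivalence relation that `r`
generates). The edges are kept. -/
def identify (g : TGraph n E) (r : g.V → g.V → Prop) : TGraph n E where
  V := Quot r
  src e := Quot.mk r (g.src e)
  tgt e := Quot.mk r (g.tgt e)
  out i := Quot.mk r (g.out i)
  finite_V := Finite.of_surjective (Quot.mk r) Quot.mk_surjective
  finite_E := g.finite_E
  nonempty_V := g.nonempty_V.map (Quot.mk r)
  connected x y := by
    obtain ⟨x, rfl⟩ := Quot.mk_surjective x
    obtain ⟨y, rfl⟩ := Quot.mk_surjective y
    refine eqvGen_map (Quot.mk r) ?_ (g.connected x y)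
    rintro _ _ ⟨e, rfl, rfl⟩
    exact .rel _ _ ⟨e, rfl, rfl⟩

/-- The quotient `g ^ π` of a graph by a partition `π` of its vertices. -/
def quot (g : TGraph n E) (π : Setoid g.V) : TGraph n E := g.identify (fun x y => π x y)

/-- Merge the two distinguished vertices, and forget them. -/
def close (g : TGraph 2 E) : TGraph 0 E :=
  (g.identify (fun x y => x = g.out 0 ∧ y = g.out 1)).forget

/-- The identifications that define `TGraph.comp`. -/
inductive CompRel {I : Type} {K : I → Type} (g : TGraph n I) (h : ∀ i, GraphOp (K i)) :
    (g.V ⊕ Σ i, (h i).V) → (g.V ⊕ Σ i, (h i).V) → Prop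
  | input (i : I) : CompRel g h (.inr ⟨i, (h i).out 0⟩) (.inl (g.src i))
  | output (i : I) : CompRel g h (.inr ⟨i, (h i).out 1⟩) (.inl (g.tgt i))

/-- Replace every edge `i` of `g` by the graph operation `h i`, the input of `h i` being placed at
the source of the edge and the output of `h i` at its target. -/
def comp {I : Type} {K : I → Type} (g : TGraph n I) (h : ∀ i, GraphOp (K i)) :
    TGraph n (Σ i, K i) where
  V := Quot (CompRel g h)
  src p := Quot.mk _ (.inr ⟨p.1, (h p.1).src p.2⟩)
  tgt p := Quot.mk _ (.inr ⟨p.1, (h p.1).tgt p.2⟩)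
  out i := Quot.mk _ (.inl (g.out i))
  finite_V :=
    haveI := g.finite_E
    Finite.of_surjective (Quot.mk _) Quot.mk_surjective
  finite_E :=
    haveI := g.finite_E
    haveI := fun i => (h i).finite_E
    inferInstance
  nonempty_V := g.nonempty_V.map (fun x => Quot.mk _ (.inl x))
  connected := by
    have inner : ∀ (i : I) (x y : (h i).V), Relation.EqvGen
        (fun a b : Quot (CompRel g h) => ∃ p : Σ i, K i,
          Quot.mk _ (.inr ⟨p.1, (h p.1).src p.2⟩) = a ∧
          Quot.mk _ (.inr ⟨p.1, (h p.1).tgt p.2⟩) = b)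
        (Quot.mk _ (.inr ⟨i, x⟩)) (Quot.mk _ (.inr ⟨i, y⟩)) := by
      intro i x y
      refine eqvGen_map (fun z => Quot.mk (CompRel g h) (.inr ⟨i, z⟩)) ?_ ((h i).connected x y)
      rintro _ _ ⟨e, rfl, rfl⟩
      exact .rel _ _ ⟨⟨i, e⟩, rfl, rfl⟩
    have outer : ∀ (x y : g.V), Relation.EqvGen
        (fun a b : Quot (CompRel g h) => ∃ p : Σ i, K i,
          Quot.mk _ (.inr ⟨p.1, (h p.1).src p.2⟩) = a ∧
          Quot.mk _ (.inr ⟨p.1, (h p.1).tgt p.2⟩) = b)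
        (Quot.mk _ (.inl x)) (Quot.mk _ (.inl y)) := by
      intro x y
      refine eqvGen_map (fun z => Quot.mk (CompRel g h) (.inl z)) ?_ (g.connected x y)
      rintro _ _ ⟨i, rfl, rfl⟩
      have := inner i ((h i).out 0) ((h i).out 1)
      rwa [Quot.sound (CompRel.input i), Quot.sound (CompRel.output i)] at this
    intro x y
    have key : ∀ z : Quot (CompRel g h), ∃ v : g.V, Relation.EqvGen
        (fun a b : Quot (CompRel g h) => ∃ p : Σ i, K i,
          Quot.mk _ (.inr ⟨p.1, (h p.1).src p.2⟩) = a ∧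
          Quot.mk _ (.inr ⟨p.1, (h p.1).tgt p.2⟩) = b) z (Quot.mk _ (.inl v)) := by
      intro z
      obtain ⟨z, rfl⟩ := Quot.mk_surjective z
      rcases z with z | ⟨i, z⟩
      · exact ⟨z, .refl _⟩
      · refine ⟨g.src i, ?_⟩
        have := inner i z ((h i).out 0)
        rwa [Quot.sound (CompRel.input i)] at this
    obtain ⟨a, ha⟩ := key x
    obtain ⟨b, hb⟩ := key y
    exact .trans _ _ _ ha (.trans _ _ _ (outer a b) (.symm _ _ hb))

/-- The identifications that define `TGraph.glue`. -/
inductive GlueRel (g : TGraph n E) (g' : TGraph n E') : (g.V ⊕ g'.V) → (g.V ⊕ g'.V) → Prop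
  | out (i : Fin n) : GlueRel g g' (.inl (g.out i)) (.inr (g'.out i))

/-- Merge the `i`-th distinguished vertices of `g` and `g'` for all `i`, and forget them. At least
one distinguished vertex is needed for the result to be connected. -/
def glue (g : TGraph (n + 1) E) (g' : TGraph (n + 1) E') : TGraph 0 (E ⊕ E') where
  V := Quot (GlueRel g g')
  src := Sum.elim (fun e => Quot.mk _ (.inl (g.src e))) (fun e => Quot.mk _ (.inr (g'.src e)))
  tgt := Sum.elim (fun e => Quot.mk _ (.inl (g.tgt e))) (fun e => Quot.mk _ (.inr (g'.tgt e)))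
  out := Fin.elim0
  finite_V := Finite.of_surjective (Quot.mk _) Quot.mk_surjective
  finite_E :=
    haveI := g.finite_E
    haveI := g'.finite_E
    inferInstance
  nonempty_V := g.nonempty_V.map (fun x => Quot.mk _ (.inl x))
  connected := by
    have key : ∀ z : Quot (GlueRel g g'), Relation.EqvGen
        (fun a b : Quot (GlueRel g g') => ∃ e : E ⊕ E',
          Sum.elim (fun e => Quot.mk _ (.inl (g.src e)))
            (fun e => Quot.mk _ (.inr (g'.src e))) e = a ∧
          Sum.elim (fun e => Quot.mk _ (.inl (g.tgt e)))
            (fun e => Quot.mk _ (.inr (g'.tgt e))) e = b) z (Quot.mk _ (.inl (g.out 0))) := by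
      intro z
      obtain ⟨z, rfl⟩ := Quot.mk_surjective z
      rcases z with z | z
      · refine eqvGen_map (fun z => Quot.mk (GlueRel g g') (.inl z)) ?_ (g.connected z (g.out 0))
        rintro _ _ ⟨e, rfl, rfl⟩
        exact .rel _ _ ⟨.inl e, rfl, rfl⟩
      · rw [Quot.sound (GlueRel.out (g := g) (g' := g') 0)]
        refine eqvGen_map (fun z => Quot.mk (GlueRel g g') (.inr z)) ?_ (g'.connected z (g'.out 0))
        rintro _ _ ⟨e, rfl, rfl⟩
        exact .rel _ _ ⟨.inr e, rfl, rfl⟩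
    intro x y
    exact .trans _ _ _ (key x) (.symm _ _ (key y))

end TGraph

/-- The graph operation `0`: one vertex and no edge. -/
def unitOp : GraphOp Empty where
  V := Unit
  src := Empty.elim
  tgt := Empty.elim
  out _ := ()
  finite_V := inferInstance
  finite_E := inferInstance
  nonempty_V := inferInstance
  connected _ _ := .refl _

/-- The graph operation `Δ`: one vertex and one edge. -/
def diagOp : GraphOp Unit where
  V := Unit
  src _ := ()
  tgt _ := ()
  out _ := ()
  finite_V := inferInstance
  finite_E := inferInstance
  nonempty_V := inferInstance
  connected _ _ := .refl _

/-- The graph operation `I`: two vertices, and one edge from the input to the output. -/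
def idOp : GraphOp Unit where
  V := Fin 2
  src _ := 0
  tgt _ := 1
  out i := i
  finite_V := inferInstance
  finite_E := inferInstance
  nonempty_V := inferInstance
  connected x y := by
    have h : ∀ z : Fin 2, Relation.EqvGen
        (fun a b : Fin 2 => ∃ _ : Unit, (0 : Fin 2) = a ∧ (1 : Fin 2) = b) z 0 := by
      intro z
      fin_cases z
      · exact .refl _
      · exact .symm _ _ (.rel _ _ ⟨(), rfl, rfl⟩)
    exact .trans _ _ _ (h x) (.symm _ _ (h y))

/-! ## Graph monomials and graph polynomials -/

/-- An `n`-graph monomial indexed by `L`: a finite connected oriented graph with `n` outputs and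
with edges labelled by `L`. For `n = 2` the output `0` is the input and the output `1` is the
output. Isomorphic monomials (`GraphMon.Iso`) stand for the same monomial: the functionals below
are required to be invariant under isomorphism, and isomorphic monomials are equal in the free
product of algebras below. -/
structure GraphMon (n : ℕ) (L : Type u) where
  E : Type
  G : TGraph n E
  lab : E → L

/-- The vector space spanned by the `n`-graph monomials indexed by `L`. -/
abbrev GraphPoly (n : ℕ) (L : Type u) := GraphMon n L →₀ ℂ

namespace GraphMon

variable {n : ℕ} {L : Type u}

/-- Isomorphism of graph monomials. -/
def Iso (m m' : GraphMon n L) : Prop :=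
  ∃ σ : m.E ≃ m'.E, TGraph.IsoAlong σ m.G m'.G ∧ ∀ e, m'.lab (σ e) = m.lab e

/-- Apply `f` to all labels. -/
def map {L' : Type v} (f : L → L') (m : GraphMon n L) : GraphMon n L' :=
  ⟨m.E, m.G, fun e => f (m.lab e)⟩

/-- The quotient `m ^ π` by a partition `π` of the vertices. -/
def quot (m : GraphMon n L) (π : Setoid m.G.V) : GraphMon n L := ⟨m.E, m.G.quot π, m.lab⟩

/-- `m ^ *`: reverse the edges and apply the involution `s` to the labels; keep the outputs. -/
def star (s : L → L) (m : GraphMon n L) : GraphMon n L := ⟨m.E, m.G.rev, fun e => s (m.lab e)⟩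

/-- The adjoint of a monomial seen as a graph operation: reverse the edges, apply the involution
`s` to the labels, and exchange input and output. -/
def adj (s : L → L) (m : GraphMon 2 L) : GraphMon 2 L := ⟨m.E, m.G.adj, fun e => s (m.lab e)⟩

/-- Merge input and output, and forget them. -/
def close (m : GraphMon 2 L) : GraphMon 0 L := ⟨m.E, m.G.close, m.lab⟩

/-- `m | m'`: merge the `i`-th outputs of `m` and `m'` for all `i`. -/
def glue (m m' : GraphMon (n + 1) L) : GraphMon 0 L :=
  ⟨m.E ⊕ m'.E, m.G.glue m'.G, Sum.elim m.lab m'.lab⟩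

/-- The monomial with two vertices and one edge, from the input to the output, labelled by `x`. -/
def edge (x : L) : GraphMon 2 L := ⟨Unit, idOp, fun _ => x⟩

/-- `Z_g (m_i, i ∈ I)` for monomials `m_i`: replace the edge `i` of `g` by `m_i`. -/
def subst {I : Type} (g : GraphOp I) (m : I → GraphMon 2 L) : GraphMon 2 L :=
  ⟨Σ i, (m i).E, g.comp (fun i => (m i).G), fun p => (m p.1).lab p.2⟩

end GraphMon

namespace GraphPoly

variable {n : ℕ} {L : Type u}

/-- The bilinear extension of `(m, m') ↦ m | m'`. -/
def glue (t t' : GraphPoly (n + 1) L) : GraphPoly 0 L :=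
  t.sum fun m c => t'.sum fun m' c' => Finsupp.single (m.glue m') (c * c')

/-- The antilinear extension of `m ↦ m ^ *`. -/
def star (s : L → L) (t : GraphPoly n L) : GraphPoly n L :=
  t.sum fun m c => Finsupp.single (m.star s) ((starRingEnd ℂ) c)

end GraphPoly

section Functionals

variable {L : Type u}

/-- The linear extension to `0`-graph polynomials of a function on `0`-graph monomials. -/
def evalPoly (τ : GraphMon 0 L → ℂ) : GraphPoly 0 L →ₗ[ℂ] ℂ := Finsupp.linearCombination ℂ τ

/-- `τ` is well-defined on isomorphism classes of monomials, that is, it is the same thing as a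
linear form on the space of `0`-graph polynomials; and it sends the graph with no edge to one. -/
structure IsTrafficFunctional (τ : GraphMon 0 L → ℂ) : Prop where
  iso_inv : ∀ t t' : GraphMon 0 L, t.Iso t' → τ t = τ t'
  unital : ∀ t : GraphMon 0 L, IsEmpty t.E → τ t = 1

open scoped ComplexOrder in
/-- The positivity condition `τ[t | t ^ *] ≥ 0` for all `n`-graph polynomials `t`, `n ≥ 1`. -/
def IsPositive (s : L → L) (τ : GraphMon 0 L → ℂ) : Prop :=
  ∀ (n : ℕ) (t : GraphPoly (n + 1) L), 0 ≤ evalPoly τ (t.glue (t.star s))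

/-! ## The injective version of a functional -/

instance finite_setoid (V : Type) [Finite V] : Finite (Setoid V) :=
  Finite.of_injective (fun π : Setoid V => fun x y => π x y)
    (fun _ _ h => Setoid.ext fun x y => iff_of_eq (congrFun (congrFun h x) y))

open Classical in
/-- The Möbius function of the lattice of partitions of the finite set `V`; here `π ≤ ρ` means
that `π` is finer than `ρ`, and `⊥` is the partition into singletons. -/
def partitionMob (V : Type) [Finite V] (π ρ : Setoid V) : ℂ :=
  letI : Fintype (Setoid V) := Fintype.ofFinite _
  letI : LocallyFiniteOrder (Setoid V) := Fintype.toLocallyFiniteOrder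
  IncidenceAlgebra.mu ℂ π ρ

/-- The injective version `τ⁰` of `τ`. -/
def injVersion (τ : GraphMon 0 L → ℂ) (t : GraphMon 0 L) : ℂ :=
  ∑ᶠ π : Setoid t.G.V, partitionMob t.G.V ⊥ π * τ (t.quot π)

end Functionals

/-! ## Colored components and the free product of functionals -/

section Components

variable {J : Type w} {L : J → Type u}

namespace GraphMon

/-- The vertex `x` is an endpoint of the edge `e`. -/
def Incident (T : GraphMon 0 (Σ j, L j)) (e : T.E) (x : T.G.V) : Prop :=
  T.G.src e = x ∨ T.G.tgt e = x

/-- The color of an edge. -/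
def color (T : GraphMon 0 (Σ j, L j)) (e : T.E) : J := (T.lab e).1

/-- The two edges have the same color and share a vertex. -/
def Adjacent (T : GraphMon 0 (Σ j, L j)) (e e' : T.E) : Prop :=
  T.color e = T.color e' ∧ ∃ x, T.Incident e x ∧ T.Incident e' x

/-- The colored components of `T`, as classes of edges: two edges are in the same class if they
are linked by a chain of edges of the same color, in which consecutive edges share a vertex. -/
def Comp (T : GraphMon 0 (Σ j, L j)) : Type := Quot T.Adjacent

/-- The color of a colored component. -/
def compColor (T : GraphMon 0 (Σ j, L j)) (c : T.Comp) : J :=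
  Quot.lift T.color (fun _ _ h => h.1) c

/-- The vertex `x` belongs to the component `c`. -/
def MemComp (T : GraphMon 0 (Σ j, L j)) (x : T.G.V) (c : T.Comp) : Prop :=
  ∃ e : T.E, Quot.mk T.Adjacent e = c ∧ T.Incident e x

theorem compColor_eq (T : GraphMon 0 (Σ j, L j)) {c : T.Comp} {e : T.E}
    (h : Quot.mk T.Adjacent e = c) : (T.lab e).1 = T.compColor c := by
  subst h
  rfl

/-- A colored component of `T`, as a graph labelled by the `L j` of its color `j`. -/
def component (T : GraphMon 0 (Σ j, L j)) (c : T.Comp) : GraphMon 0 (L (T.compColor c)) where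
  E := {e : T.E // Quot.mk T.Adjacent e = c}
  lab e := T.compColor_eq e.2 ▸ (T.lab e.1).2
  G :=
    { V := {x : T.G.V // T.MemComp x c}
      src := fun e => ⟨T.G.src e.1, e.1, e.2, .inl rfl⟩
      tgt := fun e => ⟨T.G.tgt e.1, e.1, e.2, .inr rfl⟩
      out := Fin.elim0
      finite_V := inferInstance
      finite_E :=
        haveI := T.G.finite_E
        inferInstance
      nonempty_V := by
        obtain ⟨e, rfl⟩ := Quot.mk_surjective c
        exact ⟨⟨T.G.src e, e, rfl, .inl rfl⟩⟩
      connected := by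
        have one : ∀ (e : T.E) (he : Quot.mk T.Adjacent e = c) (x : T.G.V) (hx : T.Incident e x),
            Relation.EqvGen (fun a b : {x : T.G.V // T.MemComp x c} =>
              ∃ e : {e : T.E // Quot.mk T.Adjacent e = c},
                (⟨T.G.src e.1, e.1, e.2, .inl rfl⟩ : {x : T.G.V // T.MemComp x c}) = a ∧
                (⟨T.G.tgt e.1, e.1, e.2, .inr rfl⟩ : {x : T.G.V // T.MemComp x c}) = b)
              ⟨T.G.src e, e, he, .inl rfl⟩ ⟨x, e, he, hx⟩ := by
          rintro e he x (rfl | rfl)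
          · exact .refl _
          · exact .rel _ _ ⟨⟨e, he⟩, rfl, rfl⟩
        have two : ∀ e e' : T.E, Relation.EqvGen T.Adjacent e e' →
            ∀ (he : Quot.mk T.Adjacent e = c) (he' : Quot.mk T.Adjacent e' = c),
            Relation.EqvGen (fun a b : {x : T.G.V // T.MemComp x c} =>
              ∃ e : {e : T.E // Quot.mk T.Adjacent e = c},
                (⟨T.G.src e.1, e.1, e.2, .inl rfl⟩ : {x : T.G.V // T.MemComp x c}) = a ∧
                (⟨T.G.tgt e.1, e.1, e.2, .inr rfl⟩ : {x : T.G.V // T.MemComp x c}) = b)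
              ⟨T.G.src e, e, he, .inl rfl⟩ ⟨T.G.src e', e', he', .inl rfl⟩ := by
          intro e e' h
          induction h with
          | rel a b hab =>
            intro he he'
            obtain ⟨x, hx, hx'⟩ := hab.2
            exact .trans _ _ _ (one a he x hx) (.symm _ _ (one b he' x hx'))
          | refl a => exact fun _ _ => .refl _
          | symm a b _ ih => exact fun he he' => .symm _ _ (ih he' he)
          | trans a b d h1 h2 ih1 ih2 =>
            intro he he'
            have hb : Quot.mk T.Adjacent b = c := (Quot.eqvGen_sound h1).symm.trans he
            exact .trans _ _ _ (ih1 he hb) (ih2 hb he')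
        rintro ⟨x, e, he, hx⟩ ⟨y, e', he', hy⟩
        exact .trans _ _ _ (.symm _ _ (one e he x hx))
          (.trans _ _ _ (two e e' (Quot.eqvGen_exact (he.trans he'.symm)) he he')
            (one e' he' y hy)) }

/-- The connectors of `T`: the vertices that belong to at least two colored components. -/
def Connector (T : GraphMon 0 (Σ j, L j)) : Type :=
  {x : T.G.V // ∃ c c' : T.Comp, c ≠ c' ∧ T.MemComp x c ∧ T.MemComp x c'}

/-- The graph of colored components of `T`: its vertices are the colored components and the
connectors of `T`, with an edge between a component and a connector that belongs to it. -/
def compGraph (T : GraphMon 0 (Σ j, L j)) : SimpleGraph (T.Comp ⊕ T.Connector) where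
  Adj
    | .inl c, .inr x => T.MemComp x.1 c
    | .inr x, .inl c => T.MemComp x.1 c
    | _, _ => False
  symm := ⟨by rintro (c | x) (c' | x') h <;> exact h⟩
  loopless := ⟨by rintro (c | x) h <;> exact h⟩

end GraphMon

open Classical in
/-- The injective version of the free product: the product of the `τ_j⁰` over the colored
components if the graph of colored components is a tree, and zero otherwise. If `T` has no edge
(no colored component) the value is one. -/
def freeInj (τ : ∀ j, GraphMon 0 (L j) → ℂ) (T : GraphMon 0 (Σ j, L j)) : ℂ :=
  if T.compGraph.IsTree ∨ IsEmpty T.E then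
    ∏ᶠ c : T.Comp, injVersion (τ (T.compColor c)) (T.component c)
  else 0

/-- The free product of the `τ_j`: the functional with injective version `freeInj τ`. -/
def freeProd (τ : ∀ j, GraphMon 0 (L j) → ℂ) (T : GraphMon 0 (Σ j, L j)) : ℂ :=
  ∑ᶠ π : Setoid T.G.V, freeInj τ (T.quot π)

/-- The involution on the disjoint union of the `L j`. -/
def sigmaStar (s : ∀ j, L j → L j) (x : Σ j, L j) : Σ j, L j := ⟨x.1, s x.1 x.2⟩

end Components

/-! ## Spaces of traffics -/

/-- A `𝒢`-algebra: a vector space with an action of the operad of graph operations. A linear map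
on `A ⊗ ⋯ ⊗ A` is given as a multilinear map. The field `Z_iso` says that isomorphic graph
operations act in the same way, and contains the equivariance under reordering of the edges. -/
structure GAlgebra (A : Type u) [AddCommGroup A] [Module ℂ A] where
  Z : ∀ {I : Type}, GraphOp I → MultilinearMap ℂ (fun _ : I => A) A
  Z_id : ∀ a : Unit → A, Z idOp a = a ()
  Z_comp : ∀ {I : Type} {K : I → Type} (g : GraphOp I) (h : ∀ i, GraphOp (K i))
    (a : ∀ i, K i → A), Z g (fun i => Z (h i) (a i)) = Z (g.comp h) (fun p => a p.1 p.2)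
  Z_iso : ∀ {I I' : Type} (σ : I ≃ I') (g : GraphOp I) (g' : GraphOp I'),
    TGraph.IsoAlong σ g g' → ∀ a : I' → A, Z g' a = Z g (fun i => a (σ i))

/-- An algebraic space of traffics: a `𝒢`-algebra with a unital and input-independent linear form
`Φ`. Input-independence says that `Φ ∘ Z_g = Φ ∘ Z_{Δ ∘ g}`, and that for a graph operation with
equal input and output the value of `Φ ∘ Z` does not depend on the place of this vertex. -/
structure AlgSpaceOfTraffics (A : Type u) [AddCommGroup A] [Module ℂ A] extends GAlgebra A where
  Φ : A →ₗ[ℂ] ℂ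
  Φ_unit : Φ (Z unitOp Empty.elim) = 1
  Φ_diag : ∀ {I : Type} (g : GraphOp I) (a : I → A),
    Φ (Z g a) = Φ (Z (diagOp.comp fun _ : Unit => g) (fun p => a p.2))
  Φ_indep : ∀ {I : Type} (g : TGraph 0 I) (x y : g.V) (a : I → A),
    Φ (Z (g.withOut fun _ => x) a) = Φ (Z (g.withOut fun _ => y) a)

/-- The distribution of traffics: `τ(t) = Φ(Z_g(γ))`, where `g` is the graph of `t`, with an
arbitrary vertex chosen both as input and as output, and `γ` is the labelling of `t`. -/
def AlgSpaceOfTraffics.dist {A : Type u} [AddCommGroup A] [Module ℂ A]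
    (S : AlgSpaceOfTraffics A) (t : GraphMon 0 A) : ℂ :=
  S.Φ (S.Z (t.G.withOut fun _ => Classical.arbitrary t.G.V) t.lab)

/-- A space of traffics: an algebraic space of traffics which is a `𝒢^*`-algebra (it has an
antilinear involution that is compatible with the graph operations), such that the distribution of
traffics satisfies the positivity condition. -/
structure SpaceOfTraffics (A : Type u) [AddCommGroup A] [Module ℂ A] extends
    AlgSpaceOfTraffics A where
  star : A → A
  star_add : ∀ a b, star (a + b) = star a + star b
  star_smul : ∀ (c : ℂ) (a : A), star (c • a) = (starRingEnd ℂ) c • star a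
  star_star : ∀ a, star (star a) = a
  star_Z : ∀ {I : Type} (g : GraphOp I) (a : I → A), star (Z g a) = Z g.adj (fun i => star (a i))
  positive : IsPositive star toAlgSpaceOfTraffics.dist

/-- Homomorphisms of spaces of traffics. -/
structure SpaceOfTraffics.IsHom {A : Type u} {B : Type v} [AddCommGroup A] [Module ℂ A]
    [AddCommGroup B] [Module ℂ B] (S : SpaceOfTraffics A) (S' : SpaceOfTraffics B)
    (f : A →ₗ[ℂ] B) : Prop where
  map_Z : ∀ {I : Type} (g : GraphOp I) (a : I → A), f (S.Z g a) = S'.Z g (fun i => f (a i))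
  map_star : ∀ a, f (S.star a) = S'.star (f a)
  map_Φ : ∀ a, S'.Φ (f a) = S.Φ a

/-! ## The free product of `𝒢`-algebras -/

section FreeProduct

variable {J : Type w} {A : J → Type u} [∀ j, AddCommGroup (A j)] [∀ j, Module ℂ (A j)]

/-- The elements of the space of `2`-graph polynomials that are set to zero in the free product.
* `iso`: isomorphic monomials are equal.
* `linear`: a monomial is linear in the label of each edge (in the form `Z_g` of edges).
* `comp`: an edge labelled by `Z_h(a_k, k ∈ K)`, with all the `a_k` in a same `A_j`, may be
  replaced by the graph `h` with edges labelled by the `a_k`. -/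
inductive FreeRel (S : ∀ j, GAlgebra (A j)) : GraphPoly 2 (Σ j, A j) → Prop
  | iso (m m' : GraphMon 2 (Σ j, A j)) (h : m.Iso m') :
      FreeRel S (Finsupp.single m 1 - Finsupp.single m' 1)
  | linear {I : Type} [DecidableEq I] (g : GraphOp I) (x : I → Σ j, A j) (i : I) (j : J)
      (c : ℂ) (a b : A j) :
      FreeRel S
        (Finsupp.single (GraphMon.subst g
            (Function.update (fun k => GraphMon.edge (x k)) i (GraphMon.edge ⟨j, c • a + b⟩))) 1
          - c • Finsupp.single (GraphMon.subst g
            (Function.update (fun k => GraphMon.edge (x k)) i (GraphMon.edge ⟨j, a⟩))) 1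
          - Finsupp.single (GraphMon.subst g
            (Function.update (fun k => GraphMon.edge (x k)) i (GraphMon.edge ⟨j, b⟩))) 1)
  | comp {I K : Type} [DecidableEq I] (g : GraphOp I) (x : I → Σ j, A j) (i : I) (j : J)
      (h : GraphOp K) (a : K → A j) :
      FreeRel S
        (Finsupp.single (GraphMon.subst g
            (Function.update (fun k => GraphMon.edge (x k)) i
              (GraphMon.edge ⟨j, (S j).Z h a⟩))) 1
          - Finsupp.single (GraphMon.subst g
            (Function.update (fun k => GraphMon.edge (x k)) i
              (GraphMon.subst h (fun k => GraphMon.edge ⟨j, a k⟩)))) 1)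

/-- The vector space of the free product of a family of `𝒢`-algebras: `2`-graph polynomials
labelled by the disjoint union of the algebras, modulo the space spanned by the relations. -/
abbrev FreeProduct (S : ∀ j, GAlgebra (A j)) :=
  GraphPoly 2 (Σ j, A j) ⧸ Submodule.span ℂ {r | FreeRel S r}

/-- The class of a monomial in the free product. -/
def FreeProduct.cls (S : ∀ j, GAlgebra (A j)) (m : GraphMon 2 (Σ j, A j)) : FreeProduct S :=
  Submodule.Quotient.mk (Finsupp.single m 1)

/-- The canonical map `V_j` from `A j` to the free product. -/
def FreeProduct.incl (S : ∀ j, GAlgebra (A j)) (j : J) (a : A j) : FreeProduct S :=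
  FreeProduct.cls S (GraphMon.edge ⟨j, a⟩)

end FreeProduct

end Traffic

end

/-! The injective version `freeInj` is a product over colored components that form a tree, and both
halves of the theorem come from cutting such a tree at one vertex. The tree condition is used in the
form `ColGraph.Treelike`: two distinct vertices of a component are never linked by edges outside of
it. A connected treelike graph with a root and a color `j` is a monochromatic root component
(possibly empty) with branches hanging from single vertices (`Treelike.exists_decomp`), and its
weight factors accordingly (`Decomp.weight_eq`).

Positivity. A partition of `t | t'` is a partition of each side together with a partial matching of
the blocks that contains the pairs of outputs (`sum_quot_glue`). So it suffices that the pairing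
`K`, the sum over matchings of the weights of the amalgams of two rooted graphs, is a positive
semidefinite kernel. If an amalgam is a tree, the matching respects the attachment points of the
branches (`Decomp.compat_of_treelike`). Hence `K` is a sum over the matchings `N` of the two root
components of the weight of the glued component, times the pairings of the branches at matched
vertices, times the solo weights of the branches at unmatched vertices (`Decomp.pairing_eq`). A
single unmarked vertex `u` satisfies `K(u,u) = 1`, and the solo weights are `K(a,u)` and `K(u,b)`.
Write `K = (K - K(.,u) K(u,.)) + K(.,u) K(u,.)` at each matched pair other than the roots and
expand. The solo factors then depend only on the set `Q` of pairs where the centered kernel is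
chosen, and the sum over `N` containing `Q` is a monochromatic kernel, which is positive by Möbius
inversion and positivity of `τ j` (`psd_monoKernel`). Therefore `K` is built by sums and Schur
products from kernels of branches (`kernel_expand`, `psd_of_branches`), and an induction on the
number of edges, then on the colors present at the root, concludes (`psd_kernel`).

The space of traffics. Substitution and adjunction of graphs respect the defining relations for
formal reasons. The substantial point is that the trace does: a linear relation between graphs of
color `j` which holds for `τ j` at every edge of every graph must hold for the free product
(`sum_mul_freeProd_replace_eq_zero`). Replacing an edge `e` by `h` is gluing `h` at the endpoints of
`e` and erasing `e`. Since `h` links these endpoints in the color of `e`, the edge may be kept as a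
ghost without changing the tree (`weight_insert`). The weight is then a product over the branches at
the component of `e`, independent of `h`, times the weight of this component glued with a quotient
of `h`. The sum of the latter weights is a part of the partition sum of `τ j`, where the relation
holds by inversion. Positivity of the trace follows from positivity on labelled graphs by expanding
each label as a combination of monomials, and the canonical maps preserve the trace because the free
product extends its factors (`freeProd_map`). -/

noncomputable section

namespace Traffic

/-! ## Positive semidefinite kernels -/

section Kernels

open Matrix ComplexOrder

variable {ι κ : Type*}

/-- `K` is a positive semidefinite kernel. -/
def PSD (K : ι → ι → ℂ) : Prop := (Matrix.of K).PosSemidef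

/-- Polarization: over `ℂ`, nonnegativity of the quadratic form already forces Hermitian symmetry,
which `PosSemidef` asks for separately. -/
theorem PSD.of_sum_nonneg {K : ι → ι → ℂ}
    (h : ∀ c : ι →₀ ℂ, 0 ≤ c.sum fun i a => c.sum fun j b => star a * K i j * b) :
    PSD K := by
  classical
  refine ⟨?_, h⟩
  have diag : ∀ i, (K i i).im = 0 := by
    intro i
    have := (Complex.le_def.1 (h (Finsupp.single i 1))).2
    simpa using this.symm
  ext i j
  rw [conjTranspose_apply]
  simp only [of_apply]
  rcases eq_or_ne i j with rfl | hij
  · apply Complex.ext <;> simp [diag]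
  -- Test the form on `e_i + z e_j`; the imaginary parts at `z = 1` and `z = I` show that `K i j`
  -- and `K j i` are conjugate.
  have two : ∀ z : ℂ, 0 ≤ K i i + K i j * z + (star z * K j i + star z * K j j * z) := by
    intro z
    have := h (Finsupp.single i 1 + Finsupp.single j z)
    have e : ∀ f : ι → ℂ → ℂ, (∀ k, f k 0 = 0) →
        (Finsupp.single i 1 + Finsupp.single j z).sum f = f i 1 + f j z := by
      intro f hf
      rw [Finsupp.sum_of_support_subset (s := {i, j}) _ _ _ (fun k _ => hf k),
        Finset.sum_pair hij]
      · simp [hij, hij.symm]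
      · intro k hk
        by_contra hk'
        simp only [Finset.mem_insert, Finset.mem_singleton, not_or] at hk'
        simp [Ne.symm hk'.1, Ne.symm hk'.2] at hk
    rw [e _ (by simp), e _ (by simp), e _ (by simp)] at this
    simpa using this
  have h1 := (Complex.le_def.1 (two 1)).2
  have h2 := (Complex.le_def.1 (two Complex.I)).2
  simp [diag] at h1 h2
  apply Complex.ext <;> simp <;> linarith

theorem PSD.sum_nonneg {K : ι → ι → ℂ} (hK : PSD K) (c : ι →₀ ℂ) :
    0 ≤ c.sum fun i a => c.sum fun j b => star a * K i j * b := hK.2 c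

theorem PSD.star_apply {K : ι → ι → ℂ} (hK : PSD K) (i j : ι) : star (K i j) = K j i :=
  hK.1.apply j i

theorem PSD.comap {K : ι → ι → ℂ} (hK : PSD K) (f : κ → ι) : PSD fun i j => K (f i) (f j) :=
  hK.submatrix f

/-- The Gram kernel of the vectors `∑ x, a i x • e_{f i x}`. Many kernels below are shown to be
positive by pulling a positive kernel back through finite combinations in this way. -/
theorem PSD.sum_sum {K : κ → κ → ℂ} (hK : PSD K) {X : ι → Type*}
    [∀ i, Fintype (X i)] (f : ∀ i, X i → κ) (a : ∀ i, X i → ℂ) :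
    PSD fun i j => ∑ x, ∑ y, star (a i x) * a j y * K (f i x) (f j y) := by
  refine .of_sum_nonneg fun c => ?_
  have h := (hK.comap (fun p : (Σ i : c.support, X i) => f p.1 p.2)).dotProduct_mulVec_nonneg
    (fun p => c p.1 * a p.1 p.2)
  convert h using 1
  simp only [Finsupp.sum, dotProduct, mulVec, Fintype.sum_sigma, Pi.star_apply,
    of_apply]
  rw [← Finset.sum_coe_sort c.support]
  refine Finset.sum_congr rfl fun i _ => ?_
  rw [← Finset.sum_coe_sort c.support]
  simp only [Finset.mul_sum, Finset.sum_mul]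
  rw [Finset.sum_comm]
  refine Finset.sum_congr rfl fun x _ => Finset.sum_congr rfl fun j _ =>
    Finset.sum_congr rfl fun y _ => ?_
  simp only [star_mul']
  ring

theorem PSD.one : PSD (fun _ _ : ι => (1 : ℂ)) := by
  have := (PosSemidef.one (n := Unit) (R := ℂ)).submatrix (fun _ : ι => ())
  refine (congrArg Matrix.PosSemidef ?_).mp this
  ext i j
  simp

theorem PSD.mul_rankOne {K : ι → ι → ℂ} (hK : PSD K) (a : ι → ℂ) :
    PSD fun i j => star (a i) * a j * K i j := by
  have := hK.sum_sum (X := fun _ => Unit) (fun i _ => i) (fun i _ => a i)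
  simpa using this

theorem PSD.mul {K K' : ι → ι → ℂ} (hK : PSD K) (hK' : PSD K') :
    PSD fun i j => K i j * K' i j :=
  PosSemidef.hadamard (𝕜 := ℂ) hK hK'

theorem PSD.prod {α : Type*} (s : Finset α) (K : α → ι → ι → ℂ)
    (h : ∀ x ∈ s, PSD (K x)) : PSD fun i j => ∏ x ∈ s, K x i j := by
  classical
  induction s using Finset.induction_on with
  | empty => simpa using PSD.one
  | insert x s hx ih =>
    simp only [Finset.prod_insert hx]
    exact (h x (by simp)).mul (ih fun y hy => h y (by simp [hy]))

theorem PSD.smul {K : ι → ι → ℂ} (hK : PSD K) {a : ℂ} (ha : 0 ≤ a) :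
    PSD fun i j => a * K i j := by
  refine .of_sum_nonneg fun c => ?_
  have := mul_nonneg ha (hK.sum_nonneg c)
  convert this using 1
  simp only [Finsupp.sum, Finset.mul_sum]
  refine Finset.sum_congr rfl fun i _ => Finset.sum_congr rfl fun j _ => ?_
  ring

theorem PSD.sum {α : Type*} (s : Finset α) (K : α → ι → ι → ℂ)
    (h : ∀ x ∈ s, PSD (K x)) : PSD fun i j => ∑ x ∈ s, K x i j := by
  have := Matrix.posSemidef_sum s (x := fun x => Matrix.of (K x)) h
  refine (congrArg Matrix.PosSemidef ?_).mp this
  ext i j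
  simp [Matrix.sum_apply]

/-- Projection to the orthogonal complement of the unit vector `e_u`: this is the Gram kernel of the
vectors `e_i - K u i • e_u`. -/
theorem PSD.sub_of_unit {K : ι → ι → ℂ} (hK : PSD K) {u : ι} (hu : K u u = 1) :
    PSD fun i j => K i j - K i u * K u j := by
  have := hK.sum_sum (X := fun _ : ι => Bool) (fun i x => if x then i else u)
    (fun i x => if x then 1 else - K u i)
  refine (congrArg PSD ?_).mp this
  ext i j
  have h := hK.star_apply u i
  rw [Complex.star_def] at h
  simp [hu, h]
  ring

theorem PSD.eq_kernel {G : Type*} (g : ι → G) [∀ i j, Decidable (g i = g j)] :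
    PSD fun i j => if g i = g j then (1 : ℂ) else 0 := by
  classical
  have := (PosSemidef.one (n := G) (R := ℂ)).submatrix g
  refine (congrArg Matrix.PosSemidef ?_).mp this
  ext i j
  simp [one_apply]

theorem PSD.of_subtype {K : ι → ι → ℂ} {p : ι → Prop}
    (hK : PSD fun i j : {i // p i} => K i j)
    (h1 : ∀ i j, ¬ p i → K i j = 0) (h2 : ∀ i j, ¬ p j → K i j = 0) : PSD K := by
  classical
  -- An index outside of `p` is given the empty combination, hence the zero vector.
  have := hK.sum_sum (X := fun i => {_u : Unit // p i}) (fun i x => ⟨i, x.2⟩)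
    (fun _ _ => 1)
  refine (congrArg PSD ?_).mp this
  ext i j
  by_cases hi : p i
  · by_cases hj : p j
    · have : Unique {_u : Unit // p i} := ⟨⟨(), hi⟩, fun _ => rfl⟩
      have : Unique {_u : Unit // p j} := ⟨⟨(), hj⟩, fun _ => rfl⟩
      simp
    · have : IsEmpty {_u : Unit // p j} := ⟨fun x => hj x.2⟩
      simp [h2 i j hj]
  · have : IsEmpty {_u : Unit // p i} := ⟨fun x => hi x.2⟩
    simp [h1 i j hi]

end Kernels

end Traffic
end

noncomputable section

namespace Traffic

/-! ## Colored graphs which are trees of colored components -/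

/-- A graph with colored edges, not necessarily connected. -/
structure ColGraph (V E J : Type*) where
  src : E → V
  tgt : E → V
  col : E → J

namespace ColGraph

open Relation

theorem _root_.Traffic.eqvGen_mono {X : Type*} {r s : X → X → Prop} (h : ∀ a b, r a b → s a b)
    {a b : X} (hab : EqvGen r a b) : EqvGen s a b := by
  induction hab with
  | rel a b hr => exact .rel _ _ (h a b hr)
  | refl a => exact .refl _
  | symm a b _ ih => exact .symm _ _ ih
  | trans a b c _ _ ih1 ih2 => exact .trans _ _ _ ih1 ih2

variable {V V' E E' J : Type*} (G : ColGraph V E J)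

/-- `x` is an endpoint of `e`. -/
def Inc (e : E) (x : V) : Prop := G.src e = x ∨ G.tgt e = x

/-- The endpoints of the edges in `F`. -/
def verts (F : Set E) : Set V := {x | ∃ e ∈ F, G.Inc e x}

/-- `x` and `y` are linked by a path of edges in `F`. -/
def Conn (F : Set E) : V → V → Prop := EqvGen fun a b => ∃ e ∈ F, G.src e = a ∧ G.tgt e = b

/-- `e` and `e'` are edges of `F` of the same color that share a vertex. -/
def Adj (F : Set E) (e e' : E) : Prop :=
  e ∈ F ∧ e' ∈ F ∧ G.col e = G.col e' ∧ ∃ x, G.Inc e x ∧ G.Inc e' x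

/-- The colored component of `e` in `F`. -/
def comp (F : Set E) (e : E) : Set E := {e' | EqvGen (G.Adj F) e e'}

/-- The colored components of `F`. -/
def comps (F : Set E) : Set (Set E) := G.comp F '' F

/-- The colored components of `F` form a tree: removing the edges of a component disconnects all
its vertices. -/
def Treelike (F : Set E) : Prop :=
  ∀ c ∈ G.comps F, ∀ x ∈ G.verts c, ∀ y ∈ G.verts c, G.Conn (F \ c) x y → x = y

open Classical in
/-- The product of the weights of the components, and zero if they do not form a tree. -/
def weight (w : Set E → ℂ) (F : Set E) : ℂ :=
  if G.Treelike F then ∏ᶠ c ∈ G.comps F, w c else 0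

variable {G} {F F' C : Set E} {e e' : E} {x y z : V}

theorem inc_src : G.Inc e (G.src e) := .inl rfl
theorem inc_tgt : G.Inc e (G.tgt e) := .inr rfl

theorem Conn.refl : G.Conn F x x := EqvGen.refl _
theorem Conn.symm (h : G.Conn F x y) : G.Conn F y x := EqvGen.symm _ _ h
theorem Conn.trans (h : G.Conn F x y) (h' : G.Conn F y z) : G.Conn F x z := EqvGen.trans _ _ _ h h'
theorem Conn.edge (h : e ∈ F) : G.Conn F (G.src e) (G.tgt e) := .rel _ _ ⟨e, h, rfl, rfl⟩

theorem Conn.inc (h : e ∈ F) (hx : G.Inc e x) (hy : G.Inc e y) : G.Conn F x y := by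
  rcases hx with rfl | rfl <;> rcases hy with rfl | rfl
  exacts [.refl, .edge h, (Conn.edge h).symm, .refl]

theorem Conn.lift {W E₂ J₂ : Type*} {G₂ : ColGraph W E₂ J₂} {F₂ : Set E₂} (f : V → W)
    (hf : ∀ e ∈ F, G₂.Conn F₂ (f (G.src e)) (f (G.tgt e))) (h : G.Conn F x y) :
    G₂.Conn F₂ (f x) (f y) := by
  induction h with
  | rel a b h => obtain ⟨e, he, rfl, rfl⟩ := h; exact hf e he
  | refl a => exact .refl
  | symm a b _ ih => exact ih.symm
  | trans a b c _ _ ih1 ih2 => exact ih1.trans ih2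

theorem Conn.mono (h : F ⊆ F') (hx : G.Conn F x y) : G.Conn F' x y :=
  hx.lift id fun _ he => .edge (h he)

theorem Conn.map_eq {W : Type*} (f : V → W) (hf : ∀ e ∈ F, f (G.src e) = f (G.tgt e))
    (h : G.Conn F x y) : f x = f y := by
  induction h with
  | rel a b h => obtain ⟨e, he, rfl, rfl⟩ := h; exact hf e he
  | refl a => rfl
  | symm a b _ ih => exact ih.symm
  | trans a b c _ _ ih1 ih2 => exact ih1.trans ih2

theorem Conn.eq_or (h : G.Conn F x y) : x = y ∨ x ∈ G.verts F ∧ y ∈ G.verts F := by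
  induction h with
  | rel a b h => obtain ⟨e, he, rfl, rfl⟩ := h; exact .inr ⟨⟨e, he, inc_src⟩, ⟨e, he, inc_tgt⟩⟩
  | refl a => exact .inl rfl
  | symm a b _ ih => grind
  | trans a b c _ _ ih1 ih2 => grind

theorem mem_comp_self : e ∈ G.comp F e := EqvGen.refl _

theorem comp_mem_of_mem (he : e ∈ F) (h : e' ∈ G.comp F e) : e' ∈ F := by
  have : ∀ a b, EqvGen (G.Adj F) a b → (a ∈ F ↔ b ∈ F) := by
    intro a b h
    induction h with
    | rel a b h => exact iff_of_true h.1 h.2.1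
    | refl a => rfl
    | symm a b _ ih => exact ih.symm
    | trans a b c _ _ ih1 ih2 => exact ih1.trans ih2
  exact (this _ _ h).1 he

theorem comp_mono (h : F ⊆ F') : G.comp F e ⊆ G.comp F' e := by
  intro x hx
  exact eqvGen_mono (fun _ _ hab => ⟨h hab.1, h hab.2.1, hab.2.2⟩) hx

theorem col_of_mem_comp (h : e' ∈ G.comp F e) : G.col e' = G.col e := by
  induction h with
  | rel a b h => exact h.2.2.1.symm
  | refl a => rfl
  | symm a b _ ih => exact ih.symm
  | trans a b c _ _ ih1 ih2 => exact ih2.trans ih1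

theorem subset_of_mem_comps {c : Set E} (hc : c ∈ G.comps F) : c ⊆ F := by
  obtain ⟨e, he, rfl⟩ := hc
  exact fun _ h => comp_mem_of_mem he h

theorem nonempty_of_mem_comps {c : Set E} (hc : c ∈ G.comps F) : c.Nonempty := by
  obtain ⟨e, he, rfl⟩ := hc
  exact ⟨e, mem_comp_self⟩

/-- Edges of a monochromatic set which are linked by a path in this set are in the same
component. -/
theorem mem_comp_of_conn (hCF : C ⊆ F) (hcol : ∀ e ∈ C, ∀ e' ∈ C, G.col e = G.col e')
    (h : G.Conn C x y) (he : e ∈ C) (he' : e' ∈ C) (hx : G.Inc e x) (hy : G.Inc e' y) :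
    e' ∈ G.comp F e := by
  have adj : ∀ {a b : E} {z : V}, a ∈ C → b ∈ C → G.Inc a z → G.Inc b z → G.Adj F a b :=
    fun ha hb ha' hb' => ⟨hCF ha, hCF hb, hcol _ ha _ hb, _, ha', hb'⟩
  have key : x = y ∨ ∃ a ∈ C, ∃ b ∈ C, G.Inc a x ∧ G.Inc b y ∧ EqvGen (G.Adj F) a b := by
    clear hx hy
    induction h with
    | rel a b h =>
      obtain ⟨e, he, rfl, rfl⟩ := h
      exact .inr ⟨e, he, e, he, inc_src, inc_tgt, .refl _⟩
    | refl a => exact .inl rfl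
    | symm a b _ ih =>
      rcases ih with rfl | ⟨a, ha, b, hb, h1, h2, h3⟩
      · exact .inl rfl
      · exact .inr ⟨b, hb, a, ha, h2, h1, h3.symm⟩
    | trans a b c _ _ ih1 ih2 =>
      rcases ih1 with rfl | ⟨a, ha, b, hb, h1, h2, h3⟩
      · exact ih2
      rcases ih2 with rfl | ⟨a', ha', b', hb', h1', h2', h3'⟩
      · exact .inr ⟨a, ha, b, hb, h1, h2, h3⟩
      · exact .inr ⟨a, ha, b', hb', h1, h2',
          .trans _ _ _ h3 (.trans _ _ _ (.rel _ _ (adj hb ha' h2 h1')) h3')⟩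
  rcases key with rfl | ⟨a, ha, b, hb, h1, h2, h3⟩
  · exact .rel _ _ (adj he he' hx hy)
  · exact .trans _ _ _ (.rel _ _ (adj he ha hx h1))
      (.trans _ _ _ h3 (.rel _ _ (adj hb he' h2 hy)))

/-- A chain of adjacent edges is a path. The induction carries the membership of both ends in the
component, so that the path stays in it. -/
theorem conn_of_mem_comp (h : e' ∈ G.comp F e) (hx : G.Inc e x) (hy : G.Inc e' y) :
    G.Conn (G.comp F e) x y := by
  have key : ∀ b, EqvGen (G.Adj F) e b → ∀ a, EqvGen (G.Adj F) a b → EqvGen (G.Adj F) e a →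
      ∀ x y, G.Inc a x → G.Inc b y → G.Conn (G.comp F e) x y := by
    intro b hb a hab
    induction hab with
    | rel a b h =>
      intro ha x y hx hy
      obtain ⟨z, hz, hz'⟩ := h.2.2.2
      exact (Conn.inc ha hx hz).trans (Conn.inc hb hz' hy)
    | refl a => exact fun ha x y hx hy => Conn.inc ha hx hy
    | symm a b h ih =>
      exact fun ha x y hx hy => (ih ha hb y x hy hx).symm
    | trans a b c h1 h2 ih1 ih2 =>
      intro ha x y hx hy
      have hb' := EqvGen.trans _ _ _ ha h1
      exact (ih1 hb' ha x _ hx inc_src).trans (ih2 hb hb' _ y inc_src hy)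
  exact key e' h e h (.refl _) x y hx hy

/-- If no edge of `F₁` is adjacent to an edge of `F₂`, the component of an edge of `F₁` does not
change when `F₂` is added. -/
theorem comp_eq_of_closed (hF : F ⊆ F')
    (h : ∀ a ∈ F, ∀ b ∈ F', G.Adj F' a b → b ∈ F) (he : e ∈ F) : G.comp F' e = G.comp F e := by
  refine Set.Subset.antisymm ?_ (comp_mono hF)
  have key : ∀ a b, EqvGen (G.Adj F') a b → (a ∈ F ↔ b ∈ F) ∧ (a ∈ F → EqvGen (G.Adj F) a b) := by
    intro a b hab
    induction hab with
    | rel a b hab =>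
      have h1 := h a
      have h2 := h b
      have hba : G.Adj F' b a :=
        ⟨hab.2.1, hab.1, hab.2.2.1.symm, hab.2.2.2.imp fun _ h => h.symm⟩
      refine ⟨⟨fun ha => h1 ha b hab.2.1 hab, fun hb => h2 hb a hab.1 hba⟩, fun ha => ?_⟩
      exact .rel _ _ ⟨ha, h1 ha b hab.2.1 hab, hab.2.2⟩
    | refl a => exact ⟨Iff.rfl, fun _ => .refl _⟩
    | symm a b _ ih => exact ⟨ih.1.symm, fun hb => (ih.2 (ih.1.2 hb)).symm⟩
    | trans a b c _ _ ih1 ih2 =>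
      exact ⟨ih1.1.trans ih2.1, fun ha => .trans _ _ _ (ih1.2 ha) (ih2.2 (ih1.1.1 ha))⟩
  exact fun b hb => (key _ _ hb).2 he

/-! ### Decomposition at a root -/

/-- The vertices of the component `C` at the root `r`. -/
def core (G : ColGraph V E J) (C : Set E) (r : V) : Set V := {x | x = r ∨ x ∈ G.verts C}

/-- `C` is the component of color `j` at the root `r` of the connected set of edges `F`, and the
other edges are attached to single vertices of `C`, which are given by the retraction `p`. -/
structure Decomp (G : ColGraph V E J) (F : Set E) (r : V) (j : J) (C : Set E) (p : V → V) :
    Prop where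
  subset : C ⊆ F
  col : ∀ e ∈ C, G.col e = j
  conn : ∀ x ∈ G.core C r, G.Conn C r x
  fix : ∀ x ∈ G.core C r, p x = x
  const : ∀ e ∈ F, e ∉ C → p (G.src e) = p (G.tgt e)
  col_ne : ∀ e ∈ F, e ∉ C → ∀ x ∈ G.core C r, G.Inc e x → G.col e ≠ j
  conn' : ∀ x ∈ G.core F r, G.Conn F r x

namespace Decomp

variable {r : V} {j : J} {p : V → V} (D : G.Decomp F r j C p)

/-- The edges attached to the vertex `v` of `C`. -/
def branch (_ : G.Decomp F r j C p) (v : V) : Set E := {e | e ∈ F ∧ e ∉ C ∧ p (G.src e) = v}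

theorem core_subset {C F : Set E} (h : C ⊆ F) : G.core C r ⊆ G.core F r := by
  rintro x (rfl | ⟨e, he, hx⟩)
  · exact .inl rfl
  · exact .inr ⟨e, h he, hx⟩

include D in
theorem p_inc {e : E} (he : e ∈ F) (he' : e ∉ C) (hx : G.Inc e x) : p (G.src e) = p x := by
  rcases hx with rfl | rfl
  · rfl
  · exact D.const e he he'

include D in
-- Spread from the root along a path of `F`: an edge of `C` joins two fixed points of `p`, and any
-- other edge lies in the branch that its two endpoints share.
theorem p_mem_conn (hx : G.core F r x) :
    p x ∈ G.core C r ∧ G.Conn (D.branch (p x)) (p x) x := by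
  have key : ∀ a b, G.Conn F a b →
      ((p a ∈ G.core C r ∧ G.Conn (D.branch (p a)) (p a) a) ↔
        (p b ∈ G.core C r ∧ G.Conn (D.branch (p b)) (p b) b)) := by
    intro a b h
    induction h with
    | rel a b h =>
      obtain ⟨e, he, rfl, rfl⟩ := h
      by_cases hC : e ∈ C
      · have h1 : G.src e ∈ G.core C r := .inr ⟨e, hC, inc_src⟩
        have h2 : G.tgt e ∈ G.core C r := .inr ⟨e, hC, inc_tgt⟩
        rw [D.fix _ h1, D.fix _ h2]
        exact iff_of_true ⟨h1, .refl⟩ ⟨h2, .refl⟩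
      · have h1 := D.const e he hC
        have h2 : G.Conn (D.branch (p (G.tgt e))) (G.src e) (G.tgt e) :=
          Conn.edge ⟨he, hC, h1⟩
        rw [h1]
        exact and_congr_right fun _ => ⟨fun h => h.trans h2, fun h => h.trans h2.symm⟩
    | refl a => rfl
    | symm a b _ ih => exact ih.symm
    | trans a b c _ _ ih1 ih2 => exact ih1.trans ih2
  have hr : r ∈ G.core C r := .inl rfl
  refine (key _ _ (D.conn' x hx)).1 ?_
  rw [D.fix r hr]
  exact ⟨hr, .refl⟩

theorem branch_subset (v : V) : D.branch v ⊆ F := fun _ h => h.1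

theorem p_of_mem_core_branch {v : V} (hv : v ∈ G.core C r) (hx : x ∈ G.core (D.branch v) v) :
    p x = v := by
  rcases hx with rfl | ⟨e, he, hx⟩
  · exact D.fix _ hv
  · rw [← D.p_inc he.1 he.2.1 hx, he.2.2]

/-- The branches cut the vertices into the fibers of `p`. -/
theorem mem_core_branch {v : V} (hv : v ∈ G.core C r) :
    x ∈ G.core (D.branch v) v ↔ x ∈ G.core F r ∧ p x = v := by
  constructor
  · intro hx
    refine ⟨?_, D.p_of_mem_core_branch hv hx⟩
    rcases hx with rfl | ⟨e, he, hx⟩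
    · exact core_subset D.subset hv
    · exact .inr ⟨e, he.1, hx⟩
  · rintro ⟨hx, rfl⟩
    rcases (D.p_mem_conn hx).2.eq_or with h | h
    · exact .inl h.symm
    · exact .inr h.2

theorem branch_conn {v : V} (hv : v ∈ G.core C r) :
    ∀ x ∈ G.core (D.branch v) v, G.Conn (D.branch v) v x := by
  intro x hx
  obtain ⟨h1, rfl⟩ := (D.mem_core_branch hv).1 hx
  exact (D.p_mem_conn h1).2

include D in
-- Edges outside `C` that share a vertex have the same value of `p`, and an edge outside `C` that
-- meets the core has a color different from `j`. So adjacency never leaves a branch.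
theorem adj_closed {a b : E} (h : G.Adj F a b) (ha : a ∉ C) : b ∉ C ∧ p (G.src a) = p (G.src b) := by
  obtain ⟨haF, hbF, hcol, x, hxa, hxb⟩ := h
  have hb : b ∉ C := fun hb =>
    D.col_ne a haF ha x (.inr ⟨b, hb, hxb⟩) hxa (hcol.trans (D.col b hb))
  exact ⟨hb, (D.p_inc haF ha hxa).trans (D.p_inc hbF hb hxb).symm⟩

theorem comp_branch {v : V} (he : e ∈ D.branch v) : G.comp F e = G.comp (D.branch v) e :=
  comp_eq_of_closed (D.branch_subset v)
    (fun _ ha _ hb hab => ⟨hb, (D.adj_closed hab ha.2.1).1,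
      (D.adj_closed hab ha.2.1).2 ▸ ha.2.2⟩) he

include D in
theorem comp_core (he : e ∈ C) : G.comp F e = C := by
  apply Set.Subset.antisymm
  · have hcol : ∀ a b, EqvGen (G.Adj F) a b → (a ∈ C ↔ b ∈ C) := by
      intro a b hab
      induction hab with
      | rel a b hab =>
        have hba : G.Adj F b a :=
          ⟨hab.2.1, hab.1, hab.2.2.1.symm, hab.2.2.2.imp fun _ h => h.symm⟩
        have h1 := D.adj_closed hab
        have h2 := D.adj_closed hba
        tauto
      | refl a => rfl
      | symm a b _ ih => exact ih.symm
      | trans a b c _ _ ih1 ih2 => exact ih1.trans ih2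
    exact fun b hb => (hcol _ _ hb).1 he
  · intro e' he'
    refine mem_comp_of_conn D.subset (fun a ha b hb => (D.col a ha).trans (D.col b hb).symm)
      (((D.conn (G.src e) (.inr ⟨e, he, inc_src⟩)).symm).trans
      (D.conn (G.src e') (.inr ⟨e', he', inc_src⟩))) he he' inc_src inc_src

theorem exists_branch (he : e ∈ F) (he' : e ∉ C) : ∃ v ∈ G.core C r, e ∈ D.branch v :=
  ⟨p (G.src e), (D.p_mem_conn (.inr ⟨e, he, inc_src⟩)).1, he, he', rfl⟩

/-- The condition `C.Nonempty` is there because the root may have no edge of color `j`. -/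
theorem comps_eq :
    G.comps F = {c | c = C ∧ C.Nonempty} ∪ ⋃ v ∈ G.core C r, G.comps (D.branch v) := by
  ext c
  simp only [Set.mem_union, Set.mem_ofPred_eq, Set.mem_iUnion]
  constructor
  · rintro ⟨e, he, rfl⟩
    by_cases hC : e ∈ C
    · exact .inl ⟨D.comp_core hC, ⟨e, hC⟩⟩
    · obtain ⟨v, hv, hev⟩ := D.exists_branch he hC
      exact .inr ⟨v, hv, e, hev, (D.comp_branch hev).symm⟩
  · rintro (⟨rfl, ⟨e, he⟩⟩ | ⟨v, hv, e, he, rfl⟩)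
    · exact ⟨e, D.subset he, D.comp_core he⟩
    · exact ⟨e, he.1, D.comp_branch he⟩

/-- The retraction on the branch at `v`. -/
theorem treelike_iff : G.Treelike F ↔ ∀ v ∈ G.core C r, G.Treelike (D.branch v) := by
  classical
  constructor
  · rintro h v hv c hc x hx y hy hxy
    refine h c ?_ x hx y hy (hxy.mono (Set.sdiff_subset_sdiff_left (D.branch_subset v)))
    rw [D.comps_eq]
    exact .inr (Set.mem_biUnion hv hc)
  · intro h c hc x hx y hy hxy
    rw [D.comps_eq] at hc
    rcases hc with ⟨rfl, _⟩ | hc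
    -- `p` is constant along paths that avoid `C`, and fixes the vertices of `C`.
    · have := hxy.map_eq p fun e he => D.const e he.1 he.2
      rwa [D.fix x (.inr hx), D.fix y (.inr hy)] at this
    · simp only [Set.mem_iUnion] at hc
      obtain ⟨v, hv, hc⟩ := hc
      refine h v hv c hc x hx y hy ?_
      have hcb := subset_of_mem_comps hc
      -- Collapse everything outside the branch to its root `v`: a path of `F` that avoids `c`
      -- becomes a path of the branch that avoids `c`.
      let q : V → V := fun z => if z ∈ G.core (D.branch v) v then z else v
      have hq : ∀ z ∈ G.verts c, q z = z := fun z hz => by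
        obtain ⟨e, he, hz⟩ := hz
        exact if_pos (.inr ⟨e, hcb he, hz⟩)
      have := hxy.lift (G₂ := G) (F₂ := D.branch v \ c) q ?_
      · rwa [hq x hx, hq y hy] at this
      · rintro e ⟨he, hec⟩
        by_cases heb : e ∈ D.branch v
        · have h1 : q (G.src e) = G.src e := if_pos (.inr ⟨e, heb, inc_src⟩)
          have h2 : q (G.tgt e) = G.tgt e := if_pos (.inr ⟨e, heb, inc_tgt⟩)
          rw [h1, h2]
          exact .edge ⟨heb, hec⟩
        · have h3 : ∀ z, G.Inc e z → q z = v := by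
            intro z hz
            by_cases hzb : z ∈ G.core (D.branch v) v
            · have hzv := D.p_of_mem_core_branch hv hzb
              by_cases heC : e ∈ C
              · rw [← hzv, D.fix z (.inr ⟨e, heC, hz⟩)]
                simpa [q] using fun h => (hzv.symm.trans (D.fix z (.inr ⟨e, heC, hz⟩))) 
              · exact absurd ⟨he, heC, (D.p_inc he heC hz).trans hzv⟩ heb
            · exact if_neg hzb
          rw [h3 _ inc_src, h3 _ inc_tgt]
          exact .refl

theorem weight_eq [Finite V] [Finite E] {w : Set E → ℂ} (hw : w ∅ = 1) :
    G.weight w F = w C * ∏ᶠ v ∈ G.core C r, G.weight w (D.branch v) := by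
  classical
  by_cases h : G.Treelike F
  · have h' := D.treelike_iff.1 h
    have : ∏ᶠ v ∈ G.core C r, G.weight w (D.branch v) =
        ∏ᶠ v ∈ G.core C r, ∏ᶠ c ∈ G.comps (D.branch v), w c :=
      finprod_mem_congr rfl fun v hv => if_pos (h' v hv)
    rw [this, weight, if_pos h, D.comps_eq, finprod_mem_union, finprod_mem_biUnion]
    · congr 1
      -- An empty `C` is not a component; its factor is then `w ∅ = 1`.
      by_cases hC : C.Nonempty
      · simp [hC]
      · rw [Set.not_nonempty_iff_eq_empty] at hC
        simp [hC, hw]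
    · intro a _ b _ hab
      -- A component is nonempty, and any of its edges determines the branch that contains it.
      refine Set.disjoint_left.2 fun c hc hc' => hab ?_
      obtain ⟨e, he⟩ := nonempty_of_mem_comps hc
      exact (subset_of_mem_comps hc he).2.2.symm.trans (subset_of_mem_comps hc' he).2.2
    · exact Set.toFinite _
    · exact fun _ _ => Set.toFinite _
    · refine Set.disjoint_left.2 ?_
      rintro c ⟨rfl, ⟨e, he⟩⟩ hc'
      simp only [Set.mem_iUnion] at hc'
      obtain ⟨v, _, hc⟩ := hc'
      exact (subset_of_mem_comps hc he).2.1 he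
    · exact Set.toFinite _
    · exact Set.toFinite _
  · rw [weight, if_neg h]
    rw [D.treelike_iff] at h
    push Not at h
    obtain ⟨v, hv, h⟩ := h
    rw [finprod_mem_eq_finite_toFinset_prod _ (Set.toFinite _),
      Finset.prod_eq_zero (i := v) (by simpa using hv) (if_neg h), mul_zero]

end Decomp

/-- The edges of color `j` which are linked to `r` by edges of color `j`. -/
def rootComp (G : ColGraph V E J) (F : Set E) (r : V) (j : J) : Set E :=
  {e | e ∈ F ∧ G.col e = j ∧ G.Conn {e | e ∈ F ∧ G.col e = j} r (G.src e)}

theorem core_rootComp_conn {r : V} {j : J} (hx : x ∈ G.core (G.rootComp F r j) r) :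
    G.Conn {e | e ∈ F ∧ G.col e = j} r x := by
  rcases hx with rfl | ⟨e, he, hx⟩
  · exact .refl
  · exact he.2.2.trans (Conn.inc (e := e) ⟨he.1, he.2.1⟩ inc_src hx)

/-- A path of color `j` issued from the root only uses edges that the root already reaches in this
color. -/
theorem rootComp_conn {r : V} {j : J} (hx : G.Conn {e | e ∈ F ∧ G.col e = j} r x) :
    G.Conn (G.rootComp F r j) r x := by
  have key : ∀ a b, G.Conn {e | e ∈ F ∧ G.col e = j} a b →
      G.Conn {e | e ∈ F ∧ G.col e = j} r a → G.Conn (G.rootComp F r j) a b := by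
    intro a b h
    induction h with
    | rel a b h =>
      obtain ⟨e, he, rfl, rfl⟩ := h
      exact fun ha => .edge ⟨he.1, he.2, ha⟩
    | refl a => exact fun _ => .refl
    | symm a b h ih => exact fun ha => (ih (Conn.trans ha (Conn.symm h))).symm
    | trans a b c h1 h2 ih1 ih2 => exact fun ha => (ih1 ha).trans (ih2 (Conn.trans ha h1))
  exact key _ _ hx .refl

/-- The retraction sends a vertex to the point of the core that it reaches without using `C`. Such a
point is found on a path to the root, and it is unique because two of them would be vertices of one
component linked outside of it. -/
theorem Treelike.exists_decomp (hF : G.Treelike F) {r : V} (hr : ∀ x ∈ G.core F r, G.Conn F r x)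
    (j : J) : ∃ p, G.Decomp F r j (G.rootComp F r j) p := by
  classical
  set C := G.rootComp F r j with hCdef
  have hCF : C ⊆ F := fun e he => he.1
  have uniq : ∀ x ∈ G.core C r, ∀ y ∈ G.core C r, G.Conn (F \ C) x y → x = y := by
    intro x hx y hy hxy
    have hx' := rootComp_conn (core_rootComp_conn hx)
    have hy' := rootComp_conn (core_rootComp_conn hy)
    rcases C.eq_empty_or_nonempty with hC | ⟨e, he⟩
    · simp only [core, verts, hC] at hx hy
      simp at hx hy
      rw [hx, hy]
    · have hcomp : G.comp F e = C := by
        apply Set.Subset.antisymm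
        · intro e' he'
          refine ⟨comp_mem_of_mem he.1 he', (col_of_mem_comp he').trans he.2.1, ?_⟩
          refine he.2.2.trans ((conn_of_mem_comp he' inc_src inc_src).mono ?_)
          exact fun a ha => ⟨comp_mem_of_mem he.1 ha, (col_of_mem_comp ha).trans he.2.1⟩
        · intro e' he'
          exact mem_comp_of_conn hCF (fun a ha b hb => ha.2.1.trans hb.2.1.symm)
            ((rootComp_conn he.2.2).symm.trans (rootComp_conn he'.2.2)) he he' inc_src inc_src
      have hr' : r ∈ G.verts C := by
        rcases (rootComp_conn he.2.2).eq_or with h | h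
        · exact ⟨e, he, .inl h.symm⟩
        · exact h.1
      have hv : ∀ z ∈ G.core C r, z ∈ G.verts C := by
        rintro z (rfl | hz)
        exacts [hr', hz]
      exact hF C ⟨e, he.1, hcomp⟩ x (hv x hx) y (hv y hy) hxy
  let p : V → V := fun x => if h : ∃ y, y ∈ G.core C r ∧ G.Conn (F \ C) x y then h.choose else x
  have hp : ∀ x y, y ∈ G.core C r → G.Conn (F \ C) x y → p x = y := by
    intro x y hy hxy
    have h : ∃ y, y ∈ G.core C r ∧ G.Conn (F \ C) x y := ⟨y, hy, hxy⟩
    rw [show p x = h.choose from dif_pos h]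
    exact uniq _ h.choose_spec.1 _ hy (h.choose_spec.2.symm.trans hxy)
  have ex : ∀ x, G.Conn F r x → ∃ y, y ∈ G.core C r ∧ G.Conn (F \ C) x y := by
    intro x hx
    have key : ∀ a b, G.Conn F a b → ((∃ y, y ∈ G.core C r ∧ G.Conn (F \ C) a y) ↔
        ∃ y, y ∈ G.core C r ∧ G.Conn (F \ C) b y) := by
      intro a b h
      induction h with
      | rel a b h =>
        obtain ⟨e, he, rfl, rfl⟩ := h
        by_cases heC : e ∈ C
        · exact iff_of_true ⟨_, .inr ⟨e, heC, inc_src⟩, .refl⟩ ⟨_, .inr ⟨e, heC, inc_tgt⟩, .refl⟩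
        · have h2 : G.Conn (F \ C) (G.src e) (G.tgt e) := .edge ⟨he, heC⟩
          exact exists_congr fun y => and_congr_right fun _ =>
            ⟨fun h => h2.symm.trans h, fun h => h2.trans h⟩
      | refl a => rfl
      | symm a b _ ih => exact ih.symm
      | trans a b c _ _ ih1 ih2 => exact ih1.trans ih2
    exact (key _ _ hx).1 ⟨r, .inl rfl, .refl⟩
  refine ⟨p, hCF, fun e he => he.2.1, fun x hx => rootComp_conn (core_rootComp_conn hx),
    fun x hx => hp x x hx .refl, fun e he heC => ?_, fun e he heC x hx hex hcol => heC ?_, hr⟩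
  · obtain ⟨y, hy, hxy⟩ := ex (G.src e) (hr _ (.inr ⟨e, he, inc_src⟩))
    rw [hp _ y hy hxy, hp _ y hy ((Conn.edge (F := F \ C) (e := e) ⟨he, heC⟩).symm.trans hxy)]
  · exact ⟨he, hcol, (core_rootComp_conn hx).trans (Conn.inc (e := e) ⟨he, hcol⟩ hex inc_src)⟩

/-! ### Transport along maps of vertices -/

section Transport

variable {W : Type*} {G' : ColGraph W E J}

/-- `f` and `g` exchange the endpoints of the edges in `F` in the two graphs. -/
structure SameOn (G : ColGraph V E J) (G' : ColGraph W E J) (F : Set E) (f : V → W) (g : W → V) :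
    Prop where
  src : ∀ e ∈ F, f (G.src e) = G'.src e
  tgt : ∀ e ∈ F, f (G.tgt e) = G'.tgt e
  src' : ∀ e ∈ F, g (G'.src e) = G.src e
  tgt' : ∀ e ∈ F, g (G'.tgt e) = G.tgt e
  col : ∀ e ∈ F, G.col e = G'.col e

namespace SameOn

variable {f : V → W} {g : W → V} (h : G.SameOn G' F f g)

include h

theorem symm : G'.SameOn G F g f := ⟨h.src', h.tgt', h.src, h.tgt, fun e he => (h.col e he).symm⟩

theorem mono (hF : F' ⊆ F) : G.SameOn G' F' f g :=
  ⟨fun e he => h.src e (hF he), fun e he => h.tgt e (hF he), fun e he => h.src' e (hF he),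
    fun e he => h.tgt' e (hF he), fun e he => h.col e (hF he)⟩

theorem inc (he : e ∈ F) (hx : G.Inc e x) : G'.Inc e (f x) := by
  rcases hx with rfl | rfl
  · exact .inl (h.src e he).symm
  · exact .inr (h.tgt e he).symm

theorem conn (hx : G.Conn F x y) : G'.Conn F (f x) (f y) :=
  hx.lift f fun e he => by rw [h.src e he, h.tgt e he]; exact .edge he

theorem comp_subset (e : E) : G.comp F e ⊆ G'.comp F e := by
  intro x hx
  refine eqvGen_mono ?_ hx
  rintro a b ⟨ha, hb, hc, x, hx, hx'⟩
  exact ⟨ha, hb, by rw [← h.col a ha, ← h.col b hb, hc], f x, h.inc ha hx, h.inc hb hx'⟩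

theorem comps_eq : G.comps F = G'.comps F :=
  Set.image_congr fun e _ => Set.Subset.antisymm (h.comp_subset e) (h.symm.comp_subset e)

theorem treelike (hT : G'.Treelike F) : G.Treelike F := by
  intro c hc x hx y hy hxy
  have hcF := subset_of_mem_comps hc
  obtain ⟨e, he, hx⟩ := hx
  obtain ⟨e', he', hy⟩ := hy
  have := hT c (h.comps_eq ▸ hc) _ ⟨e, he, h.inc (hcF he) hx⟩ _ ⟨e', he', h.inc (hcF he') hy⟩
    ((h.mono Set.sdiff_subset).conn hxy)
  have hg : ∀ e ∈ F, ∀ x, G.Inc e x → g (f x) = x := by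
    rintro e he x (rfl | rfl)
    · rw [h.src e he, h.src' e he]
    · rw [h.tgt e he, h.tgt' e he]
  rw [← hg e (hcF he) x hx, this, hg e' (hcF he') y hy]

theorem weight_eq {w w' : Set E → ℂ} (hw : ∀ c ⊆ F, w c = w' c) :
    G.weight w F = G'.weight w' F := by
  rw [weight, weight, ← h.comps_eq]
  have : G.Treelike F ↔ G'.Treelike F := ⟨h.symm.treelike, h.treelike⟩
  by_cases hT : G.Treelike F
  · rw [if_pos hT, if_pos (this.1 hT)]
    exact finprod_mem_congr rfl fun c hc => hw c (subset_of_mem_comps hc)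
  · rw [if_neg hT, if_neg (mt this.2 hT)]

end SameOn

end Transport

end ColGraph

end Traffic
end

noncomputable section

namespace Traffic

/-! ## Amalgamation of two graphs along a partial matching of their vertices -/

/-- `M` is a partial matching between `X` and `X'`. -/
structure IsMatching {V V' : Type*} (X : Set V) (X' : Set V') (M : Finset (V × V')) : Prop where
  fst_mem : ∀ {x y}, (x, y) ∈ M → x ∈ X
  snd_mem : ∀ {x y}, (x, y) ∈ M → y ∈ X'
  snd_unique : ∀ {x y y'}, (x, y) ∈ M → (x, y') ∈ M → y = y'
  fst_unique : ∀ {x x' y}, (x, y) ∈ M → (x', y) ∈ M → x = x'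

theorem IsMatching.mono {V V' : Type*} {X Y : Set V} {X' Y' : Set V'} {M N : Finset (V × V')}
    (h : IsMatching X X' M) (hNM : N ⊆ M) (hX : X ⊆ Y) (hX' : X' ⊆ Y') : IsMatching Y Y' N :=
  ⟨fun a => hX (h.fst_mem (hNM a)), fun a => hX' (h.snd_mem (hNM a)),
    fun a b => h.snd_unique (hNM a) (hNM b), fun a b => h.fst_unique (hNM a) (hNM b)⟩

theorem IsMatching.to_univ {V V' : Type*} {X : Set V} {X' : Set V'} {M : Finset (V × V')}
    (h : IsMatching X X' M) : IsMatching Set.univ Set.univ M :=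
  h.mono subset_rfl (Set.subset_univ _) (Set.subset_univ _)

theorem IsMatching.empty {V V' : Type*} (X : Set V) (X' : Set V') :
    IsMatching X X' ∅ := ⟨by simp, by simp, by simp, by simp⟩

section Merge

variable {V V' : Type*} {X : Set V} {X' : Set V'} {M : Finset (V × V')}

open Classical in
/-- Merge the matched vertices. -/
def merge (M : Finset (V × V')) : V ⊕ V' → V ⊕ V'
  | .inl x => .inl x
  | .inr y => if h : ∃ x, (x, y) ∈ M then .inl h.choose else .inr y

theorem merge_inl (x : V) : merge M (.inl x) = .inl x := rfl

theorem merge_inr_of_mem (hM : IsMatching X X' M) {x : V} {y : V'} (h : (x, y) ∈ M) :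
    merge M (.inr y) = .inl x := by
  have h' : ∃ x, (x, y) ∈ M := ⟨x, h⟩
  rw [show merge M (.inr y) = .inl h'.choose from dif_pos h', hM.fst_unique h'.choose_spec h]

theorem merge_inr_of_not_mem {y : V'} (h : ∀ x, (x, y) ∉ M) : merge M (.inr y) = .inr y :=
  dif_neg (by simpa using h)

theorem merge_inr_eq_inl (hM : IsMatching X X' M) {x : V} {y : V'} :
    merge M (.inr y) = .inl x ↔ (x, y) ∈ M := by
  refine ⟨fun h => ?_, merge_inr_of_mem hM⟩
  by_cases h' : ∃ x, (x, y) ∈ M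
  · obtain ⟨x', hx'⟩ := h'
    rw [merge_inr_of_mem hM hx'] at h
    cases h
    exact hx'
  · rw [merge_inr_of_not_mem (by simpa using h')] at h
    cases h

theorem merge_inr_eq_inr {y y' : V'} :
    merge M (.inr y) = .inr y' ↔ y = y' ∧ ∀ x, (x, y) ∉ M := by
  by_cases h' : ∃ x, (x, y) ∈ M
  · have : merge M (.inr y) = .inl h'.choose := dif_pos h'
    rw [this]
    simp only [reduceCtorEq, false_iff, not_and, not_forall, not_not]
    exact fun _ => h'
  · have h'' : ∀ x, (x, y) ∉ M := by simpa using h'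
    rw [merge_inr_of_not_mem h'']
    simpa using fun _ => h''

theorem merge_inr_injective (hM : IsMatching X X' M) :
    Function.Injective fun y : V' => merge M (.inr y) := by
  intro y y' h
  simp only at h
  rcases hy : merge M (.inr y') with x | z
  · rw [hy, merge_inr_eq_inl hM] at h
    rw [merge_inr_eq_inl hM] at hy
    exact hM.snd_unique h hy
  · rw [hy, merge_inr_eq_inr] at h
    rw [merge_inr_eq_inr] at hy
    exact h.1.trans hy.1.symm

end Merge

/-- The disjoint union of two sets. -/
def sumSet {E E' : Type*} (F : Set E) (F' : Set E') : Set (E ⊕ E') :=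
  {x | Sum.elim (· ∈ F) (· ∈ F') x}

section SumSet

variable {E E' : Type*} {F B : Set E} {F' B' : Set E'} {e : E} {e' : E'}

@[simp] theorem inl_mem_sumSet : Sum.inl e ∈ sumSet F F' ↔ e ∈ F := Iff.rfl
@[simp] theorem inr_mem_sumSet : Sum.inr e' ∈ sumSet F F' ↔ e' ∈ F' := Iff.rfl

end SumSet

namespace ColGraph

variable {V V' E E' J : Type*} (G : ColGraph V E J) (G' : ColGraph V' E' J)

/-- The disjoint union of two graphs, with matched vertices merged. -/
def amalg (M : Finset (V × V')) : ColGraph (V ⊕ V') (E ⊕ E') J where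
  src := Sum.elim (fun e => .inl (G.src e)) (fun e => merge M (.inr (G'.src e)))
  tgt := Sum.elim (fun e => .inl (G.tgt e)) (fun e => merge M (.inr (G'.tgt e)))
  col := Sum.elim G.col G'.col

variable {G G'} {F C B : Set E} {F' C' B' : Set E'} {M N : Finset (V × V')} {X : Set V}
  {X' : Set V'}

theorem amalg_inc_inl {e : E} {x : V ⊕ V'} :
    (G.amalg G' M).Inc (.inl e) x ↔ ∃ y, G.Inc e y ∧ .inl y = x := by
  constructor
  · rintro (h | h)
    exacts [⟨_, inc_src, h⟩, ⟨_, inc_tgt, h⟩]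
  · rintro ⟨y, rfl | rfl, rfl⟩
    exacts [.inl rfl, .inr rfl]

theorem amalg_inc_inr {e : E'} {x : V ⊕ V'} :
    (G.amalg G' M).Inc (.inr e) x ↔ ∃ y, G'.Inc e y ∧ merge M (.inr y) = x := by
  constructor
  · rintro (h | h)
    exacts [⟨_, inc_src, h⟩, ⟨_, inc_tgt, h⟩]
  · rintro ⟨y, rfl | rfl, rfl⟩
    exacts [.inl rfl, .inr rfl]

theorem exists_factor {A Y Z : Type*} [Nonempty Z] (S : Set A) (a : A → Y) (b : A → Z)
    (h : ∀ x ∈ S, ∀ x' ∈ S, a x = a x' → b x = b x') : ∃ f : Y → Z, ∀ x ∈ S, f (a x) = b x := by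
  classical
  refine ⟨fun y => if h : ∃ x ∈ S, a x = y then b h.choose else Classical.arbitrary Z, ?_⟩
  intro x hx
  have h' : ∃ x' ∈ S, a x' = a x := ⟨x, hx, rfl⟩
  simp only [dif_pos h']
  exact h _ h'.choose_spec.1 _ hx h'.choose_spec.2

/-- The family of weights `w` only depends on the matching through its restriction to the vertices
of the component. -/
structure IsLocal (G : ColGraph V E J) (G' : ColGraph V' E' J)
    (w : Finset (V × V') → Set (E ⊕ E') → ℂ) : Prop where
  empty : ∀ M, w M ∅ = 1
  congr : ∀ M N c, IsMatching Set.univ Set.univ M → IsMatching Set.univ Set.univ N →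
    (∀ x ∈ G.verts (Sum.inl ⁻¹' c), ∀ y ∈ G'.verts (Sum.inr ⁻¹' c), (x, y) ∈ M ↔ (x, y) ∈ N) →
    w M c = w N c

theorem verts_mono {B : Set E} (h : B ⊆ F) : G.verts B ⊆ G.verts F :=
  fun _ ⟨e, he, hx⟩ => ⟨e, h he, hx⟩

/-- Matched pairs away from `B` and `B'` only change which element of `V ⊕ V'` represents a vertex.
The two `merge` maps factor through each other on the vertices of `B` and `B'`, since they identify
the same ones. -/
theorem exists_sameOn_amalg (hM : IsMatching Set.univ Set.univ M)
    (hN : IsMatching Set.univ Set.univ N)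
    (h : ∀ x ∈ G.verts B, ∀ y ∈ G'.verts B', (x, y) ∈ M ↔ (x, y) ∈ N) :
    ∃ f g, (G.amalg G' M).SameOn (G.amalg G' N) (sumSet B B') f g := by
  classical
  rcases isEmpty_or_nonempty (V ⊕ V') with hV | hV
  · have : IsEmpty (E ⊕ E') := ⟨fun e => hV.elim ((G.amalg G' M).src e)⟩
    exact ⟨id, id, fun e => isEmptyElim e, fun e => isEmptyElim e, fun e => isEmptyElim e,
      fun e => isEmptyElim e, fun e => isEmptyElim e⟩
  have key : ∀ M N : Finset (V × V'), IsMatching Set.univ Set.univ M →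
      IsMatching Set.univ Set.univ N →
      (∀ x ∈ G.verts B, ∀ y ∈ G'.verts B', (x, y) ∈ M ↔ (x, y) ∈ N) →
      ∃ f : V ⊕ V' → V ⊕ V', ∀ x ∈ sumSet (G.verts B) (G'.verts B'),
        f (merge M x) = merge N x := by
    intro M N hM hN h
    refine exists_factor _ _ _ ?_
    rintro (x | y) hx (x' | y') hx' heq
    · simpa [merge_inl] using heq
    · rw [merge_inl, eq_comm, merge_inr_eq_inl hM, h _ hx _ hx'] at heq
      rw [merge_inl, merge_inr_of_mem hN heq]
    · rw [merge_inl, merge_inr_eq_inl hM, h _ hx' _ hx] at heq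
      rw [merge_inl, merge_inr_of_mem hN heq]
    · rw [merge_inr_injective hM heq]
  obtain ⟨f, hf⟩ := key M N hM hN h
  obtain ⟨g, hg⟩ := key N M hN hM fun x hx y hy => (h x hx y hy).symm
  refine ⟨f, g, ?_, ?_, ?_, ?_, ?_⟩ <;> rintro (e | e) he
  · exact hf (.inl _) ⟨e, he, inc_src⟩
  · exact hf (.inr _) ⟨e, he, inc_src⟩
  · exact hf (.inl _) ⟨e, he, inc_tgt⟩
  · exact hf (.inr _) ⟨e, he, inc_tgt⟩
  · exact hg (.inl _) ⟨e, he, inc_src⟩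
  · exact hg (.inr _) ⟨e, he, inc_src⟩
  · exact hg (.inl _) ⟨e, he, inc_tgt⟩
  · exact hg (.inr _) ⟨e, he, inc_tgt⟩
  · rfl
  · rfl

theorem IsLocal.weight_congr {w : Finset (V × V') → Set (E ⊕ E') → ℂ} (hw : IsLocal G G' w)
    (hM : IsMatching Set.univ Set.univ M) (hN : IsMatching Set.univ Set.univ N)
    (h : ∀ x ∈ G.verts B, ∀ y ∈ G'.verts B', (x, y) ∈ M ↔ (x, y) ∈ N) :
    (G.amalg G' M).weight (w M) (sumSet B B') = (G.amalg G' N).weight (w N) (sumSet B B') := by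
  obtain ⟨f, g, hfg⟩ := exists_sameOn_amalg hM hN h
  refine hfg.weight_eq fun c hc => hw.congr M N c hM hN fun x hx y hy => ?_
  have h1 : Sum.inl ⁻¹' c ⊆ B := fun e he => hc he
  have h2 : Sum.inr ⁻¹' c ⊆ B' := fun e he => hc he
  exact h x (verts_mono h1 hx) y (verts_mono h2 hy)

/-! ### Decomposition of an amalgam -/

section Embed

variable {W E₁ : Type*} {G₁ : ColGraph W E₁ J} {A : ColGraph V E J} {F₁ C₁ : Set E₁} {r₁ : W}
  {p₁ : W → W} {j : J} {U : Set E} {P : V → V} {ι : W → V} {ε : E₁ → E}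

/-- The retraction of a tree of components restricts to that of a connected subgraph. -/
theorem Decomp.embed (D₁ : G₁.Decomp F₁ r₁ j C₁ p₁)
    (D : A.Decomp U (ι r₁) j (A.rootComp U (ι r₁) j) P) (hι : Function.Injective ι)
    (hε : ∀ e ∈ F₁, ε e ∈ U) (hs : ∀ e, A.src (ε e) = ι (G₁.src e))
    (ht : ∀ e, A.tgt (ε e) = ι (G₁.tgt e)) (hc : ∀ e, A.col (ε e) = G₁.col e) {x : W}
    (hx : x ∈ G₁.core F₁ r₁) : P (ι x) = ι (p₁ x) := by
  have hinc : ∀ {e x}, G₁.Inc e x → A.Inc (ε e) (ι x) := by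
    rintro e x (rfl | rfl)
    exacts [.inl (hs e), .inr (ht e)]
  have hC : ∀ e ∈ C₁, ε e ∈ A.rootComp U (ι r₁) j := by
    intro e he
    refine ⟨hε e (D₁.subset he), (hc e).trans (D₁.col e he), ?_⟩
    rw [hs]
    refine (D₁.conn _ (.inr ⟨e, he, inc_src⟩)).lift ι fun e he => ?_
    rw [← hs, ← ht]
    exact .edge ⟨hε e (D₁.subset he), (hc e).trans (D₁.col e he)⟩
  have hcore : ∀ v ∈ G₁.core C₁ r₁, P (ι v) = ι v := by
    rintro v (rfl | ⟨e, he, hv⟩)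
    · exact D.fix _ (.inl rfl)
    · exact D.fix _ (.inr ⟨_, hC e he, hinc hv⟩)
  -- Outside the large root component `P` is constant along the edge. Inside, `P` fixes both
  -- endpoints, and since the edge has color `j` and meets the small core it belongs to `C₁`.
  have hstep : ∀ e ∈ F₁, ∀ x y, G₁.Inc e x → G₁.Inc e y →
      (∃ v ∈ G₁.core C₁ r₁, P (ι x) = ι v) → ∃ v ∈ G₁.core C₁ r₁, P (ι y) = ι v := by
    intro e he x y hx hy ⟨v, hv, hxv⟩
    by_cases heC : ε e ∈ A.rootComp U (ι r₁) j
    · rw [D.fix _ (.inr ⟨_, heC, hinc hx⟩)] at hxv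
      obtain rfl := hι hxv
      have : e ∈ C₁ := by
        by_contra h
        exact D₁.col_ne e he h _ hv hx ((hc e).symm.trans heC.2.1)
      exact ⟨y, .inr ⟨e, this, hy⟩, D.fix _ (.inr ⟨_, heC, hinc hy⟩)⟩
    · exact ⟨v, hv, ((D.p_inc (hε e he) heC (hinc hy)).symm.trans
        (D.p_inc (hε e he) heC (hinc hx))).trans hxv⟩
  have hall : ∀ x ∈ G₁.core F₁ r₁, ∃ v ∈ G₁.core C₁ r₁, P (ι x) = ι v := by
    intro x hx
    have key : ∀ a b, G₁.Conn F₁ a b → ((∃ v ∈ G₁.core C₁ r₁, P (ι a) = ι v) ↔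
        ∃ v ∈ G₁.core C₁ r₁, P (ι b) = ι v) := by
      intro a b h
      induction h with
      | rel a b h =>
        obtain ⟨e, he, rfl, rfl⟩ := h
        exact ⟨hstep e he _ _ inc_src inc_tgt, hstep e he _ _ inc_tgt inc_src⟩
      | refl a => rfl
      | symm a b _ ih => exact ih.symm
      | trans a b c _ _ ih1 ih2 => exact ih1.trans ih2
    exact (key _ _ (D₁.conn' x hx)).1 ⟨r₁, .inl rfl, D.fix _ (.inl rfl)⟩
  -- An endpoint of such an edge would be fixed by `P`, hence would lie in the core of `C₁`, where
  -- edges outside `C₁` have a color different from `j`.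
  have hnot : ∀ e ∈ F₁, e ∉ C₁ → ε e ∉ A.rootComp U (ι r₁) j := by
    intro e he heC h
    obtain ⟨v, hv, hev⟩ := hall _ (.inr ⟨e, he, inc_src⟩)
    rw [D.fix _ (.inr ⟨_, h, hinc inc_src⟩)] at hev
    exact D₁.col_ne e he heC v hv (.inl (hι hev)) ((hc e).symm.trans h.2.1)
  obtain ⟨h1, h2⟩ := D₁.p_mem_conn hx
  have := h2.map_eq (fun x => P (ι x)) fun e he => by
    have := D.const _ (hε e he.1) (hnot e he.1 he.2.1)
    rwa [hs, ht] at this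
  rw [← this, hcore _ h1]

end Embed

section Union

variable {r : V} {r' : V'} {j : J} {p : V → V} {p' : V' → V'} (D : G.Decomp F r j C p)
  (D' : G'.Decomp F' r' j C' p')

theorem conn_amalg_inl {x y : V} (h : G.Conn F x y) :
    (G.amalg G' M).Conn (sumSet F F') (.inl x) (.inl y) :=
  h.lift _ fun e he => Conn.edge (G := G.amalg G' M) (e := .inl e) he

theorem conn_amalg_inr {x y : V'} (h : G'.Conn F' x y) :
    (G.amalg G' M).Conn (sumSet F F') (merge M (.inr x)) (merge M (.inr y)) :=
  h.lift (fun x => merge M (.inr x)) fun e he =>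
    Conn.edge (G := G.amalg G' M) (e := .inr e) he

theorem mem_core_amalg (hM : IsMatching X X' M) (hr : (r, r') ∈ M) {x : V ⊕ V'} :
    x ∈ (G.amalg G' M).core (sumSet F F') (.inl r) ↔
      (∃ v ∈ G.core F r, .inl v = x) ∨ ∃ v ∈ G'.core F' r', merge M (.inr v) = x := by
  constructor
  · rintro (rfl | ⟨e | e, he, hx⟩)
    · exact .inl ⟨r, .inl rfl, rfl⟩
    · obtain ⟨y, hy, rfl⟩ := amalg_inc_inl.1 hx
      exact .inl ⟨y, .inr ⟨e, he, hy⟩, rfl⟩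
    · obtain ⟨y, hy, rfl⟩ := amalg_inc_inr.1 hx
      exact .inr ⟨y, .inr ⟨e, he, hy⟩, rfl⟩
  · rintro (⟨v, rfl | ⟨e, he, hv⟩, rfl⟩ | ⟨v, rfl | ⟨e, he, hv⟩, rfl⟩)
    · exact .inl rfl
    · exact .inr ⟨.inl e, he, amalg_inc_inl.2 ⟨v, hv, rfl⟩⟩
    · exact .inl (merge_inr_of_mem hM hr)
    · exact .inr ⟨.inr e, he, amalg_inc_inr.2 ⟨v, hv, rfl⟩⟩

theorem amalg_conn (hM : IsMatching X X' M) (hr : (r, r') ∈ M)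
    (h : ∀ x ∈ G.core F r, G.Conn F r x) (h' : ∀ x ∈ G'.core F' r', G'.Conn F' r' x) :
    ∀ x ∈ (G.amalg G' M).core (sumSet F F') (.inl r),
      (G.amalg G' M).Conn (sumSet F F') (.inl r) x := by
  intro x hx
  rcases (mem_core_amalg hM hr).1 hx with ⟨v, hv, rfl⟩ | ⟨v, hv, rfl⟩
  · exact conn_amalg_inl (h v hv)
  · rw [← merge_inr_of_mem hM hr]
    exact conn_amalg_inr (h' v hv)

include D D' in
/-- If the amalgam is a tree of components, the matching is compatible with the retractions. -/
theorem Decomp.compat_of_treelike (hM : IsMatching (G.core F r) (G'.core F' r') M)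
    (hr : (r, r') ∈ M) (hT : (G.amalg G' M).Treelike (sumSet F F')) {x : V} {y : V'}
    (hxy : (x, y) ∈ M) : (p x, p' y) ∈ M := by
  have hr' := merge_inr_of_mem hM hr
  -- Both `p` and `p'` are restrictions of the retraction `P` of the amalgam. Since `x` and `y` are
  -- one vertex there, so are `p x` and `p' y`.
  obtain ⟨P, DU⟩ := hT.exists_decomp (amalg_conn hM hr D.conn' D'.conn') j
  have h1 : P (.inl x) = .inl (p x) :=
    D.embed (ι := Sum.inl) (ε := Sum.inl) DU Sum.inl_injective (fun e he => he) (fun _ => rfl)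
      (fun _ => rfl) (fun _ => rfl) (hM.fst_mem hxy)
  rw [← hr'] at DU
  have h2 : P (merge M (.inr y)) = merge M (.inr (p' y)) :=
    D'.embed (ι := fun y => merge M (.inr y)) (ε := Sum.inr) DU (merge_inr_injective hM)
      (fun e he => he) (fun _ => rfl) (fun _ => rfl) (fun _ => rfl) (hM.snd_mem hxy)
  rw [merge_inr_of_mem hM hxy, h1] at h2
  exact (merge_inr_eq_inl hM).1 h2.symm

/-- The retraction of an amalgam. -/
def amalgRetr (p : V → V) (p' : V' → V') (M : Finset (V × V')) : V ⊕ V' → V ⊕ V'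
  | .inl x => .inl (p x)
  | .inr y => merge M (.inr (p' y))

/-- Compatibility of `M` with the retractions makes the two clauses of `amalgRetr` agree on merged
vertices. -/
theorem amalgRetr_merge (hM : IsMatching X X' M)
    (hc : ∀ x y, (x, y) ∈ M → (p x, p' y) ∈ M) (y : V') :
    amalgRetr p p' M (merge M (.inr y)) = merge M (.inr (p' y)) := by
  by_cases h : ∃ x, (x, y) ∈ M
  · obtain ⟨x, hx⟩ := h
    rw [merge_inr_of_mem hM hx, merge_inr_of_mem hM (hc x y hx)]
    rfl
  · rw [merge_inr_of_not_mem (by simpa using h)]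
    rfl

include D D' in
-- A matching that respects the retractions cannot give a branch a second attachment point, so the
-- two decompositions glue.
theorem Decomp.amalg (hM : IsMatching (G.core F r) (G'.core F' r') M)
    (hr : (r, r') ∈ M) (hc : ∀ x y, (x, y) ∈ M → (p x, p' y) ∈ M) :
    (G.amalg G' M).Decomp (sumSet F F') (.inl r) j (sumSet C C') (amalgRetr p p' M) where
  subset := by
    rintro (e | e) he
    exacts [D.subset he, D'.subset he]
  col := by
    rintro (e | e) he
    exacts [D.col e he, D'.col e he]
  conn := amalg_conn hM hr D.conn D'.conn
  fix := by
    intro x hx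
    rcases (mem_core_amalg hM hr).1 hx with ⟨v, hv, rfl⟩ | ⟨v, hv, rfl⟩
    · exact congrArg Sum.inl (D.fix v hv)
    · rw [amalgRetr_merge hM hc, D'.fix v hv]
  const := by
    rintro (e | e) he heC
    · exact congrArg Sum.inl (D.const e he heC)
    · change amalgRetr p p' M (merge M (.inr _)) = amalgRetr p p' M (merge M (.inr _))
      rw [amalgRetr_merge hM hc, amalgRetr_merge hM hc, D'.const e he heC]
  col_ne := by
    rintro (e | e) he heC x hx hex
    · obtain ⟨u, hu, rfl⟩ := amalg_inc_inl.1 hex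
      refine D.col_ne e he heC u ?_ hu
      rcases (mem_core_amalg hM hr).1 hx with ⟨v, hv, h⟩ | ⟨v, hv, h⟩
      · cases h
        exact hv
      -- The vertex `u` is merged with a core vertex `v` of the second graph. Compatibility pairs
      -- `v` with `p u` as well, so `u = p u` lies in the first core.
      · have h1 := (merge_inr_eq_inl hM).1 h
        have h2 := hc _ _ h1
        rw [D'.fix v hv] at h2
        rw [← hM.fst_unique h2 h1]
        exact (D.p_mem_conn (hM.fst_mem h1)).1
    · obtain ⟨u, hu, rfl⟩ := amalg_inc_inr.1 hex
      refine D'.col_ne e he heC u ?_ hu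
      rcases (mem_core_amalg hM hr).1 hx with ⟨v, hv, h⟩ | ⟨v, hv, h⟩
      · have h1 := (merge_inr_eq_inl hM).1 h.symm
        have h2 := hc _ _ h1
        rw [D.fix v hv] at h2
        rw [← hM.snd_unique h2 h1]
        exact (D'.p_mem_conn (hM.snd_mem h1)).1
      · rwa [← merge_inr_injective hM h]
  conn' := amalg_conn hM hr D.conn' D'.conn'

variable (hM : IsMatching (G.core F r) (G'.core F' r') M) (hr : (r, r') ∈ M)
  (hc : ∀ x y, (x, y) ∈ M → (p x, p' y) ∈ M)

/-- In this lemma and the two that follow, a core vertex of the amalgam carries both branches if it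
is matched, and only its own branch otherwise. -/
theorem Decomp.branch_amalg_of_mem {v : V} {v' : V'} (hv : (v, v') ∈ M) :
    (D.amalg D' hM hr hc).branch (.inl v) = sumSet (D.branch v) (D'.branch v') := by
  ext (e | e)
  · simp only [inl_mem_sumSet]
    refine and_congr_right fun _ => and_congr_right fun _ => ?_
    exact Sum.inl_injective.eq_iff
  · simp only [inr_mem_sumSet]
    refine and_congr_right fun _ => and_congr_right fun _ => ?_
    change amalgRetr p p' M (merge M (.inr _)) = _ ↔ _
    rw [amalgRetr_merge hM hc, merge_inr_eq_inl hM]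
    exact ⟨fun h => hM.snd_unique h hv, fun h => h ▸ hv⟩

theorem Decomp.branch_amalg_inl {v : V} (hv : ∀ v', (v, v') ∉ M) :
    (D.amalg D' hM hr hc).branch (.inl v) = sumSet (D.branch v) ∅ := by
  ext (e | e)
  · simp only [inl_mem_sumSet]
    refine and_congr_right fun _ => and_congr_right fun _ => ?_
    exact Sum.inl_injective.eq_iff
  · simp only [inr_mem_sumSet, Set.mem_empty_iff_false, iff_false]
    rintro ⟨_, _, h⟩
    change amalgRetr p p' M (merge M (.inr _)) = _ at h
    rw [amalgRetr_merge hM hc, merge_inr_eq_inl hM] at h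
    exact hv _ h

theorem Decomp.branch_amalg_inr {v : V'} (hv : ∀ x, (x, v) ∉ M) :
    (D.amalg D' hM hr hc).branch (.inr v) = sumSet ∅ (D'.branch v) := by
  ext (e | e)
  · simp only [inl_mem_sumSet, Set.mem_empty_iff_false, iff_false]
    rintro ⟨_, _, h⟩
    cases h
  · simp only [inr_mem_sumSet]
    refine and_congr_right fun _ => and_congr_right fun _ => ?_
    change amalgRetr p p' M (merge M (.inr _)) = _ ↔ _
    rw [amalgRetr_merge hM hc, merge_inr_eq_inr]
    exact ⟨fun h => h.1, fun h => ⟨h, h ▸ hv⟩⟩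

end Union

end ColGraph

end Traffic
end

noncomputable section

namespace Traffic

/-! ## The recursion formula for pairings -/

/-- `M` is a partial matching between `X` and `X'` which preserves the marks `m` and `m'` of the
vertices; the vertices that are not matched have the trivial mark `z`. -/
structure IsMarkMatching {V V' K : Type*} (m : V → K) (m' : V' → K) (z : K) (X : Set V)
    (X' : Set V') (M : Finset (V × V')) : Prop extends IsMatching X X' M where
  mark : ∀ {x y}, (x, y) ∈ M → m x = m' y
  left : ∀ x ∈ X, (∀ y, (x, y) ∉ M) → m x = z
  right : ∀ y ∈ X', (∀ x, (x, y) ∉ M) → m' y = z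

namespace ColGraph

variable {V V' E E' J K : Type*} [Fintype V] [Fintype V']
  {G : ColGraph V E J} {G' : ColGraph V' E' J} {F C : Set E} {F' C' : Set E'}
  {w : Finset (V × V') → Set (E ⊕ E') → ℂ} {m : V → K} {m' : V' → K} {z : K}

open Classical in
variable (G G' w m m' z) in
/-- The sum of the weights of the amalgams of two rooted graphs along a partial matching, which
preserves the roots and the marks. -/
def pairing (F : Set E) (r : V) (F' : Set E') (r' : V') : ℂ :=
  ∑ M : Finset (V × V') with
    IsMarkMatching m m' z (G.core F r) (G'.core F' r') M ∧ (r, r') ∈ M,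
      (G.amalg G' M).weight (w M) (sumSet F F')

open Classical in
variable (G G' w m z) in
/-- The weight of the first graph alone, if it has no mark. -/
def soloL (F : Set E) (r : V) : ℂ :=
  if ∀ x ∈ G.core F r, m x = z then (G.amalg G' ∅).weight (w ∅) (sumSet F ∅) else 0

open Classical in
variable (G G' w m' z) in
/-- The weight of the second graph alone, if it has no mark. -/
def soloR (F' : Set E') (r' : V') : ℂ :=
  if ∀ x ∈ G'.core F' r', m' x = z then (G.amalg G' ∅).weight (w ∅) (sumSet ∅ F') else 0

variable {r : V} {r' : V'} {j : J} {p : V → V} {p' : V' → V'}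
  {M : Finset (V × V')}

section Compat

variable (D : G.Decomp F r j C p) (D' : G'.Decomp F' r' j C' p')

omit [Fintype V] [Fintype V'] in
include D D' in
-- If `x` is in the core, then `(x, p' y)` is matched along with `(x, y)`, so that `y = p' y`.
theorem Decomp.mem_core_iff (hM : IsMatching (G.core F r) (G'.core F' r') M)
    (hc : ∀ x y, (x, y) ∈ M → (p x, p' y) ∈ M) {x : V} {y : V'} (h : (x, y) ∈ M) :
    x ∈ G.core C r ↔ y ∈ G'.core C' r' := by
  constructor
  · intro hx
    have := hc _ _ h
    rw [D.fix x hx] at this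
    rw [hM.snd_unique h this]
    exact (D'.p_mem_conn (hM.snd_mem h)).1
  · intro hy
    have := hc _ _ h
    rw [D'.fix y hy] at this
    rw [hM.fst_unique h this]
    exact (D.p_mem_conn (hM.fst_mem h)).1

open Classical in
-- Decompose the amalgam by `Decomp.amalg`. The matching splits into its restriction `N` to the
-- cores and one piece over each pair of `N`, and the locality of `w` lets each branch be weighted
-- with its own piece.
theorem Decomp.weight_amalg [Finite E] [Finite E'] (hw : IsLocal G G' w)
    (hM : IsMatching (G.core F r) (G'.core F' r') M)
    (hr : (r, r') ∈ M) (hc : ∀ x y, (x, y) ∈ M → (p x, p' y) ∈ M) {N : Finset (V × V')}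
    (hN : N = M.filter fun x => x.1 ∈ G.core C r) :
    (G.amalg G' M).weight (w M) (sumSet F F') = w N (sumSet C C') *
      ((∏ x ∈ N, (G.amalg G' (M.filter fun a => p a.1 = x.1 ∧ p' a.2 = x.2)).weight
          (w (M.filter fun a => p a.1 = x.1 ∧ p' a.2 = x.2))
          (sumSet (D.branch x.1) (D'.branch x.2))) *
      ((∏ v with v ∈ G.core C r ∧ ∀ v', (v, v') ∉ N,
          (G.amalg G' ∅).weight (w ∅) (sumSet (D.branch v) ∅)) *
        ∏ v' with v' ∈ G'.core C' r' ∧ ∀ v, (v, v') ∉ N,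
          (G.amalg G' ∅).weight (w ∅) (sumSet ∅ (D'.branch v')))) := by
  have hMN : ∀ {x y}, x ∈ G.core C r → ((x, y) ∈ M ↔ (x, y) ∈ N) := by
    intro x y hx
    simp [hN, hx]
  have hMN' : ∀ {x y}, y ∈ G'.core C' r' → ((x, y) ∈ M ↔ (x, y) ∈ N) := by
    intro x y hy
    simp only [hN, Finset.mem_filter, iff_self_and]
    exact fun h => (D.mem_core_iff D' hM hc h).2 hy
  have hNmat : IsMatching (G.core F r) (G'.core F' r') N :=
    hM.mono (hN ▸ Finset.filter_subset _ _) subset_rfl subset_rfl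
  rw [(D.amalg D' hM hr hc).weight_eq (hw.empty _),
    hw.congr M N (sumSet C C') hM.to_univ hNmat.to_univ fun x hx y _ => hMN (.inr hx)]
  congr 1
  -- A matched core vertex of the second graph is represented by its partner, so only the unmatched
  -- ones are added to the left core.
  have hcore : (G.amalg G' M).core (sumSet C C') (.inl r) =
      Sum.inl '' (G.core C r) ∪ Sum.inr '' {v | v ∈ G'.core C' r' ∧ ∀ x, (x, v) ∉ N} := by
    ext x
    rw [mem_core_amalg hM hr]
    constructor
    · rintro (⟨v, hv, rfl⟩ | ⟨v, hv, rfl⟩)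
      · exact .inl ⟨v, hv, rfl⟩
      · by_cases h : ∃ x, (x, v) ∈ M
        · obtain ⟨x, hx⟩ := h
          rw [merge_inr_of_mem hM hx]
          exact .inl ⟨x, (D.mem_core_iff D' hM hc hx).2 hv, rfl⟩
        · push Not at h
          rw [merge_inr_of_not_mem h]
          exact .inr ⟨v, ⟨hv, fun x => (hMN' hv).not.1 (h x)⟩, rfl⟩
    · rintro (⟨v, hv, rfl⟩ | ⟨v, ⟨hv, h⟩, rfl⟩)
      · exact .inl ⟨v, hv, rfl⟩
      · exact .inr ⟨v, hv, merge_inr_of_not_mem fun x => (hMN' hv).not.2 (h x)⟩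
  rw [hcore, finprod_mem_union _ (Set.toFinite _) (Set.toFinite _),
    finprod_mem_image Sum.inl_injective.injOn, finprod_mem_image Sum.inr_injective.injOn,
    finprod_mem_eq_finite_toFinset_prod _ (Set.toFinite _),
    finprod_mem_eq_finite_toFinset_prod _ (Set.toFinite _),
    ← Finset.prod_filter_not_mul_prod_filter _ (fun v => ∀ v', (v, v') ∉ N), mul_assoc]
  · congr 1
    · symm
      refine Finset.prod_nbij Prod.fst ?_ ?_ ?_ ?_
      · rintro ⟨x, y⟩ hxy
        have hx := (Finset.mem_filter.1 (hN ▸ hxy)).2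
        simp only [Finset.mem_filter, Set.Finite.mem_toFinset, not_forall, not_not]
        exact ⟨hx, y, hxy⟩
      · rintro ⟨x, y⟩ hxy ⟨x', y'⟩ hxy' (rfl : x = x')
        rw [hNmat.snd_unique hxy hxy']
      · intro x hx
        simp only [Finset.coe_filter, Set.Finite.mem_toFinset, not_forall, not_not] at hx
        obtain ⟨y, hy⟩ := hx.2
        exact ⟨(x, y), hy, rfl⟩
      · rintro ⟨x, y⟩ hxy
        have hx := (Finset.mem_filter.1 (hN ▸ hxy)).2
        have hxyM := (hMN hx).2 hxy
        have hy := (D.mem_core_iff D' hM hc hxyM).1 hx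
        rw [D.branch_amalg_of_mem D' hM hr hc hxyM]
        symm
        refine hw.weight_congr hM.to_univ
          (hM.mono (Finset.filter_subset _ _) subset_rfl subset_rfl).to_univ fun a ha b hb => ?_
        have h1 := D.p_of_mem_core_branch hx (.inr ha)
        have h2 := D'.p_of_mem_core_branch hy (.inr hb)
        simp [h1, h2]
    · congr 1
      · refine Finset.prod_congr (by ext; simp) fun v hv => ?_
        simp only [Finset.mem_filter, Finset.mem_univ, true_and] at hv
        rw [D.branch_amalg_inl D' hM hr hc fun y => (hMN hv.1).not.2 (hv.2 y)]
        exact hw.weight_congr hM.to_univ (IsMatching.empty _ _) fun a ha b hb => by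
          obtain ⟨e, he, _⟩ := hb
          exact he.elim
      · refine Finset.prod_congr (by ext; simp) fun v hv => ?_
        simp only [Finset.mem_filter, Finset.mem_univ, true_and] at hv
        rw [D.branch_amalg_inr D' hM hr hc fun y => (hMN' hv.1).not.2 (hv.2 y)]
        exact hw.weight_congr hM.to_univ (IsMatching.empty _ _) fun a ha b hb => by
          obtain ⟨e, he, _⟩ := ha
          exact he.elim
  · rw [Set.disjoint_left]
    rintro _ ⟨v, _, rfl⟩ ⟨v', _, h⟩
    cases h

end Compat

section Star

variable (D : G.Decomp F r j C p) (D' : G'.Decomp F' r' j C' p')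

open Classical in
include D D' in
-- By `Decomp.compat_of_treelike`, a matching that does not respect the retractions gives an amalgam
-- that is not a tree of components, of weight zero.
theorem pairing_eq_compat :
    pairing G G' w m m' z F r F' r' = ∑ M : Finset (V × V') with
      (IsMarkMatching m m' z (G.core F r) (G'.core F' r') M ∧ (r, r') ∈ M) ∧
        ∀ x y, (x, y) ∈ M → (p x, p' y) ∈ M,
      (G.amalg G' M).weight (w M) (sumSet F F') := by
  rw [pairing, ← Finset.sum_filter_of_ne (p := fun M => ∀ x y, (x, y) ∈ M → (p x, p' y) ∈ M),
    Finset.filter_filter]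
  intro M hM hne x y hxy
  simp only [Finset.mem_filter, Finset.mem_univ, true_and] at hM
  refine D.compat_of_treelike D' hM.1.toIsMatching hM.2 ?_ hxy
  by_contra h
  exact hne (if_neg h)

open Classical in
/-- Decomposition of a pairing at the components of the roots. -/
theorem Decomp.pairing_eq [Finite E] [Finite E'] (hw : IsLocal G G' w) :
    pairing G G' w m m' z F r F' r' = ∑ N : Finset (V × V') with
      IsMatching (G.core C r) (G'.core C' r') N ∧ (r, r') ∈ N,
      w N (sumSet C C') *
        ((∏ x ∈ N, pairing G G' w m m' z (D.branch x.1) x.1 (D'.branch x.2) x.2) *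
        ((∏ v with v ∈ G.core C r ∧ ∀ v', (v, v') ∉ N, soloL G G' w m z (D.branch v) v) *
        ∏ v' with v' ∈ G'.core C' r' ∧ ∀ v, (v, v') ∉ N,
          soloR G G' w m' z (D'.branch v') v')) := by
  rw [pairing_eq_compat D D']
  -- `S x` consists of the matchings allowed between the two branches at the pair `x`; `good N` says
  -- that the branches at unmatched core vertices carry no mark.
  let S : V × V' → Finset (Finset (V × V')) := fun x => Finset.univ.filter fun M =>
    IsMarkMatching m m' z (G.core (D.branch x.1) x.1) (G'.core (D'.branch x.2) x.2) M ∧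
      (x.1, x.2) ∈ M
  let T : V × V' → Finset (V × V') → ℂ := fun x M =>
    (G.amalg G' M).weight (w M) (sumSet (D.branch x.1) (D'.branch x.2))
  let good : Finset (V × V') → Prop := fun N =>
    (∀ v ∈ G.core C r, (∀ v', (v, v') ∉ N) → ∀ x ∈ G.core (D.branch v) v, m x = z) ∧
    (∀ v' ∈ G'.core C' r', (∀ v, (v, v') ∉ N) → ∀ x ∈ G'.core (D'.branch v') v', m' x = z)
  let L : Finset (V × V') → ℂ := fun N => ∏ v with v ∈ G.core C r ∧ ∀ v', (v, v') ∉ N,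
    (G.amalg G' ∅).weight (w ∅) (sumSet (D.branch v) ∅)
  let R : Finset (V × V') → ℂ := fun N => ∏ v' with v' ∈ G'.core C' r' ∧ ∀ v, (v, v') ∉ N,
    (G.amalg G' ∅).weight (w ∅) (sumSet ∅ (D'.branch v'))
  -- Distribute the product of sums. Outside `N` the family `g` is forced to be `∅`, so that it is
  -- determined by its values on `N`.
  have hprod : ∀ N : Finset (V × V'),
      ∏ x ∈ N, pairing G G' w m m' z (D.branch x.1) x.1 (D'.branch x.2) x.2 =
        ∑ g ∈ Fintype.piFinset fun x => if x ∈ N then S x else {∅}, ∏ x ∈ N, T x (g x) := by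
    intro N
    have h1 := Finset.prod_univ_sum (fun x => if x ∈ N then S x else {∅})
      (fun x M => if x ∈ N then T x M else 1)
    rw [Finset.prod_congr rfl (g := fun x => if x ∈ N then
      pairing G G' w m m' z (D.branch x.1) x.1 (D'.branch x.2) x.2 else 1)] at h1
    · rw [Finset.prod_ite_mem, Finset.univ_inter] at h1
      rw [h1]
      refine Finset.sum_congr rfl fun g _ => ?_
      rw [Finset.prod_ite_mem, Finset.univ_inter]
    · intro x _
      by_cases hx : x ∈ N
      · simp only [hx, if_true]
        rfl
      · simp [hx]
  have hsolo : ∀ N : Finset (V × V'),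
      (∏ v with v ∈ G.core C r ∧ ∀ v', (v, v') ∉ N, soloL G G' w m z (D.branch v) v) *
        (∏ v' with v' ∈ G'.core C' r' ∧ ∀ v, (v, v') ∉ N,
          soloR G G' w m' z (D'.branch v') v') = if good N then L N * R N else 0 := by
    intro N
    by_cases hg : good N
    · rw [if_pos hg]
      congr 1
      · refine Finset.prod_congr rfl fun v hv => ?_
        simp only [Finset.mem_filter, Finset.mem_univ, true_and] at hv
        exact if_pos (hg.1 v hv.1 hv.2)
      · refine Finset.prod_congr rfl fun v hv => ?_
        simp only [Finset.mem_filter, Finset.mem_univ, true_and] at hv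
        exact if_pos (hg.2 v hv.1 hv.2)
    · rw [if_neg hg]
      simp only [good, not_and_or] at hg
      rcases hg with hg | hg
      · push Not at hg
        obtain ⟨v, hv, hv', x, hx, hxz⟩ := hg
        rw [Finset.prod_eq_zero (i := v) (by simpa using ⟨hv, hv'⟩), zero_mul]
        exact if_neg fun h => hxz (h x hx)
      · push Not at hg
        obtain ⟨v, hv, hv', x, hx, hxz⟩ := hg
        rw [mul_comm, Finset.prod_eq_zero (i := v) (by simpa using ⟨hv, hv'⟩), zero_mul]
        exact if_neg fun h => hxz (h x hx)
  simp only [hprod, hsolo]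
  have hgood : ∀ (s : Finset (Finset (V × V'))) (f : Finset (V × V') → ℂ),
      (∀ N, ¬ good N → f N = 0) → ∑ N ∈ s, f N = ∑ N ∈ s with good N, f N := by
    intro s f hf
    rw [Finset.sum_filter_of_ne]
    intro N _ hne
    by_contra h
    exact hne (hf N h)
  conv_rhs => rw [hgood _ _ fun N h => by simp only [if_neg h, mul_zero]]
  simp only [Finset.sum_mul, Finset.mul_sum]
  conv_rhs => rw [Finset.sum_sigma']
  -- A compatible matching is cut into its restriction to the cores and its pieces over the pairs of
  -- core vertices; conversely the pieces are united.
  refine Finset.sum_bij'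
    (fun M _ => ⟨M.filter fun x => x.1 ∈ G.core C r, fun x =>
      if x ∈ M.filter (fun x => x.1 ∈ G.core C r) then
        M.filter fun a => p a.1 = x.1 ∧ p' a.2 = x.2 else ∅⟩)
    (fun a _ => a.1.biUnion a.2) ?_ ?_ ?_ ?_ ?_
  · intro M hM
    simp only [Finset.mem_filter, Finset.mem_univ, true_and] at hM
    obtain ⟨⟨hM, hr⟩, hc⟩ := hM
    have hcore := fun {x y} => D.mem_core_iff D' hM.toIsMatching hc (x := x) (y := y)
    simp only [Finset.mem_sigma, Finset.mem_filter, Finset.mem_univ, true_and,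
      Fintype.mem_piFinset]
    refine ⟨⟨⟨⟨?_, ?_, ?_, ?_⟩, hr, .inl rfl⟩, ?_, ?_⟩, ?_⟩
    · intro x y h
      exact (Finset.mem_filter.1 h).2
    · intro x y h
      exact (hcore (Finset.mem_filter.1 h).1).1 (Finset.mem_filter.1 h).2
    · intro x y y' h h'
      exact hM.snd_unique (Finset.mem_filter.1 h).1 (Finset.mem_filter.1 h').1
    · intro x y y' h h'
      exact hM.fst_unique (Finset.mem_filter.1 h).1 (Finset.mem_filter.1 h').1
    · intro v hv hv' x hx
      rw [D.mem_core_branch hv] at hx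
      obtain ⟨hx, rfl⟩ := hx
      refine hM.left x hx fun y hy => hv' (p' y) ?_
      simpa using ⟨hc _ _ hy, hv⟩
    · intro v hv hv' x hx
      rw [D'.mem_core_branch hv] at hx
      obtain ⟨hx, rfl⟩ := hx
      refine hM.right x hx fun y hy => hv' (p y) ?_
      simpa using ⟨hc _ _ hy, (hcore (hc _ _ hy)).2 hv⟩
    · rintro ⟨v, v'⟩
      by_cases hv : (v, v') ∈ M ∧ v ∈ G.core C r
      · have hv' := (hcore hv.1).1 hv.2
        simp only [hv, and_self, if_true, S, Finset.mem_filter, Finset.mem_univ, true_and]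
        refine ⟨⟨⟨?_, ?_, ?_, ?_⟩, ?_, ?_, ?_⟩, D.fix v hv.2, D'.fix v' hv'⟩
        · intro x y h
          rw [Finset.mem_filter] at h
          exact (D.mem_core_branch hv.2).2 ⟨hM.fst_mem h.1, h.2.1⟩
        · intro x y h
          rw [Finset.mem_filter] at h
          exact (D'.mem_core_branch hv').2 ⟨hM.snd_mem h.1, h.2.2⟩
        · intro x y y' h h'
          exact hM.snd_unique (Finset.mem_filter.1 h).1 (Finset.mem_filter.1 h').1
        · intro x y y' h h'
          exact hM.fst_unique (Finset.mem_filter.1 h).1 (Finset.mem_filter.1 h').1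
        · intro x y h
          exact hM.mark (Finset.mem_filter.1 h).1
        · intro x hx h
          rw [D.mem_core_branch hv.2] at hx
          refine hM.left x hx.1 fun y hy => h y ?_
          have := hc _ _ hy
          rw [hx.2] at this
          exact Finset.mem_filter.2 ⟨hy, hx.2, hM.snd_unique this hv.1⟩
        · intro x hx h
          rw [D'.mem_core_branch hv'] at hx
          refine hM.right x hx.1 fun y hy => h y ?_
          have := hc _ _ hy
          rw [hx.2] at this
          exact Finset.mem_filter.2 ⟨hy, hM.fst_unique this hv.1, hx.2⟩
      · simp [hv]
  · rintro ⟨N, g⟩ hNg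
    simp only [Finset.mem_sigma, Finset.mem_filter, Finset.mem_univ, true_and,
      Fintype.mem_piFinset] at hNg
    obtain ⟨⟨⟨hN, hr⟩, hg1, hg2⟩, hg⟩ := hNg
    have hmem : ∀ a, a ∈ N.biUnion g ↔ ∃ x ∈ N, a ∈ g x := by simp
    have hS : ∀ x ∈ N, IsMarkMatching m m' z (G.core (D.branch x.1) x.1)
        (G'.core (D'.branch x.2) x.2) (g x) ∧ (x.1, x.2) ∈ g x := by
      intro x hx
      have := hg x
      simpa [hx, S] using this
    have hp : ∀ x ∈ N, ∀ {a b}, (a, b) ∈ g x → p a = x.1 ∧ p' b = x.2 := by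
      intro x hx a b h
      exact ⟨D.p_of_mem_core_branch (hN.fst_mem hx) ((hS x hx).1.fst_mem h),
        D'.p_of_mem_core_branch (hN.snd_mem hx) ((hS x hx).1.snd_mem h)⟩
    simp only [Finset.mem_filter, Finset.mem_univ, true_and]
    refine ⟨⟨⟨⟨?_, ?_, ?_, ?_⟩, ?_, ?_, ?_⟩, ?_⟩, ?_⟩
    · intro a b h
      obtain ⟨x, hx, h⟩ := (hmem _).1 h
      exact ((D.mem_core_branch (hN.fst_mem hx)).1 ((hS x hx).1.fst_mem h)).1
    · intro a b h
      obtain ⟨x, hx, h⟩ := (hmem _).1 h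
      exact ((D'.mem_core_branch (hN.snd_mem hx)).1 ((hS x hx).1.snd_mem h)).1
    · intro a b b' h h'
      obtain ⟨x, hx, h⟩ := (hmem _).1 h
      obtain ⟨x', hx', h'⟩ := (hmem _).1 h'
      have h1 := hp x hx h
      have h2 := hp x' hx' h'
      have h3 : x.1 = x'.1 := h1.1.symm.trans h2.1
      have h4 : x = x' := Prod.ext h3 (hN.snd_unique (x := x.1) hx (h3 ▸ hx'))
      subst h4
      exact (hS x hx).1.snd_unique h h'
    · intro a a' b h h'
      obtain ⟨x, hx, h⟩ := (hmem _).1 h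
      obtain ⟨x', hx', h'⟩ := (hmem _).1 h'
      have h1 := hp x hx h
      have h2 := hp x' hx' h'
      have h3 : x.2 = x'.2 := h1.2.symm.trans h2.2
      have h4 : x = x' := Prod.ext (hN.fst_unique (y := x.2) hx (h3 ▸ hx')) h3
      subst h4
      exact (hS x hx).1.fst_unique h h'
    · intro a b h
      obtain ⟨x, hx, h⟩ := (hmem _).1 h
      exact (hS x hx).1.mark h
    · intro a ha h
      have hpa := (D.p_mem_conn ha).1
      have hab := (D.mem_core_branch hpa).2 ⟨ha, rfl⟩
      by_cases hv : ∃ v', (p a, v') ∈ N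
      · obtain ⟨v', hv'⟩ := hv
        exact (hS _ hv').1.left a hab fun y hy => h y ((hmem _).2 ⟨_, hv', hy⟩)
      · push Not at hv
        exact hg1 (p a) hpa hv a hab
    · intro a ha h
      have hpa := (D'.p_mem_conn ha).1
      have hab := (D'.mem_core_branch hpa).2 ⟨ha, rfl⟩
      by_cases hv : ∃ v, (v, p' a) ∈ N
      · obtain ⟨v, hv⟩ := hv
        exact (hS _ hv).1.right a hab fun y hy => h y ((hmem _).2 ⟨_, hv, hy⟩)
      · push Not at hv
        exact hg2 (p' a) hpa hv a hab
    · exact (hmem _).2 ⟨_, hr, (hS _ hr).2⟩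
    · intro a b h
      obtain ⟨x, hx, h⟩ := (hmem _).1 h
      rw [(hp x hx h).1, (hp x hx h).2]
      exact (hmem _).2 ⟨x, hx, (hS x hx).2⟩
  · intro M hM
    simp only [Finset.mem_filter, Finset.mem_univ, true_and] at hM
    obtain ⟨⟨hM, hr⟩, hc⟩ := hM
    ext ⟨a, b⟩
    simp only [Finset.mem_biUnion]
    constructor
    · rintro ⟨x, hx, h⟩
      rw [if_pos hx] at h
      exact (Finset.mem_filter.1 h).1
    · intro h
      have : (p a, p' b) ∈ M.filter (fun x => x.1 ∈ G.core C r) :=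
        Finset.mem_filter.2 ⟨hc _ _ h, (D.p_mem_conn (hM.fst_mem h)).1⟩
      refine ⟨(p a, p' b), this, ?_⟩
      rw [if_pos this]
      exact Finset.mem_filter.2 ⟨h, rfl, rfl⟩
  · rintro ⟨N, g⟩ hNg
    simp only [Finset.mem_sigma, Finset.mem_filter, Finset.mem_univ, true_and,
      Fintype.mem_piFinset] at hNg
    obtain ⟨⟨⟨hN, hr⟩, hg1, hg2⟩, hg⟩ := hNg
    have hmem : ∀ a, a ∈ N.biUnion g ↔ ∃ x ∈ N, a ∈ g x := by simp
    have hS : ∀ x ∈ N, IsMarkMatching m m' z (G.core (D.branch x.1) x.1)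
        (G'.core (D'.branch x.2) x.2) (g x) ∧ (x.1, x.2) ∈ g x := by
      intro x hx
      have := hg x
      simpa [hx, S] using this
    have hp : ∀ x ∈ N, ∀ {a b}, (a, b) ∈ g x → p a = x.1 ∧ p' b = x.2 := by
      intro x hx a b h
      exact ⟨D.p_of_mem_core_branch (hN.fst_mem hx) ((hS x hx).1.fst_mem h),
        D'.p_of_mem_core_branch (hN.snd_mem hx) ((hS x hx).1.snd_mem h)⟩
    have hfst : (N.biUnion g).filter (fun x => x.1 ∈ G.core C r) = N := by
      ext ⟨a, b⟩
      rw [Finset.mem_filter, hmem]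
      constructor
      · rintro ⟨⟨x, hx, h⟩, ha⟩
        have h1 := (hp x hx h).1
        rw [D.fix a ha] at h1
        subst h1
        rwa [(hS x hx).1.snd_unique h (hS x hx).2]
      · intro h
        exact ⟨⟨_, h, (hS _ h).2⟩, hN.fst_mem h⟩
    refine Sigma.ext hfst (heq_of_eq ?_)
    funext x
    dsimp only
    rw [hfst]
    by_cases hx : x ∈ N
    · rw [if_pos hx]
      ext ⟨a, b⟩
      rw [Finset.mem_filter, hmem]
      constructor
      · rintro ⟨⟨y, hy, h⟩, h1, h2⟩
        have := hp y hy h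
        have : x = y := Prod.ext (h1.symm.trans this.1) (h2.symm.trans this.2)
        exact this ▸ h
      · intro h
        exact ⟨⟨x, hx, h⟩, hp x hx h⟩
    · have := hg x
      rw [if_neg hx, Finset.mem_singleton] at this
      rw [if_neg hx, this]
  · intro M hM
    simp only [Finset.mem_filter, Finset.mem_univ, true_and] at hM
    obtain ⟨⟨hM, hr⟩, hc⟩ := hM
    have hgood : good (M.filter fun x => x.1 ∈ G.core C r) := by
      have hcore := fun {x y} => D.mem_core_iff D' hM.toIsMatching hc (x := x) (y := y)
      constructor
      · intro v hv hv' x hx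
        rw [D.mem_core_branch hv] at hx
        obtain ⟨hx, rfl⟩ := hx
        refine hM.left x hx fun y hy => hv' (p' y) ?_
        simpa using ⟨hc _ _ hy, hv⟩
      · intro v hv hv' x hx
        rw [D'.mem_core_branch hv] at hx
        obtain ⟨hx, rfl⟩ := hx
        refine hM.right x hx fun y hy => hv' (p y) ?_
        simpa using ⟨hc _ _ hy, (hcore (hc _ _ hy)).2 hv⟩
    rw [D.weight_amalg D' hw hM.toIsMatching hr hc rfl, if_pos hgood]
    congr 2
    refine Finset.prod_congr rfl fun x hx => ?_
    dsimp only at hx ⊢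
    rw [if_pos hx]

end Star

end ColGraph

end Traffic
end

/-! ### Enumerations of finite sets, reversed graphs, and pairings with a single vertex. -/

noncomputable section

namespace Traffic

/-- A sum over finite sets, as a sum over enumerations. -/
theorem sum_finset_eq_sum_tuples {A : Type*} [Fintype A] [DecidableEq A]
    [∀ n, DecidablePred fun e : Fin n → A => Function.Injective e] (f : Finset A → ℂ) :
    ∑ Q, f Q = ∑ n ∈ Finset.range (Fintype.card A + 1), ((n.factorial : ℂ)⁻¹ *
      ∑ e : Fin n → A with Function.Injective e, f (Finset.univ.image e)) := by
  have h1 : ∑ Q, f Q = ∑ n ∈ Finset.range (Fintype.card A + 1),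
      ∑ Q ∈ Finset.univ.filter (fun Q : Finset A => Q.card = n), f Q := by
    symm
    refine Finset.sum_fiberwise_of_maps_to (fun Q _ => ?_) _
    rw [Finset.mem_range]
    exact Nat.lt_succ_of_le (Finset.card_le_univ Q)
  rw [h1]
  refine Finset.sum_congr rfl fun n _ => ?_
  have h2 : ∑ e : Fin n → A with Function.Injective e, f (Finset.univ.image e) =
      ∑ Q ∈ Finset.univ.filter (fun Q : Finset A => Q.card = n),
        ∑ e : Fin n → A with Function.Injective e ∧ Finset.univ.image e = Q, f Q := by
    rw [← Finset.sum_fiberwise_of_maps_to (g := fun e : Fin n → A => Finset.univ.image e)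
      (t := Finset.univ.filter (fun Q : Finset A => Q.card = n))]
    · refine Finset.sum_congr rfl fun Q _ => ?_
      rw [Finset.filter_filter]
      refine Finset.sum_congr rfl fun e he => ?_
      rw [(Finset.mem_filter.1 he).2.2]
    · intro e he
      simp [Finset.card_image_of_injective _ (Finset.mem_filter.1 he).2]
  rw [h2, Finset.mul_sum]
  refine Finset.sum_congr rfl fun Q hQ => ?_
  have hQ' : Q.card = n := (Finset.mem_filter.1 hQ).2
  rw [Finset.sum_const]
  -- The enumerations of `Q` are the bijections `Fin n ≃ Q`; the factor `1 / n!` compensates for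
  -- their number.
  have hcard : (Finset.univ.filter fun e : Fin n → A =>
      Function.Injective e ∧ Finset.univ.image e = Q).card = n.factorial := by
    rw [← Fintype.card_subtype]
    have e : {e : Fin n → A // Function.Injective e ∧ Finset.univ.image e = Q} ≃ (Fin n ≃ Q) :=
      { toFun := fun e => Equiv.ofBijective
          (fun i => ⟨e.1 i, (Finset.ext_iff.1 e.2.2 _).1
            (Finset.mem_image_of_mem _ (Finset.mem_univ i))⟩)
          ⟨fun i j h => e.2.1 (congrArg Subtype.val h), fun ⟨a, ha⟩ => by
            have ha' := ha
            rw [← e.2.2] at ha'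
            obtain ⟨i, _, hi⟩ := Finset.mem_image.1 ha'
            exact ⟨i, Subtype.ext hi⟩⟩
        invFun := fun σ => ⟨fun i => σ i, Subtype.val_injective.comp σ.injective, by
          ext a
          simp only [Finset.mem_image, Finset.mem_univ, true_and]
          refine ⟨fun ⟨i, hi⟩ => hi ▸ (σ i).2, fun ha => ⟨σ.symm ⟨a, ha⟩, by simp⟩⟩⟩
        left_inv := fun e => rfl
        right_inv := fun σ => by ext; rfl }
    rw [Fintype.card_congr e, Fintype.card_equiv (Fintype.equivOfCardEq (by simp [hQ']))]
    simp
  rw [hcard, nsmul_eq_mul, ← mul_assoc, inv_mul_cancel₀ (by exact_mod_cast n.factorial_ne_zero),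
    one_mul]

namespace ColGraph

variable {V V' E E' J K : Type*}

/-- Reverse the edges. -/
def rev (G : ColGraph V E J) : ColGraph V E J := ⟨G.tgt, G.src, G.col⟩

variable {G : ColGraph V E J} {F C : Set E} {r : V} {j : J} {p : V → V}

theorem rev_inc {e : E} {x : V} : G.rev.Inc e x ↔ G.Inc e x := or_comm

theorem rev_core : G.rev.core F r = G.core F r := by
  ext x
  exact or_congr Iff.rfl (exists_congr fun e => and_congr_right fun _ => rev_inc)

theorem rev_conn {x y : V} : G.rev.Conn F x y ↔ G.Conn F x y :=
  ⟨fun h => h.lift id fun _ he => (Conn.edge he).symm,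
    fun h => h.lift id fun _ he => (Conn.edge (G := G.rev) he).symm⟩

theorem Decomp.rev (D : G.Decomp F r j C p) : G.rev.Decomp F r j C p where
  subset := D.subset
  col := D.col
  conn := fun x hx => rev_conn.2 (D.conn x (rev_core ▸ hx))
  fix := fun x hx => D.fix x (rev_core ▸ hx)
  const := fun e he heC => (D.const e he heC).symm
  col_ne := fun e he heC x hx hex => D.col_ne e he heC x (rev_core ▸ hx) (rev_inc.1 hex)
  conn' := fun x hx => rev_conn.2 (D.conn' x (rev_core ▸ hx))

theorem Decomp.branch_rev (D : G.Decomp F r j C p) (v : V) : D.rev.branch v = D.branch v := by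
  ext e
  refine and_congr_right fun he => and_congr_right fun heC => ?_
  rw [D.const e he heC]
  rfl

section Embed

variable {W E₁ : Type*} {G₁ : ColGraph W E₁ J} {A : ColGraph V E J} {F₁ : Set E₁} {r₁ : W}
  {U CU : Set E} {P : V → V} {ι : W → V} {ε : E₁ → E}

/-- A connected subgraph of a tree of components can be decomposed at the root. -/
theorem Decomp.restrict
    (D : A.Decomp U (ι r₁) j CU P) (hι : Function.Injective ι)
    (hε : ∀ e ∈ F₁, ε e ∈ U) (hs : ∀ e, A.src (ε e) = ι (G₁.src e))
    (ht : ∀ e, A.tgt (ε e) = ι (G₁.tgt e)) (hc : ∀ e, A.col (ε e) = G₁.col e)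
    (hconn : ∀ x ∈ G₁.core F₁ r₁, G₁.Conn F₁ r₁ x) :
    ∃ C₁ p₁, G₁.Decomp F₁ r₁ j C₁ p₁ := by
  classical
  have hinc : ∀ {e x}, G₁.Inc e x → A.Inc (ε e) (ι x) := by
    rintro e x (rfl | rfl)
    exacts [.inl (hs e), .inr (ht e)]
  -- The part of `F₁` that lands in the large component. That the root reaches all of it inside `C₁`
  -- is not given; it comes from following `P` along paths of `F₁`.
  let C₁ : Set E₁ := {e | e ∈ F₁ ∧ ε e ∈ CU}
  have hcore : ∀ v ∈ G₁.core C₁ r₁, ι v ∈ A.core CU (ι r₁) := by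
    rintro v (rfl | ⟨e, he, hv⟩)
    · exact .inl rfl
    · exact .inr ⟨_, he.2, hinc hv⟩
  have hstep : ∀ e ∈ F₁, ∀ x y, G₁.Inc e x → G₁.Inc e y →
      (∃ v, G₁.Conn C₁ r₁ v ∧ P (ι x) = ι v) → ∃ v, G₁.Conn C₁ r₁ v ∧ P (ι y) = ι v := by
    intro e he x y hx hy ⟨v, hv, hxv⟩
    by_cases heC : ε e ∈ CU
    · rw [D.fix _ (.inr ⟨_, heC, hinc hx⟩)] at hxv
      obtain rfl := hι hxv
      exact ⟨y, hv.trans (Conn.inc (e := e) ⟨he, heC⟩ hx hy), D.fix _ (.inr ⟨_, heC, hinc hy⟩)⟩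
    · exact ⟨v, hv, ((D.p_inc (hε e he) heC (hinc hy)).symm.trans
        (D.p_inc (hε e he) heC (hinc hx))).trans hxv⟩
  have hall : ∀ x ∈ G₁.core F₁ r₁, ∃ v, G₁.Conn C₁ r₁ v ∧ P (ι x) = ι v := by
    intro x hx
    have key : ∀ a b, G₁.Conn F₁ a b → ((∃ v, G₁.Conn C₁ r₁ v ∧ P (ι a) = ι v) ↔
        ∃ v, G₁.Conn C₁ r₁ v ∧ P (ι b) = ι v) := by
      intro a b h
      induction h with
      | rel a b h =>
        obtain ⟨e, he, rfl, rfl⟩ := h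
        exact ⟨hstep e he _ _ inc_src inc_tgt, hstep e he _ _ inc_tgt inc_src⟩
      | refl a => rfl
      | symm a b _ ih => exact ih.symm
      | trans a b c _ _ ih1 ih2 => exact ih1.trans ih2
    exact (key _ _ (hconn x hx)).1 ⟨r₁, .refl, D.fix _ (.inl rfl)⟩
  let p₁ : W → W := fun x => if h : ∃ v, P (ι x) = ι v then h.choose else x
  have hp : ∀ x v, P (ι x) = ι v → p₁ x = v := by
    intro x v h
    have h' : ∃ v, P (ι x) = ι v := ⟨v, h⟩
    rw [show p₁ x = h'.choose from dif_pos h']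
    exact hι (h'.choose_spec.symm.trans h)
  refine ⟨C₁, p₁, fun e he => he.1, fun e he => (hc e).symm.trans (D.col _ he.2), ?_,
    fun x hx => hp x x (D.fix _ (hcore x hx)), ?_, ?_, hconn⟩
  · intro x hx
    obtain ⟨v, hv, hxv⟩ := hall x (Decomp.core_subset (fun e he => he.1) hx)
    rw [D.fix _ (hcore x hx)] at hxv
    rwa [hι hxv]
  · intro e he heC
    obtain ⟨v, hv, hxv⟩ := hall _ (.inr ⟨e, he, inc_src⟩)
    rw [hp _ v hxv]
    refine (hp _ v ?_).symm
    rw [← hxv, ← hs, ← ht]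
    exact (D.const _ (hε e he) fun h => heC ⟨he, h⟩).symm
  · intro e he heC x hx hex
    rw [← hc]
    exact D.col_ne _ (hε e he) (fun h => heC ⟨he, h⟩) _ (hcore x hx) (hinc hex)

end Embed

theorem comps_empty : G.comps ∅ = ∅ := by simp [comps]

theorem core_empty : G.core ∅ r = {r} := by
  ext x
  simp [core, verts]

theorem weight_empty {w : Set E → ℂ} : G.weight w ∅ = 1 := by
  rw [weight, if_pos, comps_empty]
  · simp
  · intro c hc
    rw [comps_empty] at hc
    exact hc.elim

theorem sumSet_empty {E E' : Type*} : sumSet (∅ : Set E) (∅ : Set E') = ∅ := by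
  ext (e | e) <;> simp

section Solo

variable [Fintype V] {w : Finset (V × V) → Set (E ⊕ E) → ℂ} {m : V → K} {z : K}
  {F' : Set E} {r' : V}

open Classical in
variable (G w m z) in
/-- The pairing of a graph with the reversed graph. -/
def kernel (a b : Set E × V) : ℂ := pairing G G.rev w m m z a.1 a.2 b.1 b.2

/-- The only matching with a single vertex is the pair of roots, and every other vertex then has to
be unmarked. Solo weights thus become values of the kernel at `(∅, r₀)`, which is what centering
needs. -/
theorem kernel_single_right (hw : IsLocal G G.rev w) {r₀ : V} (h₀ : m r₀ = z) :
    kernel G w m z (F, r) (∅, r₀) = soloL G G.rev w m z F r := by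
  classical
  have key : ∀ M : Finset (V × V), IsMarkMatching m m z (G.core F r) (G.rev.core ∅ r₀) M ∧
      (r, r₀) ∈ M ↔ M = {(r, r₀)} ∧ ∀ x ∈ G.core F r, m x = z := by
    intro M
    constructor
    · rintro ⟨hM, hr⟩
      have hM' : M = {(r, r₀)} := by
        ext ⟨x, y⟩
        rw [Finset.mem_singleton]
        constructor
        · intro h
          have hy := hM.snd_mem h
          rw [core_empty] at hy
          cases hy
          rw [hM.fst_unique h hr]
        · rintro ⟨⟩
          exact hr
      refine ⟨hM', fun x hx => ?_⟩
      by_cases hxr : x = r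
      · rw [hxr, ← h₀]
        exact hM.mark hr
      · exact hM.left x hx fun y => by simp [hM', hxr]
    · rintro ⟨rfl, h⟩
      refine ⟨⟨⟨?_, ?_, ?_, ?_⟩, ?_, ?_, ?_⟩, by simp⟩
      · rintro x y hxy
        obtain ⟨rfl, rfl⟩ : x = r ∧ y = r₀ := by simpa using hxy
        exact .inl rfl
      · rintro x y hxy
        obtain ⟨rfl, rfl⟩ : x = r ∧ y = r₀ := by simpa using hxy
        exact .inl rfl
      · intro x y y' h h'
        simp at h h'
        rw [h.2, h'.2]
      · intro x y y' h h'
        simp at h h'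
        rw [h.1, h'.1]
      · intro x y hxy
        obtain ⟨rfl, rfl⟩ : x = r ∧ y = r₀ := by simpa using hxy
        rw [h _ (.inl rfl), h₀]
      · exact fun x hx _ => h x hx
      · intro y hy _
        rw [core_empty] at hy
        cases hy
        exact h₀
  simp only [kernel, pairing, key]
  by_cases h : ∀ x ∈ G.core F r, m x = z
  · have h1 : (Finset.univ.filter fun M : Finset (V × V) =>
        M = {(r, r₀)} ∧ ∀ x ∈ G.core F r, m x = z) = {{(r, r₀)}} := by
      ext M
      simp only [Finset.mem_filter, Finset.mem_univ, true_and, Finset.mem_singleton]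
      exact and_iff_left h
    rw [h1, Finset.sum_singleton, soloL, if_pos h]
    have hM := ((key _).2 ⟨rfl, h⟩).1.toIsMatching.to_univ
    refine hw.weight_congr hM (.empty _ _) fun x hx y hy => ?_
    obtain ⟨e, he, _⟩ := hy
    exact he.elim
  · have h1 : (Finset.univ.filter fun M : Finset (V × V) =>
        M = {(r, r₀)} ∧ ∀ x ∈ G.core F r, m x = z) = ∅ := by
      ext M
      simp only [Finset.mem_filter, Finset.mem_univ, true_and, Finset.notMem_empty, iff_false]
      exact fun h' => h h'.2
    rw [h1, Finset.sum_empty, soloL, if_neg h]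

theorem kernel_single_left (hw : IsLocal G G.rev w) {r₀ : V} (h₀ : m r₀ = z) :
    kernel G w m z (∅, r₀) (F, r) = soloR G G.rev w m z F r := by
  classical
  have key : ∀ M : Finset (V × V), IsMarkMatching m m z (G.core ∅ r₀) (G.rev.core F r) M ∧
      (r₀, r) ∈ M ↔ M = {(r₀, r)} ∧ ∀ x ∈ G.rev.core F r, m x = z := by
    intro M
    constructor
    · rintro ⟨hM, hr⟩
      have hM' : M = {(r₀, r)} := by
        ext ⟨x, y⟩
        rw [Finset.mem_singleton]
        constructor
        · intro h
          have hx := hM.fst_mem h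
          rw [core_empty] at hx
          cases hx
          rw [hM.snd_unique h hr]
        · rintro ⟨⟩
          exact hr
      refine ⟨hM', fun x hx => ?_⟩
      by_cases hxr : x = r
      · rw [hxr, ← h₀]
        exact (hM.mark hr).symm
      · exact hM.right x hx fun y => by simp [hM', hxr]
    · rintro ⟨rfl, h⟩
      refine ⟨⟨⟨?_, ?_, ?_, ?_⟩, ?_, ?_, ?_⟩, by simp⟩
      · rintro x y hxy
        obtain ⟨rfl, rfl⟩ : x = r₀ ∧ y = r := by simpa using hxy
        exact .inl rfl
      · rintro x y hxy
        obtain ⟨rfl, rfl⟩ : x = r₀ ∧ y = r := by simpa using hxy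
        exact .inl rfl
      · intro x y y' h h'
        simp at h h'
        rw [h.2, h'.2]
      · intro x y y' h h'
        simp at h h'
        rw [h.1, h'.1]
      · intro x y hxy
        obtain ⟨rfl, rfl⟩ : x = r₀ ∧ y = r := by simpa using hxy
        rw [h _ (.inl rfl), h₀]
      · intro y hy _
        rw [core_empty] at hy
        cases hy
        exact h₀
      · exact fun x hx _ => h x hx
  simp only [kernel, pairing, key]
  by_cases h : ∀ x ∈ G.rev.core F r, m x = z
  · have h1 : (Finset.univ.filter fun M : Finset (V × V) =>
        M = {(r₀, r)} ∧ ∀ x ∈ G.rev.core F r, m x = z) = {{(r₀, r)}} := by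
      ext M
      simp only [Finset.mem_filter, Finset.mem_univ, true_and, Finset.mem_singleton]
      exact and_iff_left h
    rw [h1, Finset.sum_singleton, soloR, if_pos h]
    have hM := ((key _).2 ⟨rfl, h⟩).1.toIsMatching.to_univ
    refine hw.weight_congr hM (.empty _ _) fun x hx y hy => ?_
    obtain ⟨e, he, _⟩ := hx
    exact he.elim
  · have h1 : (Finset.univ.filter fun M : Finset (V × V) =>
        M = {(r₀, r)} ∧ ∀ x ∈ G.rev.core F r, m x = z) = ∅ := by
      ext M
      simp only [Finset.mem_filter, Finset.mem_univ, true_and, Finset.notMem_empty, iff_false]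
      exact fun h' => h h'.2
    rw [h1, Finset.sum_empty, soloR, if_neg h]

/-- This gives norm one to the single vertex used for centering, and is the base case of the
induction in `psd_kernel`. -/
theorem kernel_empty [DecidableEq K] : kernel G w m z (∅, r) (∅, r') =
    if m r = m r' then 1 else 0 := by
  classical
  have key : ∀ M : Finset (V × V), IsMarkMatching m m z (G.core ∅ r) (G.rev.core ∅ r') M ∧
      (r, r') ∈ M ↔ M = {(r, r')} ∧ m r = m r' := by
    intro M
    rw [core_empty, core_empty]
    constructor
    · rintro ⟨hM, hr⟩
      refine ⟨?_, hM.mark hr⟩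
      ext ⟨x, y⟩
      rw [Finset.mem_singleton]
      constructor
      · intro h
        rw [hM.fst_mem h, hM.snd_mem h]
      · rintro ⟨⟩
        exact hr
    · rintro ⟨rfl, h⟩
      refine ⟨⟨⟨?_, ?_, ?_, ?_⟩, ?_, ?_, ?_⟩, by simp⟩
      · rintro x y hxy
        simp at hxy
        exact hxy.1
      · rintro x y hxy
        simp at hxy
        exact hxy.2
      · intro x y y' h h'
        simp at h h'
        rw [h.2, h'.2]
      · intro x y y' h h'
        simp at h h'
        rw [h.1, h'.1]
      · intro x y hxy
        simp at hxy
        rw [hxy.1, hxy.2, h]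
      · rintro x rfl h
        simp at h
      · rintro x rfl h
        simp at h
  simp only [kernel, pairing, key, sumSet_empty, weight_empty, Finset.sum_const, nsmul_eq_mul,
    mul_one]
  by_cases h : m r = m r'
  · have h1 : (Finset.univ.filter fun M : Finset (V × V) =>
        M = {(r, r')} ∧ m r = m r') = {{(r, r')}} := by
      ext M
      simp [h]
    rw [h1, if_pos h]
    simp
  · simp [h]

end Solo

end ColGraph

end Traffic
end

/-! ### Positivity of the pairings, by centering the branches. -/

noncomputable section

open scoped ComplexOrder

namespace Traffic

/-- A vertex of `X` other than `f a₀` and outside `Q.image f` is either unmatched or matched by `N \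
Q`. The result no longer depends on `N`, which permits summing over `N` at fixed `Q` in
`kernel_expand`. -/
theorem prod_sdiff_mul_prod_unmatched {A B : Type*} [DecidableEq A] [DecidableEq B] (f : A → B) (N Q : Finset A) (a₀ : A)
    (ha : a₀ ∈ N) (hQ : Q ⊆ N.erase a₀) (hf : Set.InjOn f N) (X : Finset B)
    (hX : ∀ a ∈ N, f a ∈ X) (L : B → ℂ) :
    (∏ a ∈ N.erase a₀ \ Q, L (f a)) * ∏ b ∈ X with b ∉ N.image f, L b =
      ∏ b ∈ X with b ≠ f a₀ ∧ b ∉ Q.image f, L b := by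
  have hQN : Q ⊆ N := hQ.trans (Finset.erase_subset _ _)
  have h1 : ∏ a ∈ N.erase a₀ \ Q, L (f a) = ∏ b ∈ (N.erase a₀ \ Q).image f, L b := by
    rw [Finset.prod_image]
    intro a ha b hb h
    simp only [Finset.coe_sdiff, Finset.coe_erase, Set.mem_sdiff, Finset.mem_coe] at ha hb
    exact hf ha.1.1 hb.1.1 h
  rw [h1, ← Finset.prod_union]
  · refine Finset.prod_congr ?_ fun _ _ => rfl
    ext b
    simp only [Finset.mem_union, Finset.mem_image, Finset.mem_sdiff, Finset.mem_erase,
      Finset.mem_filter]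
    constructor
    · rintro (⟨a, ⟨⟨h1, h2⟩, h3⟩, rfl⟩ | ⟨h1, h2⟩)
      · refine ⟨hX a h2, fun h => h1 (hf h2 ha h), ?_⟩
        rintro ⟨a', h4, h5⟩
        exact h3 (hf (hQN h4) h2 h5 ▸ h4)
      · exact ⟨h1, fun h => h2 ⟨a₀, ha, h.symm⟩, fun ⟨a, h3, h4⟩ => h2 ⟨a, hQN h3, h4⟩⟩
    · rintro ⟨h1, h2, h3⟩
      by_cases h : ∃ a ∈ N, f a = b
      · obtain ⟨a, h4, rfl⟩ := h
        exact .inl ⟨a, ⟨⟨fun h => h2 (by rw [h]), h4⟩, fun h => h3 ⟨a, h, rfl⟩⟩, rfl⟩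
      · exact .inr ⟨h1, h⟩
  · rw [Finset.disjoint_left]
    intro b hb hb'
    obtain ⟨a, h1, rfl⟩ := Finset.mem_image.1 hb
    simp only [Finset.mem_sdiff, Finset.mem_erase] at h1
    exact (Finset.mem_filter.1 hb').2 (Finset.mem_image_of_mem f h1.1.2)

namespace ColGraph

variable {V E J K : Type*} [Fintype V] {G : ColGraph V E J} {F C F' C' : Set E} {r r' : V} {j : J}
  {p p' : V → V} {w : Finset (V × V) → Set (E ⊕ E) → ℂ} {m : V → K} {z : K}

open Classical in
variable (G w) in
/-- The sum of the weights of the amalgams of two rooted monochromatic graphs along a partial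
matching that contains the given pairs of vertices. -/
def monoKernel (n : ℕ) (a b : Set E × V × (Fin n → V)) : ℂ :=
  ∑ N : Finset (V × V) with IsMatching (G.core a.1 a.2.1) (G.core b.1 b.2.1) N ∧
    (a.2.1, b.2.1) ∈ N ∧ ∀ i, (a.2.2 i, b.2.2 i) ∈ N, w N (sumSet a.1 b.1)

/-- The injective tuples of vertices of `C` which are not equal to the root. -/
abbrev Tuples (G : ColGraph V E J) (C : Set E) (r : V) (n : ℕ) : Type _ :=
  {x : Fin n → V // Function.Injective x ∧ ∀ i, x i ∈ G.core C r ∧ x i ≠ r}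

open Classical in
/-- The pairing in terms of the centered pairings of the branches. -/
theorem kernel_expand [Finite E] (D : G.Decomp F r j C p) (D' : G.Decomp F' r' j C' p')
    (hw : IsLocal G G.rev w) :
    kernel G w m z (F, r) (F', r') =
      kernel G w m z (D.branch r, r) (D'.branch r', r') *
      ∑ n ∈ Finset.range (Fintype.card (V × V) + 1), ((n.factorial : ℂ)⁻¹ *
        ∑ x : G.Tuples C r n, ∑ y : G.Tuples C' r' n,
          ((∏ i, (kernel G w m z (D.branch (x.1 i), x.1 i) (D'.branch (y.1 i), y.1 i) -
              soloL G G.rev w m z (D.branch (x.1 i)) (x.1 i) *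
              soloR G G.rev w m z (D'.branch (y.1 i)) (y.1 i))) *
          (((∏ v with v ∈ G.core C r ∧ v ≠ r ∧ v ∉ Set.range x.1,
              soloL G G.rev w m z (D.branch v) v) *
            ∏ v with v ∈ G.core C' r' ∧ v ≠ r' ∧ v ∉ Set.range y.1,
              soloR G G.rev w m z (D'.branch v) v) *
          monoKernel G w n (C, r, x.1) (C', r', y.1)))) := by
  set L : V → ℂ := fun v => soloL G G.rev w m z (D.branch v) v with hL
  set R : V → ℂ := fun v => soloR G G.rev w m z (D'.branch v) v with hR
  set k : V × V → ℂ := fun x => kernel G w m z (D.branch x.1, x.1) (D'.branch x.2, x.2) with hk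
  set S : Finset (Finset (V × V)) := Finset.univ.filter fun N =>
    IsMatching (G.core C r) (G.core C' r') N ∧ (r, r') ∈ N with hS
  have hmemS : ∀ N, N ∈ S ↔ IsMatching (G.core C r) (G.core C' r') N ∧ (r, r') ∈ N := by
    intro N
    simp [hS]
  have h0 : kernel G w m z (F, r) (F', r') = ∑ N ∈ S, w N (sumSet C C') *
      ((∏ x ∈ N, k x) * ((∏ v with v ∈ G.core C r ∧ v ∉ N.image Prod.fst, L v) *
        ∏ v with v ∈ G.core C' r' ∧ v ∉ N.image Prod.snd, R v)) := by
    have := D.pairing_eq D'.rev hw (m := m) (m' := m) (z := z)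
    have hb : ∀ v, D'.rev.branch v = D'.branch v := D'.branch_rev
    simp only [hb, rev_core] at this
    rw [kernel, this]
    refine Finset.sum_congr rfl fun N _ => ?_
    simp only [Finset.mem_image, Prod.exists, exists_and_right, exists_eq_right, not_exists]
    rfl
  let ΛL : Finset (V × V) → ℂ := fun Q =>
    ∏ v with v ∈ G.core C r ∧ v ≠ r ∧ v ∉ Q.image Prod.fst, L v
  let ΛR : Finset (V × V) → ℂ := fun Q =>
    ∏ v with v ∈ G.core C' r' ∧ v ≠ r' ∧ v ∉ Q.image Prod.snd, R v
  -- The centered pairing: `L` and `R` are the pairings of the branches with a single unmarked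
  -- vertex, when there is one.
  let kt : V × V → ℂ := fun x => k x - L x.1 * R x.2
  -- At every pair but the roots write `k = kt + L * R` and expand; `Q` is the set of pairs where
  -- `kt` is chosen. The factors `L * R` of the other pairs join those of the unmatched vertices.
  have h1 : ∀ N ∈ S, w N (sumSet C C') *
      ((∏ x ∈ N, k x) * ((∏ v with v ∈ G.core C r ∧ v ∉ N.image Prod.fst, L v) *
        ∏ v with v ∈ G.core C' r' ∧ v ∉ N.image Prod.snd, R v)) =
      ∑ Q ∈ (N.erase (r, r')).powerset,
        k (r, r') * (((∏ x ∈ Q, kt x) * (ΛL Q * ΛR Q)) * w N (sumSet C C')) := by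
    intro N hN
    obtain ⟨hN, hr⟩ := (hmemS N).1 hN
    rw [← Finset.mul_prod_erase N k hr,
      Finset.prod_congr rfl (fun x _ => (sub_add_cancel (k x) (L x.1 * R x.2)).symm),
      Finset.prod_add, Finset.mul_sum, Finset.sum_mul, Finset.mul_sum]
    refine Finset.sum_congr rfl fun Q hQ => ?_
    rw [Finset.mem_powerset] at hQ
    have e1 := prod_sdiff_mul_prod_unmatched Prod.fst N Q (r, r') hr hQ
      (by
        rintro ⟨x, y⟩ hx ⟨x', y'⟩ hx' h
        obtain rfl : x = x' := h
        rw [hN.snd_unique hx hx']) (Finset.univ.filter (· ∈ G.core C r))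
      (fun a ha => by simpa using hN.fst_mem ha) L
    have e2 := prod_sdiff_mul_prod_unmatched Prod.snd N Q (r, r') hr hQ
      (by
        rintro ⟨x, y⟩ hx ⟨x', y'⟩ hx' h
        obtain rfl : y = y' := h
        rw [hN.fst_unique hx hx']) (Finset.univ.filter (· ∈ G.core C' r'))
      (fun a ha => by simpa using hN.snd_mem ha) R
    rw [Finset.filter_filter, Finset.filter_filter] at e1 e2
    simp only [ΛL, ΛR, kt]
    rw [← e1, ← e2, Finset.prod_mul_distrib]
    ring
  rw [h0, Finset.sum_congr rfl h1, Finset.sum_comm' (s' := fun Q => Finset.univ.filter fun N =>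
    (IsMatching (G.core C r) (G.core C' r') N ∧ (r, r') ∈ N) ∧ Q ⊆ N.erase (r, r'))
    (t' := Finset.univ) (by intro N Q; simp [hmemS])]
  simp only [← Finset.mul_sum]
  change k (r, r') * _ = k (r, r') * _
  congr 1
  -- A set `Q` of pairs does not split into left and right data, but an enumeration of it does: it
  -- is a pair of tuples of vertices, as `PSD.sum_sum` requires.
  rw [sum_finset_eq_sum_tuples]
  refine Finset.sum_congr rfl fun n _ => ?_
  congr 1
  -- A necessary condition for the enumerated pairs to lie in a matching from which the root pair is
  -- removed; without it the sum over `N` is empty.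
  let good : (Fin n → V × V) → Prop := fun e =>
    (Function.Injective (fun i => (e i).1) ∧ ∀ i, (e i).1 ∈ G.core C r ∧ (e i).1 ≠ r) ∧
    (Function.Injective (fun i => (e i).2) ∧ ∀ i, (e i).2 ∈ G.core C' r' ∧ (e i).2 ≠ r')
  have h2 : ∀ e : Fin n → V × V, Function.Injective e → ∀ N,
      ((IsMatching (G.core C r) (G.core C' r') N ∧ (r, r') ∈ N) ∧
        Finset.univ.image e ⊆ N.erase (r, r')) → good e := by
    intro e he N ⟨⟨hN, hr⟩, hs⟩
    have hmem : ∀ i, ((e i).1, (e i).2) ∈ N ∧ ((e i).1, (e i).2) ≠ (r, r') := by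
      intro i
      have := hs (Finset.mem_image_of_mem e (Finset.mem_univ i))
      rw [Finset.mem_erase] at this
      exact ⟨this.2, this.1⟩
    refine ⟨⟨fun i i' h => he (Prod.ext h ?_), fun i => ⟨hN.fst_mem (hmem i).1, fun h => ?_⟩⟩,
      ⟨fun i i' h => he (Prod.ext ?_ h), fun i => ⟨hN.snd_mem (hmem i).1, fun h => ?_⟩⟩⟩
    · have h1 := (hmem i').1
      rw [← show (e i).1 = (e i').1 from h] at h1
      exact hN.snd_unique (hmem i).1 h1
    · have h1 := hmem i
      rw [h] at h1
      exact h1.2 (Prod.ext rfl (hN.snd_unique h1.1 hr))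
    · have h1 := (hmem i').1
      rw [← show (e i).2 = (e i').2 from h] at h1
      exact hN.fst_unique (hmem i).1 h1
    · have h1 := hmem i
      rw [h] at h1
      exact h1.2 (Prod.ext (hN.fst_unique h1.1 hr) rfl)
  rw [← Finset.sum_filter_of_ne (p := good)]
  swap
  · intro e he hne
    by_contra hg
    apply hne
    rw [Finset.filter_false_of_mem, Finset.sum_empty, mul_zero]
    exact fun N _ hN => hg (h2 e (Finset.mem_filter.1 he).2 N hN)
  rw [← Fintype.sum_prod_type']
  refine Finset.sum_bij' (fun e he => (⟨fun i => (e i).1, (Finset.mem_filter.1 he).2.1⟩,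
    ⟨fun i => (e i).2, (Finset.mem_filter.1 he).2.2⟩)) (fun q _ i => (q.1.1 i, q.2.1 i))
    (fun _ _ => Finset.mem_univ _) ?_ (fun _ _ => rfl) (fun _ _ => rfl) ?_
  · rintro ⟨x, y⟩ _
    simp only [Finset.mem_filter, Finset.mem_univ, true_and]
    exact ⟨fun i i' h => x.2.1 (congrArg Prod.fst h), x.2, y.2⟩
  · intro e he
    obtain ⟨he, hg⟩ := Finset.mem_filter.1 he
    have he' : Function.Injective e := (Finset.mem_filter.1 he).2
    rw [Finset.prod_image fun i _ i' _ h => he' h, mul_assoc]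
    congr 1
    congr 1
    · simp only [ΛL, ΛR]
      congr 1
      · refine Finset.prod_congr (Finset.filter_congr fun v _ => ?_) fun _ _ => rfl
        simp [Set.mem_range]
      · refine Finset.prod_congr (Finset.filter_congr fun v _ => ?_) fun _ _ => rfl
        simp [Set.mem_range]
    · refine Finset.sum_congr (Finset.filter_congr fun N _ => ?_) fun _ _ => rfl
      rw [and_assoc]
      refine and_congr_right fun hN => and_congr_right fun hr => ?_
      rw [Finset.image_subset_iff]
      constructor
      · exact fun h i => (Finset.mem_erase.1 (h i (Finset.mem_univ i))).2
      · exact fun h i _ => Finset.mem_erase.2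
          ⟨fun h' => (hg.1.2 i).2 (congrArg Prod.fst h'), h i⟩

variable (G) in
/-- A monochromatic connected graph with a root and `n` more vertices. -/
structure MonoRooted (j : J) (n : ℕ) (a : Set E × V × (Fin n → V)) : Prop where
  col : ∀ e ∈ a.1, G.col e = j
  conn : ∀ x ∈ G.core a.1 a.2.1, G.Conn a.1 a.2.1 x
  mem : ∀ i, a.2.2 i ∈ G.core a.1 a.2.1

/-- The pairings of decomposed graphs are positive if those of the branches are. -/
theorem psd_of_branches [Finite E] (hw : IsLocal G G.rev w) {r₀ : V} (h₀ : m r₀ = z)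
    (hmono : ∀ n, PSD fun a b : {a : Set E × V × (Fin n → V) // G.MonoRooted j n a} =>
      monoKernel G w n a b) {ι : Type*} (F C : ι → Set E) (r : ι → V) (p : ι → V → V)
    (D : ∀ a, G.Decomp (F a) (r a) j (C a) (p a))
    (hr : PSD fun a b => kernel G w m z ((D a).branch (r a), r a) ((D b).branch (r b), r b))
    (B : Set E × V → Prop) (hB : PSD fun a b : {b // B b} => kernel G w m z a b)
    (hB₀ : B (∅, r₀))
    (hbr : ∀ a, ∀ v ∈ G.core (C a) (r a), v ≠ r a → B ((D a).branch v, v)) :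
    PSD fun a b => kernel G w m z (F a, r a) (F b, r b) := by
  classical
  have hunit : kernel G w m z (∅, r₀) (∅, r₀) = 1 := by rw [kernel_empty, if_pos rfl]
  -- `(∅, r₀)` is a unit vector for the kernel, so centering preserves positivity.
  have hcent : PSD fun a b : {b // B b} => kernel G w m z a b -
      soloL G G.rev w m z a.1.1 a.1.2 * soloR G G.rev w m z b.1.1 b.1.2 := by
    have := hB.sub_of_unit (u := ⟨(∅, r₀), hB₀⟩) hunit
    simp only [← kernel_single_left hw h₀, ← kernel_single_right hw h₀]
    exact this
  have hstar : ∀ b, B b → soloR G G.rev w m z b.1 b.2 = star (soloL G G.rev w m z b.1 b.2) := by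
    intro b hb
    rw [← kernel_single_left hw h₀, ← kernel_single_right hw h₀]
    exact (hB.star_apply ⟨b, hb⟩ ⟨(∅, r₀), hB₀⟩).symm
  simp only [kernel_expand (D _) (D _) hw]
  refine hr.mul (.sum _ _ fun n _ => .smul ?_ (inv_nonneg.2 (Nat.cast_nonneg _)))
  let idx := Σ a : ι, G.Tuples (C a) (r a) n
  let br : idx → Fin n → {b // B b} := fun a i =>
    ⟨((D a.1).branch (a.2.1 i), a.2.1 i), hbr a.1 _ (a.2.2.2 i).1 (a.2.2.2 i).2⟩
  let mk : idx → {a : Set E × V × (Fin n → V) // G.MonoRooted j n a} := fun a =>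
    ⟨(C a.1, r a.1, a.2.1), (D a.1).col, (D a.1).conn, fun i => (a.2.2.2 i).1⟩
  let Λ : idx → ℂ := fun a => ∏ v with v ∈ G.core (C a.1) (r a.1) ∧ v ≠ r a.1 ∧
    v ∉ Set.range a.2.1, soloL G G.rev w m z ((D a.1).branch v) v
  -- A Schur product of centered kernels, one for each entry of the tuple, with the monochromatic
  -- kernel; the solo weights of the remaining vertices enter as a factor of rank one.
  have key : PSD fun a b : idx => (∏ i, (kernel G w m z (br a i) (br b i) -
      soloL G G.rev w m z (br a i).1.1 (br a i).1.2 *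
      soloR G G.rev w m z (br b i).1.1 (br b i).1.2)) *
      (star (star (Λ a)) * star (Λ b) * monoKernel G w n (mk a) (mk b)) :=
    (PSD.prod Finset.univ _ fun i _ => hcent.comap fun a => br a i).mul
      (((hmono n).comap mk).mul_rankOne fun a => star (Λ a))
  have := key.sum_sum (X := fun a => G.Tuples (C a) (r a) n) (fun a x => ⟨a, x⟩) (fun _ _ => 1)
  refine (congrArg PSD ?_).mp this
  ext a b
  refine Finset.sum_congr rfl fun x _ => Finset.sum_congr rfl fun y _ => ?_
  rw [star_star, star_one, one_mul, one_mul]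
  congr 3
  simp only [Λ, star_prod]
  refine Finset.prod_congr rfl fun v hv => ?_
  simp only [Finset.mem_filter, Finset.mem_univ, true_and] at hv
  exact (hstar _ (hbr b v hv.1 hv.2.1)).symm

variable (G) in
/-- A connected set of edges with a root. -/
def Rooted (a : Set E × V) : Prop := ∀ x ∈ G.core a.1 a.2, G.Conn a.1 a.2 x

/-- A nonzero pairing contains a treelike amalgam. Decompose it at its root and restrict to each
side. Graphs that cannot be decomposed are therefore orthogonal to all rooted graphs. -/
theorem exists_decomp_of_kernel_ne_zero {a b : Set E × V} (ha : G.Rooted a) (hb : G.Rooted b)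
    (h : kernel G w m z a b ≠ 0) (j : J) :
    (∃ C p, G.Decomp a.1 a.2 j C p) ∧ ∃ C p, G.Decomp b.1 b.2 j C p := by
  classical
  obtain ⟨M, hM, hne⟩ := Finset.exists_ne_zero_of_sum_ne_zero h
  simp only [Finset.mem_filter, Finset.mem_univ, true_and] at hM
  obtain ⟨hM, hr⟩ := hM
  have hT : (G.amalg G.rev M).Treelike (sumSet a.1 b.1) := by
    by_contra h
    exact hne (if_neg h)
  have hb' : ∀ x ∈ G.rev.core b.1 b.2, G.rev.Conn b.1 b.2 x := fun x hx =>
    rev_conn.2 (hb x (rev_core ▸ hx))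
  obtain ⟨P, DU⟩ := hT.exists_decomp (amalg_conn hM.toIsMatching hr ha hb') j
  refine ⟨DU.restrict (ι := Sum.inl) (ε := Sum.inl) Sum.inl_injective (fun _ h => h)
    (fun _ => rfl) (fun _ => rfl) (fun _ => rfl) ha, ?_⟩
  rw [← merge_inr_of_mem hM.toIsMatching hr] at DU
  obtain ⟨C, p, D⟩ := DU.restrict (G₁ := G.rev) (ι := fun y => merge M (.inr y)) (ε := Sum.inr)
    (merge_inr_injective hM.toIsMatching) (fun _ h => h)
    (fun _ => rfl) (fun _ => rfl) (fun _ => rfl) hb'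
  exact ⟨C, p, D.rev⟩

variable (G) in
/-- If the sums of the weights of the monochromatic amalgams are positive, so are the pairings. -/
theorem psd_kernel [Finite E] (hw : IsLocal G G.rev w) {r₀ : V} (h₀ : m r₀ = z)
    (hmono : ∀ j n, PSD fun a b : {a : Set E × V × (Fin n → V) // G.MonoRooted j n a} =>
      monoKernel G w n a b) :
    PSD fun a b : {a // G.Rooted a} => kernel G w m z a b := by
  classical
  have base : PSD fun a b : {a : Set E × V // a.1 = ∅} => kernel G w m z a b := by
    have := PSD.eq_kernel fun a : {a : Set E × V // a.1 = ∅} => m a.1.2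
    refine (congrArg PSD ?_).mp this
    ext ⟨⟨A, a⟩, rfl : A = ∅⟩ ⟨⟨B, b⟩, rfl : B = ∅⟩
    exact kernel_empty.symm
  -- Induction on the number of edges and, inside of it, on the set of colors of the edges at the
  -- root.
  have main : ∀ n, PSD fun a b : {a : Set E × V // G.Rooted a ∧ a.1.ncard < n + 1} =>
      kernel G w m z a b := by
    intro n
    induction n with
    | zero =>
      refine base.comap fun a : {a : Set E × V // G.Rooted a ∧ a.1.ncard < 0 + 1} => ⟨a.1, ?_⟩
      have : a.1.1.ncard = 0 := by
        have := a.2.2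
        omega
      exact (Set.ncard_eq_zero (Set.toFinite _)).1 this
    | succ n ih =>
      have inner : ∀ S : Finset J, PSD fun a b : {a : Set E × V // (G.Rooted a ∧
          a.1.ncard < n + 1 + 1) ∧ ∀ e ∈ a.1, G.Inc e a.2 → G.col e ∈ S} =>
          kernel G w m z a b := by
        intro S
        induction S using Finset.induction_on with
        | empty =>
          refine base.comap fun a : {a : Set E × V // (G.Rooted a ∧
            a.1.ncard < n + 1 + 1) ∧ ∀ e ∈ a.1, G.Inc e a.2 → G.col e ∈ (∅ : Finset J)} =>
              ⟨a.1, ?_⟩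
          -- A connected rooted graph without any edge at its root has no edge at all.
          rw [Set.eq_empty_iff_forall_notMem]
          intro e he
          have hloc := a.2.2
          simp only [Finset.notMem_empty, imp_false] at hloc
          rcases (a.2.1.1 _ (.inr ⟨e, he, inc_src⟩)).eq_or with h | h
          · exact hloc e he (.inl h.symm)
          · obtain ⟨e', he', h'⟩ := h.1
            exact hloc e' he' h'
        | insert j S hj ihS =>
          -- Graphs that have no decomposition for the color `j` pair to zero, so only the others
          -- matter.
          refine .of_subtype (p := fun a => ∃ C p, G.Decomp a.1.1 a.1.2 j C p) ?_ ?_ ?_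
          · choose C p D using fun a : {a : {a : Set E × V // (G.Rooted a ∧
              a.1.ncard < n + 1 + 1) ∧ ∀ e ∈ a.1, G.Inc e a.2 → G.col e ∈ insert j S} //
              ∃ C p, G.Decomp a.1.1 a.1.2 j C p} => a.2
            refine psd_of_branches hw h₀ (hmono j) _ C _ p D ?_
              (fun a => G.Rooted a ∧ a.1.ncard < n + 1) ih ?_ ?_
            -- The branch at the root may have as many edges as the graph itself (if no edge of
            -- color `j` meets the root), but it has lost the color `j` at the root.
            · refine ihS.comap fun a => ⟨((D a).branch a.1.1.2, a.1.1.2),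
                ⟨(D a).branch_conn (.inl rfl), lt_of_le_of_lt (Set.ncard_le_ncard
                  ((D a).branch_subset _) (Set.toFinite _)) a.1.2.1.2⟩, fun e he hinc => ?_⟩
              have := a.1.2.2 e he.1 hinc
              rcases Finset.mem_insert.1 this with h | h
              · exact absurd h ((D a).col_ne e he.1 he.2.1 _ (.inl rfl) hinc)
              · exact h
            · refine ⟨fun x hx => ?_, by simp⟩
              rw [core_empty] at hx
              cases hx
              exact .refl
            · intro a v hv hne
              refine ⟨(D a).branch_conn hv, ?_⟩
              -- A core vertex other than the root exists only if `C` has an edge, and this edge is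
              -- not in the branch.
              have hlt : ((D a).branch v).ncard < a.1.1.1.ncard := by
                refine Set.ncard_lt_ncard ?_ (Set.toFinite _)
                refine ⟨(D a).branch_subset v, fun h => ?_⟩
                rcases hv with rfl | ⟨e, he, _⟩
                · exact hne rfl
                · exact (h ((D a).subset he)).2.1 he
              exact lt_of_lt_of_le hlt (Nat.lt_succ_iff.1 a.1.2.1.2)
          · intro a b h
            by_contra h'
            exact h (exists_decomp_of_kernel_ne_zero a.2.1.1 b.2.1.1 h' j).1
          · intro a b h
            by_contra h'
            exact h (exists_decomp_of_kernel_ne_zero a.2.1.1 b.2.1.1 h' j).2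
      have hfin : (Set.range G.col).Finite := Set.finite_range _
      refine (inner hfin.toFinset).comap fun a : {a : Set E × V // G.Rooted a ∧
        a.1.ncard < n + 1 + 1} => ⟨a.1, a.2, fun e _ _ => by simp⟩
  refine (main (Nat.card E)).comap fun a : {a // G.Rooted a} => ⟨a.1, a.2, ?_⟩
  have := Set.ncard_le_card a.1.1
  omega

end ColGraph

end Traffic
end

noncomputable section

namespace Traffic

/-! ## Möbius inversion -/

instance fintypeSetoid (V : Type) [Finite V] : Fintype (Setoid V) := Fintype.ofFinite _

open Classical in
theorem sum_partitionMob {V : Type} [Finite V] (σ : Setoid V) :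
    ∑ ρ : Setoid V with ρ ≤ σ, partitionMob V ⊥ ρ = if σ = ⊥ then 1 else 0 := by
  let : LocallyFiniteOrder (Setoid V) := Fintype.toLocallyFiniteOrder
  have := IncidenceAlgebra.sum_Icc_mu_right (𝕜 := ℂ) (⊥ : Setoid V) σ
  rw [show (if σ = ⊥ then (1 : ℂ) else 0) = if ⊥ = σ then 1 else 0 by simp only [eq_comm], ← this]
  refine Finset.sum_congr ?_ fun _ _ => rfl
  ext ρ
  simp

open Classical in
-- The sums over lower sets form a triangular system, solved by well-founded induction.
theorem eq_of_sum_le_eq {P : Type*} [Fintype P] [PartialOrder P] {f g : P → ℂ}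
    (h : ∀ σ, ∑ ρ with ρ ≤ σ, f ρ = ∑ ρ with ρ ≤ σ, g ρ) : f = g := by
  funext σ
  induction σ using WellFoundedLT.induction with
  | ind σ ih =>
    have key : ∀ f : P → ℂ, ∑ ρ with ρ ≤ σ, f ρ = f σ + ∑ ρ with ρ < σ, f ρ := by
      intro f
      rw [← Finset.sum_insert (by simp)]
      refine Finset.sum_congr ?_ fun _ _ => rfl
      ext ρ
      simp [le_iff_eq_or_lt]
    have := h σ
    rw [key, key, Finset.sum_congr rfl fun ρ hρ => ih ρ (Finset.mem_filter.1 hρ).2] at this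
    exact add_right_cancel this

open Classical in
-- The partitions of a quotient correspond to the partitions upstairs that are coarser than the
-- kernel of the quotient map.
theorem sum_setoid_comap {V W : Type} [Finite V] [Finite W] {q : V → W}
    (hq : Function.Surjective q) (f : Setoid V → ℂ) :
    ∑ ρ : Setoid W, f (ρ.comap q) = ∑ τ : Setoid V with Setoid.ker q ≤ τ, f τ := by
  refine Finset.sum_bij (fun ρ _ => ρ.comap q) ?_ ?_ ?_ fun _ _ => rfl
  · intro ρ _
    simp only [Finset.mem_filter, Finset.mem_univ, true_and]
    intro x y h
    rw [Setoid.comap_rel, Setoid.ker_def.1 h]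
  · exact fun _ _ _ _ h => Setoid.comap_injective q hq h
  · intro τ hτ
    exact ⟨τ.map q, Finset.mem_univ _, Setoid.comap_map_of_ker_le _ _ (Finset.mem_filter.1 hτ).2⟩

theorem map_comap_setoid {V W : Type} {q : V → W} (hq : Function.Surjective q) (ρ : Setoid W) :
    (ρ.comap q).map q = ρ := by
  apply Setoid.comap_injective q hq
  apply Setoid.comap_map_of_ker_le
  intro x y h
  rw [Setoid.comap_rel, Setoid.ker_def.1 h]

theorem comap_le_comap_iff {V W : Type} {q : V → W} (hq : Function.Surjective q)
    {ρ σ : Setoid W} : ρ.comap q ≤ σ.comap q ↔ ρ ≤ σ := by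
  constructor
  · intro h x y hxy
    obtain ⟨x, rfl⟩ := hq x
    obtain ⟨y, rfl⟩ := hq y
    exact @h x y hxy
  · exact fun h x y hxy => @h _ _ hxy

/-- Both sides solve the triangular system of `sum_partitionMob`, whose solution is unique. -/
theorem partitionMob_comap {V W : Type} [Finite V] [Finite W] {q : V → W}
    (hq : Function.Bijective q) (ρ : Setoid W) :
    partitionMob V ⊥ (ρ.comap q) = partitionMob W ⊥ ρ := by
  classical
  have hker : Setoid.ker q = ⊥ := Setoid.ker_eq_bot_iff.2 hq.1
  refine congrFun (eq_of_sum_le_eq (f := fun ρ : Setoid W => partitionMob V ⊥ (ρ.comap q))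
    (g := fun ρ => partitionMob W ⊥ ρ) fun σ => ?_) ρ
  rw [sum_partitionMob, Finset.sum_filter]
  simp only [← comap_le_comap_iff hq.2]
  rw [sum_setoid_comap hq.2 fun τ => if τ ≤ σ.comap q then partitionMob V ⊥ τ else 0, hker]
  simp only [bot_le, Finset.filter_true]
  rw [← Finset.sum_filter, sum_partitionMob]
  have : σ.comap q = ⊥ ↔ σ = ⊥ := by
    rw [← (Setoid.comap_injective q hq.2).eq_iff (b := ⊥)]
    have : (⊥ : Setoid W).comap q = ⊥ := by
      rw [← hker]
      rfl
    rw [this]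
  simp only [this]

namespace GraphMon

variable {n : ℕ} {L : Type u}

/-- `S` is the quotient of `T` by the kernel of `q`. -/
structure IsQuot (T S : GraphMon n L) (σ : T.E ≃ S.E) (q : T.G.V → S.G.V) : Prop where
  surj : Function.Surjective q
  src : ∀ e, S.G.src (σ e) = q (T.G.src e)
  tgt : ∀ e, S.G.tgt (σ e) = q (T.G.tgt e)
  out : ∀ i, S.G.out i = q (T.G.out i)
  lab : ∀ e, S.lab (σ e) = T.lab e

variable {T S S' : GraphMon n L}

/-- The quotient map. -/
def quotMk (T : GraphMon n L) (π : Setoid T.G.V) : T.G.V → (T.quot π).G.V := Quot.mk _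

theorem ker_quotMk (T : GraphMon n L) (π : Setoid T.G.V) : Setoid.ker (T.quotMk π) = π :=
  Setoid.ker_mk_eq π

theorem quotMk_surjective (T : GraphMon n L) (π : Setoid T.G.V) :
    Function.Surjective (T.quotMk π) := Quot.mk_surjective

theorem isQuot_quot (T : GraphMon n L) (π : Setoid T.G.V) :
    T.IsQuot (T.quot π) (.refl _) (T.quotMk π) :=
  ⟨Quot.mk_surjective, fun _ => rfl, fun _ => rfl, fun _ => rfl, fun _ => rfl⟩

theorem IsQuot.trans {σ : T.E ≃ S.E} {q : T.G.V → S.G.V} {σ' : S.E ≃ S'.E}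
    {q' : S.G.V → S'.G.V} (h : T.IsQuot S σ q) (h' : S.IsQuot S' σ' q') :
    T.IsQuot S' (σ.trans σ') (q' ∘ q) where
  surj := h'.surj.comp h.surj
  src e := by simp [h'.src, h.src]
  tgt e := by simp [h'.tgt, h.tgt]
  out i := by simp [h'.out, h.out]
  lab e := by simp [h'.lab, h.lab]

/-- A quotient is determined by its kernel up to isomorphism; quotients that are built in different
ways are compared through this. -/
theorem IsQuot.iso {σ : T.E ≃ S.E} {q : T.G.V → S.G.V} {σ' : T.E ≃ S'.E}
    {q' : T.G.V → S'.G.V} (h : T.IsQuot S σ q) (h' : T.IsQuot S' σ' q')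
    (hk : Setoid.ker q = Setoid.ker q') : S.Iso S' := by
  have hk' : ∀ x y, q x = q y ↔ q' x = q' y := fun x y => Setoid.ext_iff.1 hk x y
  let f : S.G.V → S'.G.V := fun x => q' (Function.surjInv h.surj x)
  have hf : ∀ x, f (q x) = q' x := fun x => (hk' _ _).1 (Function.surjInv_eq h.surj (q x))
  have hbij : Function.Bijective f := by
    constructor
    · intro x y hxy
      obtain ⟨x, rfl⟩ := h.surj x
      obtain ⟨y, rfl⟩ := h.surj y
      rw [hf, hf] at hxy
      exact (hk' _ _).2 hxy
    · intro y
      obtain ⟨x, rfl⟩ := h'.surj y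
      exact ⟨q x, hf x⟩
  refine ⟨σ.symm.trans σ', ⟨Equiv.ofBijective f hbij, ?_, ?_, ?_⟩, ?_⟩
  · intro e
    obtain ⟨e, rfl⟩ := σ.surjective e
    simp [h.src, h'.src, hf]
  · intro e
    obtain ⟨e, rfl⟩ := σ.surjective e
    simp [h.tgt, h'.tgt, hf]
  · intro i
    simp [h.out, h'.out, hf]
  · intro e
    obtain ⟨e, rfl⟩ := σ.surjective e
    simp [h.lab, h'.lab]

theorem Iso.exists_isQuot (h : T.Iso S) : ∃ σ q, T.IsQuot S σ q ∧ Function.Injective q := by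
  obtain ⟨σ, ⟨φ, h1, h2, h3⟩, h4⟩ := h
  exact ⟨σ, φ, ⟨φ.surjective, fun e => (h1 e).symm, fun e => (h2 e).symm, fun i => (h3 i).symm,
    h4⟩, φ.injective⟩

theorem IsQuot.iso_of_injective {σ : T.E ≃ S.E} {q : T.G.V → S.G.V} (h : T.IsQuot S σ q)
    (hq : Function.Injective q) : T.Iso S :=
  ⟨σ, ⟨Equiv.ofBijective q ⟨hq, h.surj⟩, fun e => (h.src e).symm, fun e => (h.tgt e).symm,
    fun i => (h.out i).symm⟩, h.lab⟩

theorem Iso.symm (h : T.Iso S) : S.Iso T := by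
  obtain ⟨σ, ⟨φ, h1, h2, h3⟩, h4⟩ := h
  refine ⟨σ.symm, ⟨φ.symm, fun e => ?_, fun e => ?_, fun i => ?_⟩, fun e => ?_⟩
  · rw [Equiv.symm_apply_eq, h1, Equiv.apply_symm_apply]
  · rw [Equiv.symm_apply_eq, h2, Equiv.apply_symm_apply]
  · rw [Equiv.symm_apply_eq, h3]
  · rw [← h4, Equiv.apply_symm_apply]

theorem Iso.trans (h : T.Iso S) (h' : S.Iso S') : T.Iso S' := by
  obtain ⟨σ, ⟨φ, h1, h2, h3⟩, h4⟩ := h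
  obtain ⟨σ', ⟨φ', h1', h2', h3'⟩, h4'⟩ := h'
  exact ⟨σ.trans σ', ⟨φ.trans φ', by simp [h1, h1'], by simp [h2, h2'], by simp [h3, h3']⟩,
    by simp [h4, h4']⟩

theorem Iso.refl (T : GraphMon n L) : T.Iso T :=
  ⟨.refl _, ⟨.refl _, fun _ => rfl, fun _ => rfl, fun _ => rfl⟩, fun _ => rfl⟩

theorem IsQuot.quot_iso {σ : T.E ≃ S.E} {q : T.G.V → S.G.V} (h : T.IsQuot S σ q)
    (ρ : Setoid S.G.V) : (T.quot (ρ.comap q)).Iso (S.quot ρ) := by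
  refine (T.isQuot_quot _).iso (h.trans (S.isQuot_quot ρ)) ?_
  rw [ker_quotMk]
  ext x y
  exact (Setoid.ext_iff.1 (S.ker_quotMk ρ) _ _).symm

end GraphMon

section Inversion

variable {n : ℕ} {L : Type u}

/-- The function takes the same value on isomorphic monomials. -/
def IsoInvariant (g : GraphMon n L → ℂ) : Prop := ∀ t t', t.Iso t' → g t = g t'

variable {g G : GraphMon n L → ℂ} {T S : GraphMon n L}

open Classical in
theorem GraphMon.IsQuot.sum_quot (hg : IsoInvariant g) {σ : T.E ≃ S.E} {q : T.G.V → S.G.V}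
    (h : T.IsQuot S σ q) :
    ∑ ρ, g (S.quot ρ) = ∑ τ with Setoid.ker q ≤ τ, g (T.quot τ) := by
  rw [← sum_setoid_comap h.surj fun τ => g (T.quot τ)]
  exact Finset.sum_congr rfl fun ρ _ => (hg _ _ (h.quot_iso ρ)).symm

theorem IsoInvariant.quot_bot (hg : IsoInvariant g) (T : GraphMon n L) : g (T.quot ⊥) = g T :=
  (hg _ _ ((T.isQuot_quot ⊥).iso_of_injective
    (Setoid.ker_eq_bot_iff.1 (T.ker_quotMk ⊥)))).symm

/-- Möbius inversion for functions of monomials. -/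
theorem mobius_inversion (hg : IsoInvariant g) (h : ∀ T, G T = ∑ π, g (T.quot π))
    (T : GraphMon n L) : ∑ π, partitionMob T.G.V ⊥ π * G (T.quot π) = g T := by
  classical
  -- `G` at a quotient sums `g` over the coarser partitions. After exchanging the sums, the Möbius
  -- function is summed over all partitions below `τ`, which leaves only `τ = ⊥`.
  have h1 : ∀ π : Setoid T.G.V, G (T.quot π) = ∑ τ with π ≤ τ, g (T.quot τ) := by
    intro π
    have := (T.isQuot_quot π).sum_quot hg
    rw [T.ker_quotMk] at this
    rw [h, this]
  simp only [h1, Finset.mul_sum]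
  rw [Finset.sum_comm' (s' := fun τ => Finset.univ.filter fun π => π ≤ τ) (t' := Finset.univ)
    (by simp)]
  simp only [← Finset.sum_mul, sum_partitionMob, ite_mul, one_mul, zero_mul]
  rw [Finset.sum_ite_eq' Finset.univ ⊥ fun τ => g (T.quot τ), if_pos (Finset.mem_univ _),
    hg.quot_bot]

end Inversion

/-! ### Inversion formula between a functional and its injective version. -/

section InjVersion

variable {L : Type u} {φ : GraphMon 0 L → ℂ}

theorem injVersion_eq_sum (φ : GraphMon 0 L → ℂ) (T : GraphMon 0 L) :
    injVersion φ T = ∑ π, partitionMob T.G.V ⊥ π * φ (T.quot π) :=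
  finsum_eq_sum_of_fintype _

theorem injVersion_isoInvariant (hφ : IsoInvariant φ) : IsoInvariant (injVersion φ) := by
  classical
  intro T S h
  obtain ⟨σ, q, hq, hinj⟩ := h.exists_isQuot
  rw [injVersion_eq_sum, injVersion_eq_sum]
  have := sum_setoid_comap hq.surj fun τ => partitionMob T.G.V ⊥ τ * φ (T.quot τ)
  rw [Setoid.ker_eq_bot_iff.2 hinj] at this
  simp only [bot_le, Finset.filter_true] at this
  rw [← this]
  refine Finset.sum_congr rfl fun ρ _ => ?_
  rw [partitionMob_comap ⟨hinj, hq.surj⟩, hφ _ _ (hq.quot_iso ρ)]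

/-- A functional in terms of its injective version. -/
theorem sum_injVersion (hφ : IsoInvariant φ) (T : GraphMon 0 L) :
    ∑ π, injVersion φ (T.quot π) = φ T := by
  classical
  let mk : ∀ π : Setoid T.G.V, T.G.V → (T.quot π).G.V := T.quotMk
  have hmk : ∀ π, Function.Surjective (mk π) := T.quotMk_surjective
  have hker : ∀ π, Setoid.ker (mk π) = π := T.ker_quotMk
  -- `Z` is the zeta matrix of the partition lattice and `N` its Möbius matrix: the partitions above
  -- `π` form the partition lattice of the vertices of `T.quot π`.
  let N : Matrix (Setoid T.G.V) (Setoid T.G.V) ℂ := fun π τ =>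
    if π ≤ τ then partitionMob (T.quot π).G.V ⊥ (τ.map (mk π)) else 0
  let Z : Matrix (Setoid T.G.V) (Setoid T.G.V) ℂ := fun π τ => if π ≤ τ then 1 else 0
  have hNsum : ∀ π (f : Setoid T.G.V → ℂ), ∑ τ, N π τ * f τ =
      ∑ ρ : Setoid (T.quot π).G.V, partitionMob _ ⊥ ρ * f (ρ.comap (mk π)) := by
    intro π f
    have := sum_setoid_comap (hmk π) fun τ =>
      partitionMob (T.quot π).G.V ⊥ (τ.map (mk π)) * f τ
    simp only [map_comap_setoid (hmk π), hker] at this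
    rw [this, Finset.sum_filter]
    simp only [N, ite_mul, zero_mul]
  have hNZ : N * Z = 1 := by
    ext π σ
    rw [Matrix.mul_apply, hNsum, Matrix.one_apply]
    simp only [Z]
    by_cases h : π ≤ σ
    · have hσ : (σ.map (mk π)).comap (mk π) = σ :=
        Setoid.comap_map_of_ker_le _ _ ((hker π).le.trans h)
      have h1 : ∀ ρ : Setoid (T.quot π).G.V, ρ.comap (mk π) ≤ σ ↔ ρ ≤ σ.map (mk π) := by
        intro ρ
        rw [← comap_le_comap_iff (hmk π), hσ]
      simp only [h1, mul_ite, mul_one, mul_zero]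
      rw [← Finset.sum_filter, sum_partitionMob]
      have h2 : σ.map (mk π) = ⊥ ↔ π = σ := by
        rw [← (Setoid.comap_injective _ (hmk π)).eq_iff, hσ]
        have : (⊥ : Setoid (T.quot π).G.V).comap (mk π) = π := hker π
        rw [this, eq_comm]
      simp only [h2]
    · rw [if_neg fun h' => h h'.le]
      refine Finset.sum_eq_zero fun ρ _ => ?_
      rw [if_neg, mul_zero]
      exact fun h' => h (((hker π).ge.trans fun x y hxy => by
        rw [Setoid.comap_rel, Setoid.ker_def.1 hxy]).trans h')
  -- The recursion of the Möbius function gives a left inverse, while the formula needs the row `⊥`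
  -- of the product in the other order.
  have hZN : Z * N = 1 := mul_eq_one_comm.1 hNZ
  have h1 : ∀ π, injVersion φ (T.quot π) = ∑ τ, N π τ * φ (T.quot τ) := by
    intro π
    rw [hNsum, injVersion_eq_sum]
    refine Finset.sum_congr rfl fun ρ _ => ?_
    rw [hφ _ _ ((T.isQuot_quot π).quot_iso ρ)]
  simp only [h1]
  rw [Finset.sum_comm]
  have h2 : ∀ τ, ∑ π, N π τ = if ⊥ = τ then 1 else 0 := by
    intro τ
    have := congrFun (congrFun hZN ⊥) τ
    rw [Matrix.mul_apply, Matrix.one_apply] at this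
    simpa [Z] using this
  simp only [← Finset.sum_mul, h2, ite_mul, one_mul, zero_mul]
  rw [Finset.sum_ite_eq, if_pos (Finset.mem_univ _), hφ.quot_bot]

end InjVersion

/-! ## Partitions of a disjoint union -/

/-- The partition of a disjoint union obtained from partitions of the two sets and a matching
of their blocks. -/
def matchSetoid {V V' : Type} (ρ : Setoid V) (ρ' : Setoid V')
    (M : Finset (Quot (fun x y => ρ x y) × Quot (fun x y => ρ' x y))) : Setoid (V ⊕ V') :=
  Setoid.ker (merge M ∘ Sum.map (Quot.mk _) (Quot.mk _))

/-- A partial matching between `X` and `X'` that contains the pairs of outputs. -/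
structure IsOutMatching {V V' : Type*} {n : ℕ} (o : Fin n → V) (o' : Fin n → V') (X : Set V)
    (X' : Set V') (M : Finset (V × V')) : Prop extends IsMatching X X' M where
  out : ∀ i, (o i, o' i) ∈ M

theorem quotMk_eq_iff {V : Type} (π : Setoid V) {x y : V} :
    Quot.mk (fun x y => π x y) x = Quot.mk (fun x y => π x y) y ↔ π x y :=
  Setoid.ext_iff.1 (Setoid.ker_mk_eq π) x y

section

variable {V V' : Type} {ρ : Setoid V} {ρ' : Setoid V'}
  {M : Finset (Quot (fun x y => ρ x y) × Quot (fun x y => ρ' x y))}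

theorem matchSetoid_inl {x y : V} : matchSetoid ρ ρ' M (.inl x) (.inl y) ↔ ρ x y := by
  rw [← quotMk_eq_iff ρ]
  exact Sum.inl_injective.eq_iff

theorem matchSetoid_inr (hM : IsMatching Set.univ Set.univ M) {x y : V'} :
    matchSetoid ρ ρ' M (.inr x) (.inr y) ↔ ρ' x y := by
  rw [← quotMk_eq_iff ρ']
  exact (merge_inr_injective hM).eq_iff

theorem matchSetoid_inl_inr (hM : IsMatching Set.univ Set.univ M) {x : V} {y : V'} :
    matchSetoid ρ ρ' M (.inl x) (.inr y) ↔ (Quot.mk _ x, Quot.mk _ y) ∈ M := by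
  rw [← merge_inr_eq_inl hM]
  exact eq_comm

end

open Classical in
-- A partition of a disjoint union restricts to a partition of each side, and merges a block of one
-- side with at most one block of the other. This is a partial matching of blocks.
theorem sum_setoid_sum {V V' : Type} [Finite V] [Finite V']
    [∀ ρ : Setoid V, Fintype (Quot fun x y => ρ x y)]
    [∀ ρ : Setoid V', Fintype (Quot fun x y => ρ x y)] {n : ℕ} (o : Fin n → V)
    (o' : Fin n → V') (f : Setoid (V ⊕ V') → ℂ) :
    ∑ π : Setoid (V ⊕ V') with ∀ i, π (.inl (o i)) (.inr (o' i)), f π =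
      ∑ ρ : Setoid V, ∑ ρ' : Setoid V',
        ∑ M : Finset (Quot (fun x y => ρ x y) × Quot (fun x y => ρ' x y)) with
          IsOutMatching (fun i => Quot.mk _ (o i)) (fun i => Quot.mk _ (o' i)) .univ .univ M,
            f (matchSetoid ρ ρ' M) := by
  symm
  rw [Finset.sum_sigma', Finset.sum_sigma']
  refine Finset.sum_bij (fun x _ => matchSetoid x.1.1 x.1.2 x.2) ?_ ?_ ?_ fun _ _ => rfl
  · rintro ⟨⟨ρ, ρ'⟩, M⟩ h
    simp only [Finset.mem_sigma, Finset.mem_univ, Finset.mem_filter, true_and] at h ⊢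
    exact fun i => (matchSetoid_inl_inr h.toIsMatching).2 (h.out i)
  · rintro ⟨⟨ρ, ρ'⟩, M⟩ h ⟨⟨ρ₁, ρ₁'⟩, M₁⟩ h₁ heq
    simp only [Finset.mem_sigma, Finset.mem_univ, Finset.mem_filter, true_and] at h h₁ heq
    obtain rfl : ρ = ρ₁ := Setoid.ext fun x y => by
      rw [← matchSetoid_inl (M := M), heq, matchSetoid_inl]
    obtain rfl : ρ' = ρ₁' := Setoid.ext fun x y => by
      rw [← matchSetoid_inr h.toIsMatching, heq, matchSetoid_inr h₁.toIsMatching]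
    obtain rfl : M = M₁ := by
      ext ⟨x, y⟩
      obtain ⟨x, rfl⟩ := Quot.mk_surjective x
      obtain ⟨y, rfl⟩ := Quot.mk_surjective y
      rw [← matchSetoid_inl_inr h.toIsMatching, heq, matchSetoid_inl_inr h₁.toIsMatching]
    rfl
  · intro π hπ
    simp only [Finset.mem_filter, Finset.mem_univ, true_and] at hπ
    let ρ := π.comap Sum.inl
    let ρ' := π.comap Sum.inr
    let M : Finset (Quot (fun x y => ρ x y) × Quot (fun x y => ρ' x y)) :=
      Finset.univ.filter fun a => ∃ x y, Quot.mk _ x = a.1 ∧ Quot.mk _ y = a.2 ∧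
        π (.inl x) (.inr y)
    have hmem : ∀ x y, (Quot.mk _ x, Quot.mk _ y) ∈ M ↔ π (.inl x) (.inr y) := by
      intro x y
      simp only [M, Finset.mem_filter, Finset.mem_univ, true_and]
      constructor
      · rintro ⟨x', y', h1, h2, h3⟩
        exact π.trans' (π.symm' ((quotMk_eq_iff ρ).1 h1)) (π.trans' h3 ((quotMk_eq_iff ρ').1 h2))
      · exact fun h => ⟨x, y, rfl, rfl, h⟩
    have hM : IsMatching Set.univ Set.univ M := by
      refine ⟨fun _ => trivial, fun _ => trivial, ?_, ?_⟩
      · intro x y y' h h'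
        obtain ⟨x, rfl⟩ := Quot.mk_surjective x
        obtain ⟨y, rfl⟩ := Quot.mk_surjective y
        obtain ⟨y', rfl⟩ := Quot.mk_surjective y'
        rw [hmem] at h h'
        exact (quotMk_eq_iff ρ').2 (π.trans' (π.symm' h) h')
      · intro x x' y h h'
        obtain ⟨x, rfl⟩ := Quot.mk_surjective x
        obtain ⟨y, rfl⟩ := Quot.mk_surjective y
        obtain ⟨x', rfl⟩ := Quot.mk_surjective x'
        rw [hmem] at h h'
        exact (quotMk_eq_iff ρ).2 (π.trans' h (π.symm' h'))
    refine ⟨⟨⟨ρ, ρ'⟩, M⟩, ?_, ?_⟩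
    · simp only [Finset.mem_sigma, Finset.mem_univ, Finset.mem_filter, true_and]
      exact ⟨hM, fun i => (hmem _ _).2 (hπ i)⟩
    · refine Setoid.ext ?_
      rintro (x | x) (y | y)
      · exact matchSetoid_inl
      · exact (matchSetoid_inl_inr hM).trans (hmem _ _)
      · rw [Setoid.comm', π.comm']
        exact (matchSetoid_inl_inr hM).trans (hmem _ _)
      · exact matchSetoid_inr hM

end Traffic
end

noncomputable section

namespace Traffic

/-! ## Embeddings of monomials in larger graphs -/

theorem exists_injective_factor {Z Y W : Type*} {p : Z → Y} (hp : Function.Surjective p)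
    (h : Z → W) (hk : ∀ x y, p x = p y ↔ h x = h y) :
    ∃ ν : Y → W, Function.Injective ν ∧ ∀ z, ν (p z) = h z := by
  have hν : ∀ z, h (Function.surjInv hp (p z)) = h z :=
    fun z => (hk _ _).1 (Function.surjInv_eq hp _)
  refine ⟨fun y => h (Function.surjInv hp y), fun y y' hy => ?_, hν⟩
  rw [← Function.surjInv_eq hp y, ← Function.surjInv_eq hp y']
  exact (hk _ _).2 hy

namespace GraphMon

variable {n : ℕ} {L : Type u} {V E : Type*}

instance fintypeV (m : GraphMon n L) : Fintype m.G.V := Fintype.ofFinite _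

/-- The underlying labelled graph. -/
def toCol (m : GraphMon n L) : ColGraph m.G.V m.E L := ⟨m.G.src, m.G.tgt, m.lab⟩

/-- The maps `ν` and `ε` embed the monomial in the labelled graph `H`. -/
structure Embeds (m : GraphMon n L) (H : ColGraph V E L) (ν : m.G.V → V) (ε : m.E → E) :
    Prop where
  inj : Function.Injective ν
  inj' : Function.Injective ε
  src : ∀ e, H.src (ε e) = ν (m.G.src e)
  tgt : ∀ e, H.tgt (ε e) = ν (m.G.tgt e)
  lab : ∀ e, H.col (ε e) = m.lab e

/-- The monomial is isomorphic to the subgraph of `H` with edges `c`. -/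
def Models (m : GraphMon 0 L) (H : ColGraph V E L) (c : Set E) : Prop :=
  ∃ ν ε, m.Embeds H ν ε ∧ Set.range ε = c

theorem models_self (m : GraphMon 0 L) : m.Models m.toCol Set.univ :=
  ⟨id, id, ⟨Function.injective_id, Function.injective_id, fun _ => rfl, fun _ => rfl,
    fun _ => rfl⟩, Set.range_id⟩

theorem conn_univ (m : GraphMon n L) (x y : m.G.V) : m.toCol.Conn Set.univ x y :=
  eqvGen_mono (fun _ _ ⟨e, h⟩ => ⟨e, trivial, h⟩) (m.G.connected x y)

theorem exists_inc (m : GraphMon n L) (h : Nonempty m.E) (x : m.G.V) : ∃ e, m.toCol.Inc e x := by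
  obtain ⟨e⟩ := h
  rcases (m.conn_univ x (m.G.src e)).eq_or with rfl | h
  · exact ⟨e, .inl rfl⟩
  · obtain ⟨⟨e, _, h⟩, _⟩ := h
    exact ⟨e, h⟩

theorem eq_of_isEmpty (m : GraphMon n L) (h : IsEmpty m.E) (x y : m.G.V) : x = y := by
  rcases (m.conn_univ x y).eq_or with h' | h'
  · exact h'
  · obtain ⟨⟨e, _⟩, _⟩ := h'
    exact h.elim e

theorem Embeds.inc {m : GraphMon n L} {H : ColGraph V E L} {ν : m.G.V → V} {ε : m.E → E}
    (h : m.Embeds H ν ε) {e : m.E} {y : V} : H.Inc (ε e) y ↔ ∃ x, m.toCol.Inc e x ∧ ν x = y := by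
  rw [ColGraph.Inc, h.src, h.tgt]
  constructor
  · rintro (rfl | rfl)
    exacts [⟨_, .inl rfl, rfl⟩, ⟨_, .inr rfl, rfl⟩]
  · rintro ⟨x, rfl | rfl, rfl⟩
    exacts [.inl rfl, .inr rfl]

/-- In a connected graph with an edge every vertex is an endpoint, so the edge set `c` determines
the monomial. Without edges both monomials have a single vertex. -/
theorem Models.iso {m m' : GraphMon 0 L} {H : ColGraph V E L} {c : Set E} (h : m.Models H c)
    (h' : m'.Models H c) : m.Iso m' := by
  obtain ⟨ν, ε, h, rfl⟩ := h
  obtain ⟨ν', ε', h', hc⟩ := h'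
  let σ : m.E ≃ m'.E := (Equiv.ofInjective ε h.inj').trans
    ((Equiv.setCongr hc.symm).trans (Equiv.ofInjective ε' h'.inj').symm)
  have hσ : ∀ e, ε' (σ e) = ε e := by
    intro e
    simp [σ, Equiv.apply_ofInjective_symm]
  -- Without edges the position of the single vertex in `H` is arbitrary, so `φ` is only constrained
  -- at endpoints of edges.
  have hV : ∃ φ : m.G.V ≃ m'.G.V, ∀ e, (∀ x, ν x = H.src (ε e) → ν' (φ x) = ν x) ∧
      ∀ x, ν x = H.tgt (ε e) → ν' (φ x) = ν x := by
    rcases isEmpty_or_nonempty m.E with hE | hE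
    · have hE' : IsEmpty m'.E := σ.symm.isEmpty
      have : Unique m.G.V := ⟨⟨Classical.arbitrary _⟩, fun _ => m.eq_of_isEmpty hE _ _⟩
      have : Unique m'.G.V := ⟨⟨Classical.arbitrary _⟩, fun _ => m'.eq_of_isEmpty hE' _ _⟩
      exact ⟨.ofUnique _ _, fun e => hE.elim e⟩
    · have key : ∀ x, ∃ x', ν' x' = ν x := by
        intro x
        obtain ⟨e, he⟩ := m.exists_inc hE x
        obtain ⟨x', _, hx'⟩ := h'.inc.1 (hσ e ▸ h.inc.2 ⟨x, he, rfl⟩)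
        exact ⟨x', hx'⟩
      have key' : ∀ x', ∃ x, ν x = ν' x' := by
        intro x'
        obtain ⟨e', he'⟩ := m'.exists_inc (hE.map σ) x'
        obtain ⟨e, rfl⟩ := σ.surjective e'
        obtain ⟨x, _, hx⟩ := h.inc.1 (hσ e ▸ h'.inc.2 ⟨x', he', rfl⟩)
        exact ⟨x, hx⟩
      choose f hf using key
      choose f' hf' using key'
      exact ⟨⟨f, f', fun x => h.inj (by rw [hf', hf]), fun x => h'.inj (by rw [hf, hf'])⟩,
        fun e => ⟨fun x _ => hf x, fun x _ => hf x⟩⟩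
  obtain ⟨φ, hφ⟩ := hV
  refine ⟨σ, ⟨φ, fun e => h'.inj ?_, fun e => h'.inj ?_, fun i => i.elim0⟩, fun e => ?_⟩
  · rw [(hφ e).1 _ (h.src e).symm, ← h'.src, hσ, h.src]
  · rw [(hφ e).2 _ (h.tgt e).symm, ← h'.tgt, hσ, h.tgt]
  · rw [← h'.lab, hσ, h.lab]

/-- A quotient of a monomial as a subgraph of `H`. -/
theorem models_quot (X : GraphMon 0 L) {Z : Type} {q : Z → X.G.V} (hq : Function.Surjective q)
    {h : Z → V} (hk : Setoid.ker q ≤ Setoid.ker h) {H : ColGraph V E L} {ε : X.E → E}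
    (hε : Function.Injective ε) (s t : X.E → Z) (hs : ∀ e, X.G.src e = q (s e))
    (ht : ∀ e, X.G.tgt e = q (t e)) (hs' : ∀ e, H.src (ε e) = h (s e))
    (ht' : ∀ e, H.tgt (ε e) = h (t e)) (hl : ∀ e, H.col (ε e) = X.lab e) :
    (X.quot ((Setoid.ker h).map q)).Models H (Set.range ε) := by
  obtain ⟨ν, hν, hν'⟩ := exists_injective_factor
    (p := X.quotMk ((Setoid.ker h).map q) ∘ q) ((X.quotMk_surjective _).comp hq) h (by
      intro x y
      exact (Setoid.ext_iff.1 (X.ker_quotMk _) _ _).trans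
        (Setoid.ext_iff.1 (Setoid.comap_map_of_ker_le _ _ hk) x y))
  exact ⟨ν, ε, ⟨hν, hε,
    fun e => (hs' e).trans ((hν' _).symm.trans (congrArg (fun x => ν (X.quotMk _ x)) (hs e).symm)),
    fun e => (ht' e).trans ((hν' _).symm.trans (congrArg (fun x => ν (X.quotMk _ x)) (ht e).symm)),
    hl⟩, rfl⟩

/-- `X` is obtained from `t` and `t'` by merging the outputs and erasing edges. -/
structure IsGluing (t t' : GraphMon n L) (X : GraphMon 0 L) (q : t.G.V ⊕ t'.G.V → X.G.V)
    (ε : X.E → t.E ⊕ t'.E) : Prop where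
  surj : Function.Surjective q
  ker : ∀ τ, Setoid.ker q ≤ τ ↔ ∀ i, τ (.inl (t.G.out i)) (.inr (t'.G.out i))
  inj : Function.Injective ε
  src : ∀ e, X.G.src e = q (Sum.map t.G.src t'.G.src (ε e))
  tgt : ∀ e, X.G.tgt e = q (Sum.map t.G.tgt t'.G.tgt (ε e))
  lab : ∀ e, X.lab e = Sum.elim t.lab t'.lab (ε e)

theorem ker_glueRel (t t' : GraphMon n L) (τ : Setoid (t.G.V ⊕ t'.G.V)) :
    Setoid.ker (Quot.mk (TGraph.GlueRel t.G t'.G)) ≤ τ ↔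
      ∀ i, τ (.inl (t.G.out i)) (.inr (t'.G.out i)) := by
  constructor
  · exact fun h i => h (Quot.sound (.out i))
  · intro h x y hxy
    have := Quot.eqvGen_exact (Setoid.ker_def.1 hxy)
    induction this with
    | rel a b hr =>
      cases hr
      exact h _
    | refl a => exact τ.refl' a
    | symm a b hr ih => exact τ.symm' (ih (Quot.eqvGen_sound hr))
    | trans a b c hr hr' ih ih' =>
      exact τ.trans' (ih (Quot.eqvGen_sound hr)) (ih' (Quot.eqvGen_sound hr'))

theorem isGluing_glue (t t' : GraphMon (n + 1) L) :
    t.IsGluing t' (t.glue t') (Quot.mk _) id where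
  surj := Quot.mk_surjective
  ker := ker_glueRel t t'
  inj := Function.injective_id
  src := by rintro (e | e) <;> rfl
  tgt := by rintro (e | e) <;> rfl
  lab _ := rfl

/-- A further quotient of a gluing that comes from quotients of the two sides and a matching of
their vertices is the amalgam along this matching. The outputs have to be matched, as they are
already merged in the gluing. -/
theorem IsGluing.models {t t' : GraphMon n L} {X : GraphMon 0 L} {q : t.G.V ⊕ t'.G.V → X.G.V}
    {ε : X.E → t.E ⊕ t'.E} (hX : t.IsGluing t' X q ε) {V' E' : Type*} {H : ColGraph V E L}
    {H' : ColGraph V' E' L} {f : t.G.V → V} {f' : t'.G.V → V'} {θ : t.E → E} {θ' : t'.E → E'}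
    (hθ : Function.Injective θ) (hθ' : Function.Injective θ')
    (hs : ∀ e, H.src (θ e) = f (t.G.src e)) (ht : ∀ e, H.tgt (θ e) = f (t.G.tgt e))
    (hl : ∀ e, H.col (θ e) = t.lab e)
    (hs' : ∀ e, H'.src (θ' e) = f' (t'.G.src e)) (ht' : ∀ e, H'.tgt (θ' e) = f' (t'.G.tgt e))
    (hl' : ∀ e, H'.col (θ' e) = t'.lab e) {M : Finset (V × V')}
    (hM : IsMatching Set.univ Set.univ M) (ho : ∀ i, (f (t.G.out i), f' (t'.G.out i)) ∈ M)
    {c : Set (E ⊕ E')} (hc : Set.range (Sum.map θ θ' ∘ ε) = c) :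
    (X.quot ((Setoid.ker (merge M ∘ Sum.map f f')).map q)).Models (H.amalg H' M) c := by
  subst hc
  refine X.models_quot hX.surj ?_ ((hθ.sumMap hθ').comp hX.inj) _ _ hX.src hX.tgt ?_ ?_ ?_
  · rw [hX.ker]
    exact fun i => (merge_inr_of_mem hM (ho i)).symm
  · intro e
    rcases h : ε e with a | a
    · simp [h, ColGraph.amalg, hs, merge_inl]
    · simp [h, ColGraph.amalg, hs']
  · intro e
    rcases h : ε e with a | a
    · simp [h, ColGraph.amalg, ht, merge_inl]
    · simp [h, ColGraph.amalg, ht']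
  · intro e
    rw [hX.lab]
    rcases h : ε e with a | a
    · simp [h, ColGraph.amalg, hl]
    · simp [h, ColGraph.amalg, hl']

end GraphMon

/-! ### Sums over partial matchings of vertices. -/

section MatchSum

variable {n : ℕ} {L : Type u} {g : GraphMon 0 L → ℂ}

open Classical in
/-- The sum over the partitions of a gluing, in terms of the two sides. -/
theorem GraphMon.IsGluing.sum_quot {t t' : GraphMon n L} {X : GraphMon 0 L}
    {q : t.G.V ⊕ t'.G.V → X.G.V} {ε : X.E → t.E ⊕ t'.E} (hX : t.IsGluing t' X q ε)
    (P : Setoid t.G.V → Prop)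
    (F : ∀ ρ ρ', Finset ((t.quot ρ).G.V × (t'.quot ρ').G.V) → ℂ)
    (hF : ∀ ρ ρ' M m, IsMatching Set.univ Set.univ M →
      m.Models ((t.quot ρ).toCol.amalg (t'.quot ρ').toCol M) (Set.range ε) → F ρ ρ' M = g m) :
    ∑ π with P (π.comap (q ∘ Sum.inl)), g (X.quot π) = ∑ ρ with P ρ, ∑ ρ',
      ∑ M : Finset ((t.quot ρ).G.V × (t'.quot ρ').G.V) with
        IsOutMatching (t.quot ρ).G.out (t'.quot ρ').G.out .univ .univ M, F ρ ρ' M := by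
  -- Partitions of the gluing are the partitions of the disjoint union that merge the outputs;
  -- `sum_setoid_sum` splits these into two sides and a matching.
  have h1 := sum_setoid_comap hX.surj fun τ =>
    if P (τ.comap Sum.inl) then g (X.quot (τ.map q)) else 0
  simp only [map_comap_setoid hX.surj, hX.ker] at h1
  rw [Finset.sum_filter]
  refine h1.trans ?_
  have h2 := @sum_setoid_sum _ _ _ _ (fun ρ => (t.quot ρ).fintypeV) (fun ρ => (t'.quot ρ).fintypeV)
    _ t.G.out t'.G.out (fun τ => if P (τ.comap Sum.inl) then g (X.quot (τ.map q)) else 0)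
  rw [h2, Finset.sum_filter]
  refine Finset.sum_congr rfl fun ρ _ => ?_
  have h3 : ∀ (ρ' : Setoid t'.G.V) M, (matchSetoid ρ ρ' M).comap Sum.inl = ρ :=
    fun ρ' M => Setoid.ext fun x y => matchSetoid_inl
  simp only [h3]
  split_ifs with hP
  · refine Finset.sum_congr rfl fun ρ' _ => ?_
    refine Finset.sum_congr rfl fun M hM => ?_
    have ⟨hM, ho⟩ := ((@Finset.mem_filter _ _ (fun _ => Classical.propDecidable _) _ _).1 hM).2
    refine (hF ρ ρ' M _ hM ?_).symm
    exact hX.models (H := (t.quot ρ).toCol) (H' := (t'.quot ρ').toCol) (f := t.quotMk ρ)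
      (f' := t'.quotMk ρ') (θ := id) (θ' := id) Function.injective_id Function.injective_id
      (fun _ => rfl) (fun _ => rfl) (fun _ => rfl) (fun _ => rfl) (fun _ => rfl) (fun _ => rfl)
      hM ho (congrArg (fun f : t.E ⊕ t'.E → t.E ⊕ t'.E => Set.range (f ∘ ε)) Sum.map_id_id)
  · simp

open Classical in
/-- The sum of the values of `g` on the gluings of `t` and `t'` along partial matchings of the
vertices that contain the outputs. -/
def matchSum (g : GraphMon 0 L → ℂ) (t t' : GraphMon n L) : ℂ :=
  ∑ M : Finset (t.G.V × t'.G.V) with IsOutMatching t.G.out t'.G.out .univ .univ M,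
    if h : ∃ m : GraphMon 0 L, m.Models (t.toCol.amalg t'.toCol M) Set.univ then g h.choose else 0

/-- The choice made in `matchSum` is harmless, because `Models` determines the monomial up to
isomorphism. -/
theorem dite_models_eq (hg : IsoInvariant g) {V E : Type*} {H : ColGraph V E L} {c : Set E}
    {m : GraphMon 0 L} (hm : m.Models H c) [Decidable (∃ m : GraphMon 0 L, m.Models H c)] :
    (if h : ∃ m : GraphMon 0 L, m.Models H c then g h.choose else 0) = g m := by
  have h : ∃ m : GraphMon 0 L, m.Models H c := ⟨m, hm⟩
  rw [dif_pos h]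
  exact hg _ _ (h.choose_spec.iso hm)

open Classical in
-- Reduces the positivity of a functional to that of `matchSum` for its injective version.
theorem sum_quot_glue (hg : IsoInvariant g) (t t' : GraphMon (n + 1) L) :
    ∑ π, g ((t.glue t').quot π) = ∑ ρ, ∑ ρ', matchSum g (t.quot ρ) (t'.quot ρ') := by
  have := (t.isGluing_glue t').sum_quot (g := g) (fun _ => True) (fun ρ ρ' M =>
    if h : ∃ m : GraphMon 0 L, m.Models ((t.quot ρ).toCol.amalg (t'.quot ρ').toCol M) Set.univ
    then g h.choose else 0) (fun ρ ρ' M m _ hm => dite_models_eq hg (Set.range_id (α := t.E ⊕ t'.E) ▸ hm))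
  simp only [Finset.filter_true] at this
  exact this

theorem merge_image {V V' W W' : Type*} [DecidableEq W] [DecidableEq W'] {M : Finset (V × V')}
    (hM : IsMatching Set.univ Set.univ M)
    {ν : V → W} {ν' : V' → W'} (hν : Function.Injective ν) (hν' : Function.Injective ν') (y : V') :
    merge (M.image (Prod.map ν ν')) (.inr (ν' y)) = Sum.map ν ν' (merge M (.inr y)) := by
  have hM' : IsMatching Set.univ Set.univ (M.image (Prod.map ν ν')) := by
    refine ⟨fun _ => trivial, fun _ => trivial, ?_, ?_⟩
    · intro x y y' h h'
      simp only [Finset.mem_image, Prod.exists, Prod.map_apply, Prod.mk.injEq] at h h'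
      obtain ⟨a, b, hab, rfl, rfl⟩ := h
      obtain ⟨a', b', hab', h1, rfl⟩ := h'
      rw [hν h1] at hab'
      rw [hM.snd_unique hab hab']
    · intro x x' y h h'
      simp only [Finset.mem_image, Prod.exists, Prod.map_apply, Prod.mk.injEq] at h h'
      obtain ⟨a, b, hab, rfl, rfl⟩ := h
      obtain ⟨a', b', hab', rfl, h1⟩ := h'
      rw [hν' h1] at hab'
      rw [hM.fst_unique hab hab']
  by_cases h : ∃ x, (x, y) ∈ M
  · obtain ⟨x, hx⟩ := h
    rw [merge_inr_of_mem hM hx, merge_inr_of_mem hM' (x := ν x)]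
    · rfl
    · exact Finset.mem_image_of_mem (Prod.map ν ν') hx
  · push Not at h
    rw [merge_inr_of_not_mem h, merge_inr_of_not_mem]
    · rfl
    · intro x hx
      simp only [Finset.mem_image, Prod.exists, Prod.map_apply, Prod.mk.injEq] at hx
      obtain ⟨a, b, hab, _, h1⟩ := hx
      rw [hν' h1] at hab
      exact h a hab

open Classical in
/-- Sums over matchings in a larger set. -/
theorem sum_matching_image {V V' W W' : Type*} [Fintype V] [Fintype V'] [Fintype W] [Fintype W']
    {ν : V → W} {ν' : V' → W'} (hν : Function.Injective ν) (hν' : Function.Injective ν')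
    {o : Fin n → V} {o' : Fin n → V'} (f : Finset (V × V') → ℂ) (F : Finset (W × W') → ℂ)
    (hF : ∀ M, IsMatching Set.univ Set.univ M → (∀ i, (o i, o' i) ∈ M) →
      IsMatching (Set.range ν) (Set.range ν') (M.image (Prod.map ν ν')) →
        F (M.image (Prod.map ν ν')) = f M) :
    ∑ M with IsOutMatching o o' .univ .univ M, f M =
      ∑ M with IsOutMatching (ν ∘ o) (ν' ∘ o') (Set.range ν) (Set.range ν') M, F M := by
  have him : ∀ M, IsMatching Set.univ Set.univ M →
      IsMatching (Set.range ν) (Set.range ν') (M.image (Prod.map ν ν')) := by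
    intro M hM
    refine ⟨fun h => ?_, fun h => ?_, fun h h' => ?_, fun h h' => ?_⟩
    · obtain ⟨a, _, ha⟩ := Finset.mem_image.1 h
      exact ⟨a.1, congrArg Prod.fst ha⟩
    · obtain ⟨a, _, ha⟩ := Finset.mem_image.1 h
      exact ⟨a.2, congrArg Prod.snd ha⟩
    · simp only [Finset.mem_image, Prod.exists, Prod.map_apply, Prod.mk.injEq] at h h'
      obtain ⟨a, b, hab, rfl, rfl⟩ := h
      obtain ⟨a', b', hab', h1, rfl⟩ := h'
      rw [hν h1] at hab'
      rw [hM.snd_unique hab hab']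
    · simp only [Finset.mem_image, Prod.exists, Prod.map_apply, Prod.mk.injEq] at h h'
      obtain ⟨a, b, hab, rfl, rfl⟩ := h
      obtain ⟨a', b', hab', rfl, h1⟩ := h'
      rw [hν' h1] at hab'
      rw [hM.fst_unique hab hab']
  have hinj : Function.Injective (Prod.map ν ν') := hν.prodMap hν'
  refine Finset.sum_bij (fun M _ => M.image (Prod.map ν ν')) ?_ ?_ ?_ ?_
  · intro M hM
    simp only [Finset.mem_filter, Finset.mem_univ, true_and] at hM ⊢
    exact ⟨him M hM.1, fun i => Finset.mem_image_of_mem (Prod.map ν ν') (hM.out i)⟩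
  · exact fun M _ M' _ h => Finset.image_injective hinj h
  · intro N hN
    simp only [Finset.mem_filter, Finset.mem_univ, true_and] at hN
    refine ⟨Finset.univ.filter fun a => Prod.map ν ν' a ∈ N, ?_, ?_⟩
    · simp only [Finset.mem_filter, Finset.mem_univ, true_and]
      refine ⟨⟨fun _ => trivial, fun _ => trivial, ?_, ?_⟩, fun i => by simpa using hN.out i⟩
      · intro x y y' h h'
        simp only [Finset.mem_filter, Finset.mem_univ, true_and, Prod.map_apply] at h h'
        exact hν' (hN.1.snd_unique h h')
      · intro x y y' h h'
        simp only [Finset.mem_filter, Finset.mem_univ, true_and, Prod.map_apply] at h h'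
        exact hν (hN.1.fst_unique h h')
    · ext ⟨x, y⟩
      simp only [Finset.mem_image, Finset.mem_filter, Finset.mem_univ, true_and]
      constructor
      · rintro ⟨a, ha, h⟩
        exact h ▸ ha
      · intro h
        obtain ⟨a, rfl⟩ := hN.1.fst_mem h
        obtain ⟨b, rfl⟩ := hN.1.snd_mem h
        exact ⟨(a, b), h, rfl⟩
  · intro M hM
    simp only [Finset.mem_filter, Finset.mem_univ, true_and] at hM
    exact (hF M hM.1 hM.out (him M hM.1)).symm

theorem GraphMon.Models.image {L' : Type v} (l : L → L') {V V' W W' E E' A A' : Type*} [DecidableEq W] [DecidableEq W']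
    {M : Finset (V × V')} (hM : IsMatching Set.univ Set.univ M)
    {K : ColGraph V A L} {K' : ColGraph V' A' L} {H : ColGraph W E L'} {H' : ColGraph W' E' L'}
    {ν : V → W} {ν' : V' → W'} (hν : Function.Injective ν) (hν' : Function.Injective ν')
    {θ : A → E} {θ' : A' → E'} (hθ : Function.Injective θ) (hθ' : Function.Injective θ')
    (hs : ∀ e, H.src (θ e) = ν (K.src e)) (ht : ∀ e, H.tgt (θ e) = ν (K.tgt e))
    (hl : ∀ e, H.col (θ e) = l (K.col e))
    (hs' : ∀ e, H'.src (θ' e) = ν' (K'.src e)) (ht' : ∀ e, H'.tgt (θ' e) = ν' (K'.tgt e))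
    (hl' : ∀ e, H'.col (θ' e) = l (K'.col e)) {c : Set (A ⊕ A')} {m : GraphMon 0 L}
    (h : m.Models (K.amalg K' M) c) :
    (m.map l).Models (H.amalg H' (M.image (Prod.map ν ν'))) (Sum.map θ θ' '' c) := by
  obtain ⟨f, η, h, rfl⟩ := h
  have es : ∀ a, (H.amalg H' (M.image (Prod.map ν ν'))).src (Sum.map θ θ' a) =
      Sum.map ν ν' ((K.amalg K' M).src a) := by
    rintro (a | a)
    · simp [ColGraph.amalg, hs]
    · simp [ColGraph.amalg, hs', merge_image hM hν hν']
  have et : ∀ a, (H.amalg H' (M.image (Prod.map ν ν'))).tgt (Sum.map θ θ' a) =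
      Sum.map ν ν' ((K.amalg K' M).tgt a) := by
    rintro (a | a)
    · simp [ColGraph.amalg, ht]
    · simp [ColGraph.amalg, ht', merge_image hM hν hν']
  have el : ∀ a, (H.amalg H' (M.image (Prod.map ν ν'))).col (Sum.map θ θ' a) =
      l ((K.amalg K' M).col a) := by
    rintro (a | a)
    · simp [ColGraph.amalg, hl]
    · simp [ColGraph.amalg, hl']
  exact ⟨Sum.map ν ν' ∘ f, Sum.map θ θ' ∘ η, ⟨(hν.sumMap hν').comp h.inj,
    (hθ.sumMap hθ').comp h.inj', fun e => (es _).trans (congrArg _ (h.src e)),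
    fun e => (et _).trans (congrArg _ (h.tgt e)), fun e => (el _).trans (congrArg l (h.lab e))⟩,
    Set.range_comp _ η⟩

theorem image_sumMap_univ {A A' E E' : Type*} (θ : A → E) (θ' : A' → E') :
    Sum.map θ θ' '' Set.univ = sumSet (Set.range θ) (Set.range θ') := by
  ext (e | e) <;> simp

open Classical in
-- Lets the matchings be computed inside ambient graphs that are common to a whole family of
-- monomials, with labels transported by `l`. The kernels of `ColGraph` have this form.
theorem matchSum_eq_of_map_embeds (hg : IsoInvariant g) {L' : Type v} (l : L → L') {t t' : GraphMon (n + 1) L}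
    {W W' E E' : Type*} [Fintype W] [Fintype W'] {H : ColGraph W E L'} {H' : ColGraph W' E' L'}
    {ν : t.G.V → W} {ν' : t'.G.V → W'} {ε : t.E → E} {ε' : t'.E → E'} (h : (t.map l).Embeds H ν ε)
    (h' : (t'.map l).Embeds H' ν' ε') (F : Finset (W × W') → ℂ)
    (hF : ∀ M m, IsMatching (Set.range ν) (Set.range ν') M →
      (m.map l).Models (H.amalg H' M) (sumSet (Set.range ε) (Set.range ε')) → F M = g m) :
    matchSum g t t' = ∑ M with IsOutMatching (ν ∘ t.G.out) (ν' ∘ t'.G.out) (Set.range ν) (Set.range ν') M, F M := by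
  refine sum_matching_image h.inj h'.inj _ F fun M hM ho hM' => ?_
  have hm := (t.isGluing_glue t').models (H := t.toCol) (H' := t'.toCol) (f := id) (f' := id)
    (θ := id) (θ' := id) Function.injective_id Function.injective_id
    (fun _ => rfl) (fun _ => rfl) (fun _ => rfl) (fun _ => rfl) (fun _ => rfl) (fun _ => rfl)
    hM ho (c := .univ) (by rw [Sum.map_id_id]; exact Set.range_id)
  rw [dite_models_eq hg hm]
  refine hF _ _ hM' ?_
  have := hm.image l hM h.inj h'.inj h.inj' h'.inj' h.src h.tgt h.lab h'.src h'.tgt h'.lab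
  exact (image_sumMap_univ ε ε').subst this

open Classical in
theorem matchSum_eq_of_embeds (hg : IsoInvariant g) {t t' : GraphMon (n + 1) L}
    {W W' E E' : Type*} [Fintype W] [Fintype W'] {H : ColGraph W E L} {H' : ColGraph W' E' L}
    {ν : t.G.V → W} {ν' : t'.G.V → W'} {ε : t.E → E} {ε' : t'.E → E'} (h : t.Embeds H ν ε)
    (h' : t'.Embeds H' ν' ε') (F : Finset (W × W') → ℂ)
    (hF : ∀ M m, IsMatching (Set.range ν) (Set.range ν') M →
      m.Models (H.amalg H' M) (sumSet (Set.range ε) (Set.range ε')) → F M = g m) :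
    matchSum g t t' =
      ∑ M with IsOutMatching (ν ∘ t.G.out) (ν' ∘ t'.G.out) (Set.range ν) (Set.range ν') M, F M :=
  matchSum_eq_of_map_embeds hg id h h' F hF

theorem GraphMon.Iso.exists_embeds {t s : GraphMon n L} (h : t.Iso s) :
    ∃ ν ε, t.Embeds s.toCol ν ε ∧ Function.Surjective ν ∧ Function.Surjective ε ∧
      ν ∘ t.G.out = s.G.out := by
  obtain ⟨σ, ⟨φ, h1, h2, h3⟩, h4⟩ := h
  exact ⟨φ, σ, ⟨φ.injective, σ.injective, fun e => (h1 e).symm, fun e => (h2 e).symm, h4⟩,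
    φ.surjective, σ.surjective, funext h3⟩

theorem matchSum_congr (hg : IsoInvariant g) {t t' s s' : GraphMon (n + 1) L} (h : t.Iso s)
    (h' : t'.Iso s') : matchSum g t t' = matchSum g s s' := by
  classical
  obtain ⟨ν, ε, he, hν, hε, ho⟩ := h.exists_embeds
  obtain ⟨ν', ε', he', hν', hε', ho'⟩ := h'.exists_embeds
  rw [matchSum_eq_of_embeds hg he he' _ fun M m hM hm => dite_models_eq hg hm]
  have : sumSet (Set.univ : Set s.E) (Set.univ : Set s'.E) = Set.univ := by
    ext (e | e) <;> simp
  simp only [hν.range_eq, hν'.range_eq, hε.range_eq, hε'.range_eq, ho, ho', this]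
  rfl

/-- The sum over matchings of an injective version, in terms of the functional. -/
theorem matchSum_injVersion {φ : GraphMon 0 L → ℂ} (hφ : IsoInvariant φ)
    (t t' : GraphMon (n + 1) L) :
    matchSum (injVersion φ) t t' = ∑ ρ, ∑ ρ', partitionMob t.G.V ⊥ ρ *
      partitionMob t'.G.V ⊥ ρ' * φ ((t.quot ρ).glue (t'.quot ρ')) := by
  have hg := injVersion_isoInvariant hφ
  have h1 : ∀ t', IsoInvariant fun t : GraphMon (n + 1) L =>
      ∑ ρ', matchSum (injVersion φ) t (GraphMon.quot t' ρ') := fun t' t s h =>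
    Finset.sum_congr rfl fun ρ' _ => matchSum_congr hg h (.refl _)
  have h2 : IsoInvariant fun t' : GraphMon (n + 1) L => matchSum (injVersion φ) t t' :=
    fun t' s h => matchSum_congr hg (.refl _) h
  -- The value at a gluing is a double sum over the quotients of the two sides. Möbius inversion is
  -- applied to the left monomial, then to the right one.
  have h3 : ∀ t t' : GraphMon (n + 1) L, φ (t.glue t') =
      ∑ ρ, ∑ ρ', matchSum (injVersion φ) (t.quot ρ) (t'.quot ρ') := by
    intro t t'
    rw [← sum_quot_glue hg, sum_injVersion hφ]
  have h4 : ∀ t t' : GraphMon (n + 1) L, ∑ ρ', matchSum (injVersion φ) t (t'.quot ρ') =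
      ∑ ρ, partitionMob t.G.V ⊥ ρ * φ ((t.quot ρ).glue t') := fun t t' =>
    (mobius_inversion (h1 t') (fun T => h3 T t') t).symm
  have h5 := mobius_inversion h2 (fun T => rfl) t'
  rw [← h5, Finset.sum_comm]
  refine Finset.sum_congr rfl fun ρ' _ => ?_
  rw [h4, Finset.mul_sum]
  exact Finset.sum_congr rfl fun ρ _ => by ring

end MatchSum

end Traffic
end

noncomputable section

namespace Traffic

/-! ## The free product as a weight of trees of components -/

namespace ColGraph

variable {V W A E J : Type*}

section Image

variable {K : ColGraph V A J} {H : ColGraph W E J} {ν : V → W} {θ : A → E}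

/-- The maps `ν` and `θ` embed the graph `K` in the graph `H`. -/
structure Emb (K : ColGraph V A J) (H : ColGraph W E J) (ν : V → W) (θ : A → E) : Prop where
  inj : Function.Injective ν
  inj' : Function.Injective θ
  src : ∀ e, H.src (θ e) = ν (K.src e)
  tgt : ∀ e, H.tgt (θ e) = ν (K.tgt e)
  col : ∀ e, H.col (θ e) = K.col e

variable (h : K.Emb H ν θ) {F : Set A}

include h

theorem Emb.inc {e : A} {y : W} : H.Inc (θ e) y ↔ ∃ x, K.Inc e x ∧ ν x = y := by
  rw [Inc, h.src, h.tgt]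
  constructor
  · rintro (rfl | rfl)
    exacts [⟨_, .inl rfl, rfl⟩, ⟨_, .inr rfl, rfl⟩]
  · rintro ⟨x, rfl | rfl, rfl⟩
    exacts [.inl rfl, .inr rfl]

theorem Emb.verts : H.verts (θ '' F) = ν '' K.verts F := by
  ext y
  constructor
  · rintro ⟨_, ⟨e, he, rfl⟩, hy⟩
    obtain ⟨x, hx, rfl⟩ := h.inc.1 hy
    exact ⟨x, ⟨e, he, hx⟩, rfl⟩
  · rintro ⟨x, ⟨e, he, hx⟩, rfl⟩
    exact ⟨_, ⟨e, he, rfl⟩, h.inc.2 ⟨x, hx, rfl⟩⟩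

theorem Emb.conn {x y : V} : H.Conn (θ '' F) (ν x) (ν y) ↔ K.Conn F x y := by
  constructor
  · intro hxy
    have : Nonempty V := ⟨x⟩
    have hinv := Function.leftInverse_invFun h.inj
    have := hxy.lift (G₂ := K) (F₂ := F) (Function.invFun ν) (by
      rintro _ ⟨e, he, rfl⟩
      rw [h.src, h.tgt, hinv, hinv]
      exact .edge he)
    rwa [hinv, hinv] at this
  · refine fun hxy => hxy.lift ν fun e he => ?_
    rw [← h.src, ← h.tgt]
    exact .edge ⟨e, he, rfl⟩

theorem Emb.adj {e e' : A} : H.Adj (θ '' F) (θ e) (θ e') ↔ K.Adj F e e' := by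
  rw [Adj, Adj, h.inj'.mem_set_image, h.inj'.mem_set_image, h.col, h.col]
  refine and_congr_right fun _ => and_congr_right fun _ => and_congr_right fun _ => ?_
  simp only [h.inc]
  constructor
  · rintro ⟨_, ⟨x, hx, rfl⟩, ⟨x', hx', hxx⟩⟩
    exact ⟨x, hx, h.inj hxx ▸ hx'⟩
  · rintro ⟨x, hx, hx'⟩
    exact ⟨ν x, ⟨x, hx, rfl⟩, ⟨x, hx', rfl⟩⟩

theorem Emb.comp {e : A} (he : e ∈ F) : H.comp (θ '' F) (θ e) = θ '' K.comp F e := by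
  ext a
  constructor
  · intro ha
    obtain ⟨a, haF, rfl⟩ := comp_mem_of_mem (Set.mem_image_of_mem θ he) ha
    refine ⟨a, ?_, rfl⟩
    have : Nonempty A := ⟨e⟩
    have hinv := Function.leftInverse_invFun h.inj'
    have key : ∀ a b, Relation.EqvGen (H.Adj (θ '' F)) a b →
        Relation.EqvGen (K.Adj F) (Function.invFun θ a) (Function.invFun θ b) := by
      intro a b hab
      induction hab with
      | rel a b hab =>
        obtain ⟨a, -, rfl⟩ := hab.1
        obtain ⟨b, -, rfl⟩ := hab.2.1
        rw [hinv, hinv]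
        exact .rel _ _ (h.adj.1 hab)
      | refl a => exact .refl _
      | symm a b _ ih => exact .symm _ _ ih
      | trans a b c _ _ ih1 ih2 => exact .trans _ _ _ ih1 ih2
    have := key _ _ ha
    rwa [hinv, hinv] at this
  · rintro ⟨a, ha, rfl⟩
    have key : ∀ a b, Relation.EqvGen (K.Adj F) a b →
        Relation.EqvGen (H.Adj (θ '' F)) (θ a) (θ b) := by
      intro a b hab
      induction hab with
      | rel a b hab => exact .rel _ _ (h.adj.2 hab)
      | refl a => exact .refl _
      | symm a b _ ih => exact .symm _ _ ih
      | trans a b c _ _ ih1 ih2 => exact .trans _ _ _ ih1 ih2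
    exact key _ _ ha

theorem Emb.comps : H.comps (θ '' F) = Set.image θ '' K.comps F := by
  rw [ColGraph.comps, ColGraph.comps, Set.image_image, Set.image_image]
  exact Set.image_congr fun e he => h.comp he

theorem Emb.treelike : H.Treelike (θ '' F) ↔ K.Treelike F := by
  rw [Treelike, Treelike, h.comps, Set.forall_mem_image]
  refine forall₂_congr fun c hc => ?_
  rw [h.verts, Set.forall_mem_image]
  refine forall₂_congr fun x hx => ?_
  rw [Set.forall_mem_image]
  refine forall₂_congr fun y hy => ?_
  rw [← Set.image_sdiff h.inj', h.conn, h.inj.eq_iff]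

theorem Emb.weight {w : Set A → ℂ} {w' : Set E → ℂ} (hw : ∀ c ⊆ F, w' (θ '' c) = w c) :
    H.weight w' (θ '' F) = K.weight w F := by
  rw [ColGraph.weight, ColGraph.weight, h.comps]
  by_cases hT : K.Treelike F
  · rw [if_pos (h.treelike.2 hT), if_pos hT, finprod_mem_image (h.inj'.image_injective.injOn)]
    exact finprod_mem_congr rfl fun c hc => hw c (subset_of_mem_comps hc)
  · rw [if_neg (mt h.treelike.1 hT), if_neg hT]

end Image

/-- Forget the labels, and keep the colors. -/
def color {L : J → Type*} (H : ColGraph V E (Σ j, L j)) : ColGraph V E J :=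
  ⟨H.src, H.tgt, fun e => (H.col e).1⟩

theorem color_amalg {V' E' : Type*} {L : J → Type*} (H : ColGraph V E (Σ j, L j))
    (H' : ColGraph V' E' (Σ j, L j)) (M : Finset (V × V')) :
    (H.amalg H' M).color = H.color.amalg H'.color M := by
  rw [amalg, amalg, color]
  congr 1
  ext (e | e) <;> rfl

theorem Emb.color {L : J → Type*} {K : ColGraph V A (Σ j, L j)} {H : ColGraph W E (Σ j, L j)}
    {ν : V → W} {θ : A → E} (h : K.Emb H ν θ) : K.color.Emb H.color ν θ :=
  ⟨h.inj, h.inj', h.src, h.tgt, fun e => congrArg Sigma.fst (h.col e)⟩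

end ColGraph

namespace GraphMon

variable {L : Type u} {V W A E : Type*}

theorem Embeds.emb {n : ℕ} {m : GraphMon n L} {H : ColGraph V E L} {ν : m.G.V → V} {ε : m.E → E}
    (h : m.Embeds H ν ε) : m.toCol.Emb H ν ε := ⟨h.inj, h.inj', h.src, h.tgt, h.lab⟩

theorem Models.of_emb {m : GraphMon 0 L} {K : ColGraph V A L} {H : ColGraph W E L} {ν : V → W}
    {θ : A → E} (h : K.Emb H ν θ) {c : Set A} (hm : m.Models K c) : m.Models H (θ '' c) := by
  obtain ⟨f, η, hm, rfl⟩ := hm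
  exact ⟨ν ∘ f, θ ∘ η, ⟨h.inj.comp hm.inj, h.inj'.comp hm.inj',
    fun e => (h.src _).trans (congrArg ν (hm.src e)),
    fun e => (h.tgt _).trans (congrArg ν (hm.tgt e)),
    fun e => (h.col _).trans (hm.lab e)⟩, Set.range_comp θ η⟩

/-- Nonemptiness of `c` matters: `f` and `g` are inverse to each other only at endpoints of edges.
-/
theorem Models.of_sameOn {m : GraphMon 0 L} {K : ColGraph V E L} {H : ColGraph W E L} {f : V → W}
    {g : W → V} {F c : Set E} (h : K.SameOn H F f g) (hc : c ⊆ F) (hne : c.Nonempty)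
    (hm : m.Models K c) : m.Models H c := by
  obtain ⟨ν, ε, hm, rfl⟩ := hm
  have hF : ∀ e, ε e ∈ F := fun e => hc ⟨e, rfl⟩
  have hE : Nonempty m.E := Set.range_nonempty_iff_nonempty.1 hne
  have hg : ∀ x, g (f (ν x)) = ν x := by
    intro x
    obtain ⟨e, rfl | rfl⟩ := m.exists_inc hE x
    · rw [toCol, ← hm.src, h.src _ (hF e), h.src' _ (hF e)]
    · rw [toCol, ← hm.tgt, h.tgt _ (hF e), h.tgt' _ (hF e)]
  refine ⟨f ∘ ν, ε, ⟨fun x y hxy => hm.inj ?_, hm.inj', fun e => ?_, fun e => ?_, fun e => ?_⟩, rfl⟩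
  · rw [← hg x, ← hg y]
    exact congrArg g hxy
  · rw [Function.comp_apply, ← hm.src, h.src _ (hF e)]
  · rw [Function.comp_apply, ← hm.tgt, h.tgt _ (hF e)]
  · rw [← hm.lab, h.col _ (hF e)]

theorem Models.of_image {m : GraphMon 0 L} {K : ColGraph V A L} {H : ColGraph W E L} {ν : V → W}
    {θ : A → E} (h : K.Emb H ν θ) {c : Set A} (hne : c.Nonempty) (hm : m.Models H (θ '' c)) :
    m.Models K c := by
  obtain ⟨f, η, hm, hr⟩ := hm
  have hη : ∀ e, ∃ a ∈ c, θ a = η e := fun e => by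
    have : η e ∈ θ '' c := hr ▸ Set.mem_range_self e
    exact this
  choose η' hη'c hη' using hη
  have hr' : Set.range η' = c := by
    apply h.inj'.image_injective
    rw [← Set.range_comp, ← hr]
    exact congrArg Set.range (funext hη')
  have hE : Nonempty m.E := Set.range_nonempty_iff_nonempty.1 (hr' ▸ hne)
  have hf : ∀ x, ∃ a, ν a = f x := by
    intro x
    obtain ⟨e, rfl | rfl⟩ := m.exists_inc hE x
    · exact ⟨K.src (η' e), by rw [← h.src, hη', hm.src]; rfl⟩
    · exact ⟨K.tgt (η' e), by rw [← h.tgt, hη', hm.tgt]; rfl⟩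
  choose f' hf' using hf
  refine ⟨f', η', ⟨fun x y hxy => hm.inj ?_, fun x y hxy => hm.inj' ?_, fun e => h.inj ?_,
    fun e => h.inj ?_, fun e => ?_⟩, hr'⟩
  · rw [← hf', ← hf', hxy]
  · rw [← hη', ← hη', hxy]
  · rw [← h.src, hη', hm.src, hf']
  · rw [← h.tgt, hη', hm.tgt, hf']
  · rw [← h.col, hη', hm.lab]

theorem map_injective_iso {L' : Type v} {f : L → L'} (hf : Function.Injective f) {n : ℕ}
    {m m' : GraphMon n L} (h : (m.map f).Iso (m'.map f)) : m.Iso m' := by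
  obtain ⟨σ, h1, h2⟩ := h
  exact ⟨σ, h1, fun e => hf (h2 e)⟩

theorem Iso.map {L' : Type v} {n : ℕ} {m m' : GraphMon n L} (h : m.Iso m') (f : L → L') :
    (m.map f).Iso (m'.map f) := by
  obtain ⟨σ, h1, h2⟩ := h
  exact ⟨σ, h1, fun e => congrArg f (h2 e)⟩

end GraphMon

theorem IsTrafficFunctional.isoInvariant {L : Type u} {τ : GraphMon 0 L → ℂ}
    (h : IsTrafficFunctional τ) : IsoInvariant τ := h.iso_inv

/-- The graph is a single vertex, with a single partition, so the Möbius sum is `1` and so is the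
functional. -/
theorem injVersion_of_isEmpty {L : Type u} {τ : GraphMon 0 L → ℂ} (h : IsTrafficFunctional τ)
    (m : GraphMon 0 L) (hm : IsEmpty m.E) : injVersion τ m = 1 := by
  classical
  have hbot : ∀ ρ : Setoid m.G.V, ρ ≤ ⊥ := fun ρ x y _ => m.eq_of_isEmpty hm x y
  have := sum_partitionMob (⊥ : Setoid m.G.V)
  rw [if_pos rfl, Finset.filter_true_of_mem fun ρ _ => hbot ρ] at this
  rw [injVersion_eq_sum, ← this]
  refine Finset.sum_congr rfl fun π _ => ?_
  rw [h.unital (m.quot π) hm, mul_one]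

/-! ### Weights of colored components; trees of components and `Treelike`. -/

section CompWeight

variable {J : Type w} {L : J → Type u} {V W A E : Type*} {τ : ∀ j, GraphMon 0 (L j) → ℂ}

open Classical in
/-- The value at a monochromatic monomial which is determined by a property. -/
def modelValue (τ : ∀ j, GraphMon 0 (L j) → ℂ) (P : GraphMon 0 (Σ j, L j) → Prop) : ℂ :=
  if h : ∃ p : Σ j, GraphMon 0 (L j), P (p.2.map (Sigma.mk p.1)) then
    injVersion (τ h.choose.1) h.choose.2 else 0

open Classical in
/-- The weight of a monochromatic subgraph. -/
def compWeight (τ : ∀ j, GraphMon 0 (L j) → ℂ) (H : ColGraph V E (Σ j, L j)) (c : Set E) : ℂ :=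
  if c = ∅ then 1 else modelValue τ fun m => m.Models H c

theorem compWeight_eq (hτ : ∀ j, IsTrafficFunctional (τ j)) {H : ColGraph V E (Σ j, L j)}
    {c : Set E} {j : J} {m : GraphMon 0 (L j)} (hm : (m.map (Sigma.mk j)).Models H c) :
    compWeight τ H c = injVersion (τ j) m := by
  rw [compWeight, modelValue]
  split_ifs with hc h
  -- On the empty set of edges the convention `1` agrees with the injective version of a graph with
  -- no edge.
  · obtain ⟨ν, ε, hm, hr⟩ := hm
    exact (injVersion_of_isEmpty (hτ j) m (Set.range_eq_empty_iff.1 (hr.trans hc))).symm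
  -- The chosen monomial might have another color a priori, but the label of an edge of the nonempty
  -- set `c` fixes it.
  · have hp := h.choose_spec
    generalize h.choose = p at hp ⊢
    obtain ⟨j', m'⟩ := p
    have hiso := hp.iso hm
    have hiso' := hiso
    obtain ⟨ν, ε, hm, hr⟩ := hm
    obtain ⟨_, e, rfl⟩ := hr ▸ Set.nonempty_iff_ne_empty.2 hc
    obtain ⟨σ, _, hl⟩ := hiso
    have hj := congrArg Sigma.fst (hl (σ.symm e))
    obtain rfl : j = j' := hj
    exact injVersion_isoInvariant (hτ j).isoInvariant _ _
      (GraphMon.map_injective_iso sigma_mk_injective hiso')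
  · exact absurd ⟨⟨j, m⟩, hm⟩ h

theorem compWeight_empty {H : ColGraph V E (Σ j, L j)} : compWeight τ H ∅ = 1 := if_pos rfl

theorem compWeight_sameOn {K : ColGraph V E (Σ j, L j)} {H : ColGraph W E (Σ j, L j)} {f : V → W}
    {g : W → V} {F c : Set E} (h : K.SameOn H F f g) (hc : c ⊆ F) :
    compWeight τ K c = compWeight τ H c := by
  rcases c.eq_empty_or_nonempty with rfl | hne
  · rw [compWeight_empty, compWeight_empty]
  have : (fun m : GraphMon 0 (Σ j, L j) => m.Models K c) = fun m => m.Models H c := funext fun m =>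
    propext ⟨.of_sameOn h hc hne, .of_sameOn h.symm hc hne⟩
  rw [compWeight, compWeight, this]

theorem compWeight_image {K : ColGraph V A (Σ j, L j)} {H : ColGraph W E (Σ j, L j)} {ν : V → W}
    {θ : A → E} (h : K.Emb H ν θ) (c : Set A) :
    compWeight τ H (θ '' c) = compWeight τ K c := by
  rcases c.eq_empty_or_nonempty with rfl | hne
  · rw [Set.image_empty, compWeight_empty, compWeight_empty]
  have : (fun m : GraphMon 0 (Σ j, L j) => m.Models H (θ '' c)) = fun m => m.Models K c :=
    funext fun m => propext ⟨.of_image h hne, .of_emb h⟩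
  rw [compWeight, compWeight, this, if_neg hne.ne_empty, if_neg (hne.image θ).ne_empty]

namespace GraphMon

variable (T : GraphMon 0 (Σ j, L j))

/-- The edges of a component. -/
def compEdges (c : T.Comp) : Set T.E := {e | Quot.mk T.Adjacent e = c}

theorem adjacent_iff {e e' : T.E} : T.Adjacent e e' ↔ T.toCol.color.Adj Set.univ e e' := by
  simp only [ColGraph.Adj, Set.mem_univ, true_and]
  rfl

theorem comp_eq_compEdges (e : T.E) :
    T.toCol.color.comp Set.univ e = T.compEdges (Quot.mk _ e) := by
  ext e'
  have : Relation.EqvGen (T.toCol.color.Adj Set.univ) e e' ↔ Relation.EqvGen T.Adjacent e e' := by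
    constructor <;> intro h
    · exact eqvGen_mono (fun _ _ h => T.adjacent_iff.2 h) h
    · exact eqvGen_mono (fun _ _ h => T.adjacent_iff.1 h) h
  exact this.trans ⟨fun h => (Quot.eqvGen_sound h).symm, fun h => Quot.eqvGen_exact h.symm⟩

theorem compEdges_injective : Function.Injective T.compEdges := by
  intro c c' h
  obtain ⟨e, rfl⟩ := Quot.mk_surjective c
  have : e ∈ T.compEdges (Quot.mk _ e) := rfl
  rw [h] at this
  exact this

theorem comps_eq_range : T.toCol.color.comps Set.univ = Set.range T.compEdges := by
  ext c
  simp only [ColGraph.comps, Set.image_univ, Set.mem_range, comp_eq_compEdges]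
  constructor
  · rintro ⟨e, rfl⟩
    exact ⟨_, rfl⟩
  · rintro ⟨c, rfl⟩
    obtain ⟨e, rfl⟩ := Quot.mk_surjective c
    exact ⟨e, rfl⟩

theorem treelike_iff_forall_comp : T.toCol.color.Treelike Set.univ ↔
    ∀ c x y, T.MemComp x c → T.MemComp y c → T.toCol.color.Conn (T.compEdges c)ᶜ x y → x = y := by
  rw [ColGraph.Treelike, comps_eq_range, Set.forall_mem_range]
  simp only [← Set.compl_eq_univ_sdiff]
  exact ⟨fun h c x y hx hy => h c x hx y hy, fun h c x hx y hy => h c x y hx hy⟩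

theorem conn_of_memComp {c : T.Comp} {x y : T.G.V} (hx : T.MemComp x c) (hy : T.MemComp y c) :
    T.toCol.color.Conn (T.compEdges c) x y := by
  obtain ⟨e, rfl, hx⟩ := hx
  obtain ⟨e', he', hy⟩ := hy
  rw [← comp_eq_compEdges]
  refine ColGraph.conn_of_mem_comp ?_ hx hy
  rw [comp_eq_compEdges]
  exact he'

/-- The edge between a connector `x` and a component `c` is a bridge. Once it is removed, from `x`
one only reaches vertices linked to `x` outside `c` and components other than `c` that contain such
vertices; entering `c` at another vertex would contradict `Treelike`. -/
theorem isAcyclic_of_treelike (h : T.toCol.color.Treelike Set.univ) : T.compGraph.IsAcyclic := by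
  rw [treelike_iff_forall_comp] at h
  rw [SimpleGraph.isAcyclic_iff_forall_adj_isBridge]
  have key : ∀ (c : T.Comp) (x : T.Connector), T.MemComp x.1 c →
      ¬ (T.compGraph.deleteEdges {s(.inr x, .inl c)}).Reachable (.inr x) (.inl c) := by
    intro c x hx
    let S : T.Comp ⊕ T.Connector → Prop := Sum.elim
      (fun d => d ≠ c ∧ ∃ y, T.MemComp y d ∧ T.toCol.color.Conn (T.compEdges c)ᶜ x.1 y)
      (fun y => T.toCol.color.Conn (T.compEdges c)ᶜ x.1 y.1)
    have step : ∀ a b, (T.compGraph.deleteEdges {s(.inr x, .inl c)}).Adj a b → S a → S b := by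
      intro a b hab ha
      rw [SimpleGraph.deleteEdges_adj] at hab
      rcases a with d | y <;> rcases b with d' | y'
      · exact hab.1.elim
      · obtain ⟨hd, y, hy, hxy⟩ := ha
        refine hxy.trans ((T.conn_of_memComp hy hab.1).mono fun e he he' => hd ?_)
        exact he.symm.trans he'
      · have hyd : T.MemComp y.1 d' := hab.1
        refine ⟨fun hd => ?_, y.1, hyd, ha⟩
        subst hd
        have hxy : x = y := Subtype.ext (h _ _ _ hx hyd ha)
        subst hxy
        exact hab.2 rfl
      · exact hab.1.elim
    rintro ⟨p⟩
    have walk : ∀ a b, (T.compGraph.deleteEdges {s(.inr x, .inl c)}).Walk a b → S a → S b := by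
      intro a b p
      induction p with
      | nil => exact id
      | cons hab _ ih => exact fun ha => ih (step _ _ hab ha)
    exact (walk _ _ p (ColGraph.Conn.refl)).1 rfl
  rintro (c | x) (c' | x') hadj
  · exact hadj.elim
  · rw [SimpleGraph.isBridge_iff, Sym2.eq_swap]
    exact fun hr => key c x' hadj hr.symm
  · rw [SimpleGraph.isBridge_iff]
    exact key c' x hadj
  · exact hadj.elim

/-- A path outside `c` between distinct vertices `x` and `y` of `c` runs through other components.
It gives a walk from `x` that enters `c` through `y`, so the edge between `x` and `c` would not be a
bridge. -/
theorem treelike_of_isAcyclic (h : T.compGraph.IsAcyclic) : T.toCol.color.Treelike Set.univ := by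
  rw [treelike_iff_forall_comp]
  rw [SimpleGraph.isAcyclic_iff_forall_adj_isBridge] at h
  intro c x y hx hy hxy
  by_contra hne
  have conn : ∀ z, z ∈ T.toCol.color.verts (T.compEdges c)ᶜ → ∃ d, d ≠ c ∧ T.MemComp z d := by
    rintro z ⟨e, he, hz⟩
    exact ⟨Quot.mk _ e, he, e, rfl, hz⟩
  obtain ⟨hxv, hyv⟩ := hxy.eq_or.resolve_left hne
  obtain ⟨d, hd, hxd⟩ := conn x hxv
  let X : T.Connector := ⟨x, d, c, hd, hxd, hx⟩
  have hbr := SimpleGraph.isBridge_iff.1 (h (v := .inr X) (w := .inl c) hx)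
  have adj : ∀ (d : T.Comp) (z : T.Connector), d ≠ c ∨ z.1 ≠ x → T.MemComp z.1 d →
      (T.compGraph.deleteEdges {s(.inr X, .inl c)}).Adj (.inl d) (.inr z) := by
    intro d z hdz hz
    rw [SimpleGraph.deleteEdges_adj]
    refine ⟨hz, fun heq => ?_⟩
    rw [Set.mem_singleton_iff, Sym2.eq_iff] at heq
    rcases heq with ⟨h1, _⟩ | ⟨h1, h2⟩
    · cases h1
    · cases h1
      cases h2
      exact hdz.elim (fun h => h rfl) fun h => h rfl
  -- The property carried along the path: except for the starting point, the vertex lies in a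
  -- component other than `c` that is reached without the removed edge.
  let R : T.G.V → Prop := fun z => z = x ∨ ∃ d, d ≠ c ∧ T.MemComp z d ∧
    (T.compGraph.deleteEdges {s(.inr X, .inl c)}).Reachable (.inr X) (.inl d)
  have step : ∀ e ∈ (T.compEdges c)ᶜ, ∀ a b, T.toCol.color.Inc e a → T.toCol.color.Inc e b →
      R a → R b := by
    intro e he a b hea heb ha
    refine .inr ⟨Quot.mk _ e, he, ⟨e, rfl, heb⟩, ?_⟩
    rcases ha with rfl | ⟨d, hd, had, hr⟩
    · exact (adj _ X (.inl he) ⟨e, rfl, hea⟩).symm.reachable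
    · by_cases hde : d = Quot.mk _ e
      · exact hde ▸ hr
      · let Z : T.Connector := ⟨a, d, _, hde, had, ⟨e, rfl, hea⟩⟩
        exact hr.trans ((adj d Z (.inl hd) had).reachable.trans
          (adj _ Z (.inl he) ⟨e, rfl, hea⟩).symm.reachable)
  have all : ∀ a b, T.toCol.color.Conn (T.compEdges c)ᶜ a b → (R a ↔ R b) := by
    intro a b hab
    induction hab with
    | rel a b hab =>
      obtain ⟨e, he, rfl, rfl⟩ := hab
      exact ⟨step e he _ _ ColGraph.inc_src ColGraph.inc_tgt,
        step e he _ _ ColGraph.inc_tgt ColGraph.inc_src⟩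
    | refl a => rfl
    | symm a b _ ih => exact ih.symm
    | trans a b c _ _ ih1 ih2 => exact ih1.trans ih2
  rcases (all _ _ hxy).1 (.inl rfl) with h1 | ⟨d', hd', hyd', hr⟩
  · exact hne h1.symm
  · let Y : T.Connector := ⟨y, d', c, hd', hyd', hy⟩
    exact hbr (hr.trans ((adj d' Y (.inl hd') hyd').reachable.trans
      (adj c Y (.inr (Ne.symm hne)) hy).symm.reachable))

theorem compGraph_connected (hE : Nonempty T.E) : T.compGraph.Connected := by
  obtain ⟨e₀⟩ := hE
  let c₀ : T.Comp := Quot.mk _ e₀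
  have adj : ∀ (d : T.Comp) (z : T.Connector), T.MemComp z.1 d →
      T.compGraph.Adj (.inl d) (.inr z) := fun _ _ h => h
  have share : ∀ (a : T.G.V) (d d' : T.Comp), T.MemComp a d → T.MemComp a d' →
      T.compGraph.Reachable (.inl d) (.inl d') := by
    intro a d d' h h'
    by_cases hd : d = d'
    · exact hd ▸ .refl _
    · let Z : T.Connector := ⟨a, d, d', hd, h, h'⟩
      exact (adj d Z h).reachable.trans (adj d' Z h').symm.reachable
  let R : T.G.V → Prop := fun z => ∃ d, T.MemComp z d ∧ T.compGraph.Reachable (.inl c₀) (.inl d)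
  have step : ∀ e a b, T.toCol.color.Inc e a → T.toCol.color.Inc e b → R a → R b := by
    intro e a b hea heb ⟨d, hd, hr⟩
    exact ⟨Quot.mk _ e, ⟨e, rfl, heb⟩, hr.trans (share a _ _ hd ⟨e, rfl, hea⟩)⟩
  have all : ∀ a b, Relation.EqvGen (fun a b => ∃ e, T.G.src e = a ∧ T.G.tgt e = b) a b →
      (R a ↔ R b) := by
    intro a b hab
    induction hab with
    | rel a b hab =>
      obtain ⟨e, rfl, rfl⟩ := hab
      exact ⟨step e _ _ ColGraph.inc_src ColGraph.inc_tgt,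
        step e _ _ ColGraph.inc_tgt ColGraph.inc_src⟩
    | refl a => rfl
    | symm a b _ ih => exact ih.symm
    | trans a b c _ _ ih1 ih2 => exact ih1.trans ih2
  have hR : ∀ a, R a := fun a => (all _ _ (T.G.connected (T.G.src e₀) a)).1
    ⟨c₀, ⟨e₀, rfl, .inl rfl⟩, .refl _⟩
  have hcomp : ∀ d, T.compGraph.Reachable (.inl c₀) (.inl d) := by
    intro d
    obtain ⟨e, rfl⟩ := Quot.mk_surjective d
    obtain ⟨d', hd', hr⟩ := hR (T.G.src e)
    exact hr.trans (share _ _ _ hd' ⟨e, rfl, .inl rfl⟩)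
  have hall : ∀ a, T.compGraph.Reachable (.inl c₀) a := by
    rintro (d | ⟨z, d, d', h1, h2, h3⟩)
    · exact hcomp d
    · exact (hcomp d).trans (adj d _ h2).reachable
  exact (SimpleGraph.connected_iff _).2 ⟨fun a b => (hall a).symm.trans (hall b), ⟨.inl c₀⟩⟩

/-- Without edges the graph of components is empty, hence not connected and not a tree, while
`Treelike` holds for lack of components. -/
theorem isTree_or_isEmpty_iff :
    T.compGraph.IsTree ∨ IsEmpty T.E ↔ T.toCol.color.Treelike Set.univ := by
  rcases isEmpty_or_nonempty T.E with hE | hE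
  · refine iff_of_true (.inr hE) ?_
    rintro c ⟨e, _⟩
    exact hE.elim e
  · constructor
    · rintro (h | h)
      · exact T.treelike_of_isAcyclic h.isAcyclic
      · exact (not_isEmpty_of_nonempty _ h).elim
    · exact fun h => .inl ⟨T.compGraph_connected hE, T.isAcyclic_of_treelike h⟩

theorem component_models (c : T.Comp) :
    ((T.component c).map (Sigma.mk (T.compColor c))).Models T.toCol (T.compEdges c) := by
  refine ⟨Subtype.val, Subtype.val, ⟨Subtype.val_injective, Subtype.val_injective, fun _ => rfl,
    fun _ => rfl, fun e => ?_⟩, Subtype.range_coe⟩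
  have : ∀ (x : Σ j, L j) (j : J) (h : x.1 = j), x = ⟨j, h ▸ x.2⟩ := by
    rintro ⟨_, x⟩ _ rfl
    rfl
  exact this _ _ (T.compColor_eq e.2)

end GraphMon

theorem freeInj_eq_weight_univ (hτ : ∀ j, IsTrafficFunctional (τ j)) (T : GraphMon 0 (Σ j, L j)) :
    freeInj τ T = T.toCol.color.weight (compWeight τ T.toCol) Set.univ := by
  rw [freeInj, ColGraph.weight, T.comps_eq_range, finprod_mem_range T.compEdges_injective]
  simp only [compWeight_eq hτ (T.component_models _)]
  by_cases h : T.toCol.color.Treelike Set.univ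
  · rw [if_pos h, if_pos (T.isTree_or_isEmpty_iff.2 h)]
  · rw [if_neg h, if_neg (mt T.isTree_or_isEmpty_iff.1 h)]

/-- The injective version of the free product for a subgraph of a larger graph. -/
theorem freeInj_eq_weight (hτ : ∀ j, IsTrafficFunctional (τ j)) {T : GraphMon 0 (Σ j, L j)}
    {H : ColGraph V E (Σ j, L j)} {F : Set E} (h : T.Models H F) :
    freeInj τ T = H.color.weight (compWeight τ H) F := by
  obtain ⟨ν, ε, h, rfl⟩ := h
  rw [freeInj_eq_weight_univ hτ, ← Set.image_univ, h.emb.color.weight]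
  exact fun c _ => compWeight_image h.emb c

theorem freeInj_isoInvariant (hτ : ∀ j, IsTrafficFunctional (τ j)) :
    IsoInvariant (freeInj τ) := by
  intro T S h
  obtain ⟨ν, ε, h, _, hε, _⟩ := h.exists_embeds
  rw [freeInj_eq_weight hτ ⟨ν, ε, h, hε.range_eq⟩, freeInj_eq_weight_univ hτ]

theorem freeProd_eq_sum (T : GraphMon 0 (Σ j, L j)) :
    freeProd τ T = ∑ π, freeInj τ (T.quot π) := finsum_eq_sum_of_fintype _

theorem freeProd_isTrafficFunctional (hτ : ∀ j, IsTrafficFunctional (τ j)) :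
    IsTrafficFunctional (freeProd τ) where
  iso_inv T S h := by
    classical
    obtain ⟨σ, q, hq, hinj⟩ := h.exists_isQuot
    rw [freeProd_eq_sum, freeProd_eq_sum, hq.sum_quot (freeInj_isoInvariant hτ),
      Setoid.ker_eq_bot_iff.2 hinj]
    simp
  unital T hT := by
    have : Unique (Setoid T.G.V) := ⟨⟨⊥⟩, fun ρ => le_antisymm
      (fun x y _ => T.eq_of_isEmpty hT x y) bot_le⟩
    rw [freeProd_eq_sum, Fintype.sum_eq_single (default : Setoid T.G.V)
      fun ρ h => absurd (Subsingleton.elim _ _) h, freeInj_eq_weight_univ hτ]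
    have hE : IsEmpty (T.quot default).E := hT
    rw [Set.univ_eq_empty_iff.2 hE, ColGraph.weight_empty]

end CompWeight

end Traffic
end

noncomputable section

open scoped ComplexOrder

namespace Traffic

/-! ## Positivity of the free product -/

/-- A finitely supported combination involves finitely many indices. This permits placing the graphs
at hand in one finite ambient graph. -/
theorem PSD.of_fin {ι : Type*} {K : ι → ι → ℂ}
    (h : ∀ (k : ℕ) (f : Fin k → ι), PSD fun i j => K (f i) (f j)) : PSD K := by
  refine .of_sum_nonneg fun c => ?_
  let e := c.support.equivFin.symm
  have := (h _ fun i => (e i : ι)).sum_nonneg (Finsupp.equivFunOnFinite.symm fun i => c (e i))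
  rw [Finsupp.sum_fintype _ _ (by simp), Finset.sum_congr rfl fun i _ =>
    Finsupp.sum_fintype _ _ (by simp)] at this
  have key : ∀ f : ι → ℂ, ∑ x ∈ c.support, f x = ∑ i, f (e i) := by
    intro f
    rw [← Finset.sum_coe_sort, ← Equiv.sum_comp e]
  rw [Finsupp.sum, key]
  simp only [Finsupp.sum, key]
  exact this

/-- The Möbius function is real, since the system that determines it is invariant under conjugation.
-/
theorem star_partitionMob (V : Type) [Finite V] (ρ : Setoid V) :
    star (partitionMob V ⊥ ρ) = partitionMob V ⊥ ρ := by
  classical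
  refine congrFun (eq_of_sum_le_eq (f := fun ρ => star (partitionMob V ⊥ ρ))
    (g := partitionMob V ⊥) fun σ => ?_) ρ
  rw [← star_sum, sum_partitionMob]
  split_ifs <;> simp

theorem evalPoly_glue_star {L : Type u} {n : ℕ} (s : L → L) (τ : GraphMon 0 L → ℂ)
    (t : GraphPoly (n + 1) L) : evalPoly τ (t.glue (t.star s)) =
      t.sum fun m c => t.sum fun m' c' => c * star c' * τ (m.glue (m'.star s)) := by
  have h : ∀ (m : GraphMon (n + 1) L) (c : ℂ), (t.star s).sum
      (fun m' c' => Finsupp.single (m.glue m') (c * c')) =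
      t.sum fun m' c' => Finsupp.single (m.glue (m'.star s)) (c * star c') := by
    intro m c
    rw [GraphPoly.star, Finsupp.sum_sum_index (by simp) (by simp [mul_add])]
    refine Finsupp.sum_congr fun m' _ => ?_
    rw [Finsupp.sum_single_index (by simp)]
    rfl
  rw [GraphPoly.glue]
  simp only [h, evalPoly, map_finsuppSum, Finsupp.linearCombination_single, smul_eq_mul]

theorem isPositive_iff_psd {L : Type u} (s : L → L) (τ : GraphMon 0 L → ℂ) :
    IsPositive s τ ↔
      ∀ n, PSD fun t t' : GraphMon (n + 1) L => τ (t.glue (t'.star s)) := by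
  -- The coefficients are conjugated because `PSD` is antilinear in its first argument and
  -- `IsPositive` in the second one.
  have key : ∀ (n : ℕ) (t : GraphPoly (n + 1) L), evalPoly τ (t.glue (t.star s)) =
      (t.mapRange star (star_zero ℂ)).sum fun i a =>
        (t.mapRange star (star_zero ℂ)).sum fun j b => star a * τ (i.glue (j.star s)) * b := by
    intro n t
    rw [evalPoly_glue_star, Finsupp.sum_mapRange_index (by simp)]
    refine Finsupp.sum_congr fun m _ => ?_
    rw [Finsupp.sum_mapRange_index (by simp)]
    refine Finsupp.sum_congr fun m' _ => ?_
    rw [star_star]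
    ring
  constructor
  · intro h n
    refine .of_sum_nonneg fun c => ?_
    have := h n (c.mapRange star (star_zero ℂ))
    rw [key] at this
    have hc : (c.mapRange star (star_zero ℂ)).mapRange star (star_zero ℂ) = c := by
      ext m
      simp
    rwa [hc] at this
  · intro h n t
    rw [key]
    exact (h n).sum_nonneg _

section Core

variable {n : ℕ} {L : Type u} {V E : Type*} {m : GraphMon n L} {H : ColGraph V E L}
  {ν : m.G.V → V} {ε : m.E → E}

theorem GraphMon.Embeds.core_eq (h : m.Embeds H ν ε) (x : m.G.V) :
    H.core (Set.range ε) (ν x) = Set.range ν := by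
  ext y
  constructor
  · rintro (rfl | ⟨_, ⟨e, rfl⟩, hy⟩)
    · exact ⟨x, rfl⟩
    · obtain ⟨z, _, rfl⟩ := h.inc.1 hy
      exact ⟨z, rfl⟩
  · rintro ⟨z, rfl⟩
    rcases (m.conn_univ z x).eq_or with rfl | ⟨⟨e, _, hz⟩, _⟩
    · exact .inl rfl
    · exact .inr ⟨ε e, ⟨e, rfl⟩, h.inc.2 ⟨z, hz, rfl⟩⟩

theorem GraphMon.Embeds.conn (h : m.Embeds H ν ε) (x y : m.G.V) :
    H.Conn (Set.range ε) (ν x) (ν y) := by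
  rw [← Set.image_univ, h.emb.conn]
  exact m.conn_univ x y

end Core

/-- The mark of a vertex is the set of outputs located there. Preserving the marks, and leaving
unmatched only vertices without outputs, amounts to matching the `i`-th outputs for all `i`. The
root is the output `0`. -/
theorem isMarkMatching_iff_isOutMatching {V V' : Type*} {n : ℕ} {o : Fin (n + 1) → V}
    {o' : Fin (n + 1) → V'} {X : Set V} {X' : Set V'} (ho : ∀ i, o i ∈ X)
    {m : V → Set (Fin (n + 1))} {m' : V' → Set (Fin (n + 1))}
    (hm : ∀ x ∈ X, m x = {i | o i = x}) (hm' : ∀ x ∈ X', m' x = {i | o' i = x})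
    (M : Finset (V × V')) :
    IsMarkMatching m m' ∅ X X' M ∧ (o 0, o' 0) ∈ M ↔ IsOutMatching o o' X X' M := by
  constructor
  · rintro ⟨hM, -⟩
    refine ⟨hM.toIsMatching, fun i => ?_⟩
    have hi : i ∈ m (o i) := by
      rw [hm _ (ho i)]
      rfl
    by_cases h : ∃ y, (o i, y) ∈ M
    · obtain ⟨y, hy⟩ := h
      rw [hM.mark hy, hm' _ (hM.snd_mem hy)] at hi
      rwa [show o' i = y from hi]
    · push Not at h
      rw [hM.left _ (ho i) h] at hi
      exact hi.elim
  · intro hM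
    refine ⟨⟨hM.toIsMatching, ?_, ?_, ?_⟩, hM.out 0⟩
    · intro x y h
      rw [hm _ (hM.fst_mem h), hm' _ (hM.snd_mem h)]
      ext i
      constructor
      · intro (hi : o i = x)
        exact hM.snd_unique (hi ▸ hM.out i) h
      · intro (hi : o' i = y)
        exact hM.fst_unique (hi ▸ hM.out i) h
    · intro x hx h
      rw [hm _ hx]
      refine Set.eq_empty_of_forall_notMem fun i hi => ?_
      exact h _ ((show o i = x from hi) ▸ hM.out i)
    · intro y hy h
      rw [hm' _ hy]
      refine Set.eq_empty_of_forall_notMem fun i hi => ?_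
      exact h _ ((show o' i = y from hi) ▸ hM.out i)

/-! ### From the positivity of each factor to that of the free product. -/

section Free

variable {J : Type w} {L : J → Type u} {τ : ∀ j, GraphMon 0 (L j) → ℂ} {s : ∀ j, L j → L j}

theorem compWeight_isLocal {V V' E E' : Type*} (H : ColGraph V E (Σ j, L j))
    (H' : ColGraph V' E' (Σ j, L j)) :
    ColGraph.IsLocal H.color H'.color fun M => compWeight τ (H.amalg H' M) where
  empty _ := compWeight_empty
  congr M N c hM hN h := by
    obtain ⟨f, g, hfg⟩ := ColGraph.exists_sameOn_amalg (G := H) (G' := H') hM hN h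
    refine compWeight_sameOn hfg ?_
    rintro (e | e) he <;> exact he

/-- The labelled graph with reversed edges and adjoint labels. -/
def ColGraph.star {V E : Type*} (s : ∀ j, L j → L j) (H : ColGraph V E (Σ j, L j)) :
    ColGraph V E (Σ j, L j) := ⟨H.tgt, H.src, fun e => sigmaStar s (H.col e)⟩

/-- A monochromatic rooted subgraph, as a monomial. -/
def ColGraph.MonoRooted.mon {V E : Type} [Finite V] [Finite E] {H : ColGraph V E (Σ j, L j)} {j : J}
    {n : ℕ} {a : Set E × V × (Fin n → V)} (h : H.color.MonoRooted j n a) :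
    GraphMon (n + 1) (L j) where
  E := a.1
  lab e := h.col e e.2 ▸ (H.col e).2
  G :=
    { V := H.core a.1 a.2.1
      src := fun e => ⟨H.src e, .inr ⟨e, e.2, .inl rfl⟩⟩
      tgt := fun e => ⟨H.tgt e, .inr ⟨e, e.2, .inr rfl⟩⟩
      out := Fin.cons ⟨a.2.1, .inl rfl⟩ fun i => ⟨a.2.2 i, h.mem i⟩
      finite_V := inferInstance
      finite_E := inferInstance
      nonempty_V := ⟨⟨a.2.1, .inl rfl⟩⟩
      connected := by
        have key : ∀ x y, H.Conn a.1 x y → ∀ (hx : x ∈ H.core a.1 a.2.1)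
            (hy : y ∈ H.core a.1 a.2.1), Relation.EqvGen
            (fun p q : H.core a.1 a.2.1 => ∃ e : a.1,
              (⟨H.src e, .inr ⟨e, e.2, .inl rfl⟩⟩ : H.core a.1 a.2.1) = p ∧
              (⟨H.tgt e, .inr ⟨e, e.2, .inr rfl⟩⟩ : H.core a.1 a.2.1) = q) ⟨x, hx⟩ ⟨y, hy⟩ := by
          intro x y hxy
          induction hxy with
          | rel x y hxy =>
            obtain ⟨e, he, rfl, rfl⟩ := hxy
            exact fun _ _ => .rel _ _ ⟨⟨e, he⟩, rfl, rfl⟩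
          | refl x => exact fun _ _ => .refl _
          | symm x y _ ih => exact fun hx hy => .symm _ _ (ih hy hx)
          | trans x y z h1 h2 ih1 ih2 =>
            intro hx hz
            have hy : y ∈ H.core a.1 a.2.1 := by
              rcases ColGraph.Conn.eq_or (G := H) (F := a.1) h1 with rfl | h
              · exact hx
              · exact .inr h.2
            exact .trans _ _ _ (ih1 hx hy) (ih2 hy hz)
        rintro ⟨x, hx⟩ ⟨y, hy⟩
        exact key x y ((h.conn x hx).symm.trans (h.conn y hy)) hx hy }

section Mono

variable {V E : Type} [Finite V] [Finite E] {H : ColGraph V E (Σ j, L j)} {j : J}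
  {n : ℕ} {a b : Set E × V × (Fin n → V)}

theorem ColGraph.MonoRooted.embeds (h : H.color.MonoRooted j n a) :
    (h.mon.map (Sigma.mk j)).Embeds H Subtype.val Subtype.val where
  inj := Subtype.val_injective
  inj' := Subtype.val_injective
  src _ := rfl
  tgt _ := rfl
  lab e := by
    have : ∀ (x : Σ j, L j) (j : J) (h : x.1 = j), x = ⟨j, h ▸ x.2⟩ := by
      rintro ⟨_, x⟩ _ rfl
      rfl
    exact this _ _ (h.col e.1 e.2)

theorem ColGraph.MonoRooted.embeds_star (h : H.color.MonoRooted j n a) :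
    ((h.mon.star (s j)).map (Sigma.mk j)).Embeds (H.star s) Subtype.val Subtype.val where
  inj := Subtype.val_injective
  inj' := Subtype.val_injective
  src _ := rfl
  tgt _ := rfl
  lab e := congrArg (sigmaStar s) (h.embeds.lab e)

/-- A monochromatic gluing is weighted by the injective version of `τ j`; the root and the tuple are
the `n + 1` outputs. -/
theorem monoKernel_eq_matchSum [Fintype V] (hτ : ∀ j, IsTrafficFunctional (τ j))
    (ha : H.color.MonoRooted j n a) (hb : H.color.MonoRooted j n b) :
    ColGraph.monoKernel H.color (fun M => compWeight τ (H.amalg (H.star s) M)) n a b =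
      matchSum (injVersion (τ j)) ha.mon (hb.mon.star (s j)) := by
  classical
  rw [matchSum_eq_of_map_embeds (injVersion_isoInvariant (hτ j).isoInvariant) (Sigma.mk j)
    ha.embeds hb.embeds_star (fun M => compWeight τ (H.amalg (H.star s) M)
      (sumSet (Set.range Subtype.val) (Set.range Subtype.val)))
    fun M m _ hm => compWeight_eq hτ hm]
  rw [ColGraph.monoKernel]
  have h1 : ∀ {a : Set E × V × (Fin n → V)} (h : H.color.MonoRooted j n a),
      Set.range (Subtype.val : h.mon.E → E) = a.1 := fun h => Subtype.range_coe
  have h2 : ∀ {a : Set E × V × (Fin n → V)} (h : H.color.MonoRooted j n a),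
      Set.range (Subtype.val : h.mon.G.V → V) = H.core a.1 a.2.1 := fun h => Subtype.range_coe
  refine Finset.sum_congr (Finset.filter_congr fun N _ => ?_) fun N _ => ?_
  · erw [h2 ha, h2 hb]
    constructor
    · rintro ⟨hN, h0, hi⟩
      exact ⟨hN, Fin.cases h0 hi⟩
    · rintro ⟨hN, hi⟩
      exact ⟨hN, hi 0, fun i => hi i.succ⟩
  · erw [h1 ha, h1 hb]

/-- By `matchSum_injVersion` the kernel is a combination, with the real coefficients of Möbius
inversion, of values of `τ j` at gluings of quotients. The positivity of the factors enters the
proof here. -/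
theorem psd_monoKernel [Fintype V] (hτ : ∀ j, IsTrafficFunctional (τ j))
    (hpos : ∀ j, IsPositive (s j) (τ j)) (j : J) (n : ℕ) :
    PSD fun a b : {a : Set E × V × (Fin n → V) // H.color.MonoRooted j n a} =>
      ColGraph.monoKernel H.color (fun M => compWeight τ (H.amalg (H.star s) M)) n a b := by
  have h1 := (isPositive_iff_psd _ _).1 (hpos j) n
  have h2 := h1.sum_sum (ι := {a : Set E × V × (Fin n → V) // H.color.MonoRooted j n a})
    (X := fun a => Setoid a.2.mon.G.V) (fun a ρ => a.2.mon.quot ρ)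
    (fun a ρ => partitionMob a.2.mon.G.V ⊥ ρ)
  refine (congrArg PSD ?_).mp h2
  ext a b
  rw [monoKernel_eq_matchSum hτ a.2 b.2, matchSum_injVersion (hτ j).isoInvariant]
  simp only [star_partitionMob]
  rfl

end Mono

theorem psd_matchSum_freeInj (hτ : ∀ j, IsTrafficFunctional (τ j))
    (hpos : ∀ j, IsPositive (s j) (τ j)) {n : ℕ} {ι : Type} [Finite ι]
    (X : ι → GraphMon (n + 1) (Σ j, L j)) :
    PSD fun a b => matchSum (freeInj τ) (X a) ((X b).star (sigmaStar s)) := by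
  classical
  have := Fintype.ofFinite ι
  have hE : ∀ i, Finite (X i).E := fun i => (X i).G.finite_E
  -- All the graphs are placed in one disjoint union. The isolated vertex `none` has no mark and is
  -- the unit vector used for centering.
  let V₀ := Option (Σ i, (X i).G.V)
  let E₀ := Σ i, (X i).E
  let H : ColGraph V₀ E₀ (Σ j, L j) := ⟨fun e => some ⟨e.1, (X e.1).G.src e.2⟩,
    fun e => some ⟨e.1, (X e.1).G.tgt e.2⟩, fun e => (X e.1).lab e.2⟩
  let ν : ∀ i, (X i).G.V → V₀ := fun i x => some ⟨i, x⟩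
  let ε : ∀ i, (X i).E → E₀ := fun i e => ⟨i, e⟩
  have hν : ∀ i, Function.Injective (ν i) := fun i x y h => by
    exact eq_of_heq (Sigma.mk.inj (Option.some.inj h)).2
  have hε : ∀ i, Function.Injective (ε i) := fun i x y h => by
    exact eq_of_heq (Sigma.mk.inj h).2
  have hemb : ∀ i, (X i).Embeds H (ν i) (ε i) := fun i =>
    ⟨hν i, hε i, fun _ => rfl, fun _ => rfl, fun _ => rfl⟩
  have hemb' : ∀ i, ((X i).star (sigmaStar s)).Embeds (H.star s) (ν i) (ε i) := fun i =>
    ⟨hν i, hε i, fun _ => rfl, fun _ => rfl, fun _ => rfl⟩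
  let m : V₀ → Set (Fin (n + 1)) := fun x => x.elim ∅ fun p => {k | (X p.1).G.out k = p.2}
  have hm : ∀ i, ∀ x ∈ Set.range (ν i), m x = {k | ν i ((X i).G.out k) = x} := by
    rintro i _ ⟨x, rfl⟩
    ext k
    exact (hν i).eq_iff.symm
  have hker := ColGraph.psd_kernel H.color (w := fun M => compWeight τ (H.amalg (H.star s) M))
    (m := m) (z := ∅) (compWeight_isLocal H (H.star s)) (r₀ := none) rfl
    fun j n => psd_monoKernel hτ hpos j n
  refine (congrArg PSD ?_).mp (hker.comap fun i => ⟨(Set.range (ε i), ν i ((X i).G.out 0)), ?_⟩)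
  · ext a b
    rw [matchSum_eq_of_embeds (freeInj_isoInvariant hτ) (hemb a) (hemb' b)
      (fun M => (H.color.amalg H.color.rev M).weight (compWeight τ (H.amalg (H.star s) M))
        (sumSet (Set.range (ε a)) (Set.range (ε b))))]
    · rw [ColGraph.kernel, ColGraph.pairing]
      refine Finset.sum_congr ?_ fun M _ => rfl
      ext M
      refine Iff.trans (by simp only [Finset.mem_filter]; rfl)
        (Iff.trans (and_congr_right fun _ => ?_) (by simp only [Finset.mem_filter]; rfl))
      have h1 : H.color.core (Set.range (ε a)) (ν a ((X a).G.out 0)) = Set.range (ν a) :=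
        (hemb a).core_eq _
      have h2 : H.color.rev.core (Set.range (ε b)) (ν b ((X b).G.out 0)) = Set.range (ν b) :=
        (hemb' b).core_eq _
      rw [h1, h2]
      exact isMarkMatching_iff_isOutMatching (o := ν a ∘ (X a).G.out)
        (o' := ν b ∘ (X b).G.out) (X := Set.range (ν a)) (X' := Set.range (ν b)) (fun i => Set.mem_range_self _) (hm a) (hm b) M
    · intro M T _ hT
      rw [freeInj_eq_weight hτ hT, ColGraph.color_amalg]
      rfl
  · intro x hx
    have h1 : H.color.core (Set.range (ε i)) (ν i ((X i).G.out 0)) = Set.range (ν i) :=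
      (hemb i).core_eq _
    rw [h1] at hx
    obtain ⟨x, rfl⟩ := hx
    exact (hemb i).conn _ _

/-- The free product of positive functionals is positive. -/
theorem freeProd_isPositive (hτ : ∀ j, IsTrafficFunctional (τ j))
    (hpos : ∀ j, IsPositive (s j) (τ j)) : IsPositive (sigmaStar s) (freeProd τ) := by
  rw [isPositive_iff_psd]
  refine fun n => .of_fin fun k t => ?_
  -- The index runs over all quotients of all the monomials; summing over the quotients gives the
  -- free product by `sum_quot_glue`.
  have h := psd_matchSum_freeInj hτ hpos (ι := Σ a : Fin k, Setoid (t a).G.V)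
    fun p => (t p.1).quot p.2
  have h2 := h.sum_sum (X := fun a => Setoid (t a).G.V) (fun a ρ => ⟨a, ρ⟩) (fun _ _ => 1)
  refine (congrArg PSD ?_).mp h2
  ext a b
  rw [freeProd_eq_sum, sum_quot_glue (freeInj_isoInvariant hτ)]
  simp only [star_one, one_mul]
  rfl

end Free

end Traffic
end

noncomputable section

namespace Traffic

namespace ColGraph

/-! ## Erasing an edge inside of a component -/

section Insert

variable {V E J : Type*} {G : ColGraph V E J} {F F' C : Set E} {r x : V} {j : J} {p : V → V} {e : E}

/-- A path of color `j` issued from the root cannot leave `C`, because the edges outside `C` that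
meet the core have another color. -/
theorem Decomp.conn_inter (D : G.Decomp F' r j C p) (hF : F ⊆ F')
    (h : G.Conn {e | e ∈ F ∧ G.col e = j} r x) : G.Conn (C ∩ F) r x := by
  have key : ∀ a b, G.Conn {e | e ∈ F ∧ G.col e = j} a b →
      (a ∈ G.core C r → b ∈ G.core C r ∧ G.Conn (C ∩ F) a b) ∧
        (b ∈ G.core C r → a ∈ G.core C r ∧ G.Conn (C ∩ F) a b) := by
    intro a b h
    induction h with
    | rel a b h =>
      obtain ⟨e, ⟨he, hj⟩, rfl, rfl⟩ := h
      have hC : ∀ y, G.Inc e y → y ∈ G.core C r → e ∈ C := fun y hy hyc => by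
        by_contra hne
        exact D.col_ne e (hF he) hne y hyc hy hj
      exact ⟨fun h => ⟨.inr ⟨e, hC _ inc_src h, inc_tgt⟩, .edge ⟨hC _ inc_src h, he⟩⟩,
        fun h => ⟨.inr ⟨e, hC _ inc_tgt h, inc_src⟩, .edge ⟨hC _ inc_tgt h, he⟩⟩⟩
    | refl a => exact ⟨fun h => ⟨h, .refl⟩, fun h => ⟨h, .refl⟩⟩
    | symm a b _ ih =>
      exact ⟨fun h => ⟨(ih.2 h).1, (ih.2 h).2.symm⟩, fun h => ⟨(ih.1 h).1, (ih.1 h).2.symm⟩⟩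
    | trans a b c _ _ ih1 ih2 =>
      refine ⟨fun h => ?_, fun h => ?_⟩
      · have h1 := ih1.1 h
        have h2 := ih2.1 h1.1
        exact ⟨h2.1, h1.2.trans h2.2⟩
      · have h2 := ih2.2 h
        have h1 := ih1.2 h2.1
        exact ⟨h1.1, h1.2.trans h2.2⟩
  exact ((key _ _ h).1 (.inl rfl)).2

/-- An edge whose endpoints are linked by edges of its color may be erased. -/
theorem weight_insert [Finite V] [Finite E] (he : e ∉ F)
    (hF : ∀ x ∈ G.core F (G.src e), G.Conn F (G.src e) x)
    (h : G.Conn {f | f ∈ F ∧ G.col f = G.col e} (G.src e) (G.tgt e)) {w : Set E → ℂ}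
    (hw : w ∅ = 1) : G.weight (fun c => w (c \ {e})) (insert e F) = G.weight w F := by
  -- If a decomposition of `F` remains one when its root component absorbs `e`, the core and the
  -- branches are the same with and without `e`. It remains to find such a decomposition when either
  -- set is treelike; otherwise both weights vanish.
  have key : ∀ C p, G.Decomp F (G.src e) (G.col e) C p →
      G.Decomp (insert e F) (G.src e) (G.col e) (insert e C) p →
      G.weight (fun c => w (c \ {e})) (insert e F) = G.weight w F := by
    intro C p D D'
    have heC : e ∉ C := fun h => he (D.subset h)
    have hcore : G.core (insert e C) (G.src e) = G.core C (G.src e) := by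
      refine Set.Subset.antisymm ?_ (Decomp.core_subset (Set.subset_insert _ _))
      have htgt : G.tgt e ∈ G.core C (G.src e) := by
        rcases (D.conn_inter subset_rfl h).eq_or with h | h
        · exact .inl h.symm
        · exact .inr (verts_mono Set.inter_subset_left h.2)
      rintro x (rfl | ⟨f, rfl | hf, hx⟩)
      · exact .inl rfl
      · rcases hx with rfl | rfl
        exacts [.inl rfl, htgt]
      · exact .inr ⟨f, hf, hx⟩
    have hbranch : ∀ v, D'.branch v = D.branch v := by
      intro v
      ext f
      constructor
      · rintro ⟨rfl | hf, hf', hv⟩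
        · exact (hf' (.inl rfl)).elim
        · exact ⟨hf, fun h => hf' (.inr h), hv⟩
      · rintro ⟨hf, hf', hv⟩
        refine ⟨.inr hf, ?_, hv⟩
        rintro (rfl | h)
        exacts [he hf, hf' h]
    rw [D'.weight_eq (by simpa using hw), D.weight_eq hw, hcore]
    have hC : insert e C \ {e} = C := by
      rw [Set.insert_sdiff_of_mem _ (Set.mem_singleton e), Set.sdiff_singleton_eq_self heC]
    rw [hC]
    refine congrArg _ (finprod_mem_congr rfl fun v _ => ?_)
    rw [hbranch]
    have : ∀ c, c ⊆ D.branch v → w (c \ {e}) = w c := fun c hc => by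
      rw [Set.sdiff_singleton_eq_self fun h => he (hc h).1]
    exact (⟨fun _ _ => rfl, fun _ _ => rfl, fun _ _ => rfl, fun _ _ => rfl, fun _ _ => rfl⟩ :
      G.SameOn G (D.branch v) id id).weight_eq this
  by_cases hT : G.Treelike F
  · obtain ⟨p, D⟩ := hT.exists_decomp hF (G.col e)
    set C := G.rootComp F (G.src e) (G.col e)
    have hconn := D.conn_inter subset_rfl h
    have htgt : G.tgt e ∈ G.core C (G.src e) := by
      rcases hconn.eq_or with h | h
      · exact .inl h.symm
      · exact .inr (verts_mono Set.inter_subset_left h.2)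
    have hcore : G.core (insert e C) (G.src e) ⊆ G.core C (G.src e) := by
      rintro x (rfl | ⟨f, rfl | hf, hx⟩)
      · exact .inl rfl
      · rcases hx with rfl | rfl
        exacts [.inl rfl, htgt]
      · exact .inr ⟨f, hf, hx⟩
    refine key C p D ⟨Set.insert_subset_insert D.subset, ?_, fun x hx => ?_,
      fun x hx => D.fix x (hcore hx), ?_, ?_, ?_⟩
    · rintro f (rfl | hf)
      exacts [rfl, D.col f hf]
    · exact (D.conn x (hcore hx)).mono (Set.subset_insert _ _)
    · rintro f (rfl | hf) hfC
      · exact (hfC (.inl rfl)).elim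
      · exact D.const f hf fun h => hfC (.inr h)
    · rintro f (rfl | hf) hfC x hx
      · exact (hfC (.inl rfl)).elim
      · exact D.col_ne f hf (fun h => hfC (.inr h)) x (hcore hx)
    · rintro x (rfl | ⟨f, rfl | hf, hx⟩)
      · exact .refl
      · exact .inc (.inl rfl) inc_src hx
      · exact (hF x (.inr ⟨f, hf, hx⟩)).mono (Set.subset_insert _ _)
  by_cases hT' : G.Treelike (insert e F)
  · have hF' : ∀ x ∈ G.core (insert e F) (G.src e), G.Conn (insert e F) (G.src e) x := by
      rintro x (rfl | ⟨f, rfl | hf, hx⟩)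
      · exact .refl
      · exact .inc (.inl rfl) inc_src hx
      · exact (hF x (.inr ⟨f, hf, hx⟩)).mono (Set.subset_insert _ _)
    obtain ⟨p, D'⟩ := hT'.exists_decomp hF' (G.col e)
    set C' := G.rootComp (insert e F) (G.src e) (G.col e)
    have heC : e ∈ C' := ⟨.inl rfl, rfl, .refl⟩
    have hins : insert e (C' ∩ F) = C' := by
      ext f
      constructor
      · rintro (rfl | h)
        exacts [heC, h.1]
      · intro h
        rcases D'.subset h with rfl | hf
        exacts [.inl rfl, .inr ⟨h, hf⟩]
    -- The root component stays connected without `e`, whose endpoints are linked by other edges of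
    -- its color.
    have hedge : G.Conn (C' ∩ F) (G.src e) (G.tgt e) := D'.conn_inter (Set.subset_insert _ _) h
    refine key (C' ∩ F) p ⟨Set.inter_subset_right, fun f hf => D'.col f hf.1, fun x hx => ?_,
      fun x hx => D'.fix x (Decomp.core_subset Set.inter_subset_left hx), fun f hf hfC =>
        D'.const f (.inr hf) fun h => hfC ⟨h, hf⟩, fun f hf hfC x hx =>
        D'.col_ne f (.inr hf) (fun h => hfC ⟨h, hf⟩) x (Decomp.core_subset Set.inter_subset_left hx),
        hF⟩ (hins.symm ▸ D')
    refine (D'.conn x (Decomp.core_subset Set.inter_subset_left hx)).lift id fun f hf => ?_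
    rcases D'.subset hf with rfl | hfF
    · exact hedge
    · exact .edge ⟨hf, hfF⟩
  · rw [weight, weight, if_neg hT, if_neg hT']

end Insert

/-! ## Amalgams with a monochromatic graph -/

section Amalg

variable {V V' E E' J : Type*} [Fintype V] [Fintype V'] [Finite E] [Finite E']
  {G : ColGraph V E J} {G' : ColGraph V' E' J} {F C : Set E} {F' : Set E'}
  {w : Finset (V × V') → Set (E ⊕ E') → ℂ} {r : V} {r' : V'} {j : J} {p : V → V}
  {M : Finset (V × V')}

open Classical in
-- The second graph is its own root component, with empty branches. So only matchings inside the
-- core of the first graph contribute, and its branches give a factor that does not depend on the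
-- matching.
theorem Decomp.weight_amalg_mono (D : G.Decomp F r j C p) (hcol : ∀ e ∈ F', G'.col e = j)
    (hconn : ∀ x ∈ G'.core F' r', G'.Conn F' r' x) (hw : IsLocal G G' w)
    (hM : IsMatching (G.core F r) (G'.core F' r') M) (hr : (r, r') ∈ M) :
    (G.amalg G' M).weight (w M) (sumSet F F') = if ∀ x y, (x, y) ∈ M → x ∈ G.core C r then
      (∏ v with v ∈ G.core C r, (G.amalg G' ∅).weight (w ∅) (sumSet (D.branch v) ∅)) *
        w M (sumSet C F') else 0 := by
  have D' : G'.Decomp F' r' j F' id := ⟨subset_rfl, hcol, hconn, fun _ _ => rfl,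
    fun e he he' => (he' he).elim, fun e he he' => (he' he).elim, hconn⟩
  have hb : ∀ v, D'.branch v = ∅ := fun v => Set.eq_empty_of_forall_notMem fun e he => he.2.1 he.1
  split_ifs with h
  · have hc : ∀ x y, (x, y) ∈ M → (p x, id y) ∈ M := fun x y hxy => by
      rwa [D.fix x (h x y hxy)]
    have hN : M = M.filter fun x => x.1 ∈ G.core C r :=
      (Finset.filter_true_of_mem fun x hx => h x.1 x.2 hx).symm
    have hB : ∀ (v : V) (N : Finset (V × V')), N ⊆ M →
        (G.amalg G' N).weight (w N) (sumSet (D.branch v) ∅) =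
          (G.amalg G' ∅).weight (w ∅) (sumSet (D.branch v) ∅) := by
      intro v N hNM
      refine hw.weight_congr (hM.mono hNM subset_rfl subset_rfl).to_univ (.empty _ _) ?_
      rintro x _ y ⟨e, he, _⟩
      exact he.elim
    rw [D.weight_amalg D' hw hM hr hc hN, mul_comm]
    congr 1
    simp only [hb]
    rw [Finset.prod_congr rfl fun x _ => hB x.1 _ (Finset.filter_subset _ _), sumSet_empty,
      weight_empty, Finset.prod_const_one, mul_one,
      ← Finset.prod_filter_not_mul_prod_filter (Finset.univ.filter fun v => v ∈ G.core C r)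
        (fun v => ∀ v', (v, v') ∉ M)]
    congr 1
    swap
    · rw [Finset.filter_filter]
    refine Finset.prod_nbij Prod.fst ?_ ?_ ?_ fun _ _ => rfl
    · rintro ⟨x, y⟩ hxy
      simp only [Finset.mem_filter, Finset.mem_univ, true_and, not_forall, not_not]
      exact ⟨h x y hxy, y, hxy⟩
    · rintro ⟨x, y⟩ hxy ⟨x', y'⟩ hxy' (rfl : x = x')
      rw [hM.snd_unique hxy hxy']
    · intro x hx
      simp only [Finset.coe_filter, not_forall, not_not,
        Set.mem_ofPred_eq] at hx
      obtain ⟨y, hy⟩ := hx.2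
      exact ⟨(x, y), hy, rfl⟩
  · refine if_neg fun hT => h fun x y hxy => ?_
    have := D.compat_of_treelike D' hM hr hT hxy
    rw [← hM.fst_unique this hxy]
    exact (D.p_mem_conn (hM.fst_mem hxy)).1

omit [Fintype V] [Fintype V'] [Finite E] [Finite E'] in
theorem exists_decomp_of_weight_amalg_ne_zero (hF : ∀ x ∈ G.core F r, G.Conn F r x)
    (hF' : ∀ x ∈ G'.core F' r', G'.Conn F' r' x)
    (hM : IsMatching (G.core F r) (G'.core F' r') M) (hr : (r, r') ∈ M)
    (h : (G.amalg G' M).weight (w M) (sumSet F F') ≠ 0) (j : J) :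
    ∃ C p, G.Decomp F r j C p := by
  have hT : (G.amalg G' M).Treelike (sumSet F F') := by
    by_contra h'
    exact h (if_neg h')
  obtain ⟨P, DU⟩ := hT.exists_decomp (amalg_conn hM hr hF hF') j
  exact DU.restrict (ι := Sum.inl) (ε := Sum.inl) Sum.inl_injective (fun _ h => h)
    (fun _ => rfl) (fun _ => rfl) (fun _ => rfl) hF

end Amalg

end ColGraph

end Traffic
end

noncomputable section

namespace Traffic

/-! ## Replacing an edge by a graph -/

section Fill

variable {n : ℕ} {L : Type u} {I : Type}

/-- Replace every edge `i` of `g` by the monomial `m i`. -/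
def TGraph.fill (g : TGraph n I) (m : I → GraphMon 2 L) : GraphMon n L :=
  ⟨Σ i, (m i).E, g.comp fun i => (m i).G, fun p => (m p.1).lab p.2⟩

open Classical in
/-- Replace one edge of a monomial by a monomial with two outputs. -/
def GraphMon.replace (T : GraphMon n L) (e : T.E) (h : GraphMon 2 L) : GraphMon n L :=
  T.G.fill fun k => if k = e then h else .edge (T.lab k)

/-- Take the endpoints of an edge as outputs. -/
def GraphMon.outAt (T : GraphMon n L) (e : T.E) : GraphMon 2 L :=
  ⟨T.E, T.G.withOut ![T.G.src e, T.G.tgt e], T.lab⟩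

/-- The vertices of `g` in a substitution. -/
def TGraph.fillMk (g : TGraph n I) (m : I → GraphMon 2 L) : g.V → (g.fill m).G.V :=
  fun x => Quot.mk _ (.inl x)

theorem edge_vertex {M : GraphMon 2 L} {l : L} (h : M = .edge l) (y : M.G.V) :
    y = M.G.out 0 ∨ y = M.G.out 1 := by
  subst h
  exact (show ∀ y : Fin 2, y = 0 ∨ y = 1 by decide) y

theorem edge_out_ne {M : GraphMon 2 L} {l : L} (h : M = .edge l) : M.G.out 1 ≠ M.G.out 0 := by
  subst h
  exact (show (1 : Fin 2) ≠ 0 by decide)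

theorem edge_src {M : GraphMon 2 L} {l : L} (h : M = .edge l) (a : M.E) :
    M.G.src a = M.G.out 0 ∧ M.G.tgt a = M.G.out 1 ∧ M.lab a = l := by
  subst h
  exact ⟨rfl, rfl, rfl⟩

theorem edge_unique {M : GraphMon 2 L} {l : L} (h : M = .edge l) :
    Nonempty M.E ∧ ∀ a b : M.E, a = b := by
  subst h
  exact ⟨⟨()⟩, fun _ _ => rfl⟩

/-- Substituting `h` for `e` amounts to gluing `h` at the endpoints of `e` and then erasing `e`. -/
theorem TGraph.exists_isGluing_fill (T : GraphMon 0 L) (e : T.E) (m : T.E → GraphMon 2 L)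
    (hm : ∀ k, k ≠ e → m k = .edge (T.lab k)) {h : GraphMon 2 L} (he : m e = h) :
    ∃ q ε, (T.outAt e).IsGluing h (T.G.fill m) q ε ∧ Set.range ε = {.inl e}ᶜ ∧
      q ∘ Sum.inl = T.G.fillMk m := by
  classical
  subst he
  let q : T.G.V ⊕ (m e).G.V → (T.G.fill m).G.V :=
    Sum.elim (T.G.fillMk m) fun y => Quot.mk _ (.inr ⟨e, y⟩)
  let ε : (Σ k, (m k).E) → T.E ⊕ (m e).E := fun p =>
    if hp : p.1 = e then .inr (hp ▸ p.2) else .inl p.1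
  have hεe : ∀ a, ε ⟨e, a⟩ = .inr a := fun a => dif_pos rfl
  have hεk : ∀ k a, k ≠ e → ε ⟨k, a⟩ = .inl k := fun k a hk => dif_neg hk
  have h0 : ∀ k, (Quot.mk _ (.inr ⟨k, (m k).G.out 0⟩) : (T.G.fill m).G.V) =
      T.G.fillMk m (T.G.src k) := fun k => Quot.sound (.input k)
  have h1 : ∀ k, (Quot.mk _ (.inr ⟨k, (m k).G.out 1⟩) : (T.G.fill m).G.V) =
      T.G.fillMk m (T.G.tgt k) := fun k => Quot.sound (.output k)
  refine ⟨q, ε, ⟨?_, fun τ => ?_, ?_, ?_, ?_, ?_⟩, ?_, rfl⟩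
  · intro z
    obtain ⟨x | ⟨k, y⟩, rfl⟩ := Quot.mk_surjective z
    · exact ⟨.inl x, rfl⟩
    · by_cases hk : k = e
      · subst hk
        exact ⟨.inr y, rfl⟩
      · rcases edge_vertex (hm k hk) y with rfl | rfl
        · exact ⟨.inl (T.G.src k), (h0 k).symm⟩
        · exact ⟨.inl (T.G.tgt k), (h1 k).symm⟩
  · constructor
    · intro hτ i
      refine hτ (Setoid.ker_def.2 ?_)
      fin_cases i
      · exact (h0 e).symm
      · exact (h1 e).symm
    · intro hτ
      -- It induces a left inverse of `q` modulo `τ`, which shows that `q` identifies no more than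
      -- the merging of the outputs imposes.
      let f : T.G.V ⊕ (Σ k, (m k).G.V) → Quotient τ := Sum.elim (fun x => ⟦.inl x⟧) fun p =>
        if hp : p.1 = e then ⟦.inr (hp ▸ p.2)⟧
        else if p.2 = (m p.1).G.out 0 then ⟦.inl (T.G.src p.1)⟧ else ⟦.inl (T.G.tgt p.1)⟧
      have hfe : ∀ y, f (.inr ⟨e, y⟩) = ⟦.inr y⟧ := fun y => dif_pos rfl
      have hfk : ∀ k y, k ≠ e → f (.inr ⟨k, y⟩) = if y = (m k).G.out 0 then
        ⟦.inl (T.G.src k)⟧ else ⟦.inl (T.G.tgt k)⟧ := fun k y hk => dif_neg hk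
      let F : (T.G.fill m).G.V → Quotient τ := Quot.lift f (by
        rintro _ _ (k | k)
        · by_cases hk : k = e
          · subst hk
            rw [hfe]
            exact (Quotient.sound (hτ 0)).symm
          · rw [hfk _ _ hk, if_pos rfl]
            rfl
        · by_cases hk : k = e
          · subst hk
            rw [hfe]
            exact (Quotient.sound (hτ 1)).symm
          · rw [hfk _ _ hk, if_neg (edge_out_ne (hm k hk))]
            rfl)
      have hF : ∀ z, F (q z) = ⟦z⟧ := by
        rintro (x | y)
        · rfl
        · exact hfe y
      intro x y hxy
      exact Quotient.exact ((hF x).symm.trans ((congrArg F (Setoid.ker_def.1 hxy)).trans (hF y)))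
  · rintro ⟨k, a⟩ ⟨k', a'⟩ hk
    by_cases h : k = e <;> by_cases h' : k' = e
    · subst h
      subst h'
      rw [hεe, hεe] at hk
      rw [Sum.inr_injective hk]
    · subst h
      rw [hεe, hεk _ _ h'] at hk
      exact (Sum.inr_ne_inl hk).elim
    · subst h'
      rw [hεe, hεk _ _ h] at hk
      exact (Sum.inl_ne_inr hk).elim
    · rw [hεk _ _ h, hεk _ _ h'] at hk
      obtain rfl := Sum.inl_injective hk
      rw [(edge_unique (hm k h)).2 a a']
  · rintro ⟨k, a⟩
    by_cases h : k = e
    · subst h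
      rw [hεe]
      rfl
    · rw [hεk _ _ h]
      refine Eq.trans ?_ (h0 k)
      rw [← (edge_src (hm k h) a).1]
      rfl
  · rintro ⟨k, a⟩
    by_cases h : k = e
    · subst h
      rw [hεe]
      rfl
    · rw [hεk _ _ h]
      refine Eq.trans ?_ (h1 k)
      rw [← (edge_src (hm k h) a).2.1]
      rfl
  · rintro ⟨k, a⟩
    by_cases h : k = e
    · subst h
      rw [hεe]
      rfl
    · rw [hεk _ _ h]
      exact (edge_src (hm k h) a).2.2
  · ext (k | a)
    · constructor
      · rintro ⟨⟨k', a⟩, ha⟩ hke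
        by_cases h : k' = e
        · subst h
          rw [hεe] at ha
          exact Sum.inr_ne_inl ha
        · rw [hεk _ _ h] at ha
          exact h (Sum.inl_injective (ha.trans hke))
      · intro hk
        have hk' : k ≠ e := fun h => hk (congrArg Sum.inl h)
        obtain ⟨a⟩ := (edge_unique (hm k hk')).1
        exact ⟨⟨k, a⟩, hεk _ _ hk'⟩
    · exact iff_of_true ⟨⟨e, a⟩, hεe a⟩ Sum.inr_ne_inl

theorem GraphMon.exists_isGluing_replace (T : GraphMon 0 L) (e : T.E) (h : GraphMon 2 L) :
    ∃ q ε, (T.outAt e).IsGluing h (T.replace e h) q ε ∧ Set.range ε = {.inl e}ᶜ ∧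
      q ∘ Sum.inl = T.G.fillMk _ :=
  TGraph.exists_isGluing_fill T e _ (fun _ hk => if_neg hk) (if_pos rfl)

/-- Substitution in a quotient. -/
theorem TGraph.exists_isQuot_fill (g : TGraph n I) (σ : Setoid g.V) (m : I → GraphMon 2 L) :
    ∃ q, (g.fill m).IsQuot ((g.quot σ).fill m) (.refl _) q ∧
      ∀ π, Setoid.ker q ≤ π ↔ σ ≤ π.comap (g.fillMk m) := by
  let q : (g.fill m).G.V → ((g.quot σ).fill m).G.V :=
    Quot.map (Sum.map (Quot.mk fun x y => σ x y) id) (by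
      rintro _ _ (i | i)
      · exact .input (g := g.quot σ) i
      · exact .output (g := g.quot σ) i)
  refine ⟨q, ⟨?_, fun _ => rfl, fun _ => rfl, fun _ => rfl, fun _ => rfl⟩, fun π => ⟨?_, ?_⟩⟩
  · intro z
    obtain ⟨x | y, rfl⟩ := Quot.mk_surjective z
    · obtain ⟨x, rfl⟩ := Quot.mk_surjective x
      exact ⟨Quot.mk _ (.inl x), rfl⟩
    · exact ⟨Quot.mk _ (.inr y), rfl⟩
  · intro h x y hxy
    refine h (Setoid.ker_def.2 ?_)
    exact congrArg (fun z => (Quot.mk _ (.inl z) : ((g.quot σ).fill m).G.V)) (Quot.sound hxy)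
  · intro h
    let f : (g.quot σ).V → Quotient π := Quot.lift (fun x => ⟦g.fillMk m x⟧)
      fun x y hxy => Quotient.sound (h hxy)
    let F : ((g.quot σ).fill m).G.V → Quotient π :=
      Quot.lift (Sum.elim f fun p => ⟦Quot.mk _ (.inr p)⟧) (by
        rintro _ _ (i | i)
        · exact congrArg (Quotient.mk π) (Quot.sound (.input i))
        · exact congrArg (Quotient.mk π) (Quot.sound (.output i)))
    have hF : ∀ z, F (q z) = ⟦z⟧ := by
      intro z
      obtain ⟨x | y, rfl⟩ := Quot.mk_surjective z <;> rfl
    intro x y hxy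
    exact Quotient.exact ((hF x).symm.trans ((congrArg F (Setoid.ker_def.1 hxy)).trans (hF y)))

end Fill

/-! ### Partition sums of a replacement, sorted by the partition induced on the original graph. -/

section Fiber

variable {L : Type u} {g φ : GraphMon 0 L → ℂ}

open Classical in
/-- The sum of the values of `g` at the quotients of a replacement that induce the partition `ρ`. -/
def GraphMon.replaceFiber (g : GraphMon 0 L → ℂ) (c : GraphMon 0 L) (e : c.E) (h : GraphMon 2 L)
    (ρ : Setoid c.G.V) : ℂ :=
  ∑ π with π.comap (c.G.fillMk _) = ρ, g ((c.replace e h).quot π)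

open Classical in
-- The fibers over partitions coarser than `σ` collect the partitions of the replacement that factor
-- through the replacement in `c.quot σ`.
theorem sum_replaceFiber (hφ : IsoInvariant φ) (c : GraphMon 0 L) (e : c.E) (h : GraphMon 2 L)
    (σ : Setoid c.G.V) :
    ∑ ρ with σ ≤ ρ, c.replaceFiber (injVersion φ) e h ρ = φ ((c.quot σ).replace e h) := by
  obtain ⟨q, hq, hk⟩ := c.G.exists_isQuot_fill σ fun k => if k = e then h else .edge (c.lab k)
  have h1 := hq.sum_quot (injVersion_isoInvariant hφ)
  have h2 : φ ((c.quot σ).replace e h) = ∑ τ with Setoid.ker q ≤ τ,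
      injVersion φ ((c.replace e h).quot τ) :=
    (sum_injVersion hφ ((c.quot σ).replace e h)).symm.trans h1
  rw [h2]
  simp only [hk]
  unfold GraphMon.replaceFiber
  simp only [Finset.sum_filter]
  have key : ∀ ρ : Setoid c.G.V, (if σ ≤ ρ then ∑ π : Setoid (c.replace e h).G.V,
      if π.comap (c.G.fillMk _) = ρ then injVersion φ ((c.replace e h).quot π) else 0 else 0) =
      ∑ π : Setoid (c.replace e h).G.V, if π.comap (c.G.fillMk _) = ρ then
        (if σ ≤ π.comap (c.G.fillMk _) then injVersion φ ((c.replace e h).quot π) else 0)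
      else 0 := by
    intro ρ
    split_ifs with hρ
    · refine Finset.sum_congr rfl fun π _ => ?_
      split_ifs with h1 h2
      · rfl
      · exact (h2 (h1 ▸ hρ)).elim
      · rfl
    · refine (Finset.sum_eq_zero fun π _ => ?_).symm
      split_ifs with h1 h2
      · exact (hρ (h1 ▸ h2)).elim
      · rfl
      · rfl
  rw [Finset.sum_congr rfl fun ρ _ => key ρ, Finset.sum_comm]
  refine Finset.sum_congr rfl fun π _ => ?_
  rw [Finset.sum_ite_eq, if_pos (Finset.mem_univ _)]

/-- Sums of fibers over the partitions coarser than `σ` are values of `φ` at replacements in `c.quot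
σ`, where the relation holds. Inversion in the reversed order isolates each fiber. -/
theorem sum_mul_replaceFiber_eq_zero (hφ : IsoInvariant φ) {κ : Type*} (s : Finset κ) (a : κ → ℂ)
    (h : κ → GraphMon 2 L)
    (H : ∀ (c : GraphMon 0 L) (e : c.E), ∑ k ∈ s, a k * φ (c.replace e (h k)) = 0)
    (c : GraphMon 0 L) (e : c.E) (ρ : Setoid c.G.V) :
    ∑ k ∈ s, a k * c.replaceFiber (injVersion φ) e (h k) ρ = 0 := by
  classical
  refine congrFun (eq_of_sum_le_eq (P := (Setoid c.G.V)ᵒᵈ)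
    (f := fun ρ => ∑ k ∈ s, a k * c.replaceFiber (injVersion φ) e (h k) (OrderDual.ofDual ρ))
    (g := fun _ => 0) fun σ => ?_) (OrderDual.toDual ρ)
  rw [Finset.sum_const_zero, Finset.sum_comm, ← H (c.quot (OrderDual.ofDual σ)) e]
  refine Finset.sum_congr rfl fun k _ => ?_
  rw [← Finset.mul_sum, ← sum_replaceFiber hφ]
  rfl

end Fiber

end Traffic
end

noncomputable section

namespace Traffic

/-! ## Locality of the free product -/

section Bot

variable {n : ℕ} {L : Type u} {V E : Type*}

theorem GraphMon.Embeds.quot_bot {m : GraphMon n L} {H : ColGraph V E L} {ν : m.G.V → V}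
    {ε : m.E → E} (h : m.Embeds H ν ε) :
    ∃ ν' : (m.quot ⊥).G.V → V, (m.quot ⊥).Embeds H ν' ε ∧ ν' ∘ (m.quot ⊥).G.out = ν ∘ m.G.out ∧
      Set.range ν' = Set.range ν := by
  refine ⟨Quot.lift ν fun x y hxy => congrArg ν hxy, ⟨?_, h.inj', h.src, h.tgt, h.lab⟩, rfl, ?_⟩
  · intro x y hxy
    obtain ⟨x, rfl⟩ := Quot.mk_surjective x
    obtain ⟨y, rfl⟩ := Quot.mk_surjective y
    exact congrArg _ (h.inj hxy)
  · exact Set.range_quot_lift _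

end Bot

theorem IsOutMatching.of_subset {V V' : Type*} {n : ℕ} {o : Fin n → V} {o' : Fin n → V'}
    {X : Set V} {M : Finset (V × V')} :
    (IsOutMatching o o' .univ .univ M ∧ ∀ x y, (x, y) ∈ M → x ∈ X) ↔
      IsOutMatching o o' X .univ M :=
  ⟨fun h => ⟨⟨fun hxy => h.2 _ _ hxy, fun _ => trivial, h.1.snd_unique, h.1.fst_unique⟩, h.1.out⟩,
    fun h => ⟨⟨h.toIsMatching.to_univ, h.out⟩, fun _ _ hxy => h.fst_mem hxy⟩⟩

section Locality

variable {J : Type w} {L : J → Type u} {τ : ∀ j, GraphMon 0 (L j) → ℂ}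

open Classical in
/-- The sum of the weights of the gluings of `A` with the quotients of `h`, without the edge `e`. -/
def ghostSum (τ : ∀ j, GraphMon 0 (L j) → ℂ) (A : GraphMon 2 (Σ j, L j)) (e : A.E)
    (h : GraphMon 2 (Σ j, L j)) : ℂ :=
  ∑ ρ, ∑ M : Finset (A.G.V × (h.quot ρ).G.V) with
    IsOutMatching A.G.out (h.quot ρ).G.out .univ .univ M,
      (A.toCol.amalg (h.quot ρ).toCol M).color.weight
        (compWeight τ (A.toCol.amalg (h.quot ρ).toCol M)) {.inl e}ᶜ

theorem freeProd_replace (hτ : ∀ j, IsTrafficFunctional (τ j)) (T : GraphMon 0 (Σ j, L j))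
    (e : T.E) (h : GraphMon 2 (Σ j, L j)) :
    freeProd τ (T.replace e h) = ∑ ρ, ghostSum τ ((T.outAt e).quot ρ) e h := by
  classical
  obtain ⟨q, ε, hX, hε, -⟩ := T.exists_isGluing_replace e h
  rw [freeProd_eq_sum]
  have := hX.sum_quot (g := freeInj τ) (fun _ => True) (fun ρ ρ' M =>
    (((T.outAt e).quot ρ).toCol.amalg (h.quot ρ').toCol M).color.weight
        (compWeight τ (((T.outAt e).quot ρ).toCol.amalg (h.quot ρ').toCol M)) {.inl e}ᶜ)
    fun ρ ρ' M m _ hm => (freeInj_eq_weight hτ (hε ▸ hm)).symm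
  simp only [Finset.filter_true] at this
  exact this

open Classical in
-- In the fiber over `⊥` the vertices of `c` stay distinct, so its terms are quotients of `h`
-- matched with vertices of `c`, read here inside the ambient graph `A`.
theorem replaceFiber_bot (hτ : ∀ j, IsTrafficFunctional (τ j)) {j : J} {A : GraphMon 2 (Σ j, L j)}
    {e : A.E} (h0 : A.G.out 0 = A.G.src e) (h1 : A.G.out 1 = A.G.tgt e) {c : GraphMon 0 (L j)}
    {e' : c.E} {ν : c.G.V → A.G.V} {ε : c.E → A.E} (hc : (c.map (Sigma.mk j)).Embeds A.toCol ν ε)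
    (he : ε e' = e) {X : Set A.G.V} {C : Set A.E} (hν : Set.range ν = X) (hε : Set.range ε = C)
    (h : GraphMon 2 (L j)) :
    c.replaceFiber (injVersion (τ j)) e' h ⊥ =
      ∑ ρ, ∑ M : Finset (A.G.V × ((h.map (Sigma.mk j)).quot ρ).G.V) with
        IsOutMatching A.G.out ((h.map (Sigma.mk j)).quot ρ).G.out X .univ M,
          compWeight τ (A.toCol.amalg ((h.map (Sigma.mk j)).quot ρ).toCol M)
            (sumSet C .univ \ {.inl e}) := by
  subst hν hε
  have hg := injVersion_isoInvariant (hτ j).isoInvariant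
  obtain ⟨q, η, hX, hη, hq⟩ := c.exists_isGluing_replace e' h
  have h2 := hX.sum_quot (g := injVersion (τ j)) (fun ρ => ρ = ⊥) (fun ρ ρ' M =>
    if hm : ∃ m : GraphMon 0 (L j), m.Models
      (((c.outAt e').quot ρ).toCol.amalg (h.quot ρ').toCol M) {.inl e'}ᶜ
    then injVersion (τ j) hm.choose else 0)
    fun ρ ρ' M m _ hm => dite_models_eq hg (hη ▸ hm)
  rw [hq] at h2
  refine h2.trans (Eq.trans (Finset.sum_eq_single_of_mem (⊥ : Setoid c.G.V)
    (Finset.mem_filter.2 ⟨Finset.mem_univ _, rfl⟩) fun ρ hρ hne =>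
      (hne (Finset.mem_filter.1 hρ).2).elim) ?_)
  refine Finset.sum_congr rfl fun ρ' _ => ?_
  have hemb : ((c.outAt e').map (Sigma.mk j)).Embeds A.toCol ν ε :=
    ⟨hc.inj, hc.inj', hc.src, hc.tgt, hc.lab⟩
  obtain ⟨ν', hν', ho, hr⟩ := hemb.quot_bot
  have hout : ν' ∘ ((c.outAt e').quot ⊥).G.out = A.G.out := by
    refine ho.trans (funext fun i => ?_)
    fin_cases i
    · exact (hc.src e').symm.trans ((congrArg A.G.src he).trans h0.symm)
    · exact (hc.tgt e').symm.trans ((congrArg A.G.tgt he).trans h1.symm)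
  have hset : Sum.map ε id '' {Sum.inl e'}ᶜ = sumSet (Set.range ε) (.univ : Set h.E) \ {.inl e} := by
    ext (a | a)
    · constructor
      · rintro ⟨b | b, hb, hab⟩
        · obtain rfl := Sum.inl_injective hab
          refine ⟨⟨b, rfl⟩, fun h => hb ?_⟩
          rw [hc.inj' ((Sum.inl_injective h).trans he.symm)]
          rfl
        · exact (Sum.inr_ne_inl hab).elim
      · rintro ⟨⟨b, rfl⟩, hb⟩
        refine ⟨.inl b, fun h => hb ?_, rfl⟩
        rw [Sum.inl_injective h, he]
        rfl
    · exact iff_of_true ⟨.inr a, Sum.inr_ne_inl, rfl⟩ ⟨trivial, Sum.inr_ne_inl⟩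
  have hη' : Set.range ((Sum.map id id : c.E ⊕ h.E → c.E ⊕ h.E) ∘ η) =
      ({.inl e'}ᶜ : Set (((c.outAt e').quot ⊥).E ⊕ (h.quot ρ').E)) := by
    rw [Sum.map_id_id]
    exact hη
  have h3 := sum_matching_image (o := ((c.outAt e').quot ⊥).G.out) (o' := (h.quot ρ').G.out)
    hν'.inj Function.injective_id (fun M =>
    if hm : ∃ m : GraphMon 0 (L j), m.Models
      (((c.outAt e').quot ⊥).toCol.amalg (h.quot ρ').toCol M) {.inl e'}ᶜ
    then injVersion (τ j) hm.choose else 0)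
    (fun M => compWeight τ (A.toCol.amalg ((h.map (Sigma.mk j)).quot ρ').toCol M)
            (sumSet (Set.range ε) .univ \ {.inl e})) (fun M hM hMo _ => by
      have hm := hX.models (H := ((c.outAt e').quot ⊥).toCol) (H' := (h.quot ρ').toCol)
        (f := (c.outAt e').quotMk ⊥)
        (f' := h.quotMk ρ') (θ := id) (θ' := id) Function.injective_id Function.injective_id
        (fun _ => rfl) (fun _ => rfl) (fun _ => rfl) (fun _ => rfl) (fun _ => rfl) (fun _ => rfl)
        hM hMo
        hη'
      refine Eq.trans ?_ (dite_models_eq hg hm).symm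
      refine compWeight_eq hτ ?_
      have hm' := hm.image (Sigma.mk j) hM (K := ((c.outAt e').quot ⊥).toCol)
        (K' := (h.quot ρ').toCol) (H := A.toCol)
        (H' := ((h.map (Sigma.mk j)).quot ρ').toCol) hν'.inj Function.injective_id hν'.inj'
        Function.injective_id hν'.src hν'.tgt hν'.lab (fun _ => rfl) (fun _ => rfl) (fun _ => rfl)
      exact hset ▸ hm')
  refine h3.trans (Finset.sum_congr ?_ fun _ _ => rfl)
  have hid : Set.range (id : (h.quot ρ').G.V → (h.quot ρ').G.V) = .univ := Set.range_id
  rw [hout, hr, hid]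
  rfl

/-! ### Keeping the replaced edge as a ghost edge. -/

section Ghost

variable {j : J} {A B : GraphMon 2 (Σ j, L j)} {e : A.E} {M : Finset (A.G.V × B.G.V)}

theorem GraphMon.core_univ {n : ℕ} (A : GraphMon n (Σ j, L j)) (r : A.G.V) :
    A.toCol.color.core .univ r = .univ := Set.eq_univ_of_forall fun x => by
  rcases (A.conn_univ r x).eq_or with h | h
  exacts [.inl h.symm, .inr h.2]

/-- `B` links the endpoints of `e` in the color of `e`, so `weight_insert` puts `e` back as a ghost:
it takes part in the tree of components but is ignored by the weights. -/
theorem weight_amalg_erase (h0 : A.G.out 0 = A.G.src e) (h1 : A.G.out 1 = A.G.tgt e)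
    (hj : (A.lab e).1 = j) (hB : ∀ f, (B.lab f).1 = j)
    (hM : IsOutMatching A.G.out B.G.out .univ .univ M) :
    (A.toCol.amalg B.toCol M).color.weight (compWeight τ (A.toCol.amalg B.toCol M)) {.inl e}ᶜ =
      (A.toCol.color.amalg B.toCol.color M).weight
        (fun c => compWeight τ (A.toCol.amalg B.toCol M) (c \ {.inl e})) (sumSet .univ .univ) := by
  have hfinA : Finite A.E := A.G.finite_E
  have hfinB : Finite B.E := B.G.finite_E
  rw [ColGraph.color_amalg]
  set H := A.toCol.color.amalg B.toCol.color M
  have hroot : (A.G.src e, B.G.out 0) ∈ M := h0 ▸ hM.out 0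
  have hall : ∀ x ∈ H.core (sumSet .univ .univ) _, H.Conn (sumSet .univ .univ) _ x :=
    ColGraph.amalg_conn hM.toIsMatching hroot (fun x _ => A.conn_univ _ x)
      fun x _ => B.conn_univ _ x
  have hpath : H.Conn (sumSet ∅ .univ) (.inl (A.G.src e)) (.inl (A.G.tgt e)) := by
    have := ColGraph.conn_amalg_inr (G := A.toCol.color) (G' := B.toCol.color) (F := ∅) (M := M)
      (B.conn_univ (B.G.out 0) (B.G.out 1))
    rwa [merge_inr_of_mem hM.toIsMatching (hM.out 0),
      merge_inr_of_mem hM.toIsMatching (hM.out 1), h0, h1] at this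
  have hsub : ∀ f ∈ sumSet (∅ : Set A.E) (.univ : Set B.E), f ∈ ({.inl e}ᶜ : Set (A.E ⊕ B.E)) := by
    rintro (f | f) hf
    · exact hf.elim
    · exact Sum.inr_ne_inl
  have huniv : (sumSet .univ .univ : Set (A.E ⊕ B.E)) = insert (.inl e) {.inl e}ᶜ := by
    ext (f | f) <;> simp [em]
  rw [huniv] at hall ⊢
  refine (ColGraph.weight_insert (G := H) (e := .inl e) (by simp) ?_ ?_
    compWeight_empty).symm
  · intro x hx
    refine (hall x (ColGraph.Decomp.core_subset (Set.subset_insert _ _) hx)).lift id ?_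
    rintro f (rfl | hf)
    · exact hpath.mono hsub
    · exact .edge hf
  · refine hpath.mono fun f hf => ⟨hsub f hf, ?_⟩
    rcases f with f | f
    · exact hf.elim
    · exact (hB f).trans hj.symm

theorem exists_decomp_of_weight_erase_ne_zero (h0 : A.G.out 0 = A.G.src e)
    (h1 : A.G.out 1 = A.G.tgt e) (hj : (A.lab e).1 = j) (hB : ∀ f, (B.lab f).1 = j)
    (hM : IsOutMatching A.G.out B.G.out .univ .univ M)
    (hne : (A.toCol.amalg B.toCol M).color.weight
      (compWeight τ (A.toCol.amalg B.toCol M)) {.inl e}ᶜ ≠ 0) :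
    ∃ C p, A.toCol.color.Decomp .univ (A.G.src e) j C p := by
  rw [weight_amalg_erase h0 h1 hj hB hM] at hne
  refine ColGraph.exists_decomp_of_weight_amalg_ne_zero (G := A.toCol.color)
    (G' := B.toCol.color) (fun x _ => A.conn_univ _ x)
    (fun x _ => B.conn_univ _ x) ?_ (h0 ▸ hM.out 0)
    (w := fun M c => compWeight τ (A.toCol.amalg B.toCol M) (c \ {.inl e})) hne j
  rw [A.core_univ, B.core_univ]
  exact hM.toIsMatching

theorem ColGraph.Decomp.mem_of_root {V E J : Type*} {G : ColGraph V E J} {F C : Set E} {e : E}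
    {p : V → V} (D : G.Decomp F (G.src e) (G.col e) C p) (he : e ∈ F) : e ∈ C := by
  by_contra hne
  exact D.col_ne e he hne _ (.inl rfl) ColGraph.inc_src rfl

open Classical in
-- The product over the branches depends neither on `B` nor on `M`; the rest only sees the component
-- of `e`. This separation is the heart of the locality of the free product.
theorem weight_erase_eq (h0 : A.G.out 0 = A.G.src e)
    (h1 : A.G.out 1 = A.G.tgt e) (hj : (A.lab e).1 = j) (hB : ∀ f, (B.lab f).1 = j)
    (hM : IsOutMatching A.G.out B.G.out .univ .univ M) {C : Set A.E} {p : A.G.V → A.G.V}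
    (D : A.toCol.color.Decomp .univ (A.G.src e) j C p) :
    (A.toCol.amalg B.toCol M).color.weight (compWeight τ (A.toCol.amalg B.toCol M)) {.inl e}ᶜ =
      if ∀ x y, (x, y) ∈ M → x ∈ A.toCol.color.core C (A.G.src e) then
        (∏ v with v ∈ A.toCol.color.core C (A.G.src e),
          A.toCol.color.weight (compWeight τ A.toCol) (D.branch v)) *
          compWeight τ (A.toCol.amalg B.toCol M) (sumSet C .univ \ {.inl e}) else 0 := by
  have hfinA : Finite A.E := A.G.finite_E
  have hfinB : Finite B.E := B.G.finite_E
  have hw : ColGraph.IsLocal A.toCol.color B.toCol.color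
      fun M c => compWeight τ (A.toCol.amalg B.toCol M) (c \ {.inl e}) := by
    have := compWeight_isLocal (τ := τ) A.toCol B.toCol
    refine ⟨fun M => ?_, fun M N c hM hN hc => this.congr M N _ hM hN fun x hx y hy => ?_⟩
    · exact (congrArg _ (Set.empty_sdiff _)).trans (this.empty M)
    · exact hc x (ColGraph.verts_mono (fun _ ha => ha.1) hx) y
        (ColGraph.verts_mono (fun _ ha => ha.1) hy)
  have hM' : IsMatching (A.toCol.color.core .univ (A.G.src e))
      (B.toCol.color.core .univ (B.G.out 0)) M := by
    rw [A.core_univ, B.core_univ]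
    exact hM.toIsMatching
  rw [weight_amalg_erase h0 h1 hj hB hM, D.weight_amalg_mono (w := fun M c =>
    compWeight τ (A.toCol.amalg B.toCol M) (c \ {.inl e})) (fun f _ => hB f)
    (fun x _ => B.conn_univ _ x) hw hM' (h0 ▸ hM.out 0)]
  have heC : e ∈ C := by
    subst hj
    exact D.mem_of_root trivial
  have hb : ∀ v, (A.toCol.color.amalg B.toCol.color ∅).weight
      (fun c => compWeight τ (A.toCol.amalg B.toCol ∅) (c \ {.inl e})) (sumSet (D.branch v) ∅) =
      A.toCol.color.weight (compWeight τ A.toCol) (D.branch v) := by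
    intro v
    have hemb : A.toCol.Emb (A.toCol.amalg B.toCol ∅) .inl .inl :=
      ⟨Sum.inl_injective, Sum.inl_injective, fun _ => rfl, fun _ => rfl, fun _ => rfl⟩
    have hset : ∀ c : Set A.E, sumSet c (∅ : Set B.E) = Sum.inl '' c := fun c => by
      ext (f | f) <;> simp
    rw [hset, ← ColGraph.color_amalg]
    refine (hemb.color).weight fun c hc => ?_
    rw [← compWeight_image hemb c, Set.sdiff_singleton_eq_self]
    rintro ⟨f, hf, hfe⟩
    obtain rfl := Sum.inl_injective hfe
    exact (hc hf).2.1 heC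
  simp only [hb]

end Ghost

/-- If `A` can be cut at the component of `e`, all the ghost sums share the factor of the branches,
and what remains is a fiber over `⊥` for this component, where the relation holds. Otherwise every
term vanishes. -/
theorem ghostSum_eq_zero (hτ : ∀ j, IsTrafficFunctional (τ j)) {j : J}
    {A : GraphMon 2 (Σ j, L j)} {e : A.E} (h0 : A.G.out 0 = A.G.src e)
    (h1 : A.G.out 1 = A.G.tgt e) (hj : (A.lab e).1 = j) {κ : Type*} (s : Finset κ) (a : κ → ℂ)
    (h : κ → GraphMon 2 (L j)) (H : ∀ (c : GraphMon 0 (L j)) (e : c.E),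
      ∑ k ∈ s, a k * τ j (c.replace e (h k)) = 0) :
    ∑ k ∈ s, a k * ghostSum τ A e ((h k).map (Sigma.mk j)) = 0 := by
  classical
  have hfinA : Finite A.E := A.G.finite_E
  by_cases hD : ∃ C p, A.toCol.color.Decomp .univ (A.G.src e) j C p
  · obtain ⟨C, p, D⟩ := hD
    have heC : e ∈ C := by
      subst hj
      exact D.mem_of_root trivial
    have hmon : A.toCol.color.MonoRooted j 0 (C, A.G.src e, Fin.elim0) :=
      ⟨D.col, D.conn, fun i => i.elim0⟩
    let c : GraphMon 0 (L j) := ⟨hmon.mon.E, hmon.mon.G.forget, hmon.mon.lab⟩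
    have hc : (c.map (Sigma.mk j)).Embeds A.toCol Subtype.val Subtype.val :=
      ⟨hmon.embeds.inj, hmon.embeds.inj', hmon.embeds.src, hmon.embeds.tgt, hmon.embeds.lab⟩
    have key : ∀ k, ghostSum τ A e ((h k).map (Sigma.mk j)) =
        (∏ v with v ∈ A.toCol.color.core C (A.G.src e),
          A.toCol.color.weight (compWeight τ A.toCol) (D.branch v)) *
        c.replaceFiber (injVersion (τ j)) ⟨e, heC⟩ (h k) ⊥ := by
      intro k
      refine Eq.trans ?_ (congrArg _ (replaceFiber_bot hτ h0 h1 hc (e' := (⟨e, heC⟩ : C)) rfl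
        Subtype.range_coe Subtype.range_coe (h k)).symm)
      rw [ghostSum, Finset.mul_sum]
      refine Finset.sum_congr rfl fun ρ _ => ?_
      rw [Finset.mul_sum]
      refine (Finset.sum_congr rfl fun M hM => weight_erase_eq h0 h1 hj (fun _ => rfl)
        (Finset.mem_filter.1 hM).2 D).trans ?_
      rw [← Finset.sum_filter, Finset.filter_filter]
      refine Finset.sum_congr (Finset.filter_congr fun M _ => ?_) fun _ _ => rfl
      exact IsOutMatching.of_subset
    simp only [key]
    have := sum_mul_replaceFiber_eq_zero (hτ j).isoInvariant s a h H c ⟨e, heC⟩ ⊥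
    simp only [mul_left_comm (a _)]
    rw [← Finset.mul_sum]
    exact (congrArg _ this).trans (mul_zero _)
  · refine Finset.sum_eq_zero fun k _ => ?_
    rw [ghostSum, Finset.sum_eq_zero, mul_zero]
    refine fun ρ _ => Finset.sum_eq_zero fun M hM => ?_
    by_contra hne
    exact hD (exists_decomp_of_weight_erase_ne_zero h0 h1 hj (fun _ => rfl)
      (Finset.mem_filter.1 hM).2 hne)

/-- Linear relations between monochromatic graphs that hold for the functional of their color hold
for the free product. -/
theorem sum_mul_freeProd_replace_eq_zero (hτ : ∀ j, IsTrafficFunctional (τ j)) {j : J}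
    (T : GraphMon 0 (Σ j, L j)) {e : T.E} (hj : (T.lab e).1 = j) {κ : Type*} (s : Finset κ)
    (a : κ → ℂ) (h : κ → GraphMon 2 (L j)) (H : ∀ (c : GraphMon 0 (L j)) (e : c.E),
      ∑ k ∈ s, a k * τ j (c.replace e (h k)) = 0) :
    ∑ k ∈ s, a k * freeProd τ (T.replace e ((h k).map (Sigma.mk j))) = 0 := by
  simp only [freeProd_replace hτ, Finset.mul_sum]
  rw [Finset.sum_comm]
  refine Finset.sum_eq_zero fun ρ _ => ghostSum_eq_zero hτ ?_ ?_ hj s a h H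
  · rfl
  · rfl

/-- The free product extends its factors. -/
theorem freeProd_map (hτ : ∀ j, IsTrafficFunctional (τ j)) {j : J} (m : GraphMon 0 (L j)) :
    freeProd τ (m.map (Sigma.mk j)) = τ j m := by
  rw [freeProd_eq_sum, ← sum_injVersion (hτ j).isoInvariant]
  refine Finset.sum_congr rfl fun π _ => ?_
  let A := (m.map (Sigma.mk j)).quot π
  have hfin : Finite A.E := A.G.finite_E
  have hconn : ∀ x ∈ A.toCol.color.core .univ (Classical.arbitrary A.G.V),
      A.toCol.color.Conn .univ (Classical.arbitrary A.G.V) x := fun x _ => A.conn_univ _ x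
  -- The graph is monochromatic: it is its own root component, and all its branches are empty.
  have D : A.toCol.color.Decomp .univ (Classical.arbitrary A.G.V) j .univ id :=
    ⟨subset_rfl, fun _ _ => rfl, hconn, fun _ _ => rfl, fun e _ he => (he trivial).elim,
      fun e _ he => (he trivial).elim, hconn⟩
  have hb : ∀ v, D.branch v = ∅ := fun v =>
    Set.eq_empty_of_forall_notMem fun e he => he.2.1 trivial
  have h := D.weight_eq (w := compWeight τ A.toCol) compWeight_empty
  simp only [hb, ColGraph.weight_empty, finprod_mem_one, mul_one] at h
  exact (freeInj_eq_weight_univ hτ A).trans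
    (h.trans (compWeight_eq hτ (m := m.quot π) A.models_self))

end Locality

end Traffic
end

noncomputable section

namespace Traffic

/-! ## Isomorphisms between substitutions -/

section Iso

variable {n : ℕ} {L : Type u} {I I' : Type}

/-- Maps that are inverse to each other at endpoints of edges are inverse everywhere: a connected
graph with an edge has no other vertices, and one without edges has a single vertex. -/
theorem TGraph.isoAlong_of_maps {g : TGraph n I} {g' : TGraph n I'} (σ : I ≃ I') (f : g.V → g'.V)
    (f' : g'.V → g.V) (hs : ∀ e, f (g.src e) = g'.src (σ e)) (ht : ∀ e, f (g.tgt e) = g'.tgt (σ e))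
    (ho : ∀ i, f (g.out i) = g'.out i) (hs' : ∀ e, f' (g'.src (σ e)) = g.src e)
    (ht' : ∀ e, f' (g'.tgt (σ e)) = g.tgt e) : TGraph.IsoAlong σ g g' := by
  let m : GraphMon n Unit := ⟨I, g, fun _ => ()⟩
  let m' : GraphMon n Unit := ⟨I', g', fun _ => ()⟩
  have h1 : ∀ x, f' (f x) = x := by
    intro x
    rcases isEmpty_or_nonempty I with h | h
    · exact m.eq_of_isEmpty h _ _
    · obtain ⟨e, rfl | rfl⟩ := m.exists_inc h x
      · exact (congrArg f' (hs e)).trans (hs' e)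
      · exact (congrArg f' (ht e)).trans (ht' e)
  have h2 : ∀ x, f (f' x) = x := by
    intro x
    rcases isEmpty_or_nonempty I' with h | h
    · exact m'.eq_of_isEmpty h _ _
    · obtain ⟨e, he⟩ := m'.exists_inc h x
      obtain ⟨e, rfl⟩ := σ.surjective e
      rcases he with rfl | rfl
      · exact (congrArg f (hs' e)).trans (hs e)
      · exact (congrArg f (ht' e)).trans (ht e)
  exact ⟨⟨f, f', h1, h2⟩, hs, ht, ho⟩

theorem TGraph.fill_isoAlong {g : TGraph n I} {g' : TGraph n I'} {σ : I ≃ I'}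
    (h : TGraph.IsoAlong σ g g') (m : I' → GraphMon 2 L) :
    (g.fill fun i => m (σ i)).Iso (g'.fill m) := by
  obtain ⟨φ, hs, ht, ho⟩ := h
  let θ := σ.sigmaCongrLeft (β := fun i => (m i).G.V)
  have hθ : ∀ i y, θ.symm ⟨σ i, y⟩ = ⟨i, y⟩ := fun i y => θ.symm_apply_apply ⟨i, y⟩
  refine ⟨σ.sigmaCongrLeft (β := fun i => (m i).E), TGraph.isoAlong_of_maps _
    (Quot.map (Sum.map φ θ) ?_) (Quot.map (Sum.map φ.symm θ.symm) ?_)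
    (fun _ => rfl) (fun _ => rfl) (fun i => ?_) (fun e => ?_) (fun e => ?_), fun _ => rfl⟩
  · rintro _ _ (i | i)
    · rw [Sum.map_inl, hs]
      exact .input (σ i)
    · rw [Sum.map_inl, ht]
      exact .output (σ i)
  · rintro _ _ (i | i)
    · obtain ⟨i, rfl⟩ := σ.surjective i
      rw [Sum.map_inl, Sum.map_inr, hθ, ← hs, φ.symm_apply_apply]
      exact .input i
    · obtain ⟨i, rfl⟩ := σ.surjective i
      rw [Sum.map_inl, Sum.map_inr, hθ, ← ht, φ.symm_apply_apply]
      exact .output i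
  · exact congrArg (fun x => (Quot.mk _ (.inl x) : (g'.fill m).G.V)) (ho i)
  · exact congrArg (fun x => (Quot.mk _ (.inr x) : (g.fill fun i => m (σ i)).G.V)) (hθ _ _)
  · exact congrArg (fun x => (Quot.mk _ (.inr x) : (g.fill fun i => m (σ i)).G.V)) (hθ _ _)

theorem TGraph.fill_congr (g : TGraph n I) {m m' : I → GraphMon 2 L} (h : ∀ i, (m i).Iso (m' i)) :
    (g.fill m).Iso (g.fill m') := by
  unfold GraphMon.Iso at h
  choose σ h1 h2 using h
  unfold TGraph.IsoAlong at h1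
  choose φ hs ht ho using h1
  refine ⟨.sigmaCongrRight σ, TGraph.isoAlong_of_maps _
    (Quot.map (Sum.map id (Sigma.map id fun i => φ i)) ?_)
    (Quot.map (Sum.map id (Sigma.map id fun i => (φ i).symm)) ?_)
    (fun e => ?_) (fun e => ?_) (fun i => rfl) (fun e => ?_) (fun e => ?_), fun p => h2 p.1 p.2⟩
  · rintro _ _ (i | i)
    · refine (congrArg₂ (TGraph.CompRel g fun i => (m' i).G) ?_ rfl).mpr (.input i)
      exact congrArg (fun x => Sum.inr (Sigma.mk i x)) (ho i 0)
    · refine (congrArg₂ (TGraph.CompRel g fun i => (m' i).G) ?_ rfl).mpr (.output i)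
      exact congrArg (fun x => Sum.inr (Sigma.mk i x)) (ho i 1)
  · rintro _ _ (i | i)
    · refine (congrArg₂ (TGraph.CompRel g fun i => (m i).G) ?_ rfl).mpr (.input i)
      exact congrArg (fun x => Sum.inr (Sigma.mk i x)) ((Equiv.symm_apply_eq _).2 (ho i 0).symm)
    · refine (congrArg₂ (TGraph.CompRel g fun i => (m i).G) ?_ rfl).mpr (.output i)
      exact congrArg (fun x => Sum.inr (Sigma.mk i x)) ((Equiv.symm_apply_eq _).2 (ho i 1).symm)
  · exact congrArg (fun x => (Quot.mk _ (.inr ⟨e.1, x⟩) : (g.fill m').G.V)) (hs e.1 e.2)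
  · exact congrArg (fun x => (Quot.mk _ (.inr ⟨e.1, x⟩) : (g.fill m').G.V)) (ht e.1 e.2)
  · exact congrArg (fun x => (Quot.mk _ (.inr ⟨e.1, x⟩) : (g.fill m).G.V))
      ((Equiv.symm_apply_eq _).2 (hs e.1 e.2).symm)
  · exact congrArg (fun x => (Quot.mk _ (.inr ⟨e.1, x⟩) : (g.fill m).G.V))
      ((Equiv.symm_apply_eq _).2 (ht e.1 e.2).symm)

/-- Replacing the edges by themselves. -/
theorem TGraph.fill_edge (g : TGraph n I) (l : I → L) :
    (g.fill fun i => .edge (l i)).Iso ⟨I, g, l⟩ := by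
  let f : g.V ⊕ (Σ _ : I, Fin 2) → g.V :=
    Sum.elim id fun p => if p.2 = 0 then g.src p.1 else g.tgt p.1
  refine ⟨⟨fun p => p.1, fun i => ⟨i, ()⟩, fun _ => rfl, fun _ => rfl⟩,
    TGraph.isoAlong_of_maps _ (Quot.lift f ?_) (g.fillMk _) (fun _ => rfl) (fun _ => rfl)
    (fun _ => rfl) (fun e => ?_) (fun e => ?_), fun _ => rfl⟩
  · rintro _ _ (i | i) <;> rfl
  · exact (Quot.sound (.input e.1)).symm
  · exact (Quot.sound (.output e.1)).symm

/-- Associativity of the substitution. -/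
theorem TGraph.fill_fill {K : I → Type} (g : TGraph n I) (h : ∀ i, GraphOp (K i))
    (m : ∀ i, K i → GraphMon 2 L) :
    (g.fill fun i => (h i).fill (m i)).Iso ((g.comp h).fill fun p => m p.1 p.2) := by
  let f : g.V ⊕ (Σ i, ((h i).fill (m i)).G.V) → ((g.comp h).fill fun p => m p.1 p.2).G.V :=
    Sum.elim (fun x => Quot.mk _ (.inl (Quot.mk _ (.inl x)))) fun p =>
      Quot.lift (r := TGraph.CompRel (h p.1) fun k => (m p.1 k).G)
        (Sum.elim (fun y => Quot.mk _ (.inl (Quot.mk _ (.inr ⟨p.1, y⟩))))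
          fun q => Quot.mk _ (.inr ⟨⟨p.1, q.1⟩, q.2⟩)) (by
        rintro _ _ (k | k)
        · exact Quot.sound (.input (g := g.comp h) (h := fun p => (m p.1 p.2).G) ⟨p.1, k⟩)
        · exact Quot.sound (.output (g := g.comp h) (h := fun p => (m p.1 p.2).G) ⟨p.1, k⟩)) p.2
  let f₁ : (g.comp h).V → (g.fill fun i => (h i).fill (m i)).G.V :=
    Quot.lift (Sum.elim (fun x => Quot.mk _ (.inl x))
      fun p => Quot.mk _ (.inr ⟨p.1, Quot.mk _ (.inl p.2)⟩)) (by
      rintro _ _ (i | i)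
      · exact Quot.sound (.input (h := fun i => ((h i).fill (m i)).G) i)
      · exact Quot.sound (.output (h := fun i => ((h i).fill (m i)).G) i))
  let f' : (g.comp h).V ⊕ (Σ p : Σ i, K i, (m p.1 p.2).G.V) →
      (g.fill fun i => (h i).fill (m i)).G.V :=
    Sum.elim f₁ fun q => Quot.mk _ (.inr ⟨q.1.1, Quot.mk _ (.inr ⟨q.1.2, q.2⟩)⟩)
  refine ⟨(Equiv.sigmaAssoc fun i k => (m i k).E).symm, TGraph.isoAlong_of_maps _
    (Quot.lift f ?_) (Quot.lift f' ?_) (fun _ => rfl) (fun _ => rfl)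
    (fun _ => rfl) (fun e => rfl) (fun e => rfl), fun _ => rfl⟩
  · rintro _ _ (i | i)
    · exact congrArg (fun x => (Quot.mk _ (.inl x) : ((g.comp h).fill fun p => m p.1 p.2).G.V))
        (Quot.sound (.input i))
    · exact congrArg (fun x => (Quot.mk _ (.inl x) : ((g.comp h).fill fun p => m p.1 p.2).G.V))
        (Quot.sound (.output i))
  · rintro _ _ (⟨i, k⟩ | ⟨i, k⟩)
    · exact congrArg (fun x => (Quot.mk _ (.inr ⟨i, x⟩) :
        (g.fill fun i => (h i).fill (m i)).G.V)) (Quot.sound (.input k))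
    · exact congrArg (fun x => (Quot.mk _ (.inr ⟨i, x⟩) :
        (g.fill fun i => (h i).fill (m i)).G.V)) (Quot.sound (.output k))

theorem TGraph.fill_close (g : GraphOp I) (m : I → GraphMon 2 L) :
    (GraphMon.close (g.fill m)).Iso (g.close.fill m) := by
  refine ⟨.refl _, TGraph.isoAlong_of_maps _
    (Quot.lift (Quot.map (Sum.map (Quot.mk _) id) ?_) ?_)
    (Quot.lift (Sum.elim (Quot.map (g.fillMk m) ?_) fun p => Quot.mk _ (Quot.mk _ (.inr p))) ?_)
    (fun _ => rfl) (fun _ => rfl) (fun i => i.elim0) (fun e => rfl) (fun e => rfl), fun _ => rfl⟩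
  · rintro _ _ (i | i)
    · exact .input (g := g.close) i
    · exact .output (g := g.close) i
  · rintro _ _ ⟨rfl, rfl⟩
    exact congrArg (fun x => (Quot.mk _ (.inl x) : (g.close.fill m).G.V)) (Quot.sound ⟨rfl, rfl⟩)
  · rintro _ _ ⟨rfl, rfl⟩
    exact ⟨rfl, rfl⟩
  · rintro _ _ (i | i)
    · exact congrArg (Quot.mk _) (Quot.sound (.input i))
    · exact congrArg (Quot.mk _) (Quot.sound (.output i))

/-- Reversing an edge exchanges its source and its target, so the graph inserted there has to
exchange its input and its output too. -/
theorem TGraph.fill_adj (s : L → L) (g : GraphOp I) (m : I → GraphMon 2 L) :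
    (GraphMon.adj s (g.fill m)).Iso (g.adj.fill fun i => (m i).adj s) := by
  refine ⟨.refl _, TGraph.isoAlong_of_maps _ (Quot.map id ?_) (Quot.map id ?_)
    (fun _ => rfl) (fun _ => rfl) (fun i => ?_) (fun e => rfl) (fun e => rfl), fun _ => rfl⟩
  · rintro _ _ (i | i)
    · exact .output (g := g.adj) (h := fun i => ((m i).adj s).G) i
    · exact .input (g := g.adj) (h := fun i => ((m i).adj s).G) i
  · rintro _ _ (i | i)
    · exact .output (g := g) (h := fun i => (m i).G) i
    · exact .input (g := g) (h := fun i => (m i).G) i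
  · fin_cases i <;> rfl

theorem TGraph.fill_star (s : L → L) (g : TGraph n I) (m : I → GraphMon 2 L) :
    (GraphMon.star s (g.fill m)).Iso (g.rev.fill fun i => (m i).adj s) := by
  refine ⟨.refl _, TGraph.isoAlong_of_maps _ (Quot.map id ?_) (Quot.map id ?_)
    (fun _ => rfl) (fun _ => rfl) (fun i => rfl) (fun e => rfl) (fun e => rfl), fun _ => rfl⟩
  · rintro _ _ (i | i)
    · exact .output (g := g.rev) (h := fun i => ((m i).adj s).G) i
    · exact .input (g := g.rev) (h := fun i => ((m i).adj s).G) i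
  · rintro _ _ (i | i)
    · exact .output (g := g) (h := fun i => (m i).G) i
    · exact .input (g := g) (h := fun i => (m i).G) i

theorem GraphMon.adj_edge (s : L → L) (x : L) : (GraphMon.adj s (.edge x)).Iso (.edge (s x)) := by
  let φ : Fin 2 → Fin 2 := Equiv.swap 0 1
  have h0 : φ 0 = 1 := Equiv.swap_apply_left 0 1
  have h1 : φ 1 = 0 := Equiv.swap_apply_right 0 1
  refine ⟨.refl _, TGraph.isoAlong_of_maps _ φ φ (fun _ => h1) (fun _ => h0) (fun i => ?_)
    (fun _ => h0) (fun _ => h1), fun _ => rfl⟩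
  fin_cases i
  exacts [h1, h0]

theorem TGraph.fill_glue (g : TGraph (n + 1) I) (g' : TGraph (n + 1) I') (m : I → GraphMon 2 L)
    (m' : I' → GraphMon 2 L) :
    ((g.glue g').fill (Sum.elim m m')).Iso ((g.fill m).glue (g'.fill m')) := by
  let f₁ : (g.glue g').V → ((g.fill m).glue (g'.fill m')).G.V :=
    Quot.map (Sum.map (g.fillMk m) (g'.fillMk m')) (by
      rintro _ _ ⟨i⟩
      exact .out i)
  let f : (g.glue g').V ⊕ (Σ i, (Sum.elim m m' i).G.V) → ((g.fill m).glue (g'.fill m')).G.V :=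
    Sum.elim f₁ fun p => match p with
      | ⟨.inl i, y⟩ => Quot.mk _ (.inl (Quot.mk _ (.inr ⟨i, y⟩)))
      | ⟨.inr i, y⟩ => Quot.mk _ (.inr (Quot.mk _ (.inr ⟨i, y⟩)))
  let f' : (g.fill m).G.V ⊕ (g'.fill m').G.V → ((g.glue g').fill (Sum.elim m m')).G.V :=
    Sum.elim (Quot.map (Sum.map (fun x => Quot.mk _ (.inl x)) fun p => ⟨.inl p.1, p.2⟩) (by
        rintro _ _ (i | i)
        · exact .input (g := g.glue g') (h := fun i => (Sum.elim m m' i).G) (.inl i)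
        · exact .output (g := g.glue g') (h := fun i => (Sum.elim m m' i).G) (.inl i)))
      (Quot.map (Sum.map (fun x => Quot.mk _ (.inr x)) fun p => ⟨.inr p.1, p.2⟩) (by
        rintro _ _ (i | i)
        · exact .input (g := g.glue g') (h := fun i => (Sum.elim m m' i).G) (.inr i)
        · exact .output (g := g.glue g') (h := fun i => (Sum.elim m m' i).G) (.inr i)))
  refine ⟨⟨fun p => match p with
      | ⟨.inl i, y⟩ => .inl ⟨i, y⟩
      | ⟨.inr i, y⟩ => .inr ⟨i, y⟩,
    Sum.elim (fun p => ⟨.inl p.1, p.2⟩) fun p => ⟨.inr p.1, p.2⟩, ?_, ?_⟩,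
    TGraph.isoAlong_of_maps _ (Quot.lift f ?_) (Quot.lift f' ?_) ?_ ?_ (fun i => i.elim0)
      ?_ ?_, ?_⟩
  · rintro ⟨i | i, y⟩ <;> rfl
  · rintro (⟨i, y⟩ | ⟨i, y⟩) <;> rfl
  · rintro _ _ ((i | i) | (i | i))
    · exact congrArg (fun x => (Quot.mk _ (.inl x) : ((g.fill m).glue (g'.fill m')).G.V))
        (Quot.sound (.input i))
    · exact congrArg (fun x => (Quot.mk _ (.inr x) : ((g.fill m).glue (g'.fill m')).G.V))
        (Quot.sound (.input i))
    · exact congrArg (fun x => (Quot.mk _ (.inl x) : ((g.fill m).glue (g'.fill m')).G.V))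
        (Quot.sound (.output i))
    · exact congrArg (fun x => (Quot.mk _ (.inr x) : ((g.fill m).glue (g'.fill m')).G.V))
        (Quot.sound (.output i))
  · rintro _ _ ⟨i⟩
    exact congrArg (fun x => (Quot.mk _ (.inl x) : ((g.glue g').fill (Sum.elim m m')).G.V))
      (Quot.sound (.out i))
  all_goals rintro ⟨i | i, y⟩ <;> rfl

theorem TGraph.withOut_close_isoAlong (g : TGraph 0 I) (x : g.V) :
    TGraph.IsoAlong (.refl I) (TGraph.close (g.withOut fun _ => x)) g := by
  refine TGraph.isoAlong_of_maps _ (Quot.lift id ?_) (Quot.mk _) (fun _ => rfl) (fun _ => rfl)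
    (fun i => i.elim0) (fun _ => rfl) (fun _ => rfl)
  exact fun _ _ h => h.1.trans h.2.symm

theorem TGraph.diag_close_isoAlong (g : GraphOp I) :
    TGraph.IsoAlong (⟨fun p => p.2, fun i => ⟨(), i⟩, fun _ => rfl, fun _ => rfl⟩ : (Σ _ : Unit, I) ≃ I)
      (diagOp.comp fun _ : Unit => g).close g.close := by
  refine TGraph.isoAlong_of_maps _
    (Quot.lift (Quot.lift (Sum.elim (fun _ => Quot.mk _ (g.out 0)) fun p => Quot.mk _ p.2) ?_) ?_)
    (Quot.map (fun x => Quot.mk _ (.inr ⟨(), x⟩)) ?_) (fun _ => rfl) (fun _ => rfl)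
    (fun i => i.elim0) (fun _ => rfl) (fun _ => rfl)
  · rintro _ _ (i | i)
    · rfl
    · exact (Quot.sound ⟨rfl, rfl⟩).symm
  · rintro _ _ ⟨rfl, rfl⟩
    rfl
  · rintro _ _ ⟨rfl, rfl⟩
    exact ⟨Quot.sound (.input ()), Quot.sound (.output ())⟩

theorem GraphMon.replace_eq (T : GraphMon n L) {e : T.E} {h : GraphMon 2 L}
    {F : T.E → GraphMon 2 L} (h1 : F e = h) (h2 : ∀ k, k ≠ e → F k = .edge (T.lab k)) :
    T.replace e h = T.G.fill F := by
  rw [replace]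
  congr 1
  funext k
  split_ifs with hk
  · rw [hk, h1]
  · rw [h2 k hk]

/-- Replacing an edge in a substitution. -/
theorem GraphMon.exists_subst_replace (g : TGraph n I) (m : I → GraphMon 2 L) {i : I}
    {T : GraphMon 2 L} (hT : m i = T) (e : T.E) [DecidableEq I] :
    ∃ e' : (g.fill m).E, (g.fill m).lab e' = T.lab e ∧ ∀ M,
      (g.fill (Function.update m i (T.replace e M))).Iso ((g.fill m).replace e' M) := by
  classical
  subst hT
  refine ⟨⟨i, e⟩, rfl, fun M => ?_⟩
  let F : (Σ k, (m k).E) → GraphMon 2 L := fun p =>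
    if p = ⟨i, e⟩ then M else .edge ((m p.1).lab p.2)
  have hF : (g.fill m).replace ⟨i, e⟩ M = (g.comp fun k => (m k).G).fill F :=
    replace_eq _ (if_pos rfl) fun k hk => if_neg hk
  rw [hF]
  -- Associativity of substitution: the edge may be replaced before or after `m i` is inserted in
  -- `g`.
  refine Iso.trans (TGraph.fill_congr g fun k => ?_)
    (TGraph.fill_fill g (fun k => (m k).G) fun k a => F ⟨k, a⟩)
  by_cases hk : k = i
  · subst hk
    rw [Function.update_self]
    have hne : ∀ a, a ≠ e → (⟨k, a⟩ : Σ k, (m k).E) ≠ ⟨k, e⟩ := fun a ha h =>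
      ha (eq_of_heq (Sigma.mk.inj h).2)
    rw [(m k).replace_eq (F := fun a => F ⟨k, a⟩) (if_pos rfl) fun a ha => if_neg (hne a ha)]
    exact .refl _
  · rw [Function.update_of_ne hk]
    have : (fun a => F ⟨k, a⟩) = fun a => .edge ((m k).lab a) :=
      funext fun a => if_neg fun h => hk (Sigma.mk.inj h).1
    rw [this]
    exact (TGraph.fill_edge (m k).G (m k).lab).symm

theorem GraphMon.replace_congr (T : GraphMon n L) (e : T.E) {M M' : GraphMon 2 L} (h : M.Iso M') :
    (T.replace e M).Iso (T.replace e M') := by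
  refine TGraph.fill_congr _ fun k => ?_
  split_ifs
  exacts [h, .refl _]

theorem GraphMon.replace_adj (s : L → L) (T : GraphMon 2 L) (e : T.E) (M : GraphMon 2 L) :
    ((T.replace e M).adj s).Iso ((T.adj s).replace e (M.adj s)) := by
  classical
  have h : (T.adj s).replace e (M.adj s) =
      T.G.adj.fill fun k => if k = e then M.adj s else .edge (s (T.lab k)) :=
    replace_eq (T.adj s) (if_pos rfl) fun k hk => if_neg hk
  rw [h]
  refine (TGraph.fill_adj s _ _).trans (TGraph.fill_congr _ fun k => ?_)
  by_cases hk : k = e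
  · rw [if_pos hk, if_pos hk]
    exact .refl _
  · rw [if_neg hk, if_neg hk]
    exact GraphMon.adj_edge s _

theorem GraphMon.replace_close (T : GraphMon 2 L) (e : T.E) (M : GraphMon 2 L) :
    (T.replace e M).close.Iso (T.close.replace e M) := TGraph.fill_close _ _

theorem GraphMon.map_adj {L' : Type v} (f : L → L') {s : L → L} {s' : L' → L'}
    (h : ∀ x, s' (f x) = f (s x)) (m : GraphMon 2 L) : (m.map f).adj s' = (m.adj s).map f := by
  simp [GraphMon.map, GraphMon.adj, h]

end Iso

end Traffic
end

noncomputable section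

namespace Traffic

/-! ## Distributions of traffics -/

section Dist

variable {A : Type u} [AddCommGroup A] [Module ℂ A]

/-- The value of a labelled graph operation. -/
def GAlgebra.val (S : GAlgebra A) (m : GraphMon 2 A) : A := S.Z m.G m.lab

theorem GAlgebra.val_edge (S : GAlgebra A) (a : A) : S.val (.edge a) = a := S.Z_id _

theorem GAlgebra.val_fill (S : GAlgebra A) {I : Type} (g : GraphOp I) (m : I → GraphMon 2 A) :
    S.val (g.fill m) = S.Z g fun i => S.val (m i) :=
  (S.Z_comp g (fun i => (m i).G) fun i => (m i).lab).symm

theorem GAlgebra.val_fill_edge (S : GAlgebra A) {I : Type} (g : GraphOp I) (a : I → A) :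
    S.val (g.fill fun i => .edge (a i)) = S.Z g a := by
  rw [val_fill]
  simp only [val_edge]

variable (S : AlgSpaceOfTraffics A)

theorem AlgSpaceOfTraffics.dist_eq (t : GraphMon 0 A) (x : t.G.V) :
    S.dist t = S.Φ (S.Z (t.G.withOut fun _ => x) t.lab) := S.Φ_indep _ _ _ _

theorem AlgSpaceOfTraffics.dist_isTrafficFunctional : IsTrafficFunctional S.dist where
  iso_inv t t' h := by
    obtain ⟨σ, ⟨φ, hs, ht, -⟩, hl⟩ := h
    let x : t.G.V := Classical.arbitrary _
    have hiso : TGraph.IsoAlong σ (t.G.withOut fun _ : Fin 2 => x) (t'.G.withOut fun _ => φ x) :=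
      ⟨φ, hs, ht, fun _ => rfl⟩
    refine (S.dist_eq t x).trans (Eq.trans ?_ (S.dist_eq t' (φ x)).symm)
    refine congrArg S.Φ (Eq.trans ?_ (S.Z_iso σ _ _ hiso t'.lab).symm)
    exact congrArg _ (funext fun e => (hl e).symm)
  unital t h := by
    let x : t.G.V := Classical.arbitrary _
    have hV : ∀ y, y = x := fun y => t.eq_of_isEmpty h _ _
    have hiso : TGraph.IsoAlong (.equivOfIsEmpty t.E Empty) (t.G.withOut fun _ : Fin 2 => x) unitOp :=
      ⟨⟨fun _ => (), fun _ => x, fun y => (hV y).symm, fun _ => rfl⟩, fun e => h.elim e,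
        fun e => h.elim e, fun _ => rfl⟩
    refine (S.dist_eq t x).trans (Eq.trans (congrArg S.Φ ?_) S.Φ_unit)
    refine Eq.trans ?_ (S.Z_iso _ _ _ hiso _).symm
    exact congrArg _ (funext fun e => h.elim e)

/-- An inserted graph contributes only through its value in `A`, so that the multilinearity of `Z`
can be used for distributions. -/
theorem AlgSpaceOfTraffics.dist_fill {I : Type} (g : TGraph 0 I) (m : I → GraphMon 2 A) (x : g.V) :
    S.dist (g.fill m) = S.Φ (S.Z (g.withOut fun _ => x) fun i => S.val (m i)) := by
  have hiso : TGraph.IsoAlong (.refl _) ((g.fill m).G.withOut fun _ : Fin 2 => g.fillMk m x)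
      ((g.withOut fun _ : Fin 2 => x).fill m).G := by
    refine TGraph.isoAlong_of_maps _ (Quot.map id ?_) (Quot.map id ?_) (fun _ => rfl)
      (fun _ => rfl) (fun _ => rfl) (fun _ => rfl) (fun _ => rfl)
    · rintro _ _ (i | i)
      exacts [.input (g := g.withOut fun _ : Fin 2 => x) i,
        .output (g := g.withOut fun _ : Fin 2 => x) i]
    · rintro _ _ (i | i)
      exacts [.input (g := g) (h := fun i => (m i).G) i, .output (g := g) (h := fun i => (m i).G) i]
  refine (S.dist_eq (g.fill m) (g.fillMk m x)).trans (congrArg S.Φ ?_)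
  exact (S.Z_iso _ _ _ hiso _).symm.trans (S.val_fill (g.withOut fun _ => x) m)

theorem TGraph.diag_isoAlong {I : Type} (g : GraphOp I) :
    TGraph.IsoAlong (⟨fun p => p.2, fun i => ⟨(), i⟩, fun _ => rfl, fun _ => rfl⟩ : (Σ _ : Unit, I) ≃ I)
      (diagOp.comp fun _ : Unit => g) (g.close.withOut fun _ => Quot.mk _ (g.out 0)) := by
  refine TGraph.isoAlong_of_maps _
    (Quot.lift (Sum.elim (fun _ => Quot.mk _ (g.out 0)) fun p => Quot.mk _ p.2) ?_)
    (Quot.lift (fun x => Quot.mk _ (.inr ⟨(), x⟩)) ?_) (fun _ => rfl) (fun _ => rfl)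
    (fun i => rfl) (fun _ => rfl) (fun _ => rfl)
  · rintro _ _ (i | i)
    · rfl
    · exact (Quot.sound ⟨rfl, rfl⟩).symm
  · rintro _ _ ⟨rfl, rfl⟩
    exact (Quot.sound (.input ())).trans (Quot.sound (.output ())).symm

/-- Merging the input with the output is composition with `diagOp`, so this is `Φ_diag`. -/
theorem AlgSpaceOfTraffics.dist_close (m : GraphMon 2 A) : S.dist m.close = S.Φ (S.val m) := by
  refine (S.dist_eq m.close (Quot.mk _ (m.G.out 0))).trans
    (Eq.trans ?_ (S.Φ_diag m.G m.lab).symm)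
  exact congrArg S.Φ (S.Z_iso _ _ _ (TGraph.diag_isoAlong m.G) m.lab)

end Dist

/-! ## The relations of the free product -/

section Relations

/-- The relations between labelled graphs in a `𝒢`-algebra that define the free product. -/
inductive BasicRel {A : Type u} [AddCommGroup A] [Module ℂ A] (S : GAlgebra A) :
    GraphPoly 2 A → Prop
  | linear (c : ℂ) (a b : A) : BasicRel S (Finsupp.single (.edge (c • a + b)) 1 -
      c • Finsupp.single (.edge a) 1 - Finsupp.single (.edge b) 1)
  | comp {K : Type} (h : GraphOp K) (a : K → A) : BasicRel S (Finsupp.single (.edge (S.Z h a)) 1 -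
      Finsupp.single (h.fill fun k => .edge (a k)) 1)

theorem BasicRel.sum_val {A : Type u} [AddCommGroup A] [Module ℂ A] {S : GAlgebra A}
    {ρ : GraphPoly 2 A} (h : BasicRel S ρ) : Finsupp.linearCombination ℂ S.val ρ = 0 := by
  cases h with
  | linear c a b => simp [GAlgebra.val_edge]
  | comp h a => simp [GAlgebra.val_edge, GAlgebra.val_fill_edge]

variable {J : Type w} {A : J → Type u} [∀ j, AddCommGroup (A j)] [∀ j, Module ℂ (A j)]
  {S : ∀ j, GAlgebra (A j)}

theorem GraphMon.subst_update {I : Type} [DecidableEq I] {L : Type u} (g : GraphOp I) (x : I → L)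
    (i : I) (M : GraphMon 2 L) :
    GraphMon.subst g (Function.update (fun k => GraphMon.edge (x k)) i M) =
      (⟨I, g, x⟩ : GraphMon 2 L).replace i M :=
  (GraphMon.replace_eq ⟨I, g, x⟩ (e := i) (Function.update_self _ _ _)
    fun _ hk => Function.update_of_ne hk _ _).symm

theorem GraphMon.replace_update {n : ℕ} {L : Type u} (T : GraphMon n L) [DecidableEq T.E] (e : T.E) (l : L)
    (M : GraphMon 2 L) :
    (⟨T.E, T.G, Function.update T.lab e l⟩ : GraphMon n L).replace e M = T.replace e M := by
  classical
  refine GraphMon.replace_eq _ (if_pos rfl) fun k hk => ?_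
  exact (if_neg hk).trans (congrArg GraphMon.edge (Function.update_of_ne hk _ _).symm)

/-- Gives linearity and substitution a common form: inside a fixed monomial, one edge is replaced by
the terms of a relation of a single factor. -/
theorem freeRel_cases {r : GraphPoly 2 (Σ j, A j)} (h : FreeRel S r) :
    (∃ m m' : GraphMon 2 (Σ j, A j), m.Iso m' ∧ r = Finsupp.single m 1 - Finsupp.single m' 1) ∨
    ∃ (j : J) (T : GraphMon 2 (Σ j, A j)) (e : T.E) (ρ : GraphPoly 2 (A j)), (T.lab e).1 = j ∧
      BasicRel (S j) ρ ∧ r = ρ.mapDomain fun h => T.replace e (h.map (Sigma.mk j)) := by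
  cases h with
  | iso m m' h => exact .inl ⟨m, m', h, rfl⟩
  | @linear I _ g x i j c a b =>
    -- The label of the edge `i` is irrelevant since the edge gets replaced; `⟨j, 0⟩` gives it the
    -- color `j`.
    refine .inr ⟨j, ⟨I, g, (Function.update x i (⟨j, 0⟩ : Σ j, A j) : I → Σ j, A j)⟩, i, _, congrArg Sigma.fst (Function.update_self i (⟨j, 0⟩ : Σ j, A j) x), .linear c a b, ?_⟩
    · have h : ∀ M, (⟨I, g, (Function.update x i (⟨j, 0⟩ : Σ j, A j) : I → Σ j, A j)⟩ : GraphMon 2 (Σ j, A j)).replace i M =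
          GraphMon.subst g (Function.update (fun k => GraphMon.edge (x k)) i M) := fun M =>
        (GraphMon.replace_update ⟨I, g, x⟩ i _ M).trans (GraphMon.subst_update g x i M).symm
      simp only [h, Finsupp.mapDomain_sub, Finsupp.mapDomain_smul, Finsupp.mapDomain_single]
      rfl
  | @comp I K _ g x i j h a =>
    refine .inr ⟨j, ⟨I, g, (Function.update x i (⟨j, 0⟩ : Σ j, A j) : I → Σ j, A j)⟩, i, _, congrArg Sigma.fst (Function.update_self i (⟨j, 0⟩ : Σ j, A j) x), .comp h a, ?_⟩
    · have h : ∀ M, (⟨I, g, (Function.update x i (⟨j, 0⟩ : Σ j, A j) : I → Σ j, A j)⟩ : GraphMon 2 (Σ j, A j)).replace i M =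
          GraphMon.subst g (Function.update (fun k => GraphMon.edge (x k)) i M) := fun M =>
        (GraphMon.replace_update ⟨I, g, x⟩ i _ M).trans (GraphMon.subst_update g x i M).symm
      simp only [h, Finsupp.mapDomain_sub, Finsupp.mapDomain_single]
      rfl

theorem freeRel_of_basicRel {j : J} {ρ : GraphPoly 2 (A j)} (h : BasicRel (S j) ρ)
    (T : GraphMon 2 (Σ j, A j)) (e : T.E) :
    FreeRel S (ρ.mapDomain fun h => T.replace e (h.map (Sigma.mk j))) := by
  classical
  cases h with
  | linear c a b =>
    have := FreeRel.linear (S := S) T.G T.lab e j c a b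
    simp only [GraphMon.subst_update] at this
    simp only [Finsupp.mapDomain_sub, Finsupp.mapDomain_smul, Finsupp.mapDomain_single]
    exact this
  | comp h a =>
    have := FreeRel.comp (S := S) T.G T.lab e j h a
    simp only [GraphMon.subst_update] at this
    simp only [Finsupp.mapDomain_sub, Finsupp.mapDomain_single]
    exact this

namespace FreeProduct

theorem mk_eq (p : GraphPoly 2 (Σ j, A j)) :
    (Submodule.Quotient.mk p : FreeProduct S) = Finsupp.linearCombination ℂ (cls S) p := by
  have : (Submodule.mkQ _ : GraphPoly 2 (Σ j, A j) →ₗ[ℂ] FreeProduct S) =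
      Finsupp.linearCombination ℂ (cls S) :=
    Finsupp.lhom_ext' fun m => LinearMap.ext_ring (by simp [cls])
  exact LinearMap.congr_fun this p

theorem cls_iso {m m' : GraphMon 2 (Σ j, A j)} (h : m.Iso m') : cls S m = cls S m' :=
  (Submodule.Quotient.eq _).2 (Submodule.subset_span (.iso m m' h))

theorem sum_cls_replace {j : J} {ρ : GraphPoly 2 (A j)} (h : BasicRel (S j) ρ)
    (T : GraphMon 2 (Σ j, A j)) (e : T.E) :
    Finsupp.linearCombination ℂ (fun h => cls S (T.replace e (h.map (Sigma.mk j)))) ρ = 0 := by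
  have := (Submodule.Quotient.mk_eq_zero (Submodule.span ℂ {r | FreeRel S r})).2
    (Submodule.subset_span (freeRel_of_basicRel h T e))
  rw [mk_eq, Finsupp.linearCombination_mapDomain] at this
  exact this

theorem hom_ext_cls {X : Type*} [AddCommGroup X] [Module ℂ X] {f g : FreeProduct S →ₗ[ℂ] X}
    (h : ∀ m, f (cls S m) = g (cls S m)) : f = g := by
  refine Submodule.linearMap_qext _ ?_
  ext m
  exact h m

/-- A linear map on the free product is given by its values on monomials. -/
theorem exists_lift {X : Type*} [AddCommGroup X] [Module ℂ X] {σ : ℂ →+* ℂ}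
    (f : GraphPoly 2 (Σ j, A j) →ₛₗ[σ] X)
    (h1 : ∀ m m', m.Iso m' → f (Finsupp.single m 1) = f (Finsupp.single m' 1))
    (h2 : ∀ (j : J) (T : GraphMon 2 (Σ j, A j)) (e : T.E) (ρ : GraphPoly 2 (A j)),
      (T.lab e).1 = j → BasicRel (S j) ρ →
        f (ρ.mapDomain fun h => T.replace e (h.map (Sigma.mk j))) = 0) :
    ∃ F : FreeProduct S →ₛₗ[σ] X, ∀ p, F (Submodule.Quotient.mk p) = f p := by
  refine ⟨Submodule.liftQ _ f (Submodule.span_le.2 fun r hr => ?_), fun p => rfl⟩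
  rw [SetLike.mem_coe, LinearMap.mem_ker]
  rcases freeRel_cases hr with ⟨m, m', h, rfl⟩ | ⟨j, T, e, ρ, hj, h, rfl⟩
  · rw [map_sub, h1 m m' h, sub_self]
  · exact h2 j T e ρ hj h

end FreeProduct

end Relations

end Traffic
end

noncomputable section

namespace Traffic

/-! ## Multilinear maps on quotients of free modules -/

section Multilinear

variable {ι κ X : Type*} [Finite ι] [AddCommGroup X]

theorem exists_multilinearMap_single [Module ℂ X] (f : (ι → κ) → X) :
    ∃ F : MultilinearMap ℂ (fun _ : ι => κ →₀ ℂ) X,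
      ∀ p : ι → κ, F (fun i => Finsupp.single (p i) 1) = f p := by
  classical
  cases nonempty_fintype ι
  let D : MultilinearMap ℂ (fun _ : ι => Π₀ _ : κ, ℂ) X :=
    MultilinearMap.fromDFinsuppEquiv (fun _ : ι => κ) ℂ
      fun p => (MultilinearMap.mkPiRing ℂ ι (f p) : MultilinearMap ℂ (fun _ : ι => ℂ) X)
  refine ⟨D.compLinearMap fun _ => (finsuppLequivDFinsupp (M := ℂ) (ι := κ) ℂ).toLinearMap,
    fun p => ?_⟩
  have h : ∀ k : κ, finsuppLequivDFinsupp (M := ℂ) (ι := κ) ℂ (Finsupp.single k 1) =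
      DFinsupp.single k 1 := fun k => Finsupp.toDFinsupp_single k 1
  simp only [MultilinearMap.compLinearMap_apply, LinearEquiv.coe_coe, h]
  refine (MultilinearMap.fromDFinsuppEquiv_single (M := fun _ _ => ℂ) _ p
    fun _ => (1 : ℂ)).trans ?_
  simp

/-- Pass from `t'` to `t` by changing one coordinate at a time. -/
theorem multilinearMap_congr_mod {R M : Type*} [CommRing R] [AddCommGroup M] [Module R M]
    [Module R X] [DecidableEq ι] (N : Submodule R M) (f : MultilinearMap R (fun _ : ι => M) X)
    (hf : ∀ t i, ∀ r ∈ N, f (Function.update t i r) = 0) {t t' : ι → M}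
    (h : ∀ i, t i - t' i ∈ N) : f t = f t' := by
  cases nonempty_fintype ι
  have key : ∀ s : Finset ι, f (s.piecewise t t') = f t' := by
    intro s
    induction s using Finset.induction_on with
    | empty => simp
    | insert a s ha ih =>
      rw [Finset.piecewise_insert]
      have h1 : s.piecewise t t' = Function.update (s.piecewise t t') a (t' a) := by
        rw [eq_comm, Function.update_eq_self_iff, Finset.piecewise_eq_of_notMem _ _ _ ha]
      rw [← ih, ← sub_eq_zero]
      nth_rw 2 [h1]
      rw [← f.map_update_sub]
      exact hf _ _ _ (h a)
  simpa using key Finset.univ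

/-- Evaluate at arbitrary representatives; by `multilinearMap_congr_mod` the result does not depend
on them, which also gives multilinearity. -/
theorem exists_multilinearMap_quotient {R M : Type*} [CommRing R] [AddCommGroup M] [Module R M]
    [Module R X] [inst : DecidableEq ι] (N : Submodule R M) (f : MultilinearMap R (fun _ : ι => M) X)
    (hf : ∀ t i, ∀ r ∈ N, f (Function.update t i r) = 0) :
    ∃ F : MultilinearMap R (fun _ : ι => M ⧸ N) X,
      ∀ t : ι → M, F (fun i => Submodule.Quotient.mk (t i)) = f t := by
  let l : M ⧸ N → M := Function.surjInv (Submodule.Quotient.mk_surjective N)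
  have hl : ∀ q, Submodule.Quotient.mk (l q) = q :=
    Function.surjInv_eq (Submodule.Quotient.mk_surjective N)
  have hcongr : ∀ t t' : ι → M, (∀ i, (Submodule.Quotient.mk (t i) : M ⧸ N) =
      Submodule.Quotient.mk (t' i)) → f t = f t' := fun t t' h =>
    multilinearMap_congr_mod N f hf fun i => (Submodule.Quotient.eq N).1 (h i)
  have hupd : ∀ (q : ι → M ⧸ N) i (y : M ⧸ N) (y' : M), Submodule.Quotient.mk y' = y →
      f (fun k => l (Function.update q i y k)) = f (Function.update (fun k => l (q k)) i y') := by
    rintro q i y y' rfl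
    refine hcongr _ _ fun k => ?_
    rw [hl]
    by_cases hk : k = i
    · subst hk
      rw [Function.update_self, Function.update_self]
    · rw [Function.update_of_ne hk, Function.update_of_ne hk, hl]
  refine ⟨⟨fun q => f fun i => l (q i), ?_, ?_⟩, fun t => hcongr _ _ fun i => hl _⟩
  · intro hdec q i x y
    obtain rfl : hdec = inst := Subsingleton.elim _ _
    rw [hupd q i (x + y) (l x + l y) (by simp [hl]),
      hupd q i x (l x) (hl x), hupd q i y (l y) (hl y), f.map_update_add]
  · intro hdec q i c x
    obtain rfl : hdec = inst := Subsingleton.elim _ _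
    rw [hupd q i (c • x) (c • l x) (by simp [hl]),
      hupd q i x (l x) (hl x), f.map_update_smul]

theorem exists_multilinearMap_quotient_single [Module ℂ X] [DecidableEq ι] (N : Submodule ℂ (κ →₀ ℂ))
    (f : (ι → κ) → X)
    (hf : ∀ (t : ι → κ) i, ∀ r ∈ N,
      Finsupp.linearCombination ℂ (fun k => f (Function.update t i k)) r = 0) :
    ∃ F : MultilinearMap ℂ (fun _ : ι => (κ →₀ ℂ) ⧸ N) X,
      ∀ t : ι → κ, F (fun i => Submodule.Quotient.mk (Finsupp.single (t i) 1)) = f t := by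
  obtain ⟨F, hF⟩ := exists_multilinearMap_single f
  have hsingle : ∀ (v : ι → κ) i, F.toLinearMap (fun k => Finsupp.single (v k) 1) i =
      Finsupp.linearCombination ℂ fun k => f (Function.update v i k) := by
    intro v i
    refine Finsupp.lhom_ext' fun k => LinearMap.ext_ring ?_
    have : Function.update (fun k => Finsupp.single (v k) (1 : ℂ)) i (Finsupp.single k 1) =
        fun j => Finsupp.single (Function.update v i k j) 1 := by
      funext j
      exact (Function.apply_update (fun _ x => Finsupp.single x (1 : ℂ)) v i k j).symm
    simp [MultilinearMap.toLinearMap_apply, this, hF]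
  have hvan : ∀ t i, ∀ r ∈ N, F (Function.update t i r) = 0 := by
    intro t i r hr
    rcases isEmpty_or_nonempty κ with hκ | ⟨⟨k₀⟩⟩
    · exact F.map_coord_zero i (by rw [Function.update_self]; exact Subsingleton.elim _ _)
    -- `W` puts `r` in the coordinate `i` whatever basis vector is there, so that the vanishing can
    -- be tested on basis vectors.
    let W := F.compLinearMap fun k =>
      if k = i then Finsupp.linearCombination ℂ fun _ : κ => r else LinearMap.id
    have hW : W = 0 := by
      refine Module.Basis.ext_multilinear (fun _ => Finsupp.basisSingleOne) fun v => ?_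
      rw [zero_apply, ← hf v i r hr, ← hsingle v i, MultilinearMap.toLinearMap_apply]
      refine congrArg F (funext fun k => ?_)
      by_cases hk : k = i
      · subst hk
        simp
      · simp [hk]
    have := congrArg (fun G => G (Function.update t i (Finsupp.single k₀ 1))) hW
    refine Eq.trans (congrArg F (funext fun k => ?_)) this
    by_cases hk : k = i
    · subst hk
      simp
    · simp [hk]
  obtain ⟨G, hG⟩ := exists_multilinearMap_quotient N F hvan
  exact ⟨G, fun t => (hG _).trans (hF t)⟩

end Multilinear

/-! ## The graph operations on the free product -/

namespace FreeProduct

variable {J : Type w} {A : J → Type u} [∀ j, AddCommGroup (A j)] [∀ j, Module ℂ (A j)]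
  {S : ∀ j, GAlgebra (A j)}

/-- The classes of monomials span, so identities between multilinear maps on the free product reduce
to isomorphisms of graphs. -/
theorem multilinearMap_ext_cls {I X : Type*} [Finite I] [AddCommGroup X] [Module ℂ X]
    {F F' : MultilinearMap ℂ (fun _ : I => FreeProduct S) X}
    (h : ∀ m : I → GraphMon 2 (Σ j, A j), F (fun i => cls S (m i)) = F' fun i => cls S (m i)) :
    F = F' := by
  have key : F.compLinearMap (fun _ => (Submodule.mkQ _ : _ →ₗ[ℂ] FreeProduct S)) =
      F'.compLinearMap fun _ => (Submodule.mkQ _ : _ →ₗ[ℂ] FreeProduct S) :=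
    Module.Basis.ext_multilinear (fun _ => Finsupp.basisSingleOne) fun v => by
      simpa using! h v
  ext a
  choose b hb using fun i => Submodule.Quotient.mk_surjective _ (a i)
  have := congrArg (fun G => G b) key
  simpa [hb] using this

variable (S) in
-- A relation in one of the arguments becomes, by associativity of substitution, a relation at an
-- edge of the substituted graph.
theorem exists_Z {I : Type} (g : GraphOp I) :
    ∃ F : MultilinearMap ℂ (fun _ : I => FreeProduct S) (FreeProduct S),
      ∀ m : I → GraphMon 2 (Σ j, A j), F (fun i => cls S (m i)) = cls S (g.fill m) := by
  classical
  have := g.finite_E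
  refine exists_multilinearMap_quotient_single _ (fun m => cls S (g.fill m)) ?_
  intro m i r hr
  induction hr using Submodule.span_induction with
  | zero => exact map_zero _
  | add x y _ _ hx hy => rw [map_add, hx, hy, add_zero]
  | smul c x _ hx => rw [map_smul, hx, smul_zero]
  | mem r hr =>
    rcases freeRel_cases hr with ⟨m₁, m₂, h, rfl⟩ | ⟨j, T, e, ρ, -, h, rfl⟩
    · have : (g.fill (Function.update m i m₁)).Iso (g.fill (Function.update m i m₂)) := by
        refine TGraph.fill_congr _ fun k => ?_
        by_cases hk : k = i
        · subst hk
          simpa using h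
        · simpa [hk] using GraphMon.Iso.refl _
      simp [cls_iso this]
    · obtain ⟨e', -, he'⟩ := GraphMon.exists_subst_replace g (Function.update m i T)
        (Function.update_self i T m) e
      rw [Finsupp.linearCombination_mapDomain]
      refine Eq.trans ?_ (sum_cls_replace h (g.fill (Function.update m i T)) e')
      refine congrArg (fun f => Finsupp.linearCombination ℂ f ρ) (funext fun M => ?_)
      refine cls_iso ?_
      have := he' (M.map (Sigma.mk j))
      rwa [Function.update_idem] at this

theorem _root_.Traffic.TGraph.fill_idOp {L : Type*} (m : Unit → GraphMon 2 L) :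
    (idOp.fill m).Iso (m ()) := by
  refine ⟨⟨fun p => p.2, fun e => ⟨(), e⟩, fun _ => rfl, fun _ => rfl⟩,
    TGraph.isoAlong_of_maps _
      (Quot.lift (Sum.elim (m ()).G.out fun p => p.2) ?_) (fun x => Quot.mk _ (.inr ⟨(), x⟩))
      (fun _ => rfl) (fun _ => rfl) (fun _ => rfl) (fun _ => rfl) (fun _ => rfl), fun _ => rfl⟩
  rintro _ _ (i | i) <;> rfl

variable (S) in
/-- The free product of `𝒢`-algebras, as a `𝒢`-algebra. -/
def algebra : GAlgebra (FreeProduct S) where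
  Z g := (exists_Z S g).choose
  Z_id a := by
    have h : (exists_Z S idOp).choose = MultilinearMap.ofSubsingleton ℂ _ _ () LinearMap.id :=
      multilinearMap_ext_cls fun m => ((exists_Z S idOp).choose_spec m).trans
        (cls_iso (TGraph.fill_idOp m))
    rw [h]
    rfl
  Z_comp g h a := by
    have := g.finite_E
    have := fun i => (h i).finite_E
    have key : (exists_Z S g).choose.compMultilinearMap (fun i => (exists_Z S (h i)).choose) =
        (exists_Z S (g.comp h)).choose := by
      refine multilinearMap_ext_cls fun m => ?_
      rw [(exists_Z S (g.comp h)).choose_spec]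
      refine Eq.trans ?_ (cls_iso (TGraph.fill_fill g h fun i k => m ⟨i, k⟩))
      rw [← (exists_Z S g).choose_spec]
      exact congrArg _ (funext fun i => (exists_Z S (h i)).choose_spec _)
    exact congrArg (fun F => F fun p => a p.1 p.2) key
  Z_iso σ g g' h a := by
    have := g'.finite_E
    have key : (exists_Z S g').choose = (exists_Z S g).choose.domDomCongr σ := by
      refine multilinearMap_ext_cls fun m => ?_
      rw [(exists_Z S g').choose_spec]
      exact (cls_iso (TGraph.fill_isoAlong h m)).symm.trans ((exists_Z S g).choose_spec _).symm
    exact congrArg (fun F => F a) key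

theorem algebra_Z_cls {I : Type} (g : GraphOp I) (m : I → GraphMon 2 (Σ j, A j)) :
    (algebra S).Z g (fun i => cls S (m i)) = cls S (g.fill m) := (exists_Z S g).choose_spec m

end FreeProduct

end Traffic
end

/-! ### The trace and the involution on the free product. -/

noncomputable section

namespace Traffic

theorem GraphMon.Iso.close {L : Type u} {m m' : GraphMon 2 L} (h : m.Iso m') :
    m.close.Iso m'.close := by
  obtain ⟨σ, ⟨φ, hs, ht, ho⟩, hl⟩ := h
  refine ⟨σ, TGraph.isoAlong_of_maps _ (Quot.map φ ?_) (Quot.map φ.symm ?_)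
    (fun e => congrArg (Quot.mk _) (hs e)) (fun e => congrArg (Quot.mk _) (ht e))
    (fun i => i.elim0) (fun e => congrArg (Quot.mk _) (φ.symm_apply_eq.2 (hs e).symm))
    (fun e => congrArg (Quot.mk _) (φ.symm_apply_eq.2 (ht e).symm)), hl⟩
  · rintro _ _ ⟨rfl, rfl⟩
    exact ⟨ho 0, ho 1⟩
  · rintro _ _ ⟨rfl, rfl⟩
    exact ⟨φ.symm_apply_eq.2 (ho 0).symm, φ.symm_apply_eq.2 (ho 1).symm⟩

theorem GraphMon.Iso.adj {L : Type u} (s : L → L) {m m' : GraphMon 2 L} (h : m.Iso m') :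
    (m.adj s).Iso (m'.adj s) := by
  obtain ⟨σ, ⟨φ, hs, ht, ho⟩, hl⟩ := h
  refine ⟨σ, ⟨φ, ht, hs, fun i => ?_⟩, fun e => congrArg s (hl e)⟩
  fin_cases i
  exacts [ho 1, ho 0]

theorem GraphMon.adj_adj {L : Type u} {s : L → L} (hs : ∀ x, s (s x) = x) (m : GraphMon 2 L) :
    ((m.adj s).adj s).Iso m := by
  refine ⟨.refl _, ⟨.refl _, fun _ => rfl, fun _ => rfl, fun i => ?_⟩, fun e => (hs _).symm⟩
  fin_cases i <;> rfl

/-- With the other labels fixed, the distribution is a linear function of the value of the graph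
inserted at `e`, and a basic relation has value zero. -/
theorem BasicRel.sum_mul_dist_replace {A : Type u} [AddCommGroup A] [Module ℂ A]
    (S : AlgSpaceOfTraffics A) {ρ : GraphPoly 2 A} (h : BasicRel S.toGAlgebra ρ)
    (c : GraphMon 0 A) (e : c.E) : ∑ m ∈ ρ.support, ρ m * S.dist (c.replace e m) = 0 := by
  classical
  let x : c.G.V := Classical.arbitrary _
  let L : A →ₗ[ℂ] ℂ := S.Φ ∘ₗ (S.Z (c.G.withOut fun _ => x)).toLinearMap c.lab e
  have hL : ∀ m, S.dist (c.replace e m) = L (S.val m) := by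
    intro m
    refine (S.dist_fill c.G _ x).trans (congrArg S.Φ (congrArg _ (funext fun k => ?_)))
    by_cases hk : k = e
    · subst hk
      simp
    · simp [hk, GAlgebra.val_edge]
  have := congrArg L h.sum_val
  rw [map_zero, Finsupp.linearCombination_apply, Finsupp.sum, map_sum] at this
  simpa [hL] using this

namespace FreeProduct

variable {J : Type w} {A : J → Type u} [∀ j, AddCommGroup (A j)] [∀ j, Module ℂ (A j)]

section Trace

variable (S : ∀ j, AlgSpaceOfTraffics (A j))

theorem freeProd_dist_isTrafficFunctional :
    IsTrafficFunctional (freeProd fun j => (S j).dist) :=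
  freeProd_isTrafficFunctional fun j => (S j).dist_isTrafficFunctional

/-- The trace vanishes on the relations by the locality of the free product,
`sum_mul_freeProd_replace_eq_zero`. -/
theorem exists_trace : ∃ Φ : FreeProduct (fun j => (S j).toGAlgebra) →ₗ[ℂ] ℂ,
    ∀ m, Φ (cls _ m) = freeProd (fun j => (S j).dist) m.close := by
  have hiso := (freeProd_dist_isTrafficFunctional S).iso_inv
  refine (exists_lift (S := fun j => (S j).toGAlgebra) (σ := RingHom.id ℂ)
    (Finsupp.linearCombination ℂ fun m => freeProd (fun j => (S j).dist) m.close) ?_ ?_).imp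
      fun Φ hΦ m => (hΦ _).trans (by simp)
  · intro m m' h
    simp [hiso _ _ h.close]
  · intro j T e ρ hj h
    rw [Finsupp.linearCombination_mapDomain, Finsupp.linearCombination_apply, Finsupp.sum]
    refine Eq.trans (Finset.sum_congr rfl fun m _ => ?_)
      (sum_mul_freeProd_replace_eq_zero (fun j => (S j).dist_isTrafficFunctional) T.close (e := e)
        hj ρ.support ρ id fun c e => h.sum_mul_dist_replace (S j) c e)
    exact congrArg (ρ m * ·) (hiso _ _ (GraphMon.replace_close T e _))

/-- The trace on the free product. -/
def trace : FreeProduct (fun j => (S j).toGAlgebra) →ₗ[ℂ] ℂ := (exists_trace S).choose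

theorem trace_cls (m : GraphMon 2 (Σ j, A j)) :
    trace S (cls _ m) = freeProd (fun j => (S j).dist) m.close := (exists_trace S).choose_spec m

theorem trace_Z_cls {I : Type} (g : GraphOp I) (m : I → GraphMon 2 (Σ j, A j)) :
    trace S ((algebra _).Z g fun i => cls _ (m i)) =
      freeProd (fun j => (S j).dist) (g.close.fill m) := by
  rw [algebra_Z_cls, trace_cls]
  exact (freeProd_dist_isTrafficFunctional S).iso_inv _ _ (TGraph.fill_close g m)

theorem trace_Z_withOut_cls {I : Type} (g : TGraph 0 I) (x : g.V)
    (m : I → GraphMon 2 (Σ j, A j)) :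
    trace S ((algebra _).Z (g.withOut fun _ => x) fun i => cls _ (m i)) =
      freeProd (fun j => (S j).dist) (g.fill m) :=
  (trace_Z_cls S _ m).trans ((freeProd_dist_isTrafficFunctional S).iso_inv _ _
    (TGraph.fill_isoAlong (TGraph.withOut_close_isoAlong g x) m))

/-- The free product of algebraic spaces of traffics. -/
def algSpace : AlgSpaceOfTraffics (FreeProduct fun j => (S j).toGAlgebra) where
  toGAlgebra := algebra _
  Φ := trace S
  Φ_unit := by
    have h := trace_Z_cls S unitOp Empty.elim
    have h0 : (fun i => cls _ (Empty.elim i) : Empty → FreeProduct fun j => (S j).toGAlgebra) =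
        Empty.elim := funext fun i => i.elim
    rw [h0] at h
    refine h.trans ((freeProd_dist_isTrafficFunctional S).unital _ ⟨fun p => p.1.elim⟩)
  Φ_diag g a := by
    have := g.finite_E
    have key : (trace S).compMultilinearMap ((algebra _).Z g) =
        ((trace S).compMultilinearMap ((algebra _).Z (diagOp.comp fun _ : Unit => g))).domDomCongr
          ⟨fun p => p.2, fun i => ⟨(), i⟩, fun _ => rfl, fun _ => rfl⟩ :=
      multilinearMap_ext_cls fun m => (trace_Z_cls S _ m).trans
        (((freeProd_dist_isTrafficFunctional S).iso_inv _ _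
          (TGraph.fill_isoAlong (TGraph.diag_close_isoAlong g) m)).symm.trans
            (trace_Z_cls S _ _).symm)
    exact congrArg (fun F => F a) key
  Φ_indep g x y a := by
    have := g.finite_E
    have key : (trace S).compMultilinearMap ((algebra _).Z (g.withOut fun _ => x)) =
        (trace S).compMultilinearMap ((algebra _).Z (g.withOut fun _ => y)) :=
      multilinearMap_ext_cls fun m => (trace_Z_withOut_cls S g x m).trans
        (trace_Z_withOut_cls S g y m).symm
    exact congrArg (fun F => F a) key

/-- The distribution of traffics of the free product. -/
theorem algSpace_dist {E : Type} (g : TGraph 0 E) (m : E → GraphMon 2 (Σ j, A j)) :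
    (algSpace S).dist ⟨E, g, fun e => cls _ (m e)⟩ =
      freeProd (fun j => (S j).dist) (g.fill m) := trace_Z_withOut_cls S g _ m

end Trace

section Involution

variable (S : ∀ j, SpaceOfTraffics (A j))

/-- The adjoint of a basic relation is again a basic relation, with conjugate scalar, adjoint labels
and adjoint graph. -/
theorem exists_star :
    ∃ F : FreeProduct (fun j => (S j).toGAlgebra) →ₛₗ[starRingEnd ℂ]
      FreeProduct (fun j => (S j).toGAlgebra),
    ∀ m, F (cls _ m) = cls _ (m.adj (sigmaStar fun j => (S j).star)) := by
  let C : GraphMon 2 (Σ j, A j) → FreeProduct fun j => (S j).toGAlgebra :=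
    fun m => cls _ (m.adj (sigmaStar fun j => (S j).star))
  let f : GraphPoly 2 (Σ j, A j) →ₛₗ[starRingEnd ℂ] FreeProduct fun j => (S j).toGAlgebra :=
    { toFun := fun p => Finsupp.linearCombination ℂ C (p.mapRange (starRingEnd ℂ) (map_zero _))
      map_add' := fun p q => by rw [Finsupp.mapRange_add (map_add _), map_add]
      map_smul' := fun c p => by
        rw [Finsupp.mapRange_smul' c (starRingEnd ℂ c) p (fun x => map_mul _ _ _), map_smul] }
  have hf : ∀ m, f (Finsupp.single m 1) = C m := fun m => by simp [f]
  have hadj : ∀ m m' : GraphMon 2 (Σ j, A j), m.Iso m' → C m = C m' := fun m m' h =>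
    cls_iso (h.adj _)
  refine (exists_lift f (fun m m' h => by rw [hf, hf, hadj m m' h]) ?_).imp
    fun F hF m => (hF _).trans (hf m)
  · intro j T e ρ hj h
    have hC : ∀ m m' : GraphMon 2 (A j), (m.adj (S j).star).Iso m' →
        f (Finsupp.single (T.replace e (m.map (Sigma.mk j))) 1) =
          cls _ ((T.adj (sigmaStar fun j => (S j).star)).replace e (m'.map (Sigma.mk j))) := by
      intro m m' hm
      rw [hf]
      refine cls_iso ((GraphMon.replace_adj _ T e _).trans ?_)
      rw [GraphMon.map_adj (s := (S j).star) (Sigma.mk j) (fun _ => rfl)]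
      exact GraphMon.replace_congr (T.adj (sigmaStar fun j => (S j).star)) e (hm.map _)
    cases h with
    | linear c a b =>
      have := sum_cls_replace (S := fun j => (S j).toGAlgebra) (j := j) (.linear (starRingEnd ℂ c) ((S j).star a)
        ((S j).star b)) (T.adj (sigmaStar fun j => (S j).star)) e
      simp only [map_sub, map_smul, Finsupp.linearCombination_single, one_smul] at this
      simp only [Finsupp.mapDomain_sub, Finsupp.mapDomain_smul, Finsupp.mapDomain_single, map_sub,
        map_smulₛₗ, hC _ _ (GraphMon.adj_edge _ _), (S j).star_add, (S j).star_smul]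
      exact this
    | comp h a =>
      have := sum_cls_replace (S := fun j => (S j).toGAlgebra) (j := j) (.comp h.adj fun k => (S j).star (a k))
        (T.adj (sigmaStar fun j => (S j).star)) e
      simp only [map_sub, Finsupp.linearCombination_single, one_smul] at this
      simp only [Finsupp.mapDomain_sub, Finsupp.mapDomain_single, map_sub,
        hC _ _ (GraphMon.adj_edge _ _), (S j).star_Z, hC _ _ ((TGraph.fill_adj _ _ _).trans
          (TGraph.fill_congr _ fun k => GraphMon.adj_edge _ (a k)))]
      exact this

/-- The involution of the free product. -/
def star : FreeProduct (fun j => (S j).toGAlgebra) →ₛₗ[starRingEnd ℂ]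
    FreeProduct (fun j => (S j).toGAlgebra) := (exists_star S).choose

theorem star_cls (m : GraphMon 2 (Σ j, A j)) :
    star S (cls _ m) = cls _ (m.adj (sigmaStar fun j => (S j).star)) :=
  (exists_star S).choose_spec m

theorem star_star_apply (x : FreeProduct fun j => (S j).toGAlgebra) : star S (star S x) = x := by
  have key : (star S).comp (star S) = LinearMap.id (R := ℂ) := by
    refine hom_ext_cls fun m => ?_
    simp only [LinearMap.comp_apply, star_cls, LinearMap.id_apply]
    exact cls_iso (m.adj_adj fun x => Sigma.ext rfl (heq_of_eq ((S x.1).star_star x.2)))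
  exact LinearMap.congr_fun key x

theorem star_Z {I : Type} (g : GraphOp I) (a : I → FreeProduct fun j => (S j).toGAlgebra) :
    star S ((algebra _).Z g a) = (algebra _).Z g.adj fun i => star S (a i) := by
  have := g.finite_E
  have hupd : ∀ [DecidableEq I] (a : I → FreeProduct fun j => (S j).toGAlgebra) i x,
      (fun k => star S (Function.update a i x k)) =
        Function.update (fun k => star S (a k)) i (star S x) := fun a i x =>
    funext fun k => Function.apply_update (fun _ => star S) a i x k
  -- Conjugating `Z g.adj` by the antilinear involution gives a `ℂ`-multilinear map, which can be
  -- compared with `Z g` on classes of monomials.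
  let H : MultilinearMap ℂ (fun _ : I => FreeProduct fun j => (S j).toGAlgebra)
      (FreeProduct fun j => (S j).toGAlgebra) :=
    { toFun := fun a => star S ((algebra _).Z g.adj fun i => star S (a i))
      map_update_add' := fun a i x y => by
        simp only [hupd, map_add, MultilinearMap.map_update_add]
      map_update_smul' := fun a i c x => by
        simp only [hupd, map_smulₛₗ, MultilinearMap.map_update_smul, RingHomCompTriple.comp_apply,
          RingHom.id_apply] }
  have key : H = (algebra _).Z g := by
    refine multilinearMap_ext_cls fun m => ?_
    have h : (algebra fun j => (S j).toGAlgebra).Z g.adj (fun i => star S (cls _ (m i))) =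
        star S (cls _ (g.fill m)) := by
      simp only [star_cls]
      rw [algebra_Z_cls]
      exact (cls_iso (TGraph.fill_adj _ g m)).symm
    exact ((congrArg (star S) h).trans (star_star_apply S _)).trans (algebra_Z_cls g m).symm
  rw [← key]
  exact star_star_apply S _

end Involution

end FreeProduct

end Traffic
end

/-! ### Positivity of the trace, and the canonical maps. -/

noncomputable section

namespace Traffic

theorem GraphMon.Iso.glue_left {n : ℕ} {L : Type u} {m' m'' : GraphMon (n + 1) L} (h : m'.Iso m'')
    (m : GraphMon (n + 1) L) : (m.glue m').Iso (m.glue m'') := by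
  obtain ⟨σ, ⟨φ, hs, ht, ho⟩, hl⟩ := h
  refine ⟨(Equiv.refl _).sumCongr σ, TGraph.isoAlong_of_maps _ (Quot.map (Sum.map id φ) ?_)
    (Quot.map (Sum.map id φ.symm) ?_) ?_ ?_ (fun i => i.elim0) ?_ ?_, ?_⟩
  · rintro _ _ ⟨i⟩
    change TGraph.GlueRel m.G m''.G (.inl (m.G.out i)) (.inr (φ (m'.G.out i)))
    rw [ho i]
    exact .out i
  · rintro _ _ ⟨i⟩
    change TGraph.GlueRel m.G m'.G (.inl (m.G.out i)) (.inr (φ.symm (m''.G.out i)))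
    rw [φ.symm_apply_eq.2 (ho i).symm]
    exact .out i
  · rintro (e | e)
    exacts [rfl, congrArg (fun x => Quot.mk _ (Sum.inr x)) (hs e)]
  · rintro (e | e)
    exacts [rfl, congrArg (fun x => Quot.mk _ (Sum.inr x)) (ht e)]
  · rintro (e | e)
    exacts [rfl, congrArg (fun x => Quot.mk _ (Sum.inr x)) (φ.symm_apply_eq.2 (hs e).symm)]
  · rintro (e | e)
    exacts [rfl, congrArg (fun x => Quot.mk _ (Sum.inr x)) (φ.symm_apply_eq.2 (ht e).symm)]
  · rintro (e | e)
    exacts [rfl, hl e]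

namespace FreeProduct

variable {J : Type w} {A : J → Type u} [∀ j, AddCommGroup (A j)] [∀ j, Module ℂ (A j)]
  (S : ∀ j, SpaceOfTraffics (A j))

theorem algSpace_dist_glue {n : ℕ} {E E' : Type} (g : TGraph (n + 1) E) (g' : TGraph (n + 1) E')
    (m : E → GraphMon 2 (Σ j, A j)) (m' : E' → GraphMon 2 (Σ j, A j)) :
    (algSpace fun j => (S j).toAlgSpaceOfTraffics).dist
        ⟨E ⊕ E', g.glue g'.rev, Sum.elim (fun e => cls _ (m e)) fun e => star S (cls _ (m' e))⟩ =
      freeProd (fun j => (S j).dist)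
        ((g.fill m).glue ((g'.fill m').star (sigmaStar fun j => (S j).star))) := by
  have h : (Sum.elim (fun e => cls _ (m e)) fun e => star S (cls _ (m' e)) :
      E ⊕ E' → FreeProduct fun j => (S j).toGAlgebra) =
      fun e => cls _ (Sum.elim m (fun e => (m' e).adj (sigmaStar fun j => (S j).star)) e) := by
    funext e
    rcases e with e | e
    exacts [rfl, star_cls S _]
  rw [h, algSpace_dist]
  refine (freeProd_dist_isTrafficFunctional _).iso_inv _ _ ((TGraph.fill_glue _ _ _ _).trans ?_)
  exact (TGraph.fill_star _ g' m').symm.glue_left _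

open Classical in
-- Each label is a finite combination of classes of monomials. By multilinearity a graph labelled by
-- the free product expands into graphs labelled by the factors, and the positivity in
-- `freeProd_isPositive` is pulled back.
theorem algSpace_isPositive :
    IsPositive (star S) (algSpace fun j => (S j).toAlgSpaceOfTraffics).dist := by
  rw [isPositive_iff_psd]
  intro n
  have hb : ∀ x : FreeProduct fun j => (S j).toGAlgebra,
      ∃ b : GraphPoly 2 (Σ j, A j), x = ∑ k : b.support, b k • cls _ k.1 := by
    intro x
    obtain ⟨b, rfl⟩ := Submodule.Quotient.mk_surjective _ x
    refine ⟨b, (mk_eq b).trans ?_⟩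
    rw [Finsupp.linearCombination_apply, Finsupp.sum, ← Finset.sum_coe_sort]
  choose b hb using hb
  have hE : ∀ t : GraphMon (n + 1) (FreeProduct fun j => (S j).toGAlgebra), Finite t.E :=
    fun t => t.G.finite_E
  let _ : ∀ t : GraphMon (n + 1) (FreeProduct fun j => (S j).toGAlgebra), Fintype t.E :=
    fun t => Fintype.ofFinite _
  -- The coefficients are conjugated because `PSD.sum_sum` conjugates those of its first argument,
  -- whereas the adjoint falls on the second one.
  have h := ((isPositive_iff_psd _ _).1 (freeProd_isPositive
    (fun j => (S j).dist_isTrafficFunctional) fun j => (S j).positive) n).sum_sum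
      (X := fun t : GraphMon (n + 1) (FreeProduct fun j => (S j).toGAlgebra) =>
        ∀ e : t.E, (b (t.lab e)).support)
      (fun t x => t.G.fill fun e => (x e).1) fun t x => Star.star (∏ e, b (t.lab e) (x e))
  refine (congrArg PSD ?_).mp h
  funext t t'
  let P := algSpace fun j => (S j).toAlgSpaceOfTraffics
  -- Curried, so that the labels of the two sides are expanded independently.
  let F := (P.Φ.compMultilinearMap (P.Z ((t.G.glue t'.G.rev).withOut fun _ =>
    Classical.arbitrary _))).currySum
  have hF : ∀ (x : ∀ e : t.E, (b (t.lab e)).support) (y : ∀ e : t'.E, (b (t'.lab e)).support),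
      F (fun e => cls _ (x e).1) (fun e => star S (cls _ (y e).1)) = freeProd (fun j => (S j).dist)
        ((t.G.fill fun e => (x e).1).glue
          ((t'.G.fill fun e => (y e).1).star (sigmaStar fun j => (S j).star))) := fun x y =>
    algSpace_dist_glue S t.G t'.G (fun e => (x e).1) fun e => (y e).1
  have h1 : t.lab = fun e => ∑ k : (b (t.lab e)).support, b (t.lab e) k • cls _ k.1 :=
    funext fun e => hb _
  have h2 : (fun e => star S (t'.lab e)) = fun e => ∑ k : (b (t'.lab e)).support,
      Star.star (b (t'.lab e) k) • star S (cls _ k.1) := by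
    funext e
    conv_lhs => rw [hb (t'.lab e)]
    simp only [map_sum, map_smulₛₗ]
    rfl
  have h3 : P.dist (t.glue (t'.star (star S))) = F t.lab fun e => star S (t'.lab e) := rfl
  have h4 : F t.lab (fun e => star S (t'.lab e)) =
      ∑ x : ∀ e : t.E, (b (t.lab e)).support, ∑ y : ∀ e : t'.E, (b (t'.lab e)).support,
        (∏ e, b (t.lab e) (x e)) * ((∏ e, Star.star (b (t'.lab e) (y e))) *
          F (fun e => cls _ (x e).1) fun e => star S (cls _ (y e).1)) := by
    have h5 : F t.lab = ∑ x : ∀ e : t.E, (b (t.lab e)).support,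
        (∏ e, b (t.lab e) (x e)) • F fun e => cls _ (x e).1 := by
      conv_lhs => rw [h1]
      rw [MultilinearMap.map_sum]
      exact Finset.sum_congr rfl fun x _ => MultilinearMap.map_smul_univ _ _ _
    rw [h2, h5, sum_apply]
    refine Finset.sum_congr rfl fun x _ => ?_
    rw [smul_apply, MultilinearMap.map_sum, Finset.smul_sum]
    refine Finset.sum_congr rfl fun y _ => ?_
    rw [MultilinearMap.map_smul_univ, smul_eq_mul, smul_eq_mul]
  rw [h3, h4]
  refine Finset.sum_congr rfl fun x _ => Finset.sum_congr rfl fun y _ => ?_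
  rw [hF, star_star, star_prod, mul_assoc]

/-- The free product of spaces of traffics. -/
def space : SpaceOfTraffics (FreeProduct fun j => (S j).toGAlgebra) where
  toAlgSpaceOfTraffics := algSpace fun j => (S j).toAlgSpaceOfTraffics
  star := star S
  star_add := map_add _
  star_smul := map_smulₛₗ _
  star_star := star_star_apply S
  star_Z := star_Z S
  positive := algSpace_isPositive S

section Incl

variable (B : ∀ j, GAlgebra (A j)) (j : J)

theorem cls_replace_edge (x : Σ j, A j) (M : GraphMon 2 (Σ j, A j)) :
    cls B ((GraphMon.edge x).replace () M) = cls B M := by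
  have : (GraphMon.edge x).replace () M = idOp.fill fun _ => M :=
    GraphMon.replace_eq _ rfl fun k hk => (hk rfl).elim
  rw [this]
  exact cls_iso (TGraph.fill_idOp fun _ => M)

/-- The canonical map from a factor to the free product. -/
def inclₗ : A j →ₗ[ℂ] FreeProduct B :=
  have key : ∀ (c : ℂ) (a b : A j), incl B j (c • a + b) = c • incl B j a + incl B j b := by
    intro c a b
    have := sum_cls_replace (S := B) (.linear c a b) (.edge ⟨j, 0⟩) ()
    simp only [map_sub, map_smul, Finsupp.linearCombination_single, one_smul,
      cls_replace_edge] at this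
    exact sub_eq_zero.1 ((sub_sub _ _ _).symm.trans this)
  -- For `c = -1` and zero labels, the right-hand side of `key` cancels.
  have h0 : incl B j 0 = 0 := by
    have := key (-1) 0 0
    simpa using this
  { toFun := incl B j
    map_add' := fun a b => by simpa using key 1 a b
    map_smul' := fun c a => by simpa [h0] using key c a 0 }

/-- The relation that replaces an edge by a graph, applied to a monomial with a single edge: a
monochromatic monomial is the image of its value. -/
theorem cls_map (m : GraphMon 2 (A j)) : cls B (m.map (Sigma.mk j)) = incl B j ((B j).val m) := by
  have := sum_cls_replace (S := B) (.comp m.G m.lab) (.edge ⟨j, 0⟩) ()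
  simp only [map_sub, Finsupp.linearCombination_single, one_smul, cls_replace_edge] at this
  exact ((sub_eq_zero.1 this).trans (cls_iso ((TGraph.fill_edge m.G m.lab).map _))).symm

theorem algebra_Z_incl {I : Type} (g : GraphOp I) (a : I → A j) :
    (algebra B).Z g (fun i => incl B j (a i)) = incl B j ((B j).Z g a) := by
  refine (algebra_Z_cls g fun i => .edge ⟨j, a i⟩).trans ?_
  exact (cls_iso (TGraph.fill_edge g _)).trans (cls_map B j ⟨I, g, a⟩)

end Incl

theorem trace_incl (j : J) (a : A j) :
    (space S).Φ (incl _ j a) = (S j).Φ a := by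
  refine (trace_cls _ _).trans ((freeProd_map (fun j => (S j).dist_isTrafficFunctional)
    (GraphMon.edge a).close).trans ?_)
  rw [AlgSpaceOfTraffics.dist_close, GAlgebra.val_edge]

theorem isHom_incl (j : J) : (S j).IsHom (space S) (inclₗ _ j) where
  map_Z g a := (algebra_Z_incl _ j g a).symm
  map_star a := (cls_iso (GraphMon.adj_edge (sigmaStar fun j => (S j).star) (⟨j, a⟩ : Σ j, A j))).symm.trans
    (star_cls S _).symm
  map_Φ a := trace_incl S j a

theorem dist_map_incl (t : GraphMon 0 (Σ j, A j)) :
    (space S).dist (t.map fun x => incl _ x.1 x.2) = freeProd (fun j => (S j).dist) t :=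
  (algSpace_dist _ t.G fun e => .edge (t.lab e)).trans
    ((freeProd_dist_isTrafficFunctional _).iso_inv _ _ (TGraph.fill_edge t.G t.lab))

end FreeProduct

end Traffic
end

theorem theorem1p2 {J : Type w} :
    -- The free product of positive functionals on labelled graphs is well-defined and positive.
    (∀ (L : J → Type u) (s : ∀ j, L j → L j) (τ : ∀ j, Traffic.GraphMon 0 (L j) → ℂ),
      (∀ j, Function.Involutive (s j)) →
      (∀ j, Traffic.IsTrafficFunctional (τ j)) →
      (∀ j, Traffic.IsPositive (s j) (τ j)) →
      Traffic.IsTrafficFunctional (Traffic.freeProd τ) ∧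
        Traffic.IsPositive (Traffic.sigmaStar s) (Traffic.freeProd τ)) ∧
    -- The free product of spaces of traffics is well-defined as a space of traffics.
    (∀ (A : J → Type u) [∀ j, AddCommGroup (A j)] [∀ j, Module ℂ (A j)]
      (S : ∀ j, Traffic.SpaceOfTraffics (A j)),
      ∃ P : Traffic.SpaceOfTraffics (Traffic.FreeProduct fun j => (S j).toGAlgebra),
        -- the graph operations act by substitution of graphs
        (∀ {I : Type} (g : Traffic.GraphOp I) (m : I → Traffic.GraphMon 2 (Σ j, A j)),
          P.Z g (fun i => Traffic.FreeProduct.cls _ (m i)) =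
            Traffic.FreeProduct.cls _ (Traffic.GraphMon.subst g m)) ∧
        -- the involution is induced by that of graphs
        (∀ m : Traffic.GraphMon 2 (Σ j, A j), P.star (Traffic.FreeProduct.cls _ m) =
          Traffic.FreeProduct.cls _ (m.adj (Traffic.sigmaStar fun j => (S j).star))) ∧
        -- the trace is induced by the free product of the distributions of traffics
        (∀ m : Traffic.GraphMon 2 (Σ j, A j), P.Φ (Traffic.FreeProduct.cls _ m) =
          Traffic.freeProd (fun j => (S j).dist) m.close) ∧
        -- the canonical maps are homomorphisms of spaces of traffics
        (∀ j, ∃ f : A j →ₗ[ℂ] Traffic.FreeProduct fun j => (S j).toGAlgebra,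
          (∀ a, f a = Traffic.FreeProduct.incl _ j a) ∧ (S j).IsHom P f) ∧
        -- the joint distribution of traffics of the factors is the free product
        (∀ t : Traffic.GraphMon 0 (Σ j, A j),
          P.dist (t.map fun x => Traffic.FreeProduct.incl _ x.1 x.2) =
            Traffic.freeProd (fun j => (S j).dist) t)) := by
  refine ⟨fun L s τ _ hτ hpos => ⟨Traffic.freeProd_isTrafficFunctional hτ,
    Traffic.freeProd_isPositive hτ hpos⟩, fun A _ _ S => ?_⟩
  exact ⟨Traffic.FreeProduct.space S, fun g m => Traffic.FreeProduct.algebra_Z_cls g m,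
    Traffic.FreeProduct.star_cls S, Traffic.FreeProduct.trace_cls _,
    fun j => ⟨Traffic.FreeProduct.inclₗ _ j, fun _ => rfl, Traffic.FreeProduct.isHom_incl S j⟩,
    Traffic.FreeProduct.dist_map_incl S⟩
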